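/- **Setting.** Let $X$ be a locally finite simplicial complex of dimension $d=n-1\ge 0$ (every vertex lies in finitely many simplices; some simplex has dimension $d$, none has a larger one), with a linear order of its vertices, and let $\mathbb A$ be an additive category. *Controlled categories.* For a simplicial complex $K$, the category $\mathbb G_K(\mathbb A)$ has as objects the families $(M(\sigma))_{\sigma\in K}$ of objects of $\mathbb A$, and as morphisms the column-finite matrices $f_{\tau,\sigma}:M(\sigma)\to N(\tau)$. The subcategory $\mathbb A^*(K)$ (resp. $\mathbb A_*(K)$) has the same objects and those morphisms with $f_{\tau,\sigma}=0$ unless $\tau\le\sigma$ (resp. unless $\tau\ge\sigma$). Write $\mathbb A(K)$ for either one (the same choice throughout). Chain complexes are graded by $\mathbb Z$ and finite (zero outside a bounded range of degrees). *The triangulation $t^0(X\times\mathbb R)$.* Put $v_i=i$ for $i\le 0$ and $v_i=\sum_{j=0}^{i-1}\left(\frac{n+1}{n}\right)^j$ for $i\ge 0$. For $i\ge 0$ the block $X\times[v_i,v_{i+1}]$ is triangulated, after affine rescaling of $[v_i,v_{i+1}]$ to $[0,1]$, by $Sd^i$ of the prism $P$ whose simplices are spanned by $\tau\times 0$ and the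 points $(\hat\rho_0,1),\dots,(\hat\rho_m,1)$, with $\tau\subseteq\rho_0\subset\dots\subset\rho_m$ simplices of $X$ with barycentres $\hat\rho_j$ (one of the two parts may be empty). For $i<0$ it is triangulated by the product prism of $X$ (simplices spanned by $a\times0$ and $b\times1$, where $a\cup b\in X$ and no vertex of $a$ exceeds a vertex of $b$). Thus $t^0$ restricts to $Sd^{\max(i,0)}X$ on $X\times\{v_i\}$. Let $t^k$ be the homeomorphism of $X\times\mathbb R$ that is the identity on $X$ and maps $[v_i,v_{i+1}]$ affinely to $[v_{i+k},v_{i+k+1}]$ for all $i$, and $t^{-k}(X\times \mathbb R)$, $t^{-k}C$ the images of $t^0(X\times\mathbb R)$ and of a complex $C$ over it under $t^{-k}$. For $k\ge0$ let $L_k$ be the part of $t^{-k}(X\times\mathbb R)$ over $X\times[0,\infty)$; it is $Sd^kL_0$. *Subdivision functors.* For a simplicial approximation $r:L_{k+1}\to L_k$ of the identity (a simplicial map taking each vertex into every simplex of $L_k$ that contains it), and $\tilde\sigma\in L_{k+1}$, $\sigma=r\tilde\sigma$, the complex $Sd_rC\in\mathbb A(L_{k+1})$ is $(Sd_rC)_m(\tilde\sigma)=C_{m+|\sigma|-|\tilde\sigma|}(\sigma)$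 in the $\mathbb A^*$-case and $C_{m+|\tilde\sigma|-|\sigma|}(\sigma)$ in the $\mathbb A_*$-case. Its differential has the components $(d_C)_{\tau\sigma}$ from $\tilde\sigma$ to $\tilde\tau$ if $\tilde\tau\le\tilde\sigma$ (resp. $\ge$) and $|\tilde\tau|-|\tau|=|\tilde\sigma|-|\sigma|$, the components $(-1)^m\cdot(\text{incidence number})\cdot\mathrm{id}$ if $\tau=\sigma$ and $\tilde\tau$ is a facet (resp. cofacet) of $\tilde\sigma$, and is zero otherwise. Here incidence numbers are taken with respect to the orientation of $\tilde\sigma$ relative to that of $\sigma$. A *squeezing choice* is a sequence of such approximations $r_k:L_{k+1}\to L_k$ such that for every $m$ there is a $k$ such that for every closed simplex $\sigma$ of $L_m$ the composite $r_m\circ\dots\circ r_{m+k-1}$ maps each simplex of $L_{m+k}$ that has a vertex in $\sigma$ into $\sigma$. Put $Sd_kC=Sd_{r_{k-1}}\cdots Sd_{r_0}(C|_{L_0})$. A complex $C$ in $\mathbb A(t^0(X\times\mathbb R))$ is *exponential translation equivalent* if for every $k\ge 0$ the complexes $Sd_kC$ and $(t^{-k}C)|_{L_k}$ are chain equivalent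 in $\mathbb A(L_k)$. *Distances.* $X$ carries the path metric $d_X$ in which simplices are standard Euclidean simplices ($\infty$ between components). The distance in the open cone $O(X^+)$ of $(x,t)$ and $(y,s)$ is $\inf_{u\le\min(t,s)}\big((t-u)+(s-u)+\max(u,0)\,d_X(x,y)\big)$. A chain equivalence has bound $B$ if all its constituents (the map, its inverse and the two homotopies) have non-zero components only between simplices whose barycentres have distance at most $B$. **Theorem (Splitting Theorem).** Squeezing choices exist. For every squeezing choice the following holds. Let $C,D$ be finite exponential translation equivalent chain complexes in $\mathbb A^*(t^0(X\times\mathbb R))$ (resp. $\mathbb A_*(t^0(X\times\mathbb R))$), and let $f:C\to D$ be a chain equivalence in $\mathbb G_{t^0(X\times\mathbb R)}(\mathbb A)$ with finite bound $0\le B<\infty$ measured in $O(X^+)$. Then for every integer $i>B$ there is a chain equivalence $$f_i:\ C|_{t^0(X\times\{v_i\})}\to D|_{t^0(X\times\{v_i\})}$$ in $\mathbb A^*(Sd^iX)$ (resp. $\mathbb A_*(Sd^iX)$), and the bound of $f_i$ measured in $X$ tends to $0$ as $i\to\infty$. -/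

import Mathlib

open CategoryTheory
open scoped ENNReal

universe u v w

/-- The two kinds of simplicially controlled categories over a complex `X`: `upper` is `A^*(X)`,
where morphisms go from simplices to their faces, and `lower` is `A_*(X)`, where they go from
simplices to their cofaces. -/
inductive Variance
  | upper
  | lower

namespace Variance

/-- Which components `σ → τ` a morphism may have; `none` stands for the category without control. -/
def allowed {I : Type w} [Preorder I] : Option Variance → I → I → Prop
  | none, _, _ => True
  | some upper, σ, τ => τ ≤ σ
  | some lower, σ, τ => σ ≤ τ

theorem allowed_refl {I : Type w} [Preorder I] (s : Option Variance) (σ : I) : allowed s σ σ := by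
  rcases s with _ | _ | _ <;> simp [allowed]

theorem allowed_trans {I : Type w} [Preorder I] {s : Option Variance} {σ τ ρ : I}
    (h : allowed s σ τ) (k : allowed s τ ρ) : allowed s σ ρ := by
  rcases s with _ | _ | _
  · trivial
  · exact le_trans k h
  · exact le_trans h k

end Variance

theorem exists_ne_zero_of_finsum {ι M : Type*} [AddCommMonoid M] {f : ι → M}
    (h : ∑ᶠ i, f i ≠ 0) : ∃ i, f i ≠ 0 := by
  by_contra hn
  exact h (finsum_eq_zero_of_forall_eq_zero fun i => not_not.1 fun hi => hn ⟨i, hi⟩)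

/-- An object of `A` for every element of `I`. With the morphisms below this is the category
`A^*(X)`, `A_*(X)` or `G_X(A)` when `I` is the set of simplices of `X`, ordered by inclusion, and `s`
is `some .upper`, `some .lower` or `none`. -/
structure Graded (A : Type u) (I : Type w) (s : Option Variance) where
  obj : I → A

namespace Graded

section Cat

variable {A : Type u} [Category.{v} A] [Preadditive A] {I : Type w} [Preorder I]
  {s : Option Variance}

/-- Column-finite matrices with the prescribed support. -/
@[ext]
structure Hom (M N : Graded A I s) where
  app : ∀ σ τ : I, M.obj σ ⟶ N.obj τ
  finite : ∀ σ, {τ | app σ τ ≠ 0}.Finite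
  support : ∀ σ τ, app σ τ ≠ 0 → Variance.allowed s σ τ

theorem finsum_comp_eq {M N P : Graded A I s} (f : Hom M N) (g : Hom N P) (σ τ : I)
    (F : Finset I) (hF : ∀ κ, f.app σ κ ≠ 0 → κ ∈ F) :
    ∑ᶠ κ, f.app σ κ ≫ g.app κ τ = ∑ κ ∈ F, f.app σ κ ≫ g.app κ τ := by
  apply finsum_eq_sum_of_support_subset
  intro κ hκ
  apply hF
  intro h0
  apply hκ
  simp [h0]

open Classical in
/-- Matrix multiplication. -/
noncomputable def Hom.comp {M N P : Graded A I s} (f : Hom M N) (g : Hom N P) : Hom M P where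
  app σ τ := ∑ᶠ κ, f.app σ κ ≫ g.app κ τ
  finite σ := by
    apply ((f.finite σ).biUnion (t := fun κ => {τ | g.app κ τ ≠ 0}) (fun κ _ => g.finite κ)).subset
    intro τ hτ
    obtain ⟨κ, hκ⟩ := exists_ne_zero_of_finsum hτ
    simp only [Set.mem_iUnion]
    refine ⟨κ, ?_, ?_⟩
    · intro h; apply hκ; simp [h]
    · intro h; apply hκ; simp [h]
  support σ τ h := by
    obtain ⟨κ, hκ⟩ := exists_ne_zero_of_finsum h
    refine Variance.allowed_trans (f.support σ κ ?_) (g.support κ τ ?_)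
    · intro h; apply hκ; simp [h]
    · intro h; apply hκ; simp [h]

open Classical in
/-- The identity matrix. -/
noncomputable def Hom.id (M : Graded A I s) : Hom M M where
  app σ τ := if h : σ = τ then eqToHom (congrArg M.obj h) else 0
  finite σ := by
    apply (Set.finite_singleton σ).subset
    intro τ hτ
    by_contra hne
    apply hτ
    rw [dif_neg]
    exact fun h => hne h.symm
  support σ τ h := by
    by_cases hh : σ = τ
    · subst hh; exact Variance.allowed_refl s σ
    · simp [hh] at h

noncomputable instance : Category (Graded A I s) where
  Hom := Hom
  id := Hom.id
  comp := Hom.comp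
  id_comp f := by
    apply Hom.ext
    funext σ τ
    refine (finsum_eq_single _ σ ?_).trans ?_
    · intro κ hκ
      simp [Hom.id, Ne.symm hκ]
    · simp [Hom.id]
  comp_id f := by
    apply Hom.ext
    funext σ τ
    refine (finsum_eq_single _ τ ?_).trans ?_
    · intro κ hκ
      simp [Hom.id, hκ]
    · simp [Hom.id]
  assoc f g h := by
    classical
    apply Hom.ext
    funext σ τ
    let F := (f.finite σ).toFinset
    let G := F.biUnion fun κ => (g.finite κ).toFinset
    have hF : ∀ κ, f.app σ κ ≠ 0 → κ ∈ F := fun κ hκ => by simpa [F] using hκ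
    have e1 : ∀ ρ, (Hom.comp f g).app σ ρ = ∑ κ ∈ F, f.app σ κ ≫ g.app κ ρ := fun ρ =>
      finsum_comp_eq f g σ ρ F hF
    have hG : ∀ κ ∈ F, ∀ ρ, g.app κ ρ ≠ 0 → ρ ∈ G := fun κ hκ ρ hρ => by
      simp only [G, Finset.mem_biUnion]
      exact ⟨κ, hκ, by simpa using hρ⟩
    have l : (Hom.comp (Hom.comp f g) h).app σ τ
        = ∑ ρ ∈ G, (∑ κ ∈ F, f.app σ κ ≫ g.app κ ρ) ≫ h.app ρ τ := by
      refine (finsum_comp_eq (Hom.comp f g) h σ τ G ?_).trans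
        (Finset.sum_congr rfl fun ρ _ => by rw [e1])
      intro ρ hρ
      rw [e1] at hρ
      obtain ⟨κ, hκ, hne⟩ := Finset.exists_ne_zero_of_sum_ne_zero hρ
      exact hG κ hκ ρ fun h0 => hne (by simp [h0])
    have r : (Hom.comp f (Hom.comp g h)).app σ τ
        = ∑ κ ∈ F, f.app σ κ ≫ (∑ ρ ∈ G, g.app κ ρ ≫ h.app ρ τ) := by
      refine (finsum_comp_eq f (Hom.comp g h) σ τ F hF).trans
        (Finset.sum_congr rfl fun κ hκ => ?_)
      congr 1
      exact finsum_comp_eq g h κ τ G (hG κ hκ)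
    refine l.trans (Eq.trans ?_ r.symm)
    simp only [Preadditive.sum_comp, Preadditive.comp_sum, Category.assoc]
    exact Finset.sum_comm

@[ext]
theorem hom_ext {M N : Graded A I s} {f g : M ⟶ N} (h : ∀ σ τ, f.app σ τ = g.app σ τ) : f = g :=
  Hom.ext (funext fun σ => funext fun τ => h σ τ)

theorem comp_app {M N P : Graded A I s} (f : M ⟶ N) (g : N ⟶ P) (σ τ : I) :
    (f ≫ g).app σ τ = ∑ᶠ κ, f.app σ κ ≫ g.app κ τ := rfl

theorem comp_app_sum {M N P : Graded A I s} (f : M ⟶ N) (g : N ⟶ P) (σ τ : I)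
    (F : Finset I) (hF : ∀ κ, f.app σ κ ≠ 0 → κ ∈ F) :
    (f ≫ g).app σ τ = ∑ κ ∈ F, f.app σ κ ≫ g.app κ τ := finsum_comp_eq f g σ τ F hF

open Classical in
theorem id_app (M : Graded A I s) (σ τ : I) :
    Hom.app (𝟙 M) σ τ = if h : σ = τ then eqToHom (congrArg M.obj h) else 0 := rfl

instance (M N : Graded A I s) : Zero (M ⟶ N) :=
  ⟨{ app := fun _ _ => 0, finite := by simp, support := by simp }⟩

instance (M N : Graded A I s) : Add (M ⟶ N) :=
  ⟨fun f g =>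
    { app := fun σ τ => f.app σ τ + g.app σ τ
      finite := fun σ => ((f.finite σ).union (g.finite σ)).subset fun τ hτ => by
        by_contra h
        simp only [Set.mem_union, Set.mem_ofPred_eq, not_or, not_not] at h
        exact hτ (by simp [h.1, h.2])
      support := fun σ τ h => by
        by_cases hf : f.app σ τ = 0
        · exact g.support σ τ fun hg => h (by simp [hf, hg])
        · exact f.support σ τ hf }⟩

instance (M N : Graded A I s) : Neg (M ⟶ N) :=
  ⟨fun f =>
    { app := fun σ τ => -f.app σ τ
      finite := fun σ => by simpa using f.finite σ
      support := fun σ τ h => f.support σ τ (by simpa using h) }⟩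

theorem zero_app (M N : Graded A I s) (σ τ : I) : (0 : M ⟶ N).app σ τ = 0 := rfl
theorem add_app {M N : Graded A I s} (f g : M ⟶ N) (σ τ : I) :
    (f + g).app σ τ = f.app σ τ + g.app σ τ := rfl
theorem neg_app {M N : Graded A I s} (f : M ⟶ N) (σ τ : I) : (-f).app σ τ = -f.app σ τ := rfl

instance (M N : Graded A I s) : AddCommGroup (M ⟶ N) where
  add_assoc f g h := hom_ext fun σ τ => add_assoc _ _ _
  zero_add f := hom_ext fun σ τ => zero_add _
  add_zero f := hom_ext fun σ τ => add_zero _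
  add_comm f g := hom_ext fun σ τ => add_comm _ _
  neg_add_cancel f := hom_ext fun σ τ => neg_add_cancel _
  nsmul := nsmulRec
  zsmul := zsmulRec

noncomputable instance : Preadditive (Graded A I s) where
  add_comp M N P f f' g := by
    classical
    refine hom_ext fun σ τ => ?_
    let F := (f.finite σ).toFinset ∪ (f'.finite σ).toFinset
    have h1 : ∀ κ, f.app σ κ ≠ 0 → κ ∈ F := fun κ h => by simp [F, h]
    have h2 : ∀ κ, f'.app σ κ ≠ 0 → κ ∈ F := fun κ h => by simp [F, h]
    have h3 : ∀ κ, (f + f').app σ κ ≠ 0 → κ ∈ F := fun κ h => by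
      by_contra hn
      exact h (by rw [add_app, not_not.1 fun a => hn (h1 κ a), not_not.1 fun a => hn (h2 κ a),
        add_zero])
    rw [add_app, comp_app_sum _ _ _ _ F h1, comp_app_sum _ _ _ _ F h2, comp_app_sum _ _ _ _ F h3,
      ← Finset.sum_add_distrib]
    simp [add_app]
  comp_add M N P f g g' := by
    refine hom_ext fun σ τ => ?_
    have h1 : ∀ κ, f.app σ κ ≠ 0 → κ ∈ (f.finite σ).toFinset := fun κ h => by simp [h]
    rw [add_app, comp_app_sum _ _ _ _ _ h1, comp_app_sum _ _ _ _ _ h1, comp_app_sum _ _ _ _ _ h1,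
      ← Finset.sum_add_distrib]
    simp [add_app]

/-- Forgetting the control: the inclusion of a controlled category into the category of all
column-finite matrices. -/
noncomputable def forgetControl : Graded A I s ⥤ Graded A I none where
  obj M := ⟨M.obj⟩
  map f := { app := f.app, finite := f.finite, support := fun _ _ _ => trivial }

instance : (forgetControl : Graded A I s ⥤ Graded A I none).Additive where

end Cat

section Restrict

variable {A : Type u} [Category.{v} A] [Preadditive A] {I : Type w} [Preorder I]
  {J : Type w} [Preorder J]

/-- Restriction of controlled matrices to an order-convex part of the index set. -/
noncomputable def restrict (e : J ↪o I) (he : (Set.range e).OrdConnected) (s : Variance) :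
    Graded A I (some s) ⥤ Graded A J (some s) where
  obj M := ⟨fun σ => M.obj (e σ)⟩
  map f :=
    { app := fun σ τ => f.app (e σ) (e τ)
      finite := fun σ => (f.finite (e σ)).preimage e.injective.injOn
      support := fun σ τ h => by
        have := f.support _ _ h
        cases s <;> simpa [Variance.allowed] using this }
  map_id M := by
    refine hom_ext fun σ τ => ?_
    by_cases h : σ = τ
    · subst h; simp [id_app]
    · simp [id_app, h]
  map_comp {M N P} f g := by
    refine hom_ext fun σ τ => ?_
    simp only [comp_app]
    rw [← finsum_mem_range (f := fun κ => f.app (e σ) κ ≫ g.app κ (e τ)) e.injective]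
    rw [finsum_mem_def]
    refine finsum_congr fun κ => ?_
    by_cases hκ : κ ∈ Set.range e
    · rw [Set.indicator_of_mem hκ]
    · rw [Set.indicator_of_notMem hκ]
      by_contra hne
      apply hκ
      have h1 := f.support (e σ) κ fun h => hne (by simp [h])
      have h2 := g.support κ (e τ) fun h => hne (by simp [h])
      cases s
      · exact he.out ⟨τ, rfl⟩ ⟨σ, rfl⟩ ⟨h2, h1⟩
      · exact he.out ⟨σ, rfl⟩ ⟨τ, rfl⟩ ⟨h1, h2⟩

instance (e : J ↪o I) (he : (Set.range e).OrdConnected) (s : Variance) :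
    (restrict (A := A) e he s).Additive where

end Restrict
end Graded

/-- The combinatorics of one subdivision step: `J` are the simplices of the subdivision, `I` the
simplices that are subdivided, `ρ` is the map on simplices induced by a simplicial approximation,
`a` is the shift in degree, `q` says which pairs carry a component of the old differential and `e`
are the incidence numbers inside the fibres of `ρ`. -/
structure SubdivisionData (I J : Type w) [Preorder I] [Preorder J] (s : Variance) where
  ρ : J → I
  a : J → ℤ
  q : J → J → Prop
  e : J → J → ℤ
  q_shift : ∀ S T, q S T → a S = a T
  q_allowed : ∀ S T, q S T → Variance.allowed (some s) S T
  q_trans : ∀ S K T, q S K → q K T → q S T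
  q_bij : ∀ S T, q S T → Set.BijOn ρ {K | q S K ∧ q K T}
    {κ | Variance.allowed (some s) (ρ S) κ ∧ Variance.allowed (some s) κ (ρ T)}
  e_shift : ∀ S T, e S T ≠ 0 → a T = a S + 1
  e_fibre : ∀ S T, e S T ≠ 0 → ρ S = ρ T
  e_allowed : ∀ S T, e S T ≠ 0 → Variance.allowed (some s) S T
  fin : ∀ S, {T | q S T ∨ e S T ≠ 0}.Finite
  ee : ∀ S T, ∑ᶠ K, e S K * e K T = 0
  eq_qe : ∀ S T, (∑ᶠ (K) (_ : q K T), e S K) = ∑ᶠ (K) (_ : q S K), e K T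

namespace SubdivisionData

variable {A : Type u} [Category.{v} A] [Preadditive A] {I J : Type w} [Preorder I] [Preorder J]
  {s : Variance} (D : SubdivisionData I J s) (C : ChainComplex (Graded A I (some s)) ℤ)

open Classical in
/-- The identity between equal entries of `C`, and zero between different ones. -/
noncomputable def idTo (m m' : ℤ) (x x' : I) : (C.X m).obj x ⟶ (C.X m').obj x' :=
  if h : m = m' ∧ x = x' then eqToHom (by rw [h.1, h.2]) else 0

theorem idTo_comp_d {m m' : ℤ} {x x' : I} (hm : m = m') (hx : x = x') (p : ℤ) (y : I) :
    idTo C m m' x x' ≫ (C.d m' p).app x' y = (C.d m p).app x y := by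
  subst hm hx; simp [idTo]

theorem d_comp_idTo {m m' : ℤ} {x x' : I} (hm : m = m') (hx : x = x') (p : ℤ) (y : I) :
    (C.d p m).app y x ≫ idTo C m m' x x' = (C.d p m').app y x' := by
  subst hm hx; simp [idTo]

theorem idTo_comp_idTo {m m' m'' : ℤ} {x x' x'' : I} (hm : m = m') (hx : x = x') :
    idTo C m m' x x' ≫ idTo C m' m'' x' x'' = idTo C m m'' x x'' := by
  subst hm hx; simp [idTo]

theorem d_comp_d_congr {m m' : ℤ} (hm : m = m') (p p' : ℤ) (x κ y : I) :
    (C.d p m).app x κ ≫ (C.d m p').app κ y = (C.d p m').app x κ ≫ (C.d m' p').app κ y := by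
  subst hm; rfl

open Classical in
/-- The part of the subdivided differential that comes from the differential of `C`. -/
noncomputable def d1 (i j : ℤ) (S T : J) :
    (C.X (i + D.a S)).obj (D.ρ S) ⟶ (C.X (j + D.a T)).obj (D.ρ T) :=
  if D.q S T then (C.d (i + D.a S) (j + D.a T)).app (D.ρ S) (D.ρ T) else 0

/-- The part of the subdivided differential inside the fibres of `ρ`. -/
noncomputable def d2 (i j : ℤ) (S T : J) :
    (C.X (i + D.a S)).obj (D.ρ S) ⟶ (C.X (j + D.a T)).obj (D.ρ T) :=
  ((i.negOnePow : ℤ) * D.e S T) • idTo C (i + D.a S) (j + D.a T) (D.ρ S) (D.ρ T)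

theorem q_of_d1 {i j : ℤ} {S T : J} (h : D.d1 C i j S T ≠ 0) : D.q S T := by
  by_contra hq; exact h (by simp [d1, hq])

theorem e_of_d2 {i j : ℤ} {S T : J} (h : D.d2 C i j S T ≠ 0) : D.e S T ≠ 0 := by
  intro he; exact h (by simp [d2, he])

theorem or_of_d {i j : ℤ} {S T : J} (h : D.d1 C i j S T + D.d2 C i j S T ≠ 0) :
    D.q S T ∨ D.e S T ≠ 0 := by
  by_contra hq
  rw [not_or, not_not] at hq
  exact h (by simp [d1, d2, hq.1, hq.2])

theorem d1_d1 {i j k : ℤ} (S T : J) : ∑ᶠ K, D.d1 C i j S K ≫ D.d1 C j k K T = 0 := by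
  by_cases hq : D.q S T
  swap
  · apply finsum_eq_zero_of_forall_eq_zero
    intro K
    by_contra hne
    have h1 : D.q S K := D.q_of_d1 C (i := i) (j := j) fun h => hne (by rw [h, Limits.zero_comp])
    have h2 : D.q K T := D.q_of_d1 C (i := j) (j := k) fun h => hne (by rw [h, Limits.comp_zero])
    exact hq (D.q_trans S K T h1 h2)
  have key : ∑ᶠ κ, (C.d (i + D.a S) (j + D.a S)).app (D.ρ S) κ ≫
      (C.d (j + D.a S) (k + D.a T)).app κ (D.ρ T) = 0 := by
    rw [← Graded.comp_app, C.d_comp_d, Graded.zero_app]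
  have hl : ∑ᶠ K, D.d1 C i j S K ≫ D.d1 C j k K T
      = ∑ᶠ K ∈ {K | D.q S K ∧ D.q K T}, D.d1 C i j S K ≫ D.d1 C j k K T := by
    rw [finsum_mem_def]
    refine finsum_congr fun K => ?_
    by_cases hK : K ∈ {K | D.q S K ∧ D.q K T}
    · rw [Set.indicator_of_mem hK]
    · rw [Set.indicator_of_notMem hK]
      by_contra hne
      exact hK ⟨D.q_of_d1 C fun h => hne (by rw [h, Limits.zero_comp]),
        D.q_of_d1 C fun h => hne (by rw [h, Limits.comp_zero])⟩
  rw [hl, finsum_mem_eq_of_bijOn D.ρ (D.q_bij S T hq)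
    (g := fun κ => (C.d (i + D.a S) (j + D.a S)).app (D.ρ S) κ ≫
      (C.d (j + D.a S) (k + D.a T)).app κ (D.ρ T)), ← key, finsum_mem_def]
  · refine finsum_congr fun κ => ?_
    by_cases hκ : κ ∈ {κ | Variance.allowed (some s) (D.ρ S) κ ∧
      Variance.allowed (some s) κ (D.ρ T)}
    · rw [Set.indicator_of_mem hκ]
    · rw [Set.indicator_of_notMem hκ]
      by_contra hne
      exact hκ ⟨(C.d _ _).support _ _ fun h => hne (by rw [h, Limits.zero_comp]),
        (C.d _ _).support _ _ fun h => hne (by rw [h, Limits.comp_zero])⟩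
  · rintro K ⟨h1, h2⟩
    simp only [d1, if_pos h1, if_pos h2]
    apply d_comp_d_congr
    rw [D.q_shift S K h1]

theorem d2_d2 {i j k : ℤ} (hij : j + 1 = i) (S T : J) :
    ∑ᶠ K, D.d2 C i j S K ≫ D.d2 C j k K T = 0 := by
  have h : ∀ K, D.d2 C i j S K ≫ D.d2 C j k K T = (D.e S K * D.e K T) •
      (((i.negOnePow : ℤ) * (j.negOnePow : ℤ)) •
        idTo C (i + D.a S) (k + D.a T) (D.ρ S) (D.ρ T)) := by
    intro K
    by_cases he : D.e S K = 0
    · simp [d2, he]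
    have h1 := D.e_shift S K he
    have h2 := D.e_fibre S K he
    simp only [d2, Preadditive.zsmul_comp, Preadditive.comp_zsmul]
    rw [idTo_comp_idTo C (by rw [h1]; omega) h2]
    simp only [smul_smul]
    congr 1
    ring
  simp only [h]
  rw [← finsum_smul', D.ee S T, zero_smul]
  apply (D.fin S).subset
  intro K hK
  exact Or.inr fun h0 => hK (by simp [h0])

theorem d1_d2 {i j k : ℤ} (hij : j + 1 = i) (hjk : k + 1 = j) (S T : J) :
    ∑ᶠ K, (D.d1 C i j S K ≫ D.d2 C j k K T + D.d2 C i j S K ≫ D.d1 C j k K T) = 0 := by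
  classical
  set φ : (C.X (i + D.a S)).obj (D.ρ S) ⟶ (C.X (k + D.a T)).obj (D.ρ T) :=
    (i.negOnePow : ℤ) • (C.d (i + D.a S) (k + D.a T)).app (D.ρ S) (D.ρ T) with hφ
  have hneg : (j.negOnePow : ℤ) = -(i.negOnePow : ℤ) := by
    rw [← hij, Int.negOnePow_succ]; simp
  have h1 : ∀ K, D.d1 C i j S K ≫ D.d2 C j k K T = (if D.q S K then D.e K T else 0) • (-φ) := by
    intro K
    by_cases hq : D.q S K
    swap
    · simp [d1, hq]
    by_cases he : D.e K T = 0
    · simp [d2, he]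
    have h1 := D.e_shift K T he
    have h2 := D.e_fibre K T he
    simp only [d1, d2, if_pos hq, Preadditive.comp_zsmul]
    rw [d_comp_idTo C (by rw [h1]; omega) h2, hneg, hφ, mul_smul, neg_smul, smul_neg, smul_comm]
  have h2 : ∀ K, D.d2 C i j S K ≫ D.d1 C j k K T = (if D.q K T then D.e S K else 0) • φ := by
    intro K
    by_cases hq : D.q K T
    swap
    · simp [d1, hq]
    by_cases he : D.e S K = 0
    · simp [d2, he]
    have h1 := D.e_shift S K he
    have h2 := D.e_fibre S K he
    simp only [d1, d2, if_pos hq, Preadditive.zsmul_comp]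
    rw [idTo_comp_d C (by rw [h1]; omega) h2, hφ, mul_smul, smul_comm]
  have f1 : (Function.support fun K => if D.q S K then D.e K T else 0).Finite := by
    apply (D.fin S).subset
    intro K hK
    left
    by_contra h
    exact hK (by simp [h])
  have f2 : (Function.support fun K => if D.q K T then D.e S K else 0).Finite := by
    apply (D.fin S).subset
    intro K hK
    right
    intro h
    exact hK (by simp [h])
  simp only [h1, h2]
  rw [finsum_add_distrib, ← finsum_smul' f1, ← finsum_smul' f2]
  · have := D.eq_qe S T
    simp only [finsum_eq_if] at this
    rw [this]
    simp
  · apply f1.subset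
    intro K hK h0
    exact hK ((congrArg (· • _) h0).trans (zero_smul _ _))
  · apply f2.subset
    intro K hK h0
    exact hK ((congrArg (· • _) h0).trans (zero_smul _ _))

/-- The algebraic subdivision of a chain complex. -/
noncomputable def subdivide : ChainComplex (Graded A J (some s)) ℤ where
  X i := ⟨fun S => (C.X (i + D.a S)).obj (D.ρ S)⟩
  d i j :=
    { app := fun S T => D.d1 C i j S T + D.d2 C i j S T
      finite := fun S => (D.fin S).subset fun T hT => D.or_of_d C hT
      support := fun S T h => (D.or_of_d C h).elim (D.q_allowed S T) (D.e_allowed S T) }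
  shape i j hij := by
    refine Graded.hom_ext fun S T => ?_
    change D.d1 C i j S T + D.d2 C i j S T = 0
    rw [ComplexShape.down_Rel] at hij
    have h1 : D.d1 C i j S T = 0 := by
      by_cases hq : D.q S T
      · have := D.q_shift S T hq
        rw [d1, if_pos hq, C.shape _ _ (by rw [ComplexShape.down_Rel]; omega), Graded.zero_app]
      · rw [d1, if_neg hq]
    have h2 : D.d2 C i j S T = 0 := by
      by_cases he : D.e S T = 0
      · simp [d2, he]
      · have := D.e_shift S T he
        rw [d2, idTo, dif_neg (by rintro ⟨h, -⟩; omega), smul_zero]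
    rw [h1, h2, add_zero]
  d_comp_d' i j k hij hjk := by
    rw [ComplexShape.down_Rel] at hij hjk
    refine Graded.hom_ext fun S T => ?_
    change ∑ᶠ K, (D.d1 C i j S K + D.d2 C i j S K) ≫ (D.d1 C j k K T + D.d2 C j k K T) = 0
    have e : ∀ K, (D.d1 C i j S K + D.d2 C i j S K) ≫ (D.d1 C j k K T + D.d2 C j k K T)
        = (D.d1 C i j S K ≫ D.d1 C j k K T + D.d2 C i j S K ≫ D.d2 C j k K T) +
          (D.d1 C i j S K ≫ D.d2 C j k K T + D.d2 C i j S K ≫ D.d1 C j k K T) := by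
      intro K
      simp only [Preadditive.add_comp, Preadditive.comp_add]
      abel
    have fin1 : ∀ (f : ∀ K, (C.X (i + D.a S)).obj (D.ρ S) ⟶ (C.X (k + D.a T)).obj (D.ρ T)),
        (∀ K, f K ≠ 0 → D.q S K ∨ D.e S K ≠ 0) → (Function.support f).Finite :=
      fun f hf => (D.fin S).subset fun K hK => hf K hK
    have z1 : ∀ K, ¬ (D.q S K ∨ D.e S K ≠ 0) → D.d1 C i j S K = 0 := fun K h => by
      by_contra h0; exact h (Or.inl (D.q_of_d1 C h0))
    have z2 : ∀ K, ¬ (D.q S K ∨ D.e S K ≠ 0) → D.d2 C i j S K = 0 := fun K h => by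
      by_contra h0; exact h (Or.inr (D.e_of_d2 C h0))
    simp only [e]
    rw [finsum_add_distrib, finsum_add_distrib, D.d1_d1, D.d2_d2 C hij, D.d1_d2 C hij hjk]
    · simp
    all_goals
      refine fin1 _ fun K => ?_
      contrapose
      intro h
      simp [z1 K h, z2 K h]

end SubdivisionData

/-! Combinatorics of a simplicial map, on vertex sets. -/

namespace VertexMap

variable {α β : Type*}

open Classical in
/-- Dimension of a simplex minus dimension of its image. -/
noncomputable def defect (r : α → β) (S : Finset α) : ℤ := S.card - (S.image r).card

/-- A strict total order of the vertices: first by their images, then by a fixed well-order. -/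
def Before (r : α → β) (x y : α) : Prop :=
  WellOrderingRel (r x) (r y) ∨ (r x = r y ∧ WellOrderingRel x y)

open Classical in
/-- The position of a vertex `w` of `S`, minus the position of its image in the image of `S`. -/
noncomputable def place (r : α → β) (S : Finset α) (w : α) : ℤ :=
  (S.filter fun x => Before r x w).card
    - ((S.image r).filter fun u => WellOrderingRel u (r w)).card

/-- The pair `T ⊆ S` is mapped with equal defects. -/
def Straight (r : α → β) (S T : Finset α) : Prop := T ⊆ S ∧ defect r S = defect r T

open Classical in
/-- The incidence number of `T` in `S` when `T` is a facet of `S` with the same image under `r`;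
zero otherwise. -/
noncomputable def incidence (r : α → β) (S T : Finset α) : ℤ :=
  ∑ w ∈ S, if T = S.erase w ∧ T.image r = S.image r then ((place r S w).negOnePow : ℤ) else 0

open Classical in
theorem straight_iff {r : α → β} {S T : Finset α} (hTS : T ⊆ S) :
    defect r S = defect r T ↔
      (∀ x ∈ S, x ∉ T → r x ∉ T.image r) ∧
      (∀ x ∈ S, x ∉ T → ∀ y ∈ S, y ∉ T → r x = r y → x = y) := by
  have hU : T ∪ (S \ T) = S := Finset.union_sdiff_of_subset hTS
  have c1 : (S.card : ℤ) = T.card + (S \ T).card := by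
    rw [← Nat.cast_add, Nat.cast_inj, add_comm, Finset.card_sdiff_add_card_eq_card hTS]
  have himg : S.image r = T.image r ∪ ((S \ T).image r \ T.image r) := by
    rw [Finset.union_sdiff_self_eq_union, ← Finset.image_union, hU]
  have c2 : ((S.image r).card : ℤ) = (T.image r).card + ((S \ T).image r \ T.image r).card := by
    rw [himg, Finset.card_union_of_disjoint Finset.disjoint_sdiff]; push_cast; simp
  have l1 : ((S \ T).image r \ T.image r).card ≤ ((S \ T).image r).card :=
    Finset.card_le_card Finset.sdiff_subset
  have l2 : ((S \ T).image r).card ≤ (S \ T).card := Finset.card_image_le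
  unfold defect
  rw [c1, c2]
  constructor
  · intro h
    have e1 : ((S \ T).image r \ T.image r).card = ((S \ T).image r).card := by omega
    have e2 : ((S \ T).image r).card = (S \ T).card := by omega
    constructor
    · intro x hx hxT
      have := Finset.eq_of_subset_of_card_le Finset.sdiff_subset e1.ge
      have hm : r x ∈ (S \ T).image r := Finset.mem_image_of_mem r (by simp [hx, hxT])
      rw [← this] at hm
      exact (Finset.mem_sdiff.1 hm).2
    · intro x hx hxT y hy hyT hxy
      exact Finset.card_image_iff.1 e2 (by simp [hx, hxT]) (by simp [hy, hyT]) hxy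
  · rintro ⟨h1, h2⟩
    have e1 : (S \ T).image r \ T.image r = (S \ T).image r := by
      apply Finset.sdiff_eq_self_of_disjoint
      rw [Finset.disjoint_left]
      intro u hu
      obtain ⟨x, hx, rfl⟩ := Finset.mem_image.1 hu
      rw [Finset.mem_sdiff] at hx
      exact h1 x hx.1 hx.2
    have e2 : ((S \ T).image r).card = (S \ T).card := by
      apply Finset.card_image_of_injOn
      intro x hx y hy hxy
      simp only [Finset.coe_sdiff, Set.mem_sdiff, Finset.mem_coe] at hx hy
      exact h2 x hx.1 hx.2 y hy.1 hy.2 hxy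
    rw [e1, e2]; ring

theorem Straight.trans {r : α → β} {S K T : Finset α} (h : Straight r S K) (k : Straight r K T) :
    Straight r S T := ⟨k.1.trans h.1, h.2.trans k.2⟩

/-- The defect does not increase under passage to a face. -/
theorem defect_mono {r : α → β} {S T : Finset α} (hTS : T ⊆ S) : defect r T ≤ defect r S := by
  classical
  have c1 : (S.card : ℤ) = T.card + (S \ T).card := by
    rw [← Nat.cast_add, Nat.cast_inj, add_comm, Finset.card_sdiff_add_card_eq_card hTS]
  have himg : S.image r = T.image r ∪ (S \ T).image r := by
    rw [← Finset.image_union, Finset.union_sdiff_of_subset hTS]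
  have := Finset.card_union_le (T.image r) ((S \ T).image r)
  have l2 : ((S \ T).image r).card ≤ (S \ T).card := Finset.card_image_le
  unfold defect
  rw [himg]
  omega

open Classical in
theorem incidence_ne_zero {r : α → β} {S T : Finset α} (h : incidence r S T ≠ 0) :
    ∃ w ∈ S, T = S.erase w ∧ T.image r = S.image r := by
  obtain ⟨w, hw, hne⟩ := Finset.exists_ne_zero_of_sum_ne_zero h
  refine ⟨w, hw, ?_⟩
  by_contra hn
  exact hne (if_neg hn)

open Classical in
theorem incidence_erase {r : α → β} {S : Finset α} {w : α} (hw : w ∈ S)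
    (h : (S.erase w).image r = S.image r) :
    incidence r S (S.erase w) = ((place r S w).negOnePow : ℤ) := by
  unfold incidence
  rw [Finset.sum_eq_single w]
  · rw [if_pos ⟨rfl, h⟩]
  · intro x hx hxw
    rw [if_neg]
    rintro ⟨he, -⟩
    exact Finset.notMem_erase w S (he ▸ Finset.mem_erase.2 ⟨Ne.symm hxw, hw⟩)
  · intro h; exact absurd hw h

theorem incidence_defect {r : α → β} {S T : Finset α} (h : incidence r S T ≠ 0) :
    defect r S = defect r T + 1 := by
  classical
  obtain ⟨w, hw, rfl, him⟩ := incidence_ne_zero h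
  have : 0 < S.card := Finset.card_pos.2 ⟨w, hw⟩
  simp only [defect, him, Finset.card_erase_of_mem hw]
  rw [Nat.cast_sub (by omega)]
  push_cast
  ring

open Classical in
theorem straight_bij {r : α → β} {S T : Finset α} (h : Straight r S T) :
    Set.BijOn (fun K => Finset.image r K) {K | Straight r S K ∧ Straight r K T}
      {κ | T.image r ⊆ κ ∧ κ ⊆ S.image r} := by
  refine ⟨?_, ?_, ?_⟩
  · rintro K ⟨h1, h2⟩
    exact ⟨Finset.image_subset_image h2.1, Finset.image_subset_image h1.1⟩
  · have aux : ∀ K, Straight r S K → K = S.filter fun x => r x ∈ K.image r := by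
      intro K hK
      ext x
      simp only [Finset.mem_filter]
      constructor
      · intro hx; exact ⟨hK.1 hx, Finset.mem_image_of_mem r hx⟩
      · rintro ⟨hx, hm⟩
        by_contra hn
        exact ((straight_iff hK.1).1 hK.2).1 x hx hn hm
    rintro K ⟨h1, -⟩ K' ⟨h1', -⟩ hKK
    simp only at hKK
    rw [aux K h1, aux K' h1', hKK]
  · rintro κ ⟨h1, h2⟩
    have hTK : T ⊆ S.filter fun x => r x ∈ κ := fun x hx =>
      Finset.mem_filter.2 ⟨h.1 hx, h1 (Finset.mem_image_of_mem r hx)⟩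
    have h3 := (straight_iff h.1).1 h.2
    have e2 : defect r (S.filter fun x => r x ∈ κ) = defect r T := by
      rw [straight_iff hTK]
      refine ⟨fun x hx hxT => h3.1 x (Finset.mem_filter.1 hx).1 hxT, ?_⟩
      intro x hx hxT y hy hyT hxy
      exact h3.2 x (Finset.mem_filter.1 hx).1 hxT y (Finset.mem_filter.1 hy).1 hyT hxy
    refine ⟨S.filter fun x => r x ∈ κ, ⟨⟨Finset.filter_subset _ _, h.2.trans e2.symm⟩,
      ⟨hTK, e2⟩⟩, ?_⟩
    ext u
    simp only [Finset.mem_image, Finset.mem_filter]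
    constructor
    · rintro ⟨x, ⟨-, hx⟩, rfl⟩; exact hx
    · intro hu
      obtain ⟨x, hx, rfl⟩ := Finset.mem_image.1 (h2 hu)
      exact ⟨x, ⟨hx, hu⟩, rfl⟩

theorem before_irrefl (r : α → β) (x : α) : ¬ Before r x x := by
  rintro (h | ⟨-, h⟩)
  · exact irrefl _ h
  · exact irrefl _ h

theorem before_trans {r : α → β} {x y z : α} (h : Before r x y) (k : Before r y z) :
    Before r x z := by
  rcases h with h | ⟨e, h⟩ <;> rcases k with k | ⟨e', k⟩
  · exact Or.inl (_root_.trans h k)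
  · exact Or.inl (e' ▸ h)
  · exact Or.inl (e ▸ k)
  · exact Or.inr ⟨e.trans e', _root_.trans h k⟩

theorem before_total (r : α → β) {x y : α} (hxy : x ≠ y) : Before r x y ∨ Before r y x := by
  rcases trichotomous_of (WellOrderingRel (α := β)) (r x) (r y) with h | h | h
  · exact Or.inl (Or.inl h)
  · rcases trichotomous_of (WellOrderingRel (α := α)) x y with k | k | k
    · exact Or.inl (Or.inr ⟨h, k⟩)
    · exact absurd k hxy
    · exact Or.inr (Or.inr ⟨h.symm, k⟩)
  · exact Or.inr (Or.inl h)

open Classical in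
theorem place_erase {r : α → β} {S : Finset α} {w w' : α} (hw : w ∈ S)
    (him : (S.erase w).image r = S.image r) :
    place r (S.erase w) w' = place r S w' - if Before r w w' then 1 else 0 := by
  unfold place
  rw [him, Finset.filter_erase]
  split_ifs with h
  · have hm : w ∈ S.filter fun x => Before r x w' := Finset.mem_filter.2 ⟨hw, h⟩
    have : 0 < (S.filter fun x => Before r x w').card := Finset.card_pos.2 ⟨w, hm⟩
    rw [Finset.card_erase_of_mem hm, Nat.cast_sub (by omega)]
    push_cast; ring
  · rw [Finset.erase_eq_of_notMem (by simp [h])]; ring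

open Classical in
theorem place_swap {r : α → β} {S : Finset α} {w w' : α} (hw : w ∈ S) (hw' : w' ∈ S)
    (hne : w ≠ w') (h1 : (S.erase w).image r = S.image r)
    (h2 : (S.erase w').image r = S.image r) :
    ((place r S w).negOnePow : ℤ) * ((place r (S.erase w) w').negOnePow : ℤ) +
      ((place r S w').negOnePow : ℤ) * ((place r (S.erase w') w).negOnePow : ℤ) = 0 := by
  rw [place_erase hw h1, place_erase hw' h2]
  have asym : ∀ x y, Before r x y → ¬ Before r y x := fun x y h k =>
    before_irrefl r x (before_trans h k)
  rcases before_total r hne with h | h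
  · rw [if_pos h, if_neg (asym _ _ h), sub_zero, Int.negOnePow_sub]
    simp; ring
  · rw [if_pos h, if_neg (asym _ _ h), sub_zero, Int.negOnePow_sub]
    simp; ring

open Classical in
theorem place_straight {r : α → β} {S K : Finset α} (h : Straight r S K) {w : α} (hw : w ∈ K) :
    place r S w = place r K w := by
  obtain ⟨h1, h2⟩ := (straight_iff h.1).1 h.2
  have hU : K ∪ (S \ K) = S := Finset.union_sdiff_of_subset h.1
  have himg : S.image r = K.image r ∪ (S \ K).image r := by rw [← Finset.image_union, hU]
  have hd : Disjoint (K.image r) ((S \ K).image r) := by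
    rw [Finset.disjoint_right]
    intro u hu
    obtain ⟨x, hx, rfl⟩ := Finset.mem_image.1 hu
    rw [Finset.mem_sdiff] at hx
    exact h1 x hx.1 hx.2
  have c1 : (S.filter fun x => Before r x w).card =
      (K.filter fun x => Before r x w).card + ((S \ K).filter fun x => Before r x w).card := by
    conv_lhs => rw [← hU]
    rw [Finset.filter_union, Finset.card_union_of_disjoint
      (Finset.disjoint_filter_filter Finset.disjoint_sdiff)]
  have c2 : ((S.image r).filter fun u => WellOrderingRel u (r w)).card =
      ((K.image r).filter fun u => WellOrderingRel u (r w)).card +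
        (((S \ K).image r).filter fun u => WellOrderingRel u (r w)).card := by
    rw [himg, Finset.filter_union, Finset.card_union_of_disjoint
      (Finset.disjoint_filter_filter hd)]
  have c3 : (((S \ K).image r).filter fun u => WellOrderingRel u (r w)).card =
      ((S \ K).filter fun x => Before r x w).card := by
    rw [Finset.filter_image, Finset.card_image_of_injOn]
    · congr 1
      apply Finset.filter_congr
      intro x hx
      rw [Finset.mem_sdiff] at hx
      constructor
      · exact Or.inl
      · rintro (h | ⟨he, -⟩)
        · exact h
        · exact absurd (he ▸ Finset.mem_image_of_mem r hw) (h1 x hx.1 hx.2)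
    · intro x hx y hy hxy
      simp only [Finset.coe_filter, Set.mem_ofPred_eq, Finset.mem_sdiff] at hx hy
      exact h2 x hx.1.1 hx.1.2 y hy.1.1 hy.1.2 hxy
  unfold place
  rw [c1, c2, c3]
  push_cast
  ring

open Classical in
theorem place_succ {r : α → β} {S : Finset α} {x y : α} (hx : x ∈ S) (hr : r x = r y)
    (hxy : Before r x y) (h : ∀ z ∈ S, r z = r x → z = x ∨ z = y) :
    place r S y = place r S x + 1 := by
  have hset : (S.filter fun z => Before r z y) = insert x (S.filter fun z => Before r z x) := by
    ext z
    simp only [Finset.mem_filter, Finset.mem_insert]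
    constructor
    · rintro ⟨hz, hzy⟩
      by_cases hzx : z = x
      · exact Or.inl hzx
      right
      refine ⟨hz, ?_⟩
      rcases before_total r hzx with k | k
      · exact k
      exfalso
      have e : r z = r x := by
        rcases k with k | ⟨e, -⟩
        · rcases hzy with m | ⟨e, -⟩
          · rw [← hr] at m
            exact absurd (_root_.trans k m) (irrefl _)
          · exact e.trans hr.symm
        · exact e.symm
      rcases h z hz e with rfl | rfl
      · exact hzx rfl
      · exact before_irrefl r _ hzy
    · rintro (rfl | ⟨hz, hzx⟩)
      · exact ⟨hx, hxy⟩
      · exact ⟨hz, before_trans hzx hxy⟩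
  unfold place
  rw [hset, Finset.card_insert_of_notMem (by simp [before_irrefl]), hr]
  push_cast
  ring

open Classical in
theorem incidence_incidence (K' : PreAbstractSimplicialComplex α) (r : α → β)
    (S T : K'.faces) : ∑ᶠ K : K'.faces, incidence r S.1 K.1 * incidence r K.1 T.1 = 0 := by
  by_cases hex : ∃ K : K'.faces, incidence r S.1 K.1 * incidence r K.1 T.1 ≠ 0
  swap
  · push Not at hex
    exact finsum_eq_zero_of_forall_eq_zero hex
  obtain ⟨K, hK⟩ := hex
  obtain ⟨w, hw, hKw, him⟩ := incidence_ne_zero (left_ne_zero_of_mul hK)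
  obtain ⟨w', hw', hTw, him'⟩ := incidence_ne_zero (right_ne_zero_of_mul hK)
  rw [hKw, Finset.mem_erase] at hw'
  obtain ⟨hne, hwS'⟩ := hw'
  have hTS : T.1 = (S.1.erase w').erase w := by rw [hTw, hKw, Finset.erase_right_comm]
  have hTS' : T.1 = (S.1.erase w).erase w' := by rw [hTw, hKw]
  have hle : ∀ x, T.1 ⊆ S.1.erase x → S.1.erase x ∈ K'.faces := fun x hx =>
    (K'.isRelLowerSet_faces S.2).2 (Finset.erase_subset _ _)
      ((K'.isRelLowerSet_faces T.2).1.mono hx)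
  have m1 := hle w (by rw [hTS']; exact Finset.erase_subset _ _)
  have m2 := hle w' (by rw [hTS]; exact Finset.erase_subset _ _)
  have i1 : (S.1.erase w).image r = S.1.image r := by rw [← hKw, him]
  have i2 : (S.1.erase w').image r = S.1.image r := by
    apply le_antisymm (Finset.image_subset_image (Finset.erase_subset _ _))
    rw [← him, ← him']
    apply Finset.image_subset_image
    rw [hTS]; exact Finset.erase_subset _ _
  have hd : (⟨S.1.erase w, m1⟩ : K'.faces) ≠ ⟨S.1.erase w', m2⟩ := by
    intro h
    have h' : S.1.erase w = S.1.erase w' := congrArg Subtype.val h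
    exact Finset.notMem_erase w' S.1 (h' ▸ Finset.mem_erase.2 ⟨hne, hwS'⟩)
  rw [finsum_eq_sum_of_support_subset (s := {⟨S.1.erase w, m1⟩, ⟨S.1.erase w', m2⟩}),
    Finset.sum_pair hd]
  · simp only
    rw [incidence_erase hw i1, incidence_erase hwS' i2]
    have j1 : incidence r (S.1.erase w) T.1 = ((place r (S.1.erase w) w').negOnePow : ℤ) := by
      rw [hTS']
      apply incidence_erase (Finset.mem_erase.2 ⟨hne, hwS'⟩)
      rw [← hTS', him', him, i1]
    have j2 : incidence r (S.1.erase w') T.1 = ((place r (S.1.erase w') w).negOnePow : ℤ) := by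
      rw [hTS]
      apply incidence_erase (Finset.mem_erase.2 ⟨hne.symm, hw⟩)
      rw [← hTS, him', him, i2]
    rw [j1, j2]
    exact place_swap hw hwS' hne.symm i1 i2
  · intro L hL
    obtain ⟨x, hx, hLx, -⟩ := incidence_ne_zero (left_ne_zero_of_mul hL)
    obtain ⟨y, hy, hTy, -⟩ := incidence_ne_zero (right_ne_zero_of_mul hL)
    have hxT : x ∉ T.1 := by rw [hTy, hLx]; simp
    have : x = w ∨ x = w' := by
      rw [hTS'] at hxT
      simp only [Finset.mem_erase, not_and_or, not_not] at hxT
      tauto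
    simp only [Finset.coe_insert, Finset.coe_singleton, Set.mem_insert_iff,
      Set.mem_singleton_iff, Subtype.ext_iff, hLx]
    rcases this with rfl | rfl <;> simp

theorem erase_defect [DecidableEq α] [DecidableEq β] {r : α → β} {S : Finset α} {w : α}
    (hw : w ∈ S) (h : (S.erase w).image r = S.image r) :
    defect r S = defect r (S.erase w) + 1 := by
  have : 0 < S.card := Finset.card_pos.2 ⟨w, hw⟩
  unfold defect
  have h' := congrArg Finset.card h
  rw [Finset.card_erase_of_mem hw, Nat.cast_sub (by omega)]
  have e1 : ∀ F : Finset α, (@Finset.image _ _ (fun a b => Classical.propDecidable (a = b)) r F)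
    = F.image r := fun F => by congr!
  rw [e1, e1, h]
  push_cast; ring

open Classical in
theorem image_erase_eq {r : α → β} {S : Finset α} {w z : α} (hz : z ∈ S) (hzw : z ≠ w)
    (h : r w = r z) : (S.erase w).image r = S.image r := by
  apply le_antisymm (Finset.image_subset_image (Finset.erase_subset _ _))
  intro u hu
  obtain ⟨x, hx, rfl⟩ := Finset.mem_image.1 hu
  by_cases hxw : x = w
  · rw [hxw, h]
    exact Finset.mem_image_of_mem r (Finset.mem_erase.2 ⟨hzw, hz⟩)
  · exact Finset.mem_image_of_mem r (Finset.mem_erase.2 ⟨hxw, hx⟩)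

open Classical in
theorem exists_of_image_erase_eq {r : α → β} {S : Finset α} {w : α} (hw : w ∈ S)
    (h : (S.erase w).image r = S.image r) : ∃ z ∈ S, z ≠ w ∧ r w = r z := by
  have : r w ∈ (S.erase w).image r := h ▸ Finset.mem_image_of_mem r hw
  obtain ⟨z, hz, he⟩ := Finset.mem_image.1 this
  rw [Finset.mem_erase] at hz
  exact ⟨z, hz.2, hz.1, he.symm⟩

open Classical in
theorem incidence_straight (K' : PreAbstractSimplicialComplex α) (r : α → β) (S T : K'.faces) :
    (∑ᶠ (K : K'.faces) (_ : Straight r K.1 T.1), incidence r S.1 K.1) =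
      ∑ᶠ (K : K'.faces) (_ : Straight r S.1 K.1), incidence r K.1 T.1 := by
  simp only [finsum_eq_if]
  by_cases hyp : T.1 ⊆ S.1 ∧ defect r S.1 = defect r T.1 + 1
  swap
  · rw [finsum_eq_zero_of_forall_eq_zero, finsum_eq_zero_of_forall_eq_zero]
    · intro K
      split_ifs with hK
      · by_contra hne
        obtain ⟨w, hw, hT, -⟩ := incidence_ne_zero hne
        refine hyp ⟨?_, hK.2.trans (incidence_defect hne)⟩
        exact Finset.Subset.trans (hT ▸ Finset.erase_subset _ _) hK.1
      · rfl
    · intro K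
      split_ifs with hK
      · by_contra hne
        obtain ⟨w, hw, hT, -⟩ := incidence_ne_zero hne
        refine hyp ⟨Finset.Subset.trans hK.1 (hT ▸ Finset.erase_subset _ _), ?_⟩
        rw [← hK.2]; exact incidence_defect hne
      · rfl
  obtain ⟨hTS, hdef⟩ := hyp
  have hTne : T.1.Nonempty := (K'.isRelLowerSet_faces T.2).1
  have hmem : ∀ K : Finset α, T.1 ⊆ K → K ⊆ S.1 → K ∈ K'.faces := fun K h1 h2 =>
    (K'.isRelLowerSet_faces S.2).2 h2 (hTne.mono h1)
  by_cases hcase : ∃ w ∈ S.1, w ∉ T.1 ∧ r w ∈ T.1.image r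
  · obtain ⟨w, hwS, hwT, hwr⟩ := hcase
    obtain ⟨t, ht, htw⟩ := Finset.mem_image.1 hwr
    have htne : t ≠ w := fun h => hwT (h ▸ ht)
    have hins : insert w T.1 ⊆ S.1 := Finset.insert_subset hwS hTS
    have hee : (insert w T.1).erase w = T.1 := Finset.erase_insert hwT
    have himT : T.1.image r = (insert w T.1).image r := by
      rw [Finset.image_insert, Finset.insert_eq_of_mem hwr]
    have hst : Straight r S.1 (insert w T.1) := by
      refine ⟨hins, ?_⟩
      rw [erase_defect (Finset.mem_insert_self w T.1) (by rw [hee]; exact himT), hee]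
      exact hdef
    obtain ⟨h1, h2⟩ := (straight_iff hst.1).1 hst.2
    have hTe : T.1 ⊆ S.1.erase w := fun x hx =>
      Finset.mem_erase.2 ⟨fun h => hwT (h ▸ hx), hTS hx⟩
    have himS : (S.1.erase w).image r = S.1.image r :=
      image_erase_eq (hTS ht) htne htw.symm
    have hst' : Straight r (S.1.erase w) T.1 := by
      refine ⟨hTe, ?_⟩
      have := erase_defect hwS himS
      omega
    rw [finsum_eq_single _ (⟨S.1.erase w, hmem _ hTe (Finset.erase_subset _ _)⟩ : K'.faces),
      finsum_eq_single _ (⟨insert w T.1, hmem _ (Finset.subset_insert _ _) hins⟩ : K'.faces),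
      if_pos hst, if_pos hst']
    · simp only
      rw [incidence_erase hwS himS, place_straight hst (Finset.mem_insert_self w T.1)]
      conv_rhs => rw [← hee]
      rw [Finset.erase_insert hwT, ← incidence_erase (Finset.mem_insert_self w T.1)
        (by rw [hee]; exact himT), hee]
    · intro K hK
      split_ifs with hs
      swap
      · rfl
      by_contra hne
      obtain ⟨x, hx, hTx, him⟩ := incidence_ne_zero hne
      have hKx : K.1 = insert x T.1 := by rw [hTx, Finset.insert_erase hx]
      by_cases hxw : x = w
      · exact hK (Subtype.ext (by rw [hKx, hxw]))
      · refine h1 x (hs.1 hx) ?_ ?_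
        · rw [Finset.mem_insert, not_or]
          exact ⟨hxw, by rw [hTx]; exact Finset.notMem_erase _ _⟩
        · rw [← himT, him]; exact Finset.mem_image_of_mem r hx
    · intro K hK
      split_ifs with hs
      swap
      · rfl
      by_contra hne
      obtain ⟨x, hx, hKx, him⟩ := incidence_ne_zero hne
      have hxT : x ∉ T.1 := fun h => by
        have := hs.1 h
        rw [hKx] at this
        exact Finset.notMem_erase _ _ this
      have hxw : x ≠ w := fun h => hK (Subtype.ext (by rw [hKx, h]))
      obtain ⟨z, hz, hzx, hrz⟩ := exists_of_image_erase_eq hx (hKx ▸ him)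
      have hxi : x ∉ insert w T.1 := by rw [Finset.mem_insert, not_or]; exact ⟨hxw, hxT⟩
      by_cases hzi : z ∈ insert w T.1
      · exact h1 x hx hxi (hrz ▸ Finset.mem_image_of_mem r hzi)
      · exact hzx (h2 z hz hzi x hx hxi hrz.symm)
  · push Not at hcase
    have hns : ¬ defect r S.1 = defect r T.1 := by omega
    rw [straight_iff hTS, not_and] at hns
    have hnot := hns hcase
    push Not at hnot
    obtain ⟨x, hx, hxT, y, hy, hyT, hrxy, hxy⟩ := hnot
    have key : ∀ x y, x ∈ S.1 → x ∉ T.1 → y ∈ S.1 → y ∉ T.1 → r x = r y → x ≠ y →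
        Before r x y → (∑ᶠ K : K'.faces, if Straight r K.1 T.1 then incidence r S.1 K.1 else 0)
          = 0 := by
      intro x y hx hxT hy hyT hrxy hxy hbef
      have ix : (S.1.erase x).image r = S.1.image r := image_erase_eq hy (Ne.symm hxy) hrxy
      have iy : (S.1.erase y).image r = S.1.image r := image_erase_eq hx hxy hrxy.symm
      have sub : ∀ z, z ∉ T.1 → T.1 ⊆ S.1.erase z := fun z hz u hu =>
        Finset.mem_erase.2 ⟨fun h => hz (h ▸ hu), hTS hu⟩
      have sx : Straight r (S.1.erase x) T.1 := by
        refine ⟨sub x hxT, ?_⟩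
        have := erase_defect hx ix
        omega
      have sy : Straight r (S.1.erase y) T.1 := by
        refine ⟨sub y hyT, ?_⟩
        have := erase_defect hy iy
        omega
      have inj := ((straight_iff sx.1).1 sx.2).2
      have fib : ∀ z ∈ S.1, r z = r x → z = x ∨ z = y := by
        intro z hz hrz
        by_cases hzx : z = x
        · exact Or.inl hzx
        right
        have hzT : z ∉ T.1 := fun h => hcase x hx hxT (hrz ▸ Finset.mem_image_of_mem r h)
        exact inj z (Finset.mem_erase.2 ⟨hzx, hz⟩) hzT y
          (Finset.mem_erase.2 ⟨Ne.symm hxy, hy⟩) hyT (hrz.trans hrxy)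
      have hd : (⟨S.1.erase x, hmem _ (sub x hxT) (Finset.erase_subset _ _)⟩ : K'.faces) ≠
          ⟨S.1.erase y, hmem _ (sub y hyT) (Finset.erase_subset _ _)⟩ := by
        intro h
        have h' : S.1.erase x = S.1.erase y := congrArg Subtype.val h
        exact Finset.notMem_erase y S.1 (h' ▸ Finset.mem_erase.2 ⟨Ne.symm hxy, hy⟩)
      rw [finsum_eq_sum_of_support_subset (s := {⟨S.1.erase x, hmem _ (sub x hxT)
        (Finset.erase_subset _ _)⟩, ⟨S.1.erase y, hmem _ (sub y hyT)
        (Finset.erase_subset _ _)⟩}), Finset.sum_pair hd, if_pos sx, if_pos sy]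
      · simp only
        rw [incidence_erase hx ix, incidence_erase hy iy, place_succ hx hrxy hbef fib,
          Int.negOnePow_succ]
        simp
      · intro K hK
        have hs : Straight r K.1 T.1 := by
          by_contra h; exact hK (if_neg h)
        have hne : incidence r S.1 K.1 ≠ 0 := fun h => hK (by simp [h])
        obtain ⟨u, hu, hKu, him⟩ := incidence_ne_zero hne
        have huT : u ∉ T.1 := fun h => by
          have := hs.1 h
          rw [hKu] at this
          exact Finset.notMem_erase _ _ this
        obtain ⟨z, hz, hzu, hrz⟩ := exists_of_image_erase_eq hu (hKu ▸ him)
        have hzT : z ∉ T.1 := fun h => hcase u hu huT (hrz ▸ Finset.mem_image_of_mem r h)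
        have : u = x ∨ u = y := by
          by_cases hux : u = x
          · exact Or.inl hux
          by_cases hzx : z = x
          · exact fib u hu (hrz.trans (by rw [hzx]))
          exact absurd (inj z (Finset.mem_erase.2 ⟨hzx, hz⟩) hzT u
            (Finset.mem_erase.2 ⟨hux, hu⟩) huT hrz.symm) hzu
        simp only [Finset.coe_insert, Finset.coe_singleton, Set.mem_insert_iff,
          Set.mem_singleton_iff, Subtype.ext_iff, hKu]
        rcases this with rfl | rfl <;> simp
    have hl : (∑ᶠ K : K'.faces, if Straight r K.1 T.1 then incidence r S.1 K.1 else 0) = 0 := by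
      rcases before_total r hxy with h | h
      · exact key x y hx hxT hy hyT hrxy hxy h
      · exact key y x hy hyT hx hxT hrxy.symm (Ne.symm hxy) h
    rw [hl]
    symm
    apply finsum_eq_zero_of_forall_eq_zero
    intro K
    split_ifs with hs
    swap
    · rfl
    by_contra hne
    obtain ⟨u, hu, hTu, him⟩ := incidence_ne_zero hne
    exact hcase u (hs.1 hu) (by rw [hTu]; exact Finset.notMem_erase _ _)
      (him ▸ Finset.mem_image_of_mem r hu)

end VertexMap

/-- Every vertex lies in finitely many simplices. -/
def LocallyFiniteComplex {α : Type*} (K : PreAbstractSimplicialComplex α) : Prop :=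
  ∀ x, {σ ∈ K.faces | x ∈ σ}.Finite

namespace VertexMap

variable {α β : Type w} {K' : PreAbstractSimplicialComplex α} {K : PreAbstractSimplicialComplex β}

/-- `r` is a simplicial map from `K'` to `K`. -/
def IsSimplicial (K' : PreAbstractSimplicialComplex α) (K : PreAbstractSimplicialComplex β)
    (r : α → β) : Prop :=
  open Classical in ∀ σ ∈ K'.faces, σ.image r ∈ K.faces

open Classical in
/-- The map on simplices induced by a simplicial map. -/
noncomputable def onFaces {r : α → β} (hr : IsSimplicial K' K r) (S : K'.faces) : K.faces :=
  ⟨S.1.image r, hr S.1 S.2⟩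

theorem onFaces_bij {r : α → β} (hr : IsSimplicial K' K r) {S T : K'.faces}
    (h : Straight r S.1 T.1) :
    Set.BijOn (onFaces hr) {L | Straight r S.1 L.1 ∧ Straight r L.1 T.1}
      {κ | onFaces hr T ≤ κ ∧ κ ≤ onFaces hr S} := by
  classical
  obtain ⟨h1, h2, h3⟩ := straight_bij h
  refine ⟨fun L hL => h1 hL, ?_, ?_⟩
  · intro L hL L' hL' he
    exact Subtype.ext (h2 hL hL' (congrArg Subtype.val he))
  · intro κ hκ
    obtain ⟨L, hL, he⟩ := h3 (show κ.1 ∈ _ from hκ)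
    exact ⟨⟨L, (K'.isRelLowerSet_faces S.2).2 hL.1.1
      ((K'.isRelLowerSet_faces T.2).1.mono hL.2.1)⟩, hL, Subtype.ext he⟩

theorem incidence_sub {r : α → β} {S T : Finset α} (h : incidence r S T ≠ 0) : T ⊆ S := by
  classical
  obtain ⟨w, -, hw, -⟩ := incidence_ne_zero h
  rw [hw]; exact Finset.erase_subset _ _

theorem incidence_onFaces {r : α → β} (hr : IsSimplicial K' K r) {S T : K'.faces}
    (h : incidence r S.1 T.1 ≠ 0) : onFaces hr S = onFaces hr T := by
  obtain ⟨w, -, -, hw⟩ := incidence_ne_zero h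
  exact Subtype.ext hw.symm

/-- The data of one subdivision step along `r`. In the `upper` case they are those of simplicial
chains, in the `lower` case those of simplicial cochains. -/
noncomputable def subdivisionData {r : α → β} (hr : IsSimplicial K' K r)
    (hK' : LocallyFiniteComplex K') : ∀ s, SubdivisionData K.faces K'.faces s
  | .upper =>
    { ρ := onFaces hr
      a := fun S => -defect r S.1
      q := fun S T => Straight r S.1 T.1
      e := fun S T => incidence r S.1 T.1
      q_shift := fun S T h => by rw [h.2]
      q_allowed := fun S T h => h.1
      q_trans := fun S L T h k => h.trans k
      q_bij := fun S T h => by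
        convert onFaces_bij hr h using 1
        ext κ; exact and_comm
      e_shift := fun S T h => by rw [incidence_defect h]; ring
      e_fibre := fun S T h => incidence_onFaces hr h
      e_allowed := fun S T h => incidence_sub h
      fin := fun S => by
        refine ((S.1.powerset.finite_toSet).preimage (f := Subtype.val)
          Subtype.val_injective.injOn).subset ?_
        intro T hT
        simp only [Set.mem_preimage, Finset.mem_coe, Finset.mem_powerset]
        exact hT.elim (fun h => h.1) incidence_sub
      ee := fun S T => incidence_incidence K' r S T
      eq_qe := fun S T => incidence_straight K' r S T }
  | .lower =>
    { ρ := onFaces hr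
      a := fun S => defect r S.1
      q := fun S T => Straight r T.1 S.1
      e := fun S T => incidence r T.1 S.1
      q_shift := fun S T h => h.2.symm
      q_allowed := fun S T h => h.1
      q_trans := fun S L T h k => k.trans h
      q_bij := fun S T h => by
        convert onFaces_bij hr h using 1
        · ext L; exact and_comm
        · rfl
      e_shift := fun S T h => incidence_defect h
      e_fibre := fun S T h => (incidence_onFaces hr h).symm
      e_allowed := fun S T h => incidence_sub h
      fin := fun S => by
        obtain ⟨x, hx⟩ := (K'.isRelLowerSet_faces S.2).1
        refine ((hK' x).preimage (f := Subtype.val) Subtype.val_injective.injOn).subset ?_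
        intro T hT
        exact ⟨T.2, hT.elim (fun h => h.1 hx) (fun h => incidence_sub h hx)⟩
      ee := fun S T => by
        rw [← incidence_incidence K' r T S]
        exact finsum_congr fun L => mul_comm _ _
      eq_qe := fun S T => (incidence_straight K' r T S).symm }

end VertexMap

/-! Subdivisions of complexes whose vertices are points of a vector space. -/

namespace Geometric

variable {F : Type w} [AddCommGroup F] [Module ℝ F]

/-- Barycentre of a finite set of points. -/
noncomputable def bary (σ : Finset F) : F := (σ.card : ℝ)⁻¹ • ∑ x ∈ σ, x

open Classical in
/-- Barycentric subdivision: the simplices are the sets of barycentres of nonempty flags. -/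
noncomputable def Sd (K : PreAbstractSimplicialComplex F) : PreAbstractSimplicialComplex F where
  faces := {σ | ∃ c : Finset (Finset F), c.Nonempty ∧ (∀ ρ ∈ c, ρ ∈ K.faces) ∧
    IsChain (· ⊆ ·) (c : Set (Finset F)) ∧ σ = c.image bary}
  isRelLowerSet_faces := by
    rintro _ ⟨c, hc, hK, hch, rfl⟩
    refine ⟨hc.image _, ?_⟩
    intro τ hτ hne
    obtain ⟨c', hc', rfl⟩ := Finset.subset_image_iff.1 hτ
    exact ⟨c', Finset.image_nonempty.1 hne, fun ρ hρ => hK ρ (hc' hρ),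
      hch.mono (by exact_mod_cast hc'), rfl⟩

/-- Every point lies in finitely many closed simplices. -/
def PointFinite (K : PreAbstractSimplicialComplex F) : Prop :=
  ∀ y, {σ ∈ K.faces | y ∈ convexHull ℝ (σ : Set F)}.Finite

theorem PointFinite.locallyFinite {K : PreAbstractSimplicialComplex F} (h : PointFinite K) :
    LocallyFiniteComplex K := fun x =>
  (h x).subset fun _ hσ => ⟨hσ.1, subset_convexHull ℝ _ hσ.2⟩

theorem bary_mem {σ : Finset F} (h : σ.Nonempty) : bary σ ∈ convexHull ℝ (σ : Set F) := by
  rw [bary, Finset.smul_sum]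
  have hc : (σ.card : ℝ) ≠ 0 := by exact_mod_cast h.card_pos.ne'
  refine (convex_convexHull ℝ _).sum_mem (fun _ _ => by positivity) ?_
    (fun x hx => subset_convexHull ℝ _ hx)
  simp [hc]

theorem exists_max_of_chain {F : Type*} {c : Finset (Finset F)} (hc : c.Nonempty)
    (h : IsChain (· ⊆ ·) (c : Set (Finset F))) : ∃ m ∈ c, ∀ ρ ∈ c, ρ ⊆ m := by
  obtain ⟨m, hm, hmax⟩ := c.exists_max_image Finset.card hc
  refine ⟨m, hm, fun ρ hρ => ?_⟩
  rcases h.total hρ hm with h | h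
  · exact h
  · exact (Finset.eq_of_subset_of_card_le h (hmax ρ hρ)).ge

theorem PointFinite.sd {K : PreAbstractSimplicialComplex F} (h : PointFinite K) :
    PointFinite (Sd K) := by
  classical
  intro y
  apply ((h y).biUnion (t := fun m => ((m.powerset.powerset.image
    fun c : Finset (Finset F) => c.image bary : Finset (Finset F)) : Set (Finset F)))
    fun m _ => Finset.finite_toSet _).subset
  rintro σ ⟨⟨c, hc, hK, hch, rfl⟩, hy⟩
  obtain ⟨m, hm, hmax⟩ := exists_max_of_chain hc hch
  simp only [Set.mem_iUnion]
  refine ⟨m, ⟨hK m hm, ?_⟩, ?_⟩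
  · refine convexHull_min ?_ (convex_convexHull ℝ _) hy
    intro x hx
    simp only [Finset.coe_image, Set.mem_image, Finset.mem_coe] at hx
    obtain ⟨ρ, hρ, rfl⟩ := hx
    exact convexHull_mono (by exact_mod_cast hmax ρ hρ)
      (bary_mem (K.isRelLowerSet_faces (hK ρ hρ)).1)
  · simp only [Finset.coe_image, Set.mem_image, Finset.mem_coe, Finset.mem_powerset]
    exact ⟨c, fun ρ hρ => Finset.mem_powerset.2 (hmax ρ hρ), by congr!⟩

/-- All vertices of simplices lie in a convex set of heights. -/
theorem Sd_subset {K : PreAbstractSimplicialComplex F} {Z : Set F} (hZ : Convex ℝ Z)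
    (h : ∀ σ ∈ K.faces, (σ : Set F) ⊆ Z) : ∀ σ ∈ (Sd K).faces, (σ : Set F) ⊆ Z := by
  classical
  rintro _ ⟨c, hc, hK, hch, rfl⟩ x hx
  simp only [Finset.coe_image, Set.mem_image, Finset.mem_coe] at hx
  obtain ⟨ρ, hρ, rfl⟩ := hx
  exact convexHull_min (h ρ (hK ρ hρ)) hZ (bary_mem (K.isRelLowerSet_faces (hK ρ hρ)).1)

open Classical in
theorem PointFinite.map {G : Type*} [AddCommGroup G] [Module ℝ G]
    {K : PreAbstractSimplicialComplex F} (h : PointFinite K) (f : F →ᵃ[ℝ] G)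
    (hf : Function.Injective f) : PointFinite (K.map f) := by
  intro y
  by_cases hy : ∃ x, f x = y
  · obtain ⟨x, rfl⟩ := hy
    apply ((h x).image fun σ => σ.image f).subset
    rintro _ ⟨⟨σ, hσ, rfl⟩, hx⟩
    refine ⟨σ, ⟨hσ, ?_⟩, rfl⟩
    simp only [Finset.coe_image] at hx
    rw [← AffineMap.image_convexHull] at hx
    obtain ⟨x', hx', he⟩ := hx
    exact hf he ▸ hx'
  · convert Set.finite_empty
    apply Set.eq_empty_of_forall_notMem
    rintro _ ⟨⟨σ, hσ, rfl⟩, hx⟩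
    simp only [Finset.coe_image] at hx
    rw [← AffineMap.image_convexHull] at hx
    obtain ⟨x', -, he⟩ := hx
    exact hy ⟨x', he⟩

end Geometric

/-! The triangulations of `X × ℝ`. -/

namespace Cone

open Geometric

/-- The ambient vector space of `X × ℝ`: points are pairs of barycentric coordinates and a
height. -/
abbrev Pt (V : Type w) : Type w := (V →₀ ℝ) × ℝ

variable {V : Type w}

/-- A vertex of `X` as a point. -/
noncomputable def vertex (x : V) : V →₀ ℝ := Finsupp.single x 1

open Classical in
/-- The barycentre of a simplex of `X`. -/
noncomputable def centre (ρ : Finset V) : V →₀ ℝ := bary (ρ.image vertex)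

open Classical in
/-- `X` with its vertices made points. -/
noncomputable def realize (X : PreAbstractSimplicialComplex V) :
    PreAbstractSimplicialComplex (V →₀ ℝ) := X.map vertex

/-- The iterated barycentric subdivision `Sd^i X`. -/
noncomputable def SdX (X : PreAbstractSimplicialComplex V) (i : ℕ) :
    PreAbstractSimplicialComplex (V →₀ ℝ) := Sd^[i] (realize X)

open Classical in
/-- The prism between `X` (at height 0) and `Sd X` (at height 1). -/
noncomputable def sdPrism (X : PreAbstractSimplicialComplex V) :
    PreAbstractSimplicialComplex (Pt V) where
  faces := {σ | ∃ (τ : Finset V) (c : Finset (Finset V)), (τ = ∅ ∨ τ ∈ X.faces) ∧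
    (∀ ρ ∈ c, ρ ∈ X.faces ∧ τ ⊆ ρ) ∧ IsChain (· ⊆ ·) (c : Set (Finset V)) ∧
    (τ.Nonempty ∨ c.Nonempty) ∧
    σ = τ.image (fun x => (vertex x, (0 : ℝ))) ∪ c.image (fun ρ => (centre ρ, (1 : ℝ)))}
  isRelLowerSet_faces := by
    rintro _ ⟨τ, c, hτ, hc, hch, hne, rfl⟩
    refine ⟨by rcases hne with h | h <;> simp [h], ?_⟩
    intro σ hσ hσne
    obtain ⟨a, ha, b, hb, rfl⟩ : ∃ a ⊆ τ, ∃ b ⊆ c, σ = a.image (fun x => (vertex x, (0 : ℝ))) ∪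
        b.image (fun ρ => (centre ρ, (1 : ℝ))) := by
      refine ⟨τ.filter fun x => (vertex x, (0 : ℝ)) ∈ σ, Finset.filter_subset _ _,
        c.filter fun ρ => (centre ρ, (1 : ℝ)) ∈ σ, Finset.filter_subset _ _, ?_⟩
      ext p
      simp only [Finset.mem_union, Finset.mem_image, Finset.mem_filter]
      constructor
      · intro hp
        have := hσ hp
        simp only [Finset.mem_union, Finset.mem_image] at this
        rcases this with ⟨x, hx, rfl⟩ | ⟨x, hx, rfl⟩
        · exact Or.inl ⟨x, ⟨hx, hp⟩, rfl⟩
        · exact Or.inr ⟨x, ⟨hx, hp⟩, rfl⟩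
      · rintro (⟨x, ⟨-, hp⟩, rfl⟩ | ⟨x, ⟨-, hp⟩, rfl⟩) <;> exact hp
    refine ⟨a, b, ?_, fun ρ hρ => ⟨(hc ρ (hb hρ)).1, ha.trans (hc ρ (hb hρ)).2⟩,
      hch.mono (by exact_mod_cast hb), ?_, rfl⟩
    · rcases a.eq_empty_or_nonempty with h | h
      · exact Or.inl h
      · right
        rcases hτ with rfl | hτ
        · simp [Finset.subset_empty.1 ha] at h
        · exact (X.isRelLowerSet_faces hτ).2 ha h
    · simpa using hσne

open Classical in
/-- The prism between `X` (at height 0) and `X` (at height 1). -/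
noncomputable def prism [LinearOrder V] (X : PreAbstractSimplicialComplex V) :
    PreAbstractSimplicialComplex (Pt V) where
  faces := {σ | ∃ a b : Finset V, a ∪ b ∈ X.faces ∧ (∀ x ∈ a, ∀ y ∈ b, x ≤ y) ∧
    σ = a.image (fun x => (vertex x, (0 : ℝ))) ∪ b.image (fun x => (vertex x, (1 : ℝ)))}
  isRelLowerSet_faces := by
    rintro _ ⟨a, b, hab, hle, rfl⟩
    refine ⟨by simpa using (X.isRelLowerSet_faces hab).1, ?_⟩
    intro σ hσ hσne
    obtain ⟨a', ha, b', hb, rfl⟩ : ∃ a' ⊆ a, ∃ b' ⊆ b,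
        σ = a'.image (fun x => (vertex x, (0 : ℝ))) ∪ b'.image (fun x => (vertex x, (1 : ℝ))) := by
      refine ⟨a.filter fun x => (vertex x, (0 : ℝ)) ∈ σ, Finset.filter_subset _ _,
        b.filter fun x => (vertex x, (1 : ℝ)) ∈ σ, Finset.filter_subset _ _, ?_⟩
      ext p
      simp only [Finset.mem_union, Finset.mem_image, Finset.mem_filter]
      constructor
      · intro hp
        have := hσ hp
        simp only [Finset.mem_union, Finset.mem_image] at this
        rcases this with ⟨x, hx, rfl⟩ | ⟨x, hx, rfl⟩
        · exact Or.inl ⟨x, ⟨hx, hp⟩, rfl⟩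
        · exact Or.inr ⟨x, ⟨hx, hp⟩, rfl⟩
      · rintro (⟨x, ⟨-, hp⟩, rfl⟩ | ⟨x, ⟨-, hp⟩, rfl⟩) <;> exact hp
    exact ⟨a', b', (X.isRelLowerSet_faces hab).2 (Finset.union_subset_union ha hb)
      (by simpa using hσne), fun x hx y hy => hle x (ha hx) y (hb hy), rfl⟩

/-- The heights `v_i`, for a complex of dimension `d`. -/
noncomputable def height (d : ℕ) (i : ℤ) : ℝ :=
  if i ≤ 0 then i else ∑ j ∈ Finset.range i.toNat, (((d : ℝ) + 2) / (d + 1)) ^ j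

theorem one_le_ratio (d : ℕ) : 1 ≤ ((d : ℝ) + 2) / (d + 1) := by
  rw [le_div_iff₀ (by positivity)]; linarith

theorem height_nat (d i : ℕ) :
    height d i = ∑ j ∈ Finset.range i, (((d : ℝ) + 2) / (d + 1)) ^ j := by
  unfold height
  split_ifs with h
  · have : i = 0 := by omega
    subst this; simp
  · simp

theorem height_neg (d : ℕ) {i : ℤ} (h : i ≤ 0) : height d i = i := if_pos h

theorem height_lt (d : ℕ) (i : ℤ) : height d i < height d (i + 1) := by
  rcases lt_or_ge i 0 with h | h
  · rw [height_neg d (by omega), height_neg d (by omega)]; push_cast; linarith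
  · obtain ⟨n, rfl⟩ := Int.eq_ofNat_of_zero_le h
    have : ((n : ℤ) + 1) = ((n + 1 : ℕ) : ℤ) := by push_cast; ring
    rw [this, height_nat, height_nat, Finset.sum_range_succ]
    have := one_le_ratio d
    have : 0 < (((d : ℝ) + 2) / (d + 1)) ^ n := by positivity
    linarith

theorem le_height (d : ℕ) (i : ℤ) : (i : ℝ) ≤ height d i := by
  rcases le_or_gt i 0 with h | h
  · rw [height_neg d h]
  · obtain ⟨n, rfl⟩ := Int.eq_ofNat_of_zero_le h.le
    rw [height_nat]
    calc ((n : ℤ) : ℝ) = ∑ _j ∈ Finset.range n, (1 : ℝ) := by simp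
      _ ≤ _ := Finset.sum_le_sum fun j _ => one_le_pow₀ (one_le_ratio d)

/-- The affine map taking `X × [0,1]` to `X × [v_i, v_{i+1}]`. -/
noncomputable def blockMap (d : ℕ) (i : ℤ) : Pt V →ᵃ[ℝ] Pt V :=
  (AffineMap.id ℝ (V →₀ ℝ)).prodMap (AffineMap.lineMap (height d i) (height d (i + 1)))

theorem blockMap_apply (d : ℕ) (i : ℤ) (p : Pt V) :
    blockMap d i p = (p.1, AffineMap.lineMap (height d i) (height d (i + 1)) p.2) := rfl

theorem blockMap_injective (d : ℕ) (i : ℤ) : Function.Injective (blockMap (V := V) d i) := by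
  intro p q h
  rw [blockMap_apply, blockMap_apply, Prod.mk.injEq] at h
  exact Prod.ext h.1 (AffineMap.lineMap_injective ℝ (height_lt d i).ne h.2)

/-- The triangulation of `X × [0,1]` that is used for `X × [v_i, v_{i+1}]`. -/
noncomputable def block [LinearOrder V] (X : PreAbstractSimplicialComplex V) (i : ℤ) :
    PreAbstractSimplicialComplex (Pt V) :=
  if 0 ≤ i then Sd^[i.toNat] (sdPrism X) else prism X

open Classical in
/-- The triangulation `t^0(X × ℝ)`. -/
noncomputable def triangulation [LinearOrder V] (X : PreAbstractSimplicialComplex V) (d : ℕ) :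
    PreAbstractSimplicialComplex (Pt V) where
  faces := {σ | ∃ i : ℤ, σ ∈ ((block X i).map (blockMap d i)).faces}
  isRelLowerSet_faces := by
    rintro σ ⟨i, hi⟩
    have h := PreAbstractSimplicialComplex.isRelLowerSet_faces _ hi
    exact ⟨h.1, fun τ hτ hne => ⟨i, h.2 hτ hne⟩⟩

/-- The effect on heights of the exponential translation by 1, which is affine from
`[v_i, v_{i+1}]` to `[v_{i+1}, v_{i+2}]`. -/
noncomputable def shift (d : ℕ) (t : ℝ) : ℝ :=
  if t ≤ 0 then t + 1 else ((d : ℝ) + 2) / (d + 1) * t + 1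

/-- The exponential translation `t^k` for `k ≥ 0`. -/
noncomputable def translate (d k : ℕ) (p : Pt V) : Pt V := (p.1, (shift d)^[k] p.2)

theorem shift_strictMono (d : ℕ) : StrictMono (shift d) := by
  intro s t h
  have := one_le_ratio d
  unfold shift
  split_ifs <;> nlinarith

theorem translate_injective (d k : ℕ) : Function.Injective (translate (V := V) d k) := by
  intro p q h
  rw [translate, translate, Prod.mk.injEq] at h
  exact Prod.ext h.1 ((shift_strictMono d).injective.iterate k h.2)

open Classical in
/-- The part over `X × [0,∞)` of the triangulation `t^{-k}(X × ℝ)`; there it is the `k`-fold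
barycentric subdivision of `t^0(X × ℝ)`. -/
noncomputable def level [LinearOrder V] (X : PreAbstractSimplicialComplex V) (d k : ℕ) :
    PreAbstractSimplicialComplex (Pt V) where
  faces := {σ | σ.image (translate d k) ∈ (triangulation X d).faces ∧ ∀ p ∈ σ, 0 ≤ p.2}
  isRelLowerSet_faces := by
    rintro σ ⟨h, h0⟩
    have h' := (triangulation X d).isRelLowerSet_faces h
    refine ⟨by simpa using h'.1, fun τ hτ hne => ⟨h'.2 (Finset.image_subset_image hτ) (by simpa),
      fun p hp => h0 p (hτ hp)⟩⟩

section Finiteness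

/-- The affine span of the vertices of `ρ`. -/
def coords (ρ : Finset V) : Set (V →₀ ℝ) :=
  {f | (∀ x, x ∉ ρ → f x = 0) ∧ Finsupp.linearCombination ℝ (fun _ => (1 : ℝ)) f = 1}

theorem convex_coords (ρ : Finset V) : Convex ℝ (coords ρ) := by
  rintro f ⟨hf, hf1⟩ g ⟨hg, hg1⟩ a b _ _ hab
  refine ⟨fun x hx => by simp [hf x hx, hg x hx], ?_⟩
  rw [map_add, map_smul, map_smul, hf1, hg1]
  simpa using hab

theorem vertex_mem_coords {ρ : Finset V} {x : V} (h : x ∈ ρ) : vertex x ∈ coords ρ := by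
  refine ⟨fun y hy => ?_, by simp [vertex]⟩
  exact Finsupp.single_eq_of_ne fun e => hy (e ▸ h)

theorem centre_mem_coords {ρ τ : Finset V} (h : τ ⊆ ρ) (hne : τ.Nonempty) :
    centre τ ∈ coords ρ := by
  classical
  refine convexHull_min ?_ (convex_coords ρ) (bary_mem (hne.image _))
  intro p hp
  simp only [Finset.coe_image, Set.mem_image, Finset.mem_coe] at hp
  obtain ⟨x, hx, rfl⟩ := hp
  exact vertex_mem_coords (h hx)

theorem pointFinite_of_carrier {X : PreAbstractSimplicialComplex V}
    (hX : LocallyFiniteComplex X) {K : PreAbstractSimplicialComplex (Pt V)}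
    (G : Finset V → Finset (Pt V))
    (h : ∀ σ ∈ K.faces, ∃ ρ ∈ X.faces, σ ⊆ G ρ ∧ ∀ p ∈ σ, p.1 ∈ coords ρ) : PointFinite K := by
  intro y
  by_cases hy : y.1 = 0
  · convert Set.finite_empty
    apply Set.eq_empty_of_forall_notMem
    rintro σ ⟨hσ, hyσ⟩
    obtain ⟨ρ, -, -, hc⟩ := h σ hσ
    have : y.1 ∈ coords ρ := convexHull_min (t := {p : Pt V | p.1 ∈ coords ρ}) hc
      ((convex_coords ρ).is_linear_preimage (f := Prod.fst) ⟨fun _ _ => rfl, fun _ _ => rfl⟩) hyσ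
    rw [hy] at this
    simpa using this.2
  · obtain ⟨x, hx⟩ := Finsupp.ne_iff.1 hy
    apply ((hX x).biUnion (t := fun ρ => ((G ρ).powerset : Set (Finset (Pt V))))
      fun ρ _ => Finset.finite_toSet _).subset
    rintro σ ⟨hσ, hyσ⟩
    obtain ⟨ρ, hρ, hG, hc⟩ := h σ hσ
    have : y.1 ∈ coords ρ := convexHull_min (t := {p : Pt V | p.1 ∈ coords ρ}) hc
      ((convex_coords ρ).is_linear_preimage (f := Prod.fst) ⟨fun _ _ => rfl, fun _ _ => rfl⟩) hyσ
    simp only [Set.mem_iUnion]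
    refine ⟨ρ, ⟨hρ, ?_⟩, by simpa using hG⟩
    by_contra hn
    exact hx (this.1 x hn)

open Classical in
theorem pointFinite_sdPrism {X : PreAbstractSimplicialComplex V} (hX : LocallyFiniteComplex X) :
    PointFinite (sdPrism X) := by
  apply pointFinite_of_carrier hX fun ρ => ρ.image (fun x => (vertex x, (0 : ℝ))) ∪
    ρ.powerset.image (fun τ => (centre τ, (1 : ℝ)))
  rintro _ ⟨τ, c, hτ, hc, hch, hne, rfl⟩
  obtain ⟨ρ, hρ, h1, h2⟩ : ∃ ρ ∈ X.faces, τ ⊆ ρ ∧ ∀ κ ∈ c, κ ⊆ ρ := by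
    rcases c.eq_empty_or_nonempty with rfl | hcne
    · refine ⟨τ, ?_, Finset.Subset.refl _, by simp⟩
      rcases hτ with rfl | hτ
      · simp at hne
      · exact hτ
    · obtain ⟨m, hm, hmax⟩ := exists_max_of_chain hcne hch
      exact ⟨m, (hc m hm).1, (hc m hm).2, hmax⟩
  refine ⟨ρ, hρ, Finset.union_subset_union (Finset.image_subset_image h1)
    (Finset.image_subset_image fun κ hκ => Finset.mem_powerset.2 (h2 κ hκ)), ?_⟩
  intro p hp
  simp only [Finset.mem_union, Finset.mem_image] at hp
  rcases hp with ⟨x, hx, rfl⟩ | ⟨κ, hκ, rfl⟩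
  · exact vertex_mem_coords (h1 hx)
  · exact centre_mem_coords (h2 κ hκ) (X.isRelLowerSet_faces (hc κ hκ).1).1

open Classical in
theorem pointFinite_prism [LinearOrder V] {X : PreAbstractSimplicialComplex V}
    (hX : LocallyFiniteComplex X) : PointFinite (prism X) := by
  apply pointFinite_of_carrier hX fun ρ => ρ.image (fun x => (vertex x, (0 : ℝ))) ∪
    ρ.image (fun x => (vertex x, (1 : ℝ)))
  rintro _ ⟨a, b, hab, -, rfl⟩
  have ha : a ⊆ a ∪ b := by intro x hx; simp [hx]
  have hb : b ⊆ a ∪ b := by intro x hx; simp [hx]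
  refine ⟨_, hab, Finset.union_subset_union (Finset.image_subset_image ha)
    (Finset.image_subset_image hb), ?_⟩
  intro p hp
  simp only [Finset.mem_union, Finset.mem_image] at hp
  rcases hp with ⟨x, hx, rfl⟩ | ⟨x, hx, rfl⟩
  · exact vertex_mem_coords (ha hx)
  · exact vertex_mem_coords (hb hx)

theorem pointFinite_block [LinearOrder V] {X : PreAbstractSimplicialComplex V}
    (hX : LocallyFiniteComplex X) (i : ℤ) : PointFinite (block X i) := by
  unfold block
  split_ifs
  · induction i.toNat with
    | zero => exact pointFinite_sdPrism hX
    | succ n ih => rw [Function.iterate_succ_apply']; exact ih.sd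
  · exact pointFinite_prism hX

theorem convex_slab : Convex ℝ {p : Pt V | p.2 ∈ Set.Icc (0 : ℝ) 1} :=
  (convex_Icc 0 1).is_linear_preimage (f := Prod.snd) ⟨fun _ _ => rfl, fun _ _ => rfl⟩

theorem block_slab [LinearOrder V] (X : PreAbstractSimplicialComplex V) (i : ℤ) :
    ∀ σ ∈ (block X i).faces, (σ : Set (Pt V)) ⊆ {p : Pt V | p.2 ∈ Set.Icc (0 : ℝ) 1} := by
  classical
  unfold block
  split_ifs
  · induction i.toNat with
    | zero =>
      rintro _ ⟨τ, c, -, -, -, -, rfl⟩ p hp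
      simp only [Finset.mem_coe, Finset.mem_union, Finset.mem_image] at hp
      rcases hp with ⟨x, -, rfl⟩ | ⟨x, -, rfl⟩ <;> simp
    | succ n ih => rw [Function.iterate_succ_apply']; exact Sd_subset convex_slab ih
  · rintro _ ⟨a, b, -, -, rfl⟩ p hp
    simp only [Finset.mem_coe, Finset.mem_union, Finset.mem_image] at hp
    rcases hp with ⟨x, -, rfl⟩ | ⟨x, -, rfl⟩ <;> simp

theorem locallyFinite_triangulation [LinearOrder V] {X : PreAbstractSimplicialComplex V}
    (hX : LocallyFiniteComplex X) (d : ℕ) : LocallyFiniteComplex (triangulation X d) := by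
  classical
  intro y
  have hI : {i : ℤ | height d i ≤ y.2 ∧ y.2 ≤ height d (i + 1)}.Finite := by
    apply (Set.finite_Icc (min (-1) ⌊y.2 - 1⌋) ⌈y.2⌉).subset
    rintro i ⟨h1, h2⟩
    constructor
    · by_contra hlt
      rw [not_le, lt_min_iff] at hlt
      rw [height_neg d (by omega)] at h2
      have := Int.floor_le (y.2 - 1)
      have h3 : ((i : ℤ) : ℝ) + 1 ≤ (⌊y.2 - 1⌋ : ℤ) := by exact_mod_cast hlt.2
      push_cast at h2
      linarith
    · have := (le_height d i).trans (h1.trans (Int.le_ceil y.2))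
      exact_mod_cast this
  apply (hI.biUnion (t := fun i => {σ ∈ ((block X i).map (blockMap d i)).faces |
    y ∈ convexHull ℝ (σ : Set (Pt V))}) fun i _ => by
      convert (pointFinite_block hX i).map (blockMap d i) (blockMap_injective d i) y).subset
  rintro σ ⟨⟨i, hi⟩, hy⟩
  simp only [Set.mem_iUnion]
  refine ⟨i, ?_, hi, subset_convexHull ℝ _ hy⟩
  obtain ⟨σ', hσ', rfl⟩ := hi
  obtain ⟨p, hp, rfl⟩ := Finset.mem_image.1 hy
  have hp' := block_slab X i σ' hσ' hp
  have hlt := height_lt d i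
  simp only [Set.mem_ofPred_eq, Set.mem_Icc] at hp'
  rw [blockMap_apply]
  simp only [Set.mem_ofPred_eq, AffineMap.lineMap_apply, vsub_eq_sub, smul_eq_mul, vadd_eq_add]
  constructor <;> nlinarith

theorem locallyFinite_level [LinearOrder V] {X : PreAbstractSimplicialComplex V}
    (hX : LocallyFiniteComplex X) (d k : ℕ) : LocallyFiniteComplex (level X d k) := by
  classical
  intro y
  refine Set.Finite.of_finite_image (f := fun σ => σ.image (translate d k))
    ((locallyFinite_triangulation hX d (translate d k y)).subset ?_)
    (Finset.image_injective (translate_injective d k)).injOn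
  rintro _ ⟨σ, ⟨hσ, hy⟩, rfl⟩
  refine ⟨?_, Finset.mem_image_of_mem _ hy⟩
  convert hσ.1

end Finiteness

/-! Parts of the triangulations, as order-convex sets of simplices. -/

section Parts

variable [LinearOrder V] (X : PreAbstractSimplicialComplex V) (d : ℕ)

open Classical in
/-- `t^k` maps the simplices of `t^{-k}(X × ℝ)` over `[0,∞)` to simplices of `t^0(X × ℝ)`. -/
noncomputable def levelEmbedding (k : ℕ) :
    (level X d k).faces ↪o (triangulation X d).faces where
  toFun σ := ⟨σ.1.image (translate d k), σ.2.1⟩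
  inj' _ _ h := Subtype.ext (Finset.image_injective (translate_injective d k)
    (congrArg Subtype.val h))
  map_rel_iff' := Finset.image_subset_image_iff (translate_injective d k)

theorem levelEmbedding_convex (k : ℕ) : (Set.range (levelEmbedding X d k)).OrdConnected := by
  classical
  constructor
  rintro _ ⟨σ, rfl⟩ _ ⟨τ, rfl⟩ ⟨ρ, hρ⟩ ⟨-, h⟩
  obtain ⟨κ, hκ, rfl⟩ := Finset.subset_image_iff.1 (show ρ ⊆ τ.1.image (translate d k) from h)
  exact ⟨⟨κ, by convert hρ, fun p hp => τ.2.2 p (hκ hp)⟩, rfl⟩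

open Classical in
theorem sdPrism_bottom (i : ℕ) : ∀ σ ∈ (SdX X i).faces,
    σ.image (fun x => (x, (0 : ℝ))) ∈ (Sd^[i] (sdPrism X)).faces := by
  unfold SdX
  induction i with
  | zero =>
    rintro _ ⟨σ, hσ, rfl⟩
    refine ⟨σ, ∅, Or.inr hσ, by simp, by simp, Or.inl (X.isRelLowerSet_faces hσ).1, ?_⟩
    ext p
    simp
  | succ n ih =>
    rw [Function.iterate_succ_apply', Function.iterate_succ_apply']
    rintro _ ⟨c, hc, hK, hch, rfl⟩
    have hinj : Function.Injective fun x : V →₀ ℝ => (x, (0 : ℝ)) := fun x y h =>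
      congrArg Prod.fst h
    refine ⟨c.image fun ρ => ρ.image fun x => (x, (0 : ℝ)), hc.image _, ?_, ?_, ?_⟩
    · intro ρ hρ
      obtain ⟨κ, hκ, rfl⟩ := Finset.mem_image.1 hρ
      exact ih κ (hK κ hκ)
    · rw [Finset.coe_image]
      rintro _ ⟨ρ, hρ, rfl⟩ _ ⟨κ, hκ, rfl⟩ hne
      have hne' : ρ ≠ κ := fun h => hne (by rw [h])
      exact (hch hρ hκ hne').imp (Finset.image_subset_image ·) (Finset.image_subset_image ·)
    · ext1 p
      have hb : ∀ ρ : Finset (V →₀ ℝ),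
          bary (ρ.image fun x => (x, (0 : ℝ))) = (bary ρ, (0 : ℝ)) := by
        intro ρ
        rw [bary, bary, Finset.card_image_of_injective _ hinj, Finset.sum_image hinj.injOn]
        ext1
        · simp [Prod.fst_sum]
        · simp [Prod.snd_sum]
      simp only [Finset.mem_image]
      constructor
      · rintro ⟨_, ⟨ρ, hρ, rfl⟩, rfl⟩
        exact ⟨_, ⟨ρ, hρ, rfl⟩, hb ρ⟩
      · rintro ⟨_, ⟨ρ, hρ, rfl⟩, rfl⟩
        exact ⟨_, ⟨ρ, hρ, rfl⟩, (hb ρ).symm⟩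

open Classical in
theorem slice_mem (i : ℕ) (σ : (SdX X i).faces) :
    σ.1.image (fun x => (x, height d i)) ∈ (triangulation X d).faces := by
  refine ⟨i, σ.1.image (fun x => (x, (0 : ℝ))), ?_, ?_⟩
  · rw [block, if_pos (by omega)]
    exact sdPrism_bottom X i σ.1 σ.2
  · ext p
    simp [blockMap_apply]

open Classical in
/-- `σ ↦ σ × {v_i}`, from the simplices of `Sd^i X` to those of `t^0(X × ℝ)`. -/
noncomputable def sliceEmbedding (i : ℕ) :
    (SdX X i).faces ↪o (triangulation X d).faces where
  toFun σ := ⟨σ.1.image fun x => (x, height d i), slice_mem X d i σ⟩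
  inj' _ _ h := Subtype.ext (Finset.image_injective
    (fun _ _ hxy => congrArg Prod.fst hxy) (congrArg Subtype.val h))
  map_rel_iff' := Finset.image_subset_image_iff fun _ _ hxy => congrArg Prod.fst hxy

theorem sliceEmbedding_convex (i : ℕ) : (Set.range (sliceEmbedding X d i)).OrdConnected := by
  classical
  constructor
  rintro _ ⟨σ, rfl⟩ _ ⟨τ, rfl⟩ ⟨ρ, hρ⟩ ⟨-, h⟩
  obtain ⟨κ, hκ, rfl⟩ := Finset.subset_image_iff.1
    (show ρ ⊆ τ.1.image (fun x => (x, height d i)) from h)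
  have hne : κ.Nonempty := by simpa using ((triangulation X d).isRelLowerSet_faces hρ).1
  exact ⟨⟨κ, ((SdX X i).isRelLowerSet_faces τ.2).2 hκ hne⟩, rfl⟩

end Parts

/-! Distances. -/

/-- Euclidean distance of barycentric coordinates. -/
noncomputable def euclid (x y : V →₀ ℝ) : ℝ := Real.sqrt ((x - y).sum fun _ a => a ^ 2)

open Classical in
/-- The path metric of `X`, in which every simplex is a standard Euclidean simplex: the infimum
of the lengths of broken lines whose pieces lie in simplices (`∞` if there are none). -/
noncomputable def pathDist (X : PreAbstractSimplicialComplex V) (x y : V →₀ ℝ) : ℝ≥0∞ :=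
  ⨅ (m : ℕ) (p : ℕ → V →₀ ℝ) (_ : p 0 = x ∧ p m = y ∧ ∀ j < m, ∃ σ ∈ (realize X).faces,
    p j ∈ convexHull ℝ (σ : Set (V →₀ ℝ)) ∧ p (j + 1) ∈ convexHull ℝ (σ : Set (V →₀ ℝ))),
    ∑ j ∈ Finset.range m, ENNReal.ofReal (euclid (p j) (p (j + 1)))

/-- The distance of the open cone `O(X⁺)`, pulled back to `X × ℝ`: to join two points one goes down
vertically to a common height `u`, then horizontally, where distances are those of `X` multiplied
by `max u 0`, then vertically up. -/
noncomputable def coneDist (X : PreAbstractSimplicialComplex V) (p q : Pt V) : ℝ≥0∞ :=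
  ⨅ (u : ℝ) (_ : u ≤ p.2) (_ : u ≤ q.2),
    ENNReal.ofReal (p.2 - u) + ENNReal.ofReal (q.2 - u) + ENNReal.ofReal u * pathDist X p.1 q.1

/-! Subdivision and exponential translation of chain complexes. -/

section Translation

variable [LinearOrder V] (X : PreAbstractSimplicialComplex V) (d : ℕ)

/-- The composite `r m ∘ ⋯ ∘ r (m + k - 1)`. -/
def composite (r : ℕ → Pt V → Pt V) (m : ℕ) : ℕ → Pt V → Pt V
  | 0 => id
  | k + 1 => composite r m k ∘ r (m + k)

/-- A squeezing choice of simplicial approximations `r k` to the identity, from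
`t^{-(k+1)}(X × ℝ)` to `t^{-k}(X × ℝ)`, over `[0,∞)`: vertices go to vertices of their carriers,
and iterates retract neighbourhoods of simplices onto these simplices. -/
structure IsSqueezing (r : ℕ → Pt V → Pt V) : Prop where
  simplicial : ∀ k, VertexMap.IsSimplicial (level X d (k + 1)) (level X d k) (r k)
  approximation : ∀ k, ∀ κ ∈ (level X d (k + 1)).faces, ∀ w ∈ κ, ∀ σ ∈ (level X d k).faces,
    w ∈ convexHull ℝ (σ : Set (Pt V)) → r k w ∈ σ
  retraction : ∀ m, ∃ k, ∀ σ ∈ (level X d m).faces, ∀ κ ∈ (level X d (m + k)).faces,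
    (∃ w ∈ κ, w ∈ convexHull ℝ (σ : Set (Pt V))) → ∀ w ∈ κ, composite r m k w ∈ σ

variable {X d} {A : Type u} [Category.{v} A] [Preadditive A] {s : Variance}

/-- The restriction of `t^{-k} C` to `X × [0,∞)`. -/
noncomputable def translated
    (C : ChainComplex (Graded A (triangulation X d).faces (some s)) ℤ) (k : ℕ) :
    ChainComplex (Graded A (level X d k).faces (some s)) ℤ :=
  ((Graded.restrict (levelEmbedding X d k) (levelEmbedding_convex X d k) s).mapHomologicalComplex
    _).obj C

/-- The restriction of the `k`-fold subdivision of `C` to `X × [0,∞)`. -/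
noncomputable def subdivided (hX : LocallyFiniteComplex X) {r : ℕ → Pt V → Pt V}
    (hr : IsSqueezing X d r)
    (C : ChainComplex (Graded A (triangulation X d).faces (some s)) ℤ) :
    ∀ k, ChainComplex (Graded A (level X d k).faces (some s)) ℤ
  | 0 => translated C 0
  | k + 1 => (VertexMap.subdivisionData (hr.simplicial k) (locallyFinite_level hX d (k + 1))
      s).subdivide (subdivided hX hr C k)

/-- Exponential translation equivalence (over `X × [0,∞)`). -/
def ExpTranslationEquivalent (hX : LocallyFiniteComplex X) {r : ℕ → Pt V → Pt V}
    (hr : IsSqueezing X d r)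
    (C : ChainComplex (Graded A (triangulation X d).faces (some s)) ℤ) : Prop :=
  ∀ k, Nonempty (HomotopyEquiv (subdivided hX hr C k) (translated C k))

/-- The restriction of `C` to `X × {v_i}`, as a complex over `Sd^i X`. -/
noncomputable def slice
    (C : ChainComplex (Graded A (triangulation X d).faces (some s)) ℤ) (i : ℕ) :
    ChainComplex (Graded A (SdX X i).faces (some s)) ℤ :=
  ((Graded.restrict (sliceEmbedding X d i) (sliceEmbedding_convex X d i) s).mapHomologicalComplex
    _).obj C

end Translation

end Cone

/-- A complex that vanishes outside a bounded range of degrees. -/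
def IsFiniteComplex {A : Type u} [Category.{v} A] [Preadditive A] {I : Type w} [Preorder I]
    {s : Option Variance} (C : ChainComplex (Graded A I s) ℤ) : Prop :=
  ∃ N : ℕ, ∀ n : ℤ, (N : ℤ) < |n| → Limits.IsZero (C.X n)

/-- The underlying chain complex in the category of column-finite matrices. -/
noncomputable def forgetComplex {A : Type u} [Category.{v} A] [Preadditive A] {I : Type w} [Preorder I]
    {s : Option Variance} (C : ChainComplex (Graded A I s) ℤ) :
    ChainComplex (Graded A I none) ℤ :=
  (Graded.forgetControl.mapHomologicalComplex _).obj C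

/-- All four constituents of the chain equivalence have non-zero components only between simplices
at distance at most `b`. -/
structure HasBound {A : Type u} [Category.{v} A] [Preadditive A] {I : Type w} [Preorder I]
    {s : Option Variance} {C D : ChainComplex (Graded A I s) ℤ} (δ : I → I → ℝ≥0∞) (b : ℝ≥0∞)
    (f : HomotopyEquiv C D) : Prop where
  hom : ∀ n σ τ, (f.hom.f n).app σ τ ≠ 0 → δ σ τ ≤ b
  inv : ∀ n σ τ, (f.inv.f n).app σ τ ≠ 0 → δ σ τ ≤ b
  homHomInv : ∀ m n σ τ, (f.homotopyHomInvId.hom m n).app σ τ ≠ 0 → δ σ τ ≤ b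
  homInvHom : ∀ m n σ τ, (f.homotopyInvHomId.hom m n).app σ τ ≠ 0 → δ σ τ ≤ b

/-! The bound of the slices comes for free: a morphism of A^* or A_* over Sd^i X joins only nested
simplices, and the mesh of Sd^i X decays geometrically (`mesh_SdX`). The problem is to extract an
equivalence over one slice from an equivalence f that does not respect faces.

Translation turns boundedness into smallness. Seen over L_k, the components of f between simplices
at heights in a fixed interval [δ, H], with δ > 0, join simplices whose distance tends to zero with
k: vertical distances are divided by the k-th power of the ratio, horizontal ones by at least k
(`exists_translate_of_close`). Exponential translation equivalence allows t^{-k}C to be replaced by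
Sd_k C, and Sd_k C is as good as C over L_0 once every simplex of L_k is given a suitable label in
L_0.

Such labels are made stepwise. On the way from L_{j+1} to L_j a simplex is sent either to its
carrier or to its image under r_j; both rules are monotone, and the image is a face of the carrier.
The fibres of r_j can be contracted without leaving the fibre and without enlarging carriers
(`contract_homotopy`). A perturbation argument (`isIso_quotient_of_section` and its dual) then shows
that for every pattern of choices the labelled complex is equivalent to C over L_0, and that the
identity matrix which changes one pattern into a comparable one, in the direction permitted by the
variance, is an equivalence (`isIso_relabel_subdivide`, `translated_labels`).

Three patterns matter: carriers in all steps (labels p), carriers in the lowest m steps and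
approximations above (labels q), approximations in all steps (labels t). They satisfy t ≤ q ≤ p.
Squeezing gives, for sufficiently fine and close simplices S and T, that q(T) ≤ p(S) and t(T) ≤ q(S)
(`label_le_label_of_close`). So f, which need not be controlled for any single labelling, is
controlled as a map from C labelled by p to D labelled by q, and again from q to t; the same holds
for its inverse, while the homotopies are controlled from p to t. (This is the case of A^*; for A_*
the order of the patterns is reversed.) Cutting down to labels at height v_i preserves products,
because these labels form a convex set. The composites of f with its inverse become homotopic to
changes of labels, which are invertible up to homotopy, and a two-out-of-six argument
(`isIso_of_ladder`) makes the cut of f an equivalence. Its source and target are equivalent to the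
slices of C and D.

The geometric input is that barycentric coordinates of each L_k are Lipschitz at bounded height
(`rigid_level`). A simplex close to a point of a closed simplex σ therefore lies in a simplex that
has a vertex in σ, and the retraction property pushes it into σ (`exists_squeeze`). Since v_i > 0,
simplices with labels at height v_i stay away from height 0, where translation would not shrink
distances.

For the existence of squeezing choices, the barycentre of a simplex is sent to that of its vertices
which is itself the barycentre of a smallest simplex; two such steps retract neighbourhoods
(`exists_isSqueezing`). -/

/-- A family of objects of `A` over a set of indices, every index being labelled by an element of
`I`. -/
structure Labelled (A : Type u) (I : Type w) (s : Variance) where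
  ι : Type w
  lab : ι → I
  obj : ι → A

/-! ### Controlled matrices whose indices carry labels -/

namespace Labelled

variable {A : Type u} [Category.{v} A] [Preadditive A] {I : Type w} [Preorder I]
  {s : Variance}

/-- Column-finite matrices, controlled by the labels. -/
@[ext]
structure Hom (M N : Labelled A I s) where
  app : ∀ i j, M.obj i ⟶ N.obj j
  finite : ∀ i, {j | app i j ≠ 0}.Finite
  support : ∀ i j, app i j ≠ 0 → Variance.allowed (some s) (M.lab i) (N.lab j)

theorem finsum_comp_eq {M N P : Labelled A I s} (f : Hom M N) (g : Hom N P) (i : M.ι) (k : P.ι)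
    (F : Finset N.ι) (hF : ∀ j, f.app i j ≠ 0 → j ∈ F) :
    ∑ᶠ j, f.app i j ≫ g.app j k = ∑ j ∈ F, f.app i j ≫ g.app j k := by
  apply finsum_eq_sum_of_support_subset
  intro j hj
  apply hF
  intro h0
  apply hj
  simp [h0]

/-- Matrix multiplication. -/
noncomputable def Hom.comp {M N P : Labelled A I s} (f : Hom M N) (g : Hom N P) : Hom M P where
  app i k := ∑ᶠ j, f.app i j ≫ g.app j k
  finite i := by
    apply ((f.finite i).biUnion (t := fun j => {k | g.app j k ≠ 0}) (fun j _ => g.finite j)).subset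
    intro k hk
    obtain ⟨j, hj⟩ := exists_ne_zero_of_finsum hk
    simp only [Set.mem_iUnion]
    refine ⟨j, ?_, ?_⟩
    · intro h; apply hj; simp [h]
    · intro h; apply hj; simp [h]
  support i k h := by
    obtain ⟨j, hj⟩ := exists_ne_zero_of_finsum h
    refine Variance.allowed_trans (f.support i j ?_) (g.support j k ?_)
    · intro h; apply hj; simp [h]
    · intro h; apply hj; simp [h]

open Classical in
/-- The identity matrix. -/
noncomputable def Hom.id (M : Labelled A I s) : Hom M M where
  app i j := if h : i = j then eqToHom (congrArg M.obj h) else 0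
  finite i := by
    apply (Set.finite_singleton i).subset
    intro j hj
    by_contra hne
    apply hj
    rw [dif_neg]
    exact fun h => hne h.symm
  support i j h := by
    by_cases hh : i = j
    · subst hh; exact Variance.allowed_refl _ _
    · simp [hh] at h

noncomputable instance : Category (Labelled A I s) where
  Hom := Hom
  id := Hom.id
  comp := Hom.comp
  id_comp f := by
    apply Hom.ext
    funext i k
    refine (finsum_eq_single _ i ?_).trans ?_
    · intro j hj
      simp [Hom.id, Ne.symm hj]
    · simp [Hom.id]
  comp_id f := by
    apply Hom.ext
    funext i k
    refine (finsum_eq_single _ k ?_).trans ?_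
    · intro j hj
      simp [Hom.id, hj]
    · simp [Hom.id]
  assoc f g h := by
    classical
    apply Hom.ext
    funext i l
    let F := (f.finite i).toFinset
    let G := F.biUnion fun j => (g.finite j).toFinset
    have hF : ∀ j, f.app i j ≠ 0 → j ∈ F := fun j hj => by simpa [F] using hj
    have e1 : ∀ k, (Hom.comp f g).app i k = ∑ j ∈ F, f.app i j ≫ g.app j k := fun k =>
      finsum_comp_eq f g i k F hF
    have hG : ∀ j ∈ F, ∀ k, g.app j k ≠ 0 → k ∈ G := fun j hj k hk => by
      simp only [G, Finset.mem_biUnion]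
      exact ⟨j, hj, by simpa using hk⟩
    have el : (Hom.comp (Hom.comp f g) h).app i l
        = ∑ k ∈ G, (∑ j ∈ F, f.app i j ≫ g.app j k) ≫ h.app k l := by
      refine (finsum_comp_eq (Hom.comp f g) h i l G ?_).trans
        (Finset.sum_congr rfl fun k _ => by rw [e1])
      intro k hk
      rw [e1] at hk
      obtain ⟨j, hj, hne⟩ := Finset.exists_ne_zero_of_sum_ne_zero hk
      exact hG j hj k fun h0 => hne (by simp [h0])
    have r : (Hom.comp f (Hom.comp g h)).app i l
        = ∑ j ∈ F, f.app i j ≫ (∑ k ∈ G, g.app j k ≫ h.app k l) := by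
      refine (finsum_comp_eq f (Hom.comp g h) i l F hF).trans
        (Finset.sum_congr rfl fun j hj => ?_)
      congr 1
      exact finsum_comp_eq g h j l G (hG j hj)
    refine el.trans (Eq.trans ?_ r.symm)
    simp only [Preadditive.sum_comp, Preadditive.comp_sum, Category.assoc]
    exact Finset.sum_comm

theorem hom_ext {M N : Labelled A I s} {f g : M ⟶ N} (h : ∀ i j, f.app i j = g.app i j) :
    f = g :=
  Hom.ext (funext fun i => funext fun j => h i j)

theorem comp_app {M N P : Labelled A I s} (f : M ⟶ N) (g : N ⟶ P) (i : M.ι) (k : P.ι) :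
    (f ≫ g).app i k = ∑ᶠ j, f.app i j ≫ g.app j k := rfl

theorem comp_app_sum {M N P : Labelled A I s} (f : M ⟶ N) (g : N ⟶ P) (i : M.ι) (k : P.ι)
    (F : Finset N.ι) (hF : ∀ j, f.app i j ≠ 0 → j ∈ F) :
    (f ≫ g).app i k = ∑ j ∈ F, f.app i j ≫ g.app j k := finsum_comp_eq f g i k F hF

open Classical in
theorem id_app (M : Labelled A I s) (i j : M.ι) :
    Hom.app (𝟙 M) i j = if h : i = j then eqToHom (congrArg M.obj h) else 0 := rfl

instance (M N : Labelled A I s) : Zero (M ⟶ N) :=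
  ⟨{ app := fun _ _ => 0, finite := by simp, support := by simp }⟩

instance (M N : Labelled A I s) : Add (M ⟶ N) :=
  ⟨fun f g =>
    { app := fun i j => f.app i j + g.app i j
      finite := fun i => ((f.finite i).union (g.finite i)).subset fun j hj => by
        by_contra h
        simp only [Set.mem_union, Set.mem_ofPred_eq, not_or, not_not] at h
        exact hj (by simp [h.1, h.2])
      support := fun i j h => by
        by_cases hf : f.app i j = 0
        · exact g.support i j fun hg => h (by simp [hf, hg])
        · exact f.support i j hf }⟩

instance (M N : Labelled A I s) : Neg (M ⟶ N) :=
  ⟨fun f =>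
    { app := fun i j => -f.app i j
      finite := fun i => by simpa using f.finite i
      support := fun i j h => f.support i j (by simpa using h) }⟩

theorem add_app {M N : Labelled A I s} (f g : M ⟶ N) (i : M.ι) (j : N.ι) :
    (f + g).app i j = f.app i j + g.app i j := rfl
theorem neg_app {M N : Labelled A I s} (f : M ⟶ N) (i : M.ι) (j : N.ι) :
    (-f).app i j = -f.app i j := rfl

instance (M N : Labelled A I s) : AddCommGroup (M ⟶ N) where
  add_assoc f g h := hom_ext fun i j => add_assoc _ _ _
  zero_add f := hom_ext fun i j => zero_add _
  add_zero f := hom_ext fun i j => add_zero _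
  add_comm f g := hom_ext fun i j => add_comm _ _
  neg_add_cancel f := hom_ext fun i j => neg_add_cancel _
  nsmul := nsmulRec
  zsmul := zsmulRec

theorem sub_app {M N : Labelled A I s} (f g : M ⟶ N) (i : M.ι) (j : N.ι) :
    (f - g).app i j = f.app i j - g.app i j := by
  rw [sub_eq_add_neg, add_app, neg_app, sub_eq_add_neg]

noncomputable instance : Preadditive (Labelled A I s) where
  add_comp M N P f f' g := by
    classical
    refine hom_ext fun i k => ?_
    let F := (f.finite i).toFinset ∪ (f'.finite i).toFinset
    have h1 : ∀ j, f.app i j ≠ 0 → j ∈ F := fun j h => by simp [F, h]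
    have h2 : ∀ j, f'.app i j ≠ 0 → j ∈ F := fun j h => by simp [F, h]
    have h3 : ∀ j, (f + f').app i j ≠ 0 → j ∈ F := fun j h => by
      by_contra hn
      exact h (by rw [add_app, not_not.1 fun a => hn (h1 j a), not_not.1 fun a => hn (h2 j a),
        add_zero])
    rw [add_app, comp_app_sum _ _ _ _ F h1, comp_app_sum _ _ _ _ F h2, comp_app_sum _ _ _ _ F h3,
      ← Finset.sum_add_distrib]
    simp [add_app]
  comp_add M N P f g g' := by
    refine hom_ext fun i k => ?_
    have h1 : ∀ j, f.app i j ≠ 0 → j ∈ (f.finite i).toFinset := fun j h => by simp [h]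
    rw [add_app, comp_app_sum _ _ _ _ _ h1, comp_app_sum _ _ _ _ _ h1, comp_app_sum _ _ _ _ _ h1,
      ← Finset.sum_add_distrib]
    simp [add_app]

end Labelled

theorem Variance.allowed_map {I J : Type*} [Preorder I] [Preorder J] {p : J → I} (hp : Monotone p)
    {s : Variance} {S T : J} (h : allowed (some s) S T) : allowed (some s) (p S) (p T) := by
  cases s
  · exact hp h
  · exact hp h

namespace Labelled

variable {A : Type u} [Category.{v} A] [Preadditive A] {I : Type w} [Preorder I]
  {J : Type w} [Preorder J] {s : Variance}

/-- A controlled family over `J`, labelled by `I` through a monotone map. -/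
noncomputable def ofGraded (s : Variance) (p : J → I) (hp : Monotone p) :
    Graded A J (some s) ⥤ Labelled A I s where
  obj M := ⟨J, p, M.obj⟩
  map f := ⟨f.app, f.finite, fun S T h => Variance.allowed_map hp (f.support S T h)⟩

instance (p : J → I) (hp : Monotone p) :
    (ofGraded (A := A) s p hp).Additive where

/-- The identity matrix, as a morphism that changes the labels. -/
noncomputable def relabel {p q : J → I} (hp : Monotone p) (hq : Monotone q)
    (h : ∀ S, Variance.allowed (some s) (p S) (q S)) :
    ofGraded (A := A) s p hp ⟶ ofGraded s q hq where
  app M := ⟨(Graded.Hom.id M).app, (Graded.Hom.id M).finite, fun S T hST => by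
    have hne : S = T := by
      by_contra hn
      exact hST (dif_neg hn)
    exact hne ▸ h S⟩
  naturality M N f := by
    refine hom_ext fun S T => ?_
    have h1 : (f ≫ 𝟙 N).app S T = (𝟙 M ≫ f).app S T := by rw [Category.comp_id, Category.id_comp]
    exact h1

/-- Restriction to the indices with labels in an order-convex set. -/
noncomputable def restrict (s : Variance) (Z : Set I) (hZ : Z.OrdConnected) :
    Labelled A I s ⥤ Labelled A I s where
  obj M := ⟨{i : M.ι // M.lab i ∈ Z}, fun i => M.lab i, fun i => M.obj i⟩
  map f := ⟨fun i j => f.app i j,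
    fun i => (f.finite i).preimage (f := Subtype.val) Subtype.val_injective.injOn,
    fun i j h => f.support i j h⟩
  map_id M := by
    refine hom_ext fun i j => ?_
    by_cases h : i = j
    · subst h; simp [id_app]
    · have h' : i.1 ≠ j.1 := fun e => h (Subtype.ext e)
      simp [id_app, h, h']
  map_comp {M N P} f g := by
    refine hom_ext fun i k => ?_
    simp only [comp_app]
    rw [← finsum_mem_range (f := fun j => f.app i.1 j ≫ g.app j k.1)
      (g := fun j : {j : N.ι // N.lab j ∈ Z} => j.1) Subtype.val_injective, finsum_mem_def]
    refine finsum_congr fun j => ?_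
    by_cases hj : j ∈ Set.range fun j : {j : N.ι // N.lab j ∈ Z} => j.1
    · rw [Set.indicator_of_mem hj]
    · rw [Set.indicator_of_notMem hj]
      by_contra hne
      apply hj
      have h1 := f.support i.1 j fun h => hne (by simp [h])
      have h2 := g.support j k.1 fun h => hne (by simp [h])
      -- By the supports of the two factors, the label of an intermediate index lies between two
      -- labels in `Z`. Convexity is what makes cutting compatible with products.
      refine ⟨⟨j, ?_⟩, rfl⟩
      cases s
      · exact hZ.out k.2 i.2 ⟨h2, h1⟩
      · exact hZ.out i.2 k.2 ⟨h1, h2⟩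

instance (Z : Set I) (hZ : Z.OrdConnected) : (restrict (A := A) s Z hZ).Additive where

end Labelled

/-! ### Deforming a complex onto a quotient or a subcomplex -/

namespace ChainComplex

variable {𝒱 : Type u} [Category.{v} 𝒱]

/-- Iterated composition of an endomorphism. -/
def iter {X : 𝒱} (φ : X ⟶ X) : ℕ → (X ⟶ X)
  | 0 => 𝟙 X
  | k + 1 => iter φ k ≫ φ

theorem iter_succ' {X : 𝒱} (φ : X ⟶ X) (k : ℕ) : iter φ (k + 1) = φ ≫ iter φ k := by
  induction k with
  | zero => simp [iter]
  | succ k ih => rw [iter, ih, Category.assoc, ← iter, ih]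

variable [Preadditive 𝒱] {P C : ChainComplex 𝒱 ℤ}

/-- Iterated composition of an endomorphism of a complex. -/
def iterMap (φ : P ⟶ P) : ℕ → (P ⟶ P)
  | 0 => 𝟙 P
  | k + 1 => iterMap φ k ≫ φ

theorem iterMap_f (φ : P ⟶ P) (k : ℕ) (n : ℤ) : (iterMap φ k).f n = iter (φ.f n) k := by
  induction k with
  | zero => rfl
  | succ k ih => rw [iterMap, iter, HomologicalComplex.comp_f, ih]

theorem quotient_iterMap (φ : P ⟶ P) (h : (HomotopyCategory.quotient _ _).map φ = 𝟙 _) (k : ℕ) :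
    (HomotopyCategory.quotient _ _).map (iterMap φ k) = 𝟙 _ := by
  induction k with
  | zero => exact CategoryTheory.Functor.map_id _ _
  | succ k ih => rw [iterMap, Functor.map_comp, ih, h, Category.id_comp]

/-- The endomorphism `1 - (dh + hd)`. -/
noncomputable def deform (h : ∀ i j, P.X i ⟶ P.X j) : P ⟶ P := 𝟙 P - Homotopy.nullHomotopicMap h

theorem quotient_deform (h : ∀ i j, P.X i ⟶ P.X j)
    (hz : ∀ i j, ¬ (ComplexShape.down ℤ).Rel j i → h i j = 0) :
    (HomotopyCategory.quotient _ _).map (deform h) = 𝟙 _ := by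
  rw [deform, Functor.map_sub, CategoryTheory.Functor.map_id,
    HomotopyCategory.eq_of_homotopy _ _ (Homotopy.nullHomotopy h hz), Functor.map_zero, sub_zero]

theorem deform_f (h : ∀ i j, P.X i ⟶ P.X j) (n : ℤ) :
    (deform h).f n = 𝟙 _ - (P.d n (n - 1) ≫ h (n - 1) n + h n (n + 1) ≫ P.d (n + 1) n) := by
  rw [deform, HomologicalComplex.sub_f_apply, HomologicalComplex.id_f,
    Homotopy.nullHomotopicMap_f (k₂ := n + 1) (k₁ := n) (k₀ := n - 1) (by simp) (by simp)]

/-- A chain map with a degreewise section is a chain equivalence if some homotopy deforms the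
identity to the projection, up to a nilpotent error. -/
theorem isIso_quotient_of_section (a : P ⟶ C) (s₀ : ∀ n, C.X n ⟶ P.X n)
    (h : ∀ i j, P.X i ⟶ P.X j) (hz : ∀ i j, ¬ (ComplexShape.down ℤ).Rel j i → h i j = 0)
    (h1 : ∀ n, s₀ n ≫ a.f n = 𝟙 _) (h2 : ∀ i j, h i j ≫ a.f j = 0) (N : ℕ)
    (hN : ∀ n, iter ((deform h).f n - a.f n ≫ s₀ n) N = 0) :
    IsIso ((HomotopyCategory.quotient _ _).map a) := by
  have ha : ∀ n, (deform h).f n ≫ a.f n = a.f n := by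
    intro n
    rw [deform_f, Preadditive.sub_comp, Preadditive.add_comp, Category.assoc, Category.assoc,
      h2, ← a.comm, ← Category.assoc, h2]
    simp
  have hak : ∀ k n, iter ((deform h).f n) k ≫ a.f n = a.f n := by
    intro k n
    induction k with
    | zero => simp [iter]
    | succ k ih => rw [iter, Category.assoc, ha, ih]
  -- On anything killed by `a` the deformation acts like the nilpotent error, since its iterates are
  -- again killed by `a`; hence its `N`-th power vanishes there.
  have key : ∀ n (Y : 𝒱) (x : Y ⟶ P.X n), x ≫ a.f n = 0 → x ≫ iter ((deform h).f n) N = 0 := by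
    intro n Y x hx
    have : ∀ k, x ≫ iter ((deform h).f n) k = x ≫ iter ((deform h).f n - a.f n ≫ s₀ n) k := by
      intro k
      induction k with
      | zero => rfl
      | succ k ih =>
        have h0 : (x ≫ iter ((deform h).f n) k) ≫ a.f n = 0 := by
          rw [Category.assoc, hak, hx]
        rw [iter, iter, ← Category.assoc, ← Category.assoc, ← ih, Preadditive.comp_sub,
          ← Category.assoc _ (a.f n), h0]
        simp
    rw [this, hN, Limits.comp_zero]
  -- The degreewise section need not commute with the differentials. Its defect is killed by `a`,
  -- hence by the `N`-th power of the deformation, so the section followed by that power is a chain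
  -- map.
  let σ : C ⟶ P :=
    { f := fun n => s₀ n ≫ iter ((deform h).f n) N
      comm' := by
        intro i j _
        have e : P.d i j ≫ iter ((deform h).f j) N = iter ((deform h).f i) N ≫ P.d i j := by
          rw [← iterMap_f, ← iterMap_f, HomologicalComplex.Hom.comm]
        rw [Category.assoc, ← e, ← Category.assoc, ← Category.assoc, ← sub_eq_zero,
          ← Preadditive.sub_comp]
        apply key
        rw [Preadditive.sub_comp, Category.assoc, Category.assoc, h1, ← a.comm,
          ← Category.assoc (s₀ i), h1]
        simp }
  have e1 : σ ≫ a = 𝟙 C := by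
    ext n
    change (s₀ n ≫ iter ((deform h).f n) N) ≫ a.f n = _
    rw [Category.assoc, hak, h1]; rfl
  -- The other composite is a power of a map homotopic to the identity.
  have e2 : a ≫ σ = iterMap (deform h) N := by
    ext n
    rw [iterMap_f, HomologicalComplex.comp_f]
    change a.f n ≫ s₀ n ≫ iter ((deform h).f n) N = _
    have := key n _ (a.f n ≫ s₀ n - 𝟙 _) (by
      rw [Preadditive.sub_comp, Category.assoc, h1]; simp)
    rw [Preadditive.sub_comp, Category.assoc, Category.id_comp, sub_eq_zero] at this
    exact this
  refine ⟨(HomotopyCategory.quotient _ _).map σ, ?_, ?_⟩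
  · rw [← Functor.map_comp, e2, quotient_iterMap _ (quotient_deform h hz)]
  · rw [← Functor.map_comp, e1, CategoryTheory.Functor.map_id]

/-- The dual of `isIso_quotient_of_section`. -/
theorem isIso_quotient_of_retraction (a : C ⟶ P) (s₀ : ∀ n, P.X n ⟶ C.X n)
    (h : ∀ i j, P.X i ⟶ P.X j) (hz : ∀ i j, ¬ (ComplexShape.down ℤ).Rel j i → h i j = 0)
    (h1 : ∀ n, a.f n ≫ s₀ n = 𝟙 _) (h2 : ∀ i j, a.f i ≫ h i j = 0) (N : ℕ)
    (hN : ∀ n, iter ((deform h).f n - s₀ n ≫ a.f n) N = 0) :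
    IsIso ((HomotopyCategory.quotient _ _).map a) := by
  have ha : ∀ n, a.f n ≫ (deform h).f n = a.f n := by
    intro n
    rw [deform_f, Preadditive.comp_sub, Preadditive.comp_add, ← Category.assoc (a.f n) (h _ _),
      h2, ← Category.assoc, a.comm, Category.assoc, h2]
    simp
  have hak : ∀ k n, a.f n ≫ iter ((deform h).f n) k = a.f n := by
    intro k n
    induction k with
    | zero => simp [iter]
    | succ k ih => rw [iter, ← Category.assoc, ih, ha]
  have key : ∀ n (Y : 𝒱) (x : P.X n ⟶ Y), a.f n ≫ x = 0 → iter ((deform h).f n) N ≫ x = 0 := by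
    intro n Y x hx
    have : ∀ k, iter ((deform h).f n) k ≫ x = iter ((deform h).f n - s₀ n ≫ a.f n) k ≫ x := by
      intro k
      induction k with
      | zero => rfl
      | succ k ih =>
        have h0 : a.f n ≫ iter ((deform h).f n) k ≫ x = 0 := by
          rw [← Category.assoc, hak, hx]
        rw [iter_succ', iter_succ', Category.assoc, Category.assoc, ← ih, Preadditive.sub_comp,
          Category.assoc, h0]
        simp
    rw [this, hN, Limits.zero_comp]
  -- Here the correcting power is composed on the other side: it kills everything that vanishes
  -- after precomposition with `a`.
  let σ : P ⟶ C :=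
    { f := fun n => iter ((deform h).f n) N ≫ s₀ n
      comm' := by
        intro i j _
        have e : P.d i j ≫ iter ((deform h).f j) N = iter ((deform h).f i) N ≫ P.d i j := by
          rw [← iterMap_f, ← iterMap_f, HomologicalComplex.Hom.comm]
        rw [← Category.assoc (P.d i j), e, Category.assoc, Category.assoc, ← sub_eq_zero,
          ← Preadditive.comp_sub]
        apply key
        rw [Preadditive.comp_sub, ← Category.assoc, ← Category.assoc, h1, a.comm,
          Category.assoc, h1]
        simp }
  have e1 : a ≫ σ = 𝟙 C := by
    ext n
    change a.f n ≫ iter ((deform h).f n) N ≫ s₀ n = _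
    rw [← Category.assoc, hak, h1]; rfl
  have e2 : σ ≫ a = iterMap (deform h) N := by
    ext n
    rw [iterMap_f, HomologicalComplex.comp_f]
    change (iter ((deform h).f n) N ≫ s₀ n) ≫ a.f n = _
    have := key n _ (s₀ n ≫ a.f n - 𝟙 _) (by
      rw [Preadditive.comp_sub, ← Category.assoc, h1]; simp)
    rw [Preadditive.comp_sub, Category.comp_id, sub_eq_zero, ← Category.assoc] at this
    exact this
  refine ⟨(HomotopyCategory.quotient _ _).map σ, ?_, ?_⟩
  · rw [← Functor.map_comp, e1, CategoryTheory.Functor.map_id]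
  · rw [← Functor.map_comp, e2, quotient_iterMap _ (quotient_deform h hz)]

end ChainComplex

namespace Labelled

variable {A : Type u} [Category.{v} A] [Preadditive A] {I : Type w} [Preorder I] {s : Variance}

/-- An endomorphism that strictly lowers a bounded natural number attached to the indices is
nilpotent. -/
theorem iter_eq_zero {M : Labelled A I s} (ν : M ⟶ M) (g : M.ι → ℕ) (N : ℕ)
    (hg : ∀ i, g i < N) (h : ∀ i j, ν.app i j ≠ 0 → g j < g i) : ChainComplex.iter ν N = 0 := by
  have key : ∀ k i j, (ChainComplex.iter ν k).app i j ≠ 0 → g j + k ≤ g i := by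
    intro k
    induction k with
    | zero =>
      intro i j hij
      have : i = j := by
        by_contra hne
        exact hij (dif_neg hne)
      rw [this, add_zero]
    | succ k ih =>
      intro i j hij
      obtain ⟨l, hl⟩ := exists_ne_zero_of_finsum (show
        (∑ᶠ l, (ChainComplex.iter ν k).app i l ≫ ν.app l j) ≠ 0 from hij)
      have h1 := ih i l fun h => hl (by simp [h])
      have h2 := h l j fun h => hl (by simp [h])
      omega
  refine hom_ext fun i j => ?_
  by_contra hne
  have := key N i j hne
  have := hg i
  omega

end Labelled

/-! ### Contractible fibres make a subdivision step an equivalence -/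

namespace SubdivisionData

variable {I J : Type w} [Preorder I] [Preorder J] {s : Variance}

/-- A contraction of the fibres of a subdivision step, with error term `W`. -/
structure Contraction (D : SubdivisionData I J s) (W : J → J → ℤ) where
  H : J → J → ℤ
  mono : Monotone D.ρ
  shift : ∀ S T, H S T ≠ 0 → D.a S = D.a T + 1
  fibre : ∀ S T, H S T ≠ 0 → D.ρ S = D.ρ T
  fin : ∀ S, {T | H S T ≠ 0}.Finite
  q_refl : ∀ S, D.q S S
  q_diag : ∀ S T, D.q S T → D.ρ S = D.ρ T → S = T
  eq : ∀ S T, (∑ᶠ K, D.e S K * H K T) + (∑ᶠ K, H S K * D.e K T) =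
    (open Classical in if S = T then 1 else 0) - W S T

variable {A : Type u} [Category.{v} A] [Preadditive A] {L : Type w} [Preorder L]

section

variable {D : SubdivisionData I J s} {W : J → J → ℤ} (E : D.Contraction W)
  (C : ChainComplex (Graded A I (some s)) ℤ)

theorem idTo_eq_zero {m m' : ℤ} {x x' : I} (h : ¬ (m = m' ∧ x = x')) : idTo C m m' x x' = 0 :=
  dif_neg h

theorem idTo_ne_zero {m m' : ℤ} {x x' : I} (h : idTo C m m' x x' ≠ 0) : m = m' ∧ x = x' := by
  by_contra hn
  exact h (idTo_eq_zero C hn)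

theorem idTo_self (m : ℤ) (x : I) : idTo C m m x x = 𝟙 _ := by simp [idTo]

/-- A labelling of the subdivision that is respected by the contraction. -/
structure Contraction.Compatible (E : D.Contraction W) (p : J → L) : Prop where
  mono : Monotone p
  H : ∀ S T, E.H S T ≠ 0 → Variance.allowed (some s) (p S) (p T)

variable {p : J → L} (hp : E.Compatible p)

/-- The subdivided complex with labels. -/
noncomputable abbrev labelled (D : SubdivisionData I J s)
    (C : ChainComplex (Graded A I (some s)) ℤ) {p : J → L} (hp : Monotone p) :
    ChainComplex (Labelled A L s) ℤ :=
  ((Labelled.ofGraded s p hp).mapHomologicalComplex _).obj (D.subdivide C)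

/-- The entries of the contraction of fibres as a homotopy. -/
noncomputable def Contraction.h (i j : ℤ) (S T : J) :
    (C.X (i + D.a S)).obj (D.ρ S) ⟶ (C.X (j + D.a T)).obj (D.ρ T) :=
  ((j.negOnePow : ℤ) * E.H S T) • idTo C (i + D.a S) (j + D.a T) (D.ρ S) (D.ρ T)

theorem Contraction.h_eq_zero {i j : ℤ} {S T : J} (h : E.H S T = 0) : E.h C i j S T = 0 := by
  rw [Contraction.h, h, mul_zero, zero_smul]

theorem Contraction.H_of_h {i j : ℤ} {S T : J} (h : E.h C i j S T ≠ 0) : E.H S T ≠ 0 :=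
  fun h0 => h (E.h_eq_zero C h0)

theorem d1_eq_zero {i j : ℤ} {S T : J} (h : ¬ D.q S T) : D.d1 C i j S T = 0 := if_neg h

theorem d2_eq_zero {i j : ℤ} {S T : J} (h : D.e S T = 0) : D.d2 C i j S T = 0 := by
  rw [d2, h, mul_zero, zero_smul]

theorem Contraction.h_rel (i j : ℤ) (h : ¬ (ComplexShape.down ℤ).Rel j i) (S T : J) :
    E.h C i j S T = 0 := by
  by_cases h0 : E.H S T = 0
  · exact E.h_eq_zero C h0
  · rw [Contraction.h, idTo_eq_zero, smul_zero]
    rintro ⟨h1, -⟩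
    have := E.shift S T h0
    apply h
    rw [ComplexShape.down_Rel]
    omega

theorem negOnePow_sq (n : ℤ) : (n.negOnePow : ℤ) * (n.negOnePow : ℤ) = 1 := by
  rw [← Units.val_mul, Int.units_mul_self, Units.val_one]

/-- Both factors carry the sign of the same degree, here `n` and in `Contraction.h_d2` the degree `n
+ 1`. The signs cancel, and the integral matrix product inside the fibre remains. -/
theorem Contraction.d2_h (n : ℤ) (S T : J) :
    ∑ᶠ K, D.d2 C n (n - 1) S K ≫ E.h C (n - 1) n K T =
      (∑ᶠ K, D.e S K * E.H K T) • idTo C (n + D.a S) (n + D.a T) (D.ρ S) (D.ρ T) := by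
  rw [finsum_smul']
  · refine finsum_congr fun K => ?_
    by_cases he : D.e S K = 0
    · rw [d2_eq_zero C he, he, zero_mul, zero_smul, Limits.zero_comp]
    rw [d2, Contraction.h, Preadditive.zsmul_comp, Preadditive.comp_zsmul,
      idTo_comp_idTo C (by rw [D.e_shift S K he]; ring) (D.e_fibre S K he), smul_smul]
    congr 1
    linear_combination (D.e S K * E.H K T) * negOnePow_sq n
  · apply (D.fin S).subset
    intro K hK
    exact Or.inr fun h0 => hK (by simp [h0])

theorem Contraction.h_d2 (n : ℤ) (S T : J) :
    ∑ᶠ K, E.h C n (n + 1) S K ≫ D.d2 C (n + 1) n K T =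
      (∑ᶠ K, E.H S K * D.e K T) • idTo C (n + D.a S) (n + D.a T) (D.ρ S) (D.ρ T) := by
  rw [finsum_smul']
  · refine finsum_congr fun K => ?_
    by_cases he : E.H S K = 0
    · rw [E.h_eq_zero C he, he, zero_mul, zero_smul, Limits.zero_comp]
    rw [d2, Contraction.h, Preadditive.zsmul_comp, Preadditive.comp_zsmul,
      idTo_comp_idTo C (by rw [E.shift S K he]; ring) (E.fibre S K he), smul_smul]
    congr 1
    linear_combination (E.H S K * D.e K T) * negOnePow_sq (n + 1)
  · apply (E.fin S).subset
    intro K hK h0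
    exact hK (by simp [h0])

/-- Inside one fibre the old differential is diagonal by `q_diag`, and `H` does not leave the fibre.
So only the intermediate index `S` contributes. -/
theorem Contraction.d1_h (n : ℤ) {S T : J} (hST : D.ρ S = D.ρ T) :
    ∑ᶠ K, D.d1 C n (n - 1) S K ≫ E.h C (n - 1) n K T =
      ((n.negOnePow : ℤ) * E.H S T) • (C.d (n + D.a S) (n + D.a T)).app (D.ρ S) (D.ρ T) := by
  rw [finsum_eq_single _ S]
  · rw [d1, if_pos (E.q_refl S), Contraction.h, Preadditive.comp_zsmul]
    by_cases he : E.H S T = 0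
    · simp [he]
    rw [d_comp_idTo C (by rw [E.shift S T he]; ring) hST]
  · intro K hK
    by_cases hq : D.q S K
    swap
    · rw [d1_eq_zero C hq, Limits.zero_comp]
    by_cases he : E.H K T = 0
    · rw [E.h_eq_zero C he, Limits.comp_zero]
    exact absurd (E.q_diag S K hq (hST.trans (E.fibre K T he).symm)).symm hK

/-- Now only the intermediate index `T` contributes, and the homotopy carries the sign of degree `n
+ 1` instead of `n`. This sign makes the term cancel that of `Contraction.d1_h`. -/
theorem Contraction.h_d1 (n : ℤ) {S T : J} (hST : D.ρ S = D.ρ T) :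
    ∑ᶠ K, E.h C n (n + 1) S K ≫ D.d1 C (n + 1) n K T =
      -(((n.negOnePow : ℤ) * E.H S T) •
        (C.d (n + D.a S) (n + D.a T)).app (D.ρ S) (D.ρ T)) := by
  rw [finsum_eq_single _ T]
  · rw [d1, if_pos (E.q_refl T), Contraction.h, Preadditive.zsmul_comp]
    by_cases he : E.H S T = 0
    · simp [he]
    rw [idTo_comp_d C (by rw [E.shift S T he]; ring) hST, ← neg_smul, Int.negOnePow_succ]
    simp
  · intro K hK
    by_cases hq : D.q K T
    swap
    · rw [d1_eq_zero C hq, Limits.comp_zero]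
    by_cases he : E.H S K = 0
    · rw [E.h_eq_zero C he, Limits.zero_comp]
    exact absurd (E.q_diag K T hq ((E.fibre S K he).symm.trans hST)) hK

open Classical in
-- Inside a fibre the contributions of the old differential cancel, and those of the incidence
-- numbers add up to the contraction identity.
theorem Contraction.comm (n : ℤ) {S T : J} (hST : D.ρ S = D.ρ T) :
    (∑ᶠ K, (D.d1 C n (n - 1) S K + D.d2 C n (n - 1) S K) ≫ E.h C (n - 1) n K T) +
      (∑ᶠ K, E.h C n (n + 1) S K ≫ (D.d1 C (n + 1) n K T + D.d2 C (n + 1) n K T)) =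
    ((if S = T then 1 else 0) - W S T) •
      idTo C (n + D.a S) (n + D.a T) (D.ρ S) (D.ρ T) := by
  simp only [Preadditive.add_comp, Preadditive.comp_add]
  rw [finsum_add_distrib, finsum_add_distrib, E.d1_h C n hST, E.h_d1 C n hST, E.d2_h, E.h_d2,
    ← E.eq S T, add_smul]
  · abel
  · exact (E.fin S).subset fun K hK h0 => hK (by
      simp only [E.h_eq_zero C h0, Limits.zero_comp])
  · exact (E.fin S).subset fun K hK h0 => hK (by
      simp only [E.h_eq_zero C h0, Limits.zero_comp])
  · refine (D.fin S).subset fun K hK => Or.inl ?_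
    by_contra h
    exact hK (by simp only [d1_eq_zero C h, Limits.zero_comp])
  · exact (D.fin S).subset fun K hK => Or.inr fun h => hK (by
      simp only [d2_eq_zero C h, Limits.zero_comp])

/-- The contraction of fibres as a homotopy. -/
noncomputable def Contraction.hom (i j : ℤ) :
    (D.labelled C hp.mono).X i ⟶ (D.labelled C hp.mono).X j where
  app S T := E.h C i j S T
  finite S := (E.fin S).subset fun _ hT => E.H_of_h C hT
  support S _ h := hp.H S _ (E.H_of_h C h)

theorem Contraction.hom_rel (i j : ℤ) (h : ¬ (ComplexShape.down ℤ).Rel j i) :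
    E.hom C hp i j = 0 :=
  Labelled.hom_ext fun S T => E.h_rel C i j h S T

open Classical in
/-- The identity matrix of the subdivided complex. -/
noncomputable def one (n : ℤ) (S T : J) :
    (C.X (n + D.a S)).obj (D.ρ S) ⟶ (C.X (n + D.a T)).obj (D.ρ T) :=
  (if S = T then (1 : ℤ) else 0) • idTo C (n + D.a S) (n + D.a T) (D.ρ S) (D.ρ T)

theorem one_eq (hp : Monotone p) (n : ℤ) (S T : J) :
    Labelled.Hom.app (𝟙 ((D.labelled C hp).X n)) S T = D.one C n S T := by
  by_cases h : S = T
  · subst h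
    rw [one, if_pos rfl, idTo_self, one_smul]
    exact dif_pos rfl
  · rw [one, if_neg h, zero_smul]
    exact dif_neg h

theorem ofGraded_one {p : I → L} (hp : Monotone p) (n : ℤ) (σ τ : I) :
    Labelled.Hom.app (𝟙 ((((Labelled.ofGraded s p hp).mapHomologicalComplex
      (ComplexShape.down ℤ)).obj C).X n)) σ τ = idTo C n n σ τ := by
  by_cases h : σ = τ
  · subst h
    rw [idTo_self]
    exact dif_pos rfl
  · rw [idTo_eq_zero C fun h' => h h'.2]
    exact dif_neg h

theorem Contraction.deform_app (n : ℤ) (S T : J) :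
    ((ChainComplex.deform (E.hom C hp)).f n).app S T = D.one C n S T -
      ((∑ᶠ K, (D.d1 C n (n - 1) S K + D.d2 C n (n - 1) S K) ≫ E.h C (n - 1) n K T) +
      (∑ᶠ K, E.h C n (n + 1) S K ≫ (D.d1 C (n + 1) n K T + D.d2 C (n + 1) n K T))) := by
  rw [ChainComplex.deform_f, ← one_eq C hp.mono]
  exact (Labelled.sub_app _ _ _ _).trans rfl

/-- On the fibres, the deformation is the error term. -/
theorem Contraction.deform_fibre (n : ℤ) {S T : J} (hST : D.ρ S = D.ρ T) :
    ((ChainComplex.deform (E.hom C hp)).f n).app S T =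
      W S T • idTo C (n + D.a S) (n + D.a T) (D.ρ S) (D.ρ T) := by
  rw [E.deform_app, E.comm C n hST, one, ← sub_smul, sub_sub_cancel]

/-- The homotopy does not change images under `ρ`, and the differentials move them only in the
allowed direction. -/
theorem Contraction.deform_allowed (n : ℤ) {S T : J}
    (h : ((ChainComplex.deform (E.hom C hp)).f n).app S T ≠ 0) :
    Variance.allowed (some s) (D.ρ S) (D.ρ T) := by
  have hd : ∀ {i j : ℤ} {S T : J}, D.d1 C i j S T + D.d2 C i j S T ≠ 0 →
      Variance.allowed (some s) (D.ρ S) (D.ρ T) := fun h =>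
    Variance.allowed_map E.mono ((D.or_of_d C h).elim (D.q_allowed _ _) (D.e_allowed _ _))
  by_contra hn
  apply h
  have h0 : D.one C n S T = 0 := by
    rw [one, if_neg, zero_smul]
    rintro rfl
    exact hn (Variance.allowed_refl _ _)
  rw [E.deform_app, h0]
  have e1 : ∑ᶠ K, E.h C n (n + 1) S K ≫ (D.d1 C (n + 1) n K T + D.d2 C (n + 1) n K T) = 0 := by
    refine finsum_eq_zero_of_forall_eq_zero fun K => ?_
    by_contra hne
    have h1 := E.fibre S K (E.H_of_h C fun h0 => hne (by rw [h0, Limits.zero_comp]))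
    exact hn (h1 ▸ hd fun h0 => hne (by rw [h0, Limits.comp_zero]))
  have e2 : ∑ᶠ K, (D.d1 C n (n - 1) S K + D.d2 C n (n - 1) S K) ≫ E.h C (n - 1) n K T = 0 := by
    refine finsum_eq_zero_of_forall_eq_zero fun K => ?_
    by_contra hne
    have h1 := E.fibre K T (E.H_of_h C fun h0 => hne (by rw [h0, Limits.comp_zero]))
    exact hn (h1 ▸ hd fun h0 => hne (by rw [h0, Limits.zero_comp]))
  rw [e1, e2, add_zero, sub_zero]
  rfl

/-- The rank function of a finite-dimensional complex. -/
structure IsRank (s : Variance) (g : I → ℕ) (N : ℕ) : Prop where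
  lt : ∀ σ, g σ < N
  strict : ∀ σ τ, Variance.allowed (some s) σ τ → σ ≠ τ → g τ < g σ

/-- Within fibres the deformation coincides with `π`. All its other entries strictly lower the
bounded rank of the image, so the difference is nilpotent of order `N`. -/
theorem Contraction.iter_deform {g : I → ℕ} {N : ℕ} (hg : IsRank s g N) (n : ℤ)
    (π : (D.labelled C hp.mono).X n ⟶ (D.labelled C hp.mono).X n)
    (h : ∀ S T : J, π.app S T = W S T • idTo C (n + D.a S) (n + D.a T) (D.ρ S) (D.ρ T)) :
    ChainComplex.iter ((ChainComplex.deform (E.hom C hp)).f n - π) N = 0 := by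
  refine Labelled.iter_eq_zero _ (fun S => g (D.ρ S)) N (fun S => hg.lt _) fun (S T : J) hne => ?_
  have e : ((ChainComplex.deform (E.hom C hp)).f n - π).app S T =
      ((ChainComplex.deform (E.hom C hp)).f n).app S T - π.app S T := Labelled.sub_app _ _ _ _
  rw [e] at hne
  have hρ : D.ρ S ≠ D.ρ T := fun hST => hne
    (sub_eq_zero.2 ((E.deform_fibre C hp n hST).trans (h S T).symm))
  refine hg.strict _ _ (E.deform_allowed C hp n (fun h0 => hne ?_)) hρ
  refine sub_eq_zero.2 (h0.trans (Eq.symm ((h S T).trans ?_)))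
  rw [idTo_eq_zero C fun hh => hρ hh.2, smul_zero]
  rfl

end

/-- The projection to the image of a section `β`, on entries that are not shifted. -/
noncomputable def projection (D : SubdivisionData I J s) (β : I → J) (S T : J) : ℤ :=
  open Classical in if D.a S = 0 ∧ T = β (D.ρ S) then 1 else 0

/-! The projection onto the complex that is subdivided. -/

section Upper

variable {D : SubdivisionData I J .upper} (C : ChainComplex (Graded A I (some .upper)) ℤ)

/-- The condition under which the entries that are not shifted project to the complex that is
subdivided. -/
structure IsAugmented (D : SubdivisionData I J .upper) : Prop where
  e_zero : open Classical in ∀ S, ∑ᶠ K, D.e S K * (if D.a K = 0 then 1 else 0) = 0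
  q_unique : ∀ S τ, D.a S = 0 → τ ≤ D.ρ S → ∃ K, D.q S K ∧ D.ρ K = τ ∧
    ∀ K', D.q S K' → D.ρ K' = τ → K' = K

/-- Incidence numbers disappear because the augmentation kills fibre boundaries. For the old
differential, an unshifted simplex has exactly one straight face over each face of its image, and a
shifted one has no unshifted straight face. -/
theorem IsAugmented.comm (hD : IsAugmented D) (i j : ℤ) (hij : j + 1 = i) (S : J) (τ : I) :
    ∑ᶠ σ, idTo C (i + D.a S) i (D.ρ S) σ ≫ (C.d i j).app σ τ =
      ∑ᶠ K, (D.d1 C i j S K + D.d2 C i j S K) ≫ idTo C (j + D.a K) j (D.ρ K) τ := by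
  classical
  have h2 : ∑ᶠ K, D.d2 C i j S K ≫ idTo C (j + D.a K) j (D.ρ K) τ = 0 := by
    have : ∀ K, D.d2 C i j S K ≫ idTo C (j + D.a K) j (D.ρ K) τ =
        (D.e S K * (if D.a K = 0 then 1 else 0)) •
          ((i.negOnePow : ℤ) • idTo C (i + D.a S) j (D.ρ S) τ) := by
      intro K
      by_cases he : D.e S K = 0
      · rw [d2_eq_zero C he, he, zero_mul, zero_smul, Limits.zero_comp]
      rw [d2, Preadditive.zsmul_comp, idTo_comp_idTo C (by rw [D.e_shift S K he]; omega)
        (D.e_fibre S K he), smul_smul]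
      split_ifs with h
      · rw [mul_one, mul_comm]
      · rw [idTo_eq_zero, smul_zero, smul_zero]
        rintro ⟨h', -⟩
        have := D.e_shift S K he
        exact h (by omega)
    simp only [this]
    rw [← finsum_smul', hD.e_zero, zero_smul]
    apply (D.fin S).subset
    intro K hK
    exact Or.inr fun h0 => hK (by simp [h0])
  simp only [Preadditive.add_comp]
  rw [finsum_add_distrib, h2, add_zero]
  · rw [finsum_eq_single _ (D.ρ S)]
    swap
    · intro σ hσ
      rw [idTo_eq_zero C fun h => hσ h.2.symm, Limits.zero_comp]
    have hz : ∀ K, D.a S ≠ 0 → D.d1 C i j S K ≫ idTo C (j + D.a K) j (D.ρ K) τ = 0 := by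
      intro K h0
      by_cases hq : D.q S K
      · rw [idTo_eq_zero, Limits.comp_zero]
        rintro ⟨h', -⟩
        have := D.q_shift S K hq
        omega
      · rw [d1_eq_zero C hq, Limits.zero_comp]
    by_cases h0 : D.a S = 0
    swap
    · rw [idTo_eq_zero C fun h => h0 (by omega), Limits.zero_comp,
        finsum_eq_zero_of_forall_eq_zero fun K => hz K h0]
    rw [idTo_comp_d C (by omega) rfl]
    by_cases hτ : τ ≤ D.ρ S
    · obtain ⟨K, hq, hK, hu⟩ := hD.q_unique S τ h0 hτ
      rw [finsum_eq_single _ K]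
      · rw [d1, if_pos hq, d_comp_idTo C (by rw [← D.q_shift S K hq, h0, add_zero]) hK]
      · intro K' hne
        by_cases hq' : D.q S K'
        · rw [idTo_eq_zero C fun h => hne (hu K' hq' h.2), Limits.comp_zero]
        · rw [d1_eq_zero C hq', Limits.zero_comp]
    · rw [finsum_eq_zero_of_forall_eq_zero]
      · by_contra hne
        exact hτ ((C.d _ _).support _ _ hne)
      · intro K
        by_contra hne
        have hq := D.q_of_d1 C (i := i) (j := j) (S := S) (T := K) fun h =>
          hne (by rw [h, Limits.zero_comp])
        have hK := (idTo_ne_zero C fun h => hne (by rw [h, Limits.comp_zero])).2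
        rw [d1, if_pos hq] at hne
        exact hτ (hK ▸ (C.d _ _).support _ _ fun h => hne (by rw [h, Limits.zero_comp]))
  · refine (D.fin S).subset fun K hK => Or.inl ?_
    by_contra h
    exact hK (by simp only [d1_eq_zero C h, Limits.zero_comp])
  · exact (D.fin S).subset fun K hK => Or.inr fun h => hK (by
      simp only [d2_eq_zero C h, Limits.zero_comp])

variable {p' : J → L} {p : I → L}

/-- The projection of the subdivision to the complex that is subdivided. -/
noncomputable def augmentation (hD : IsAugmented D) (hp' : Monotone p') (hp : Monotone p)
    (h : ∀ S, p (D.ρ S) ≤ p' S) :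
    D.labelled C hp' ⟶
      ((Labelled.ofGraded .upper p hp).mapHomologicalComplex _).obj C where
  f n :=
    { app := fun S σ => idTo C (n + D.a S) n (D.ρ S) σ
      finite := fun S => (Set.finite_singleton (D.ρ S)).subset fun σ hσ =>
        (idTo_ne_zero C hσ).2.symm
      support := fun S σ hne => by
        have : D.ρ S = σ := (idTo_ne_zero C hne).2
        subst this
        exact h S }
  comm' i j hij := Labelled.hom_ext fun S τ => hD.comm C i j hij S τ

open Classical in
/-- The projection is a chain equivalence. -/
theorem isIso_augmentation (hD : IsAugmented D) {β : I → J} (hβ : ∀ σ, D.ρ (β σ) = σ)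
    (hβa : ∀ σ, D.a (β σ) = 0) (ha : ∀ S, D.a S ≤ 0)
    (E : D.Contraction (D.projection β))
    (hp' : E.Compatible p') (hp : Monotone p)
    (h : ∀ S, p (D.ρ S) ≤ p' S) (hβp : ∀ σ, p' (β σ) ≤ p σ) {g : I → ℕ} {N : ℕ}
    (hg : IsRank .upper g N) :
    IsIso ((HomotopyCategory.quotient _ _).map (augmentation C hD hp'.mono hp h)) := by
  refine ChainComplex.isIso_quotient_of_section _
    (fun n =>
      { app := fun σ T => if T = β σ then idTo C n (n + D.a T) σ (D.ρ T) else 0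
        finite := fun σ => (Set.finite_singleton (β σ)).subset fun T hT => by
          by_contra hne
          exact hT (if_neg hne)
        support := fun σ T hT => by
          have : T = β σ := by
            by_contra hne
            exact hT (if_neg hne)
          rw [this]
          exact hβp σ })
    (E.hom C hp') (E.hom_rel C hp') ?_ ?_ N ?_
  · intro n
    refine Labelled.hom_ext fun (σ τ : I) => ?_
    refine Eq.trans (b := ∑ᶠ T, (if T = β σ then idTo C n (n + D.a T) σ (D.ρ T) else 0) ≫
      idTo C (n + D.a T) n (D.ρ T) τ) rfl ?_
    rw [finsum_eq_single _ (β σ) fun T hT => by rw [if_neg hT, Limits.zero_comp], if_pos rfl,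
      idTo_comp_idTo C (by rw [hβa, add_zero]) (hβ σ).symm]
    exact (ofGraded_one C hp n σ τ).symm
  · intro i j
    refine Labelled.hom_ext fun (S : J) (τ : I) => ?_
    refine Eq.trans (b := ∑ᶠ T, E.h C i j S T ≫ idTo C (j + D.a T) j (D.ρ T) τ) rfl ?_
    apply finsum_eq_zero_of_forall_eq_zero
    intro T
    by_cases h0 : E.H S T = 0
    · rw [E.h_eq_zero C h0, Limits.zero_comp]
    -- The homotopy lowers the nonpositive shift by one, so it never ends in an unshifted entry.
    · rw [idTo_eq_zero, Limits.comp_zero]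
      rintro ⟨h', -⟩
      have := E.shift S T h0
      have := ha S
      omega
  · intro n
    refine E.iter_deform C hp' hg n _ fun (S T : J) => ?_
    unfold projection
    refine Eq.trans (b := ∑ᶠ σ, idTo C (n + D.a S) n (D.ρ S) σ ≫
      (if T = β σ then idTo C n (n + D.a T) σ (D.ρ T) else 0)) rfl ?_
    rw [finsum_eq_single _ (D.ρ S) fun σ hσ => by
      rw [idTo_eq_zero C fun h => hσ h.2.symm, Limits.zero_comp]]
    by_cases h0 : D.a S = 0
    · by_cases hT : T = β (D.ρ S)
      · rw [if_pos hT, if_pos ⟨h0, hT⟩, one_smul, idTo_comp_idTo C (by omega) rfl]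
      · rw [if_neg hT, if_neg fun h' => hT h'.2, zero_smul, Limits.comp_zero]
    · rw [idTo_eq_zero C fun h => h0 (by omega), Limits.zero_comp,
        if_neg fun h' : _ ∧ _ => h0 h'.1, zero_smul]

end Upper

section Lower

variable {D : SubdivisionData I J .lower} (C : ChainComplex (Graded A I (some .lower)) ℤ)

/-- The condition under which the complex that is subdivided embeds into the entries that are not
shifted. -/
structure IsCoaugmented (D : SubdivisionData I J .lower) : Prop where
  e_zero : open Classical in ∀ T, ∑ᶠ K, (if D.a K = 0 then 1 else 0) * D.e K T = 0
  q_unique : ∀ T σ, D.a T = 0 → σ ≤ D.ρ T → ∃ K, D.q K T ∧ D.ρ K = σ ∧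
    ∀ K', D.q K' T → D.ρ K' = σ → K' = K
  fin : ∀ σ, {S | D.ρ S = σ}.Finite

/-- This is dual to `IsAugmented.comm`. An element of `I` is sent to all unshifted entries over it,
so finite fibres are needed for column-finiteness and for manipulating the sums. -/
theorem IsCoaugmented.comm (hD : IsCoaugmented D) (i j : ℤ) (σ : I) (T : J) :
    ∑ᶠ K, idTo C i (i + D.a K) σ (D.ρ K) ≫ (D.d1 C i j K T + D.d2 C i j K T) =
      ∑ᶠ τ, (C.d i j).app σ τ ≫ idTo C j (j + D.a T) τ (D.ρ T) := by
  classical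
  have fin : ∀ x : ∀ K, (C.X (i + D.a K)).obj (D.ρ K) ⟶ (C.X (j + D.a T)).obj (D.ρ T),
      (Function.support fun K => idTo C i (i + D.a K) σ (D.ρ K) ≫ x K).Finite := fun x =>
    (hD.fin σ).subset fun K hK => by
      by_contra hne
      exact hK (by
        beta_reduce
        rw [idTo_eq_zero C fun h => hne h.2.symm, Limits.zero_comp])
  have h2 : ∑ᶠ K, idTo C i (i + D.a K) σ (D.ρ K) ≫ D.d2 C i j K T = 0 := by
    have : ∀ K, idTo C i (i + D.a K) σ (D.ρ K) ≫ D.d2 C i j K T =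
        ((if D.a K = 0 then 1 else 0) * D.e K T) •
          ((i.negOnePow : ℤ) • idTo C i (j + D.a T) σ (D.ρ T)) := by
      intro K
      by_cases he : D.e K T = 0
      · rw [d2_eq_zero C he, he, mul_zero, zero_smul, Limits.comp_zero]
      rw [d2, Preadditive.comp_zsmul]
      split_ifs with h
      · by_cases hσ : σ = D.ρ K
        · rw [idTo_comp_idTo C (by omega) hσ, smul_smul, one_mul, mul_comm]
        · rw [idTo_eq_zero C fun h => hσ h.2, Limits.zero_comp, smul_zero, idTo_eq_zero, smul_zero,
            smul_zero]
          exact fun h' => hσ (h'.2.trans (D.e_fibre K T he).symm)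
      · rw [idTo_eq_zero C fun h' => h (by omega), Limits.zero_comp, smul_zero, zero_mul,
          zero_smul]
    -- Outside the fibre of `σ` every term vanishes. Inside it, finiteness of the fibre allows the
    -- common morphism to be taken out of the sum of coefficients.
    by_cases hr : σ = D.ρ T
    swap
    · refine finsum_eq_zero_of_forall_eq_zero fun K => ?_
      rw [this, idTo_eq_zero C fun h => hr h.2, smul_zero, smul_zero]
    simp only [this]
    rw [← finsum_smul', hD.e_zero, zero_smul]
    apply (hD.fin σ).subset
    intro K hK
    exact (D.e_fibre K T fun h0 => hK (by simp [h0])).trans hr.symm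
  simp only [Preadditive.comp_add]
  rw [finsum_add_distrib (fin _) (fin _), h2, add_zero]
  symm
  rw [finsum_eq_single _ (D.ρ T)]
  swap
  · intro τ hτ
    rw [idTo_eq_zero C fun h => hτ h.2, Limits.comp_zero]
  by_cases h0 : D.a T = 0
  swap
  · rw [idTo_eq_zero C fun h => h0 (by omega), Limits.comp_zero,
      finsum_eq_zero_of_forall_eq_zero fun K => ?_]
    by_cases hq : D.q K T
    · rw [idTo_eq_zero, Limits.zero_comp]
      rintro ⟨h', -⟩
      have := D.q_shift K T hq
      omega
    · rw [d1_eq_zero C hq, Limits.comp_zero]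
  rw [d_comp_idTo C (by omega) rfl]
  by_cases hσ : σ ≤ D.ρ T
  · obtain ⟨K, hq, hK, hu⟩ := hD.q_unique T σ h0 hσ
    rw [finsum_eq_single _ K]
    · rw [d1, if_pos hq, idTo_comp_d C (by rw [D.q_shift K T hq, h0, add_zero]) hK.symm]
    · intro K' hne
      by_cases hq' : D.q K' T
      · rw [idTo_eq_zero C fun h => hne (hu K' hq' h.2.symm), Limits.zero_comp]
      · rw [d1_eq_zero C hq', Limits.comp_zero]
  · rw [finsum_eq_zero_of_forall_eq_zero]
    · by_contra hne
      exact hσ ((C.d _ _).support _ _ hne)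
    · intro K
      by_contra hne
      have hq := D.q_of_d1 C (i := i) (j := j) (S := K) (T := T) fun h =>
        hne (by rw [h, Limits.comp_zero])
      have hK := (idTo_ne_zero C fun h => hne (by rw [h, Limits.zero_comp])).2
      rw [d1, if_pos hq] at hne
      exact hσ (hK ▸ (C.d _ _).support _ _ fun h => hne (by rw [h, Limits.comp_zero]))

variable {p' : J → L} {p : I → L}

/-- The inclusion into the subdivision of the complex that is subdivided. -/
noncomputable def coaugmentation (hD : IsCoaugmented D) (hp' : Monotone p') (hp : Monotone p)
    (h : ∀ S, p (D.ρ S) ≤ p' S) :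
    ((Labelled.ofGraded .lower p hp).mapHomologicalComplex _).obj C ⟶ D.labelled C hp' where
  f n :=
    { app := fun σ S => idTo C n (n + D.a S) σ (D.ρ S)
      finite := fun σ => (hD.fin σ).subset fun S hS => (idTo_ne_zero C hS).2.symm
      support := fun σ S hne => by
        have : σ = D.ρ S := (idTo_ne_zero C hne).2
        subst this
        exact h S }
  comm' i j hij := Labelled.hom_ext fun σ T => hD.comm C i j σ T

open Classical in
/-- The inclusion is a chain equivalence. -/
theorem isIso_coaugmentation (hD : IsCoaugmented D) {β : I → J} (hβ : ∀ σ, D.ρ (β σ) = σ)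
    (hβa : ∀ σ, D.a (β σ) = 0) (ha : ∀ S, 0 ≤ D.a S)
    (E : D.Contraction fun S T => D.projection β T S)
    (hp' : E.Compatible p') (hp : Monotone p)
    (h : ∀ S, p (D.ρ S) ≤ p' S) (hβp : ∀ σ, p' (β σ) ≤ p σ) {g : I → ℕ} {N : ℕ}
    (hg : IsRank .lower g N) :
    IsIso ((HomotopyCategory.quotient _ _).map (coaugmentation C hD hp'.mono hp h)) := by
  refine ChainComplex.isIso_quotient_of_retraction _
    (fun n =>
      { app := fun T σ => if T = β σ then idTo C (n + D.a T) n (D.ρ T) σ else 0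
        finite := fun T => (Set.finite_singleton (D.ρ T)).subset fun σ hσ => by
          by_contra hne
          refine hσ (if_neg fun h => hne ?_)
          rw [h, hβ]; rfl
        support := fun T σ hT => by
          have : T = β σ := by
            by_contra hne
            exact hT (if_neg hne)
          rw [this]
          exact hβp σ })
    (E.hom C hp') (E.hom_rel C hp') ?_ ?_ N ?_
  · intro n
    refine Labelled.hom_ext fun (σ τ : I) => ?_
    refine Eq.trans (b := ∑ᶠ T, idTo C n (n + D.a T) σ (D.ρ T) ≫
      (if T = β τ then idTo C (n + D.a T) n (D.ρ T) τ else 0)) rfl ?_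
    rw [finsum_eq_single _ (β τ) fun T hT => by rw [if_neg hT, Limits.comp_zero], if_pos rfl]
    refine Eq.trans ?_ (ofGraded_one C hp n σ τ).symm
    by_cases hst : σ = τ
    · subst hst
      rw [idTo_comp_idTo C (by rw [hβa, add_zero]) (hβ σ).symm]
    · rw [idTo_eq_zero C fun h => hst (h.2.trans (hβ τ)), Limits.zero_comp,
        idTo_eq_zero C fun h => hst h.2]
  · intro i j
    refine Labelled.hom_ext fun (σ : I) (T : J) => ?_
    refine Eq.trans (b := ∑ᶠ S, idTo C i (i + D.a S) σ (D.ρ S) ≫ E.h C i j S T) rfl ?_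
    apply finsum_eq_zero_of_forall_eq_zero
    intro S
    by_cases h0 : E.H S T = 0
    · rw [E.h_eq_zero C h0, Limits.comp_zero]
    -- A nonzero entry of the homotopy starts in shift at least one, since its end has nonnegative
    -- shift; unshifted entries are not sources.
    · rw [idTo_eq_zero, Limits.zero_comp]
      rintro ⟨h', -⟩
      have := E.shift S T h0
      have := ha T
      omega
  · intro n
    refine E.iter_deform C hp' hg n _ fun (S T : J) => ?_
    unfold projection
    refine Eq.trans (b := ∑ᶠ σ, (if S = β σ then idTo C (n + D.a S) n (D.ρ S) σ else 0) ≫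
      idTo C n (n + D.a T) σ (D.ρ T)) rfl ?_
    rw [finsum_eq_single _ (D.ρ T) fun σ hσ => by
      rw [idTo_eq_zero C fun h => hσ h.2, Limits.comp_zero]]
    by_cases h0 : D.a T = 0
    · by_cases hT : S = β (D.ρ T)
      · rw [if_pos hT, if_pos ⟨h0, hT⟩, one_smul, idTo_comp_idTo C (by rw [hT, hβa, add_zero])
          (by rw [hT, hβ])]
      · rw [if_neg hT, if_neg fun h' => hT h'.2, zero_smul, Limits.zero_comp]
    · rw [idTo_eq_zero C (m := n) fun h => h0 (by omega), Limits.comp_zero,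
        if_neg fun h' : _ ∧ _ => h0 h'.1, zero_smul]

end Lower

end SubdivisionData

/-! ### Chain operations in the fibres of a simplicial map -/

namespace VertexMap

section Chains

open Classical

variable {α β : Type w} (r : α → β)

/-- The sign of a vertex of a simplex. -/
noncomputable def sign (S : Finset α) (w : α) : ℤ := ((place r S w).negOnePow : ℤ)

theorem sign_sq (S : Finset α) (w : α) : sign r S w * sign r S w = 1 :=
  SubdivisionData.negOnePow_sq _

/-- The differential of the fibres. -/
noncomputable def boundary : (Finset α →₀ ℤ) →ₗ[ℤ] (Finset α →₀ ℤ) :=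
  Finsupp.linearCombination ℤ fun S => ∑ w ∈ S,
    if (S.erase w).image r = S.image r then sign r S w • Finsupp.single (S.erase w) 1 else 0

/-- Adding a vertex whose image is there already. -/
noncomputable def join (v : α) : (Finset α →₀ ℤ) →ₗ[ℤ] (Finset α →₀ ℤ) :=
  Finsupp.linearCombination ℤ fun S =>
    if r v ∈ S.image r then sign r (insert v S) v • Finsupp.single (insert v S) 1 else 0

/-- Adding a vertex whose image is new. -/
noncomputable def cone (v : α) : (Finset α →₀ ℤ) →ₗ[ℤ] (Finset α →₀ ℤ) :=
  Finsupp.linearCombination ℤ fun S =>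
    if r v ∈ S.image r then 0 else Finsupp.single (insert v S) 1

/-- Removing the only vertex with image `x`. -/
noncomputable def strip (x : β) : (Finset α →₀ ℤ) →ₗ[ℤ] (Finset α →₀ ℤ) :=
  Finsupp.linearCombination ℤ fun S => ∑ w ∈ S,
    if r w = x ∧ x ∉ (S.erase w).image r then Finsupp.single (S.erase w) 1 else 0

/-- The sum of the coefficients of the simplices with defect zero. -/
noncomputable def augment : (Finset α →₀ ℤ) →ₗ[ℤ] ℤ :=
  Finsupp.linearCombination ℤ fun S => if defect r S = 0 then 1 else 0

theorem boundary_single (S : Finset α) : boundary r (Finsupp.single S 1) = ∑ w ∈ S,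
    if (S.erase w).image r = S.image r then sign r S w • Finsupp.single (S.erase w) 1 else 0 := by
  rw [boundary, Finsupp.linearCombination_single, one_smul]

theorem join_single (v : α) (S : Finset α) : join r v (Finsupp.single S 1) =
    if r v ∈ S.image r then sign r (insert v S) v • Finsupp.single (insert v S) 1 else 0 := by
  rw [join, Finsupp.linearCombination_single, one_smul]

theorem cone_single (v : α) (S : Finset α) : cone r v (Finsupp.single S 1) =
    if r v ∈ S.image r then 0 else Finsupp.single (insert v S) 1 := by
  rw [cone, Finsupp.linearCombination_single, one_smul]

theorem strip_single (x : β) (S : Finset α) : strip r x (Finsupp.single S 1) = ∑ w ∈ S,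
    if r w = x ∧ x ∉ (S.erase w).image r then Finsupp.single (S.erase w) 1 else 0 := by
  rw [strip, Finsupp.linearCombination_single, one_smul]

theorem augment_single (S : Finset α) : augment r (Finsupp.single S 1) =
    if defect r S = 0 then 1 else 0 := by
  rw [augment, Finsupp.linearCombination_single, one_smul]

variable {r}

theorem image_insert_erase_eq {v w : α} {u : Finset α} (hv : v ∉ u) (hw : w ∈ u) :
    ((insert v u).erase w).image r = insert (r v) ((u.erase w).image r) := by
  rw [Finset.erase_insert_of_ne fun h : v = w => hv (h ▸ hw), Finset.image_insert]

theorem eq_of_two {u : Finset α} {x : β} {z z' : α} (h : x ∉ ((u.erase z).erase z').image r)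
    {y : α} (hy : y ∈ u) (hr : r y = x) : y = z ∨ y = z' := by
  by_contra hn
  rw [not_or] at hn
  exact h (Finset.mem_image.2 ⟨y, Finset.mem_erase.2 ⟨hn.2, Finset.mem_erase.2 ⟨hn.1, hy⟩⟩, hr⟩)

/-- The two vertices with the same image have opposite signs. -/
theorem sign_pair {u : Finset α} {z z' : α} (hz : z ∈ u) (hz' : z' ∈ u) (hne : z ≠ z')
    (hr : r z = r z') (h : ∀ y ∈ u, r y = r z → y = z ∨ y = z') :
    sign r u z + sign r u z' = 0 := by
  unfold sign
  rcases before_total r hne with hb | hb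
  · rw [place_succ hz hr hb h, Int.negOnePow_succ]
    simp
  · rw [place_succ hz' hr.symm hb fun y hy hyr => (h y hy (hyr.trans hr.symm)).symm,
      Int.negOnePow_succ]
    simp

/-- The vertex `z` is alone over its image, so removing it lowers the number of vertices and of
images together. -/
theorem straight_erase {u : Finset α} {z : α} (h : r z ∉ (u.erase z).image r) :
    Straight r u (u.erase z) := by
  refine ⟨Finset.erase_subset _ _, (straight_iff (Finset.erase_subset _ _)).2 ⟨?_, ?_⟩⟩
  · intro y hy hy'
    have : y = z := by
      by_contra hn
      exact hy' (Finset.mem_erase.2 ⟨hn, hy⟩)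
    rwa [this]
  · intro y hy hy' y' hy2 hy2' _
    have e : ∀ y ∈ u, y ∉ u.erase z → y = z := fun y hy hy' => by
      by_contra hn
      exact hy' (Finset.mem_erase.2 ⟨hn, hy⟩)
    rw [e y hy hy', e y' hy2 hy2']

theorem defect_eq_zero_iff {u : Finset α} : defect r u = 0 ↔ Set.InjOn r u := by
  rw [← Finset.card_image_iff, defect, sub_eq_zero]
  constructor
  · intro h; exact_mod_cast h.symm
  · intro h; exact_mod_cast h.symm

theorem defect_nonneg (u : Finset α) : 0 ≤ defect r u := by
  have := Finset.card_image_le (s := u) (f := r)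
  unfold defect
  omega

/-- Erasing `v` from the join returns `u`. Erasing a vertex that is removable in `u` gives minus the
join of that face. In addition, the presence of `v` makes removable the only vertex of `u` over `r
v`, if there is just one; this produces the term with `cone` and `strip`, with sign opposite to that
of `v` because the two vertices are adjacent in the order over their common image. -/
theorem boundary_join {v : α} {u : Finset α} (hv : v ∉ u) (hx : r v ∈ u.image r) :
    boundary r (join r v (Finsupp.single u 1)) = Finsupp.single u 1 -
      join r v (boundary r (Finsupp.single u 1)) -
      cone r v (strip r (r v) (Finsupp.single u 1)) := by
  rw [join_single, if_pos hx, map_smul, boundary_single, boundary_single, strip_single,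
    Finset.sum_insert hv, Finset.erase_insert hv, Finset.image_insert, Finset.insert_eq_of_mem hx,
    if_pos rfl, smul_add, smul_smul, sign_sq, one_smul, sub_sub, sub_eq_add_neg]
  congr 1
  rw [map_sum, map_sum, ← Finset.sum_add_distrib, ← Finset.sum_neg_distrib, Finset.smul_sum]
  refine Finset.sum_congr rfl fun w hw => ?_
  have hvw : v ≠ w := fun h => hv (h ▸ hw)
  have hS : (insert v u).erase w = insert v (u.erase w) := Finset.erase_insert_of_ne hvw
  have hi := image_insert_erase_eq (r := r) hv hw
  by_cases h1 : (u.erase w).image r = u.image r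
  · have h2 : ((insert v u).erase w).image r = u.image r := by
      rw [hi, h1, Finset.insert_eq_of_mem hx]
    have h3 := place_swap (r := r) (S := insert v u) (w := v) (w' := w) (by simp) (by simp [hw])
      hvw (by rw [Finset.erase_insert hv, Finset.image_insert, Finset.insert_eq_of_mem hx])
      (by rw [h2, Finset.image_insert, Finset.insert_eq_of_mem hx])
    rw [Finset.erase_insert hv, hS] at h3
    change sign r _ _ * sign r _ _ + sign r _ _ * sign r _ _ = 0 at h3
    rw [if_pos h2, if_pos h1, if_neg fun h => h.2 (h1 ▸ hx), map_zero, add_zero, map_smul,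
      join_single, if_pos (h1 ▸ hx), smul_smul, smul_smul, hS, ← neg_smul]
    congr 1
    have e1 := sign_sq r (insert v u) w
    have e2 := sign_sq r u w
    linear_combination (sign r (insert v u) w * sign r u w) * h3 -
      (sign r (insert v u) v * sign r (insert v u) w) * e2 -
      (sign r (insert v (u.erase w)) v * sign r u w) * e1
  · rw [if_neg h1, map_zero, zero_add]
    have hw' : r w ∉ (u.erase w).image r := fun h => h1 (by
      rw [← Finset.insert_eq_of_mem h, ← Finset.image_insert, Finset.insert_erase hw])
    by_cases h2 : r w = r v
    · have h4 : r v ∉ (u.erase w).image r := h2 ▸ hw'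
      have h5 := sign_pair (r := r) (u := insert v u) (z := v) (z' := w) (by simp) (by simp [hw])
        hvw h2.symm (by
          intro y hy hyv
          rcases Finset.mem_insert.1 hy with rfl | hy
          · exact Or.inl rfl
          · right
            by_contra hn
            exact h4 (Finset.mem_image.2 ⟨y, Finset.mem_erase.2 ⟨hn, hy⟩, hyv⟩))
      rw [if_pos (show r w = r v ∧ _ from ⟨h2, h4⟩), cone_single, if_neg h4, if_pos, smul_smul, hS, ← neg_one_smul ℤ]
      · congr 1
        linear_combination sign r (insert v u) w * h5 - sign_sq r (insert v u) w
      · rw [hi, ← h2, ← Finset.image_insert, Finset.insert_erase hw]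
    · rw [if_neg fun h : r w = r v ∧ _ => h2 h.1, if_neg, map_zero, smul_zero, neg_zero]
      intro h
      rw [hi] at h
      have : r w ∈ u.image r := Finset.mem_image_of_mem _ hw
      rw [← h, Finset.mem_insert] at this
      exact this.elim h2 hw'

/-- The new vertex is alone over its image. It cannot be removed within the fibre, and its addition
is straight, so it does not change the signs of the other vertices. -/
theorem boundary_cone {v : α} {u : Finset α} (hv : v ∉ u) (hx : r v ∉ u.image r) :
    boundary r (cone r v (Finsupp.single u 1)) = cone r v (boundary r (Finsupp.single u 1)) := by
  rw [cone_single, if_neg hx, boundary_single, boundary_single, Finset.sum_insert hv,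
    Finset.erase_insert hv, if_neg, zero_add, map_sum]
  swap
  · rw [Finset.image_insert]
    exact fun h => hx (h ▸ Finset.mem_insert_self _ _)
  refine Finset.sum_congr rfl fun w hw => ?_
  have hvw : v ≠ w := fun h => hv (h ▸ hw)
  have hS : (insert v u).erase w = insert v (u.erase w) := Finset.erase_insert_of_ne hvw
  have hx' : r v ∉ (u.erase w).image r := fun h =>
    hx (Finset.image_subset_image (Finset.erase_subset _ _) h)
  rw [hS, Finset.image_insert, Finset.image_insert]
  by_cases h1 : (u.erase w).image r = u.image r
  · rw [if_pos h1, if_pos (by rw [h1]), map_smul, cone_single, if_neg hx']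
    congr 1
    have h := straight_erase (r := r) (u := insert v u) (z := v)
      (by rw [Finset.erase_insert hv]; exact hx)
    rw [Finset.erase_insert hv] at h
    rw [sign, sign, place_straight h hw]
  · rw [if_neg h1, if_neg, map_zero]
    intro h
    apply h1
    rw [← Finset.erase_insert hx', h, Finset.erase_insert hx]

theorem strip_of_unique {u : Finset α} {z : α} (hz : z ∈ u) (h : r z ∉ (u.erase z).image r) :
    strip r (r z) (Finsupp.single u 1) = Finsupp.single (u.erase z) 1 := by
  rw [strip_single, Finset.sum_eq_single z, if_pos ⟨rfl, h⟩]
  · intro w hw hwz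
    rw [if_neg]
    rintro ⟨h1, -⟩
    exact h (Finset.mem_image.2 ⟨w, Finset.mem_erase.2 ⟨hwz, hw⟩, h1⟩)
  · exact fun h => absurd hz h

theorem strip_eq_zero {u : Finset α} {x : β}
    (h : ∀ z ∈ u, r z = x → x ∈ (u.erase z).image r) :
    strip r x (Finsupp.single u 1) = 0 := by
  rw [strip_single]
  exact Finset.sum_eq_zero fun w hw => if_neg fun h' => h'.2 (h w hw h'.1)

/-- If one vertex lies over `x`, removing it is straight and preserves the signs. If two do, the
faces that omit one of them have the same strip with opposite signs. With more vertices over `x`, or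
none, both sides vanish. -/
theorem strip_boundary (x : β) (u : Finset α) :
    strip r x (boundary r (Finsupp.single u 1)) =
      boundary r (strip r x (Finsupp.single u 1)) := by
  by_cases hex : ∃ z ∈ u, r z = x ∧ x ∉ (u.erase z).image r
  · obtain ⟨z, hz, rfl, hzu⟩ := hex
    rw [strip_of_unique hz hzu, boundary_single, boundary_single, map_sum,
      ← Finset.add_sum_erase _ _ hz, if_neg, map_zero, zero_add]
    · refine Finset.sum_congr rfl fun w hw => ?_
      obtain ⟨hwz, hwu⟩ := Finset.mem_erase.1 hw
      have hzw : z ∈ u.erase w := Finset.mem_erase.2 ⟨Ne.symm hwz, hz⟩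
      have hz' : r z ∉ ((u.erase w).erase z).image r := fun h => hzu
        (Finset.image_subset_image (by
          rw [Finset.erase_right_comm]; exact Finset.erase_subset _ _) h)
      have i1 : u.image r = insert (r z) ((u.erase z).image r) := by
        rw [← Finset.image_insert, Finset.insert_erase hz]
      have i2 : (u.erase w).image r = insert (r z) (((u.erase z).erase w).image r) := by
        rw [← Finset.image_insert, Finset.erase_right_comm, Finset.insert_erase hzw]
      have hz2 : r z ∉ ((u.erase z).erase w).image r := by rwa [Finset.erase_right_comm]
      by_cases h1 : ((u.erase z).erase w).image r = (u.erase z).image r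
      · rw [if_pos h1, if_pos (by rw [i1, i2, h1]), map_smul, strip_of_unique hzw hz',
          Finset.erase_right_comm]
        congr 1
        rw [sign, sign, place_straight (straight_erase hzu) hw]
      · rw [if_neg h1, if_neg, map_zero]
        intro h
        apply h1
        rw [← Finset.erase_insert hz2, ← i2, h, i1, Finset.erase_insert hzu]
    · intro h
      exact hzu (h ▸ Finset.mem_image_of_mem r hz)
  · push Not at hex
    rw [strip_eq_zero hex, map_zero, boundary_single, map_sum]
    by_cases hex2 : ∃ w ∈ u, strip r x (if (u.erase w).image r = u.image r then
        sign r u w • Finsupp.single (u.erase w) 1 else 0) ≠ 0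
    swap
    · push Not at hex2
      exact Finset.sum_eq_zero hex2
    obtain ⟨w, hw, hne⟩ := hex2
    have hi : (u.erase w).image r = u.image r := by
      by_contra h
      rw [if_neg h, map_zero] at hne
      exact hne rfl
    rw [if_pos hi, map_smul] at hne
    obtain ⟨z, hz, hzx, hzu⟩ : ∃ z ∈ u.erase w, r z = x ∧ x ∉ ((u.erase w).erase z).image r := by
      by_contra hn
      push Not at hn
      rw [strip_eq_zero hn, smul_zero] at hne
      exact hne rfl
    subst hzx
    obtain ⟨hzw, hzu'⟩ := Finset.mem_erase.1 hz
    have hwx : r w = r z := by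
      obtain ⟨y, hy, hyr⟩ := Finset.mem_image.1 (hex z hzu' rfl)
      obtain ⟨hyz, hyu⟩ := Finset.mem_erase.1 hy
      rcases eq_of_two hzu hyu hyr with rfl | rfl
      · exact hyr
      · exact absurd rfl hyz
    have hw2 : w ∈ u.erase z := Finset.mem_erase.2 ⟨hzw.symm, hw⟩
    rw [Finset.sum_eq_add_of_mem w z hw hzu' hzw.symm, if_pos hi,
      if_pos (image_erase_eq hw hzw.symm hwx.symm), map_smul, map_smul, strip_of_unique hz hzu,
      ← hwx, strip_of_unique hw2 (by rw [Finset.erase_right_comm, hwx]; exact hzu),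
      Finset.erase_right_comm, ← add_smul, sign_pair hw hzu' hzw.symm hwx, zero_smul]
    · intro y hy hyw
      exact eq_of_two hzu hy (hyw.trans hwx)
    · rintro y hy ⟨hyw, hyz⟩
      split_ifs
      · rw [map_smul, strip_eq_zero, smul_zero]
        intro y' hy' hyr
        rcases eq_of_two hzu (Finset.mem_of_mem_erase hy') hyr with rfl | rfl
        · exact Finset.mem_image.2 ⟨z, by simp [hzu', hzw, hyz.symm], rfl⟩
        · exact Finset.mem_image.2 ⟨w, by simp [hw, hzw.symm, hyw.symm], hwx⟩
      · rw [map_zero]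

/-- A face of defect zero exists in the boundary only if exactly two vertices share an image. Then
there are exactly two such faces, with opposite signs. -/
theorem augment_boundary (u : Finset α) :
    augment r (boundary r (Finsupp.single u 1)) = 0 := by
  rw [boundary_single, map_sum]
  by_cases hex : ∃ w ∈ u, augment r (if (u.erase w).image r = u.image r then
      sign r u w • Finsupp.single (u.erase w) 1 else 0) ≠ 0
  swap
  · push Not at hex
    exact Finset.sum_eq_zero hex
  obtain ⟨w, hw, hne⟩ := hex
  have hi : (u.erase w).image r = u.image r := by
    by_contra h
    rw [if_neg h, map_zero] at hne
    exact hne rfl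
  rw [if_pos hi, map_smul, augment_single] at hne
  have hd : defect r (u.erase w) = 0 := by
    by_contra h
    rw [if_neg h, smul_zero] at hne
    exact hne rfl
  have hinj := defect_eq_zero_iff.1 hd
  obtain ⟨z, hz, hzw, hr⟩ := exists_of_image_erase_eq hw hi
  have h2 : ∀ y ∈ u, r y = r w → y = w ∨ y = z := by
    intro y hy hyr
    by_contra hn
    rw [not_or] at hn
    exact hn.2 (hinj (by simp [hy, hn.1]) (by simp [hz, hzw]) (hyr.trans hr))
  have hi2 := image_erase_eq hw hzw.symm hr.symm
  have hd2 : defect r (u.erase z) = 0 := by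
    have e1 := erase_defect hw hi
    have e2 := erase_defect hz hi2
    omega
  rw [Finset.sum_eq_add_of_mem w z hw hz hzw.symm, if_pos hi, if_pos hi2, map_smul, map_smul,
    augment_single, augment_single, if_pos hd, if_pos hd2, ← add_smul,
    sign_pair hw hz hzw.symm hr h2, zero_smul]
  rintro y hy ⟨hyw, hyz⟩
  rw [if_neg, map_zero]
  intro h
  obtain ⟨y', hy', hne', hr'⟩ := exists_of_image_erase_eq hy h
  by_cases h3 : y' = w
  · exact (h2 y hy (h3 ▸ hr')).elim hyw hyz
  · exact hne' (hinj (by simp [hy', h3]) (by simp [hy, hyw]) hr'.symm)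

/-- Stripping is straight where it is possible. Where it is not, two vertices lie over `x`, the
defect is positive and both sides are zero. -/
theorem augment_strip {u : Finset α} {x : β} (hx : x ∈ u.image r) :
    augment r (strip r x (Finsupp.single u 1)) = augment r (Finsupp.single u 1) := by
  by_cases hex : ∃ z ∈ u, r z = x ∧ x ∉ (u.erase z).image r
  · obtain ⟨z, hz, rfl, hzu⟩ := hex
    rw [strip_of_unique hz hzu, augment_single, augment_single, (straight_erase hzu).2]
  · push Not at hex
    rw [strip_eq_zero hex, map_zero, augment_single, if_neg]
    rw [defect_eq_zero_iff]
    intro hinj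
    obtain ⟨z, hz, rfl⟩ := Finset.mem_image.1 hx
    obtain ⟨y, hy, hyr⟩ := Finset.mem_image.1 (hex z hz rfl)
    obtain ⟨hyz, hyu⟩ := Finset.mem_erase.1 hy
    exact hyz (hinj hyu hz hyr)

theorem augment_cone {u : Finset α} {v : α} (hv : v ∉ u) (hx : r v ∉ u.image r) :
    augment r (cone r v (Finsupp.single u 1)) = augment r (Finsupp.single u 1) := by
  have h := straight_erase (r := r) (u := insert v u) (z := v)
    (by rwa [Finset.erase_insert hv])
  rw [Finset.erase_insert hv] at h
  rw [cone_single, if_neg hx, augment_single, augment_single, h.2]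

theorem boundary_eq_zero {u : Finset α} (h : Set.InjOn r u) :
    boundary r (Finsupp.single u 1) = 0 := by
  rw [boundary_single]
  refine Finset.sum_eq_zero fun w hw => if_neg fun hi => ?_
  obtain ⟨z, hz, hzw, hr⟩ := exists_of_image_erase_eq hw hi
  exact hzw (h hz hw hr.symm)

end Chains

end VertexMap

/-! ### Contracting the fibres over a barycentric subdivision -/

/-- Every vertex of the subdivision of `K` is the barycentre `vert τ` of a simplex `τ`, which is
`car (vert τ)`, and `r` maps it to a vertex of `τ`. -/
structure FlagData {α β : Type w} (K : PreAbstractSimplicialComplex β) (r : α → β) where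
  car : α → Finset β
  vert : Finset β → α
  car_vert : ∀ τ ∈ K.faces, car (vert τ) = τ
  mem : ∀ τ ∈ K.faces, r (vert τ) ∈ τ

namespace FlagData

open VertexMap

section

open Classical

variable {α β : Type w} {K : PreAbstractSimplicialComplex β} {r : α → β} (F : FlagData K r)

/-- The vertices of the subdivision. -/
def IsVertex (w : α) : Prop := F.car w ∈ K.faces ∧ F.vert (F.car w) = w

/-- The simplices of the subdivision, and the empty set. -/
def IsFlag (S : Finset α) : Prop := (∀ w ∈ S, F.IsVertex w) ∧
  ∀ w ∈ S, ∀ w' ∈ S, F.car w ⊆ F.car w' ∨ F.car w' ⊆ F.car w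

/-- The flags of simplices strictly below the simplex with barycentre `v`. -/
def Under (v : α) (u : Finset α) : Prop := F.IsFlag u ∧ ∀ w ∈ u, F.car w ⊂ F.car v

variable {F}

theorem IsFlag.mono {S T : Finset α} (h : F.IsFlag S) (hTS : T ⊆ S) : F.IsFlag T :=
  ⟨fun w hw => h.1 w (hTS hw), fun w hw w' hw' => h.2 w (hTS hw) w' (hTS hw')⟩

theorem isFlag_empty : F.IsFlag ∅ := ⟨by simp, by simp⟩

theorem IsVertex.r_mem {w : α} (h : F.IsVertex w) : r w ∈ F.car w := by
  have := F.mem _ h.1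
  rwa [h.2] at this

theorem IsVertex.eq {w w' : α} (h : F.IsVertex w) (h' : F.IsVertex w') (he : F.car w = F.car w') :
    w = w' := by
  rw [← h.2, ← h'.2, he]

theorem isVertex_vert {τ : Finset β} (h : τ ∈ K.faces) : F.IsVertex (F.vert τ) := by
  rw [IsVertex, F.car_vert τ h]
  exact ⟨h, rfl⟩

theorem Under.notMem {v : α} {u : Finset α} (h : F.Under v u) : v ∉ u := fun hv =>
  (h.2 v hv).2 (Finset.Subset.refl _)

theorem Under.isFlag_insert {v : α} {u : Finset α} (h : F.Under v u) (hv : F.IsVertex v) :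
    F.IsFlag (insert v u) := by
  refine ⟨?_, ?_⟩
  · intro w hw
    rcases Finset.mem_insert.1 hw with rfl | hw
    · exact hv
    · exact h.1.1 w hw
  · intro w hw w' hw'
    rcases Finset.mem_insert.1 hw with rfl | hu
    · rcases Finset.mem_insert.1 hw' with rfl | hu'
      · exact Or.inl (Finset.Subset.refl _)
      · exact Or.inr (h.2 _ hu').1
    · rcases Finset.mem_insert.1 hw' with rfl | hu'
      · exact Or.inl (h.2 _ hu).1
      · exact h.1.2 w hu w' hu'

theorem Under.car_subset {v : α} {u : Finset α} (h : F.Under v u) {w : α} (hw : w ∈ insert v u) :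
    F.car w ⊆ F.car v := by
  rcases Finset.mem_insert.1 hw with rfl | hw
  · exact Finset.Subset.refl _
  · exact (h.2 w hw).1

theorem Under.image_subset {v : α} {u : Finset α} (h : F.Under v u) (hv : F.IsVertex v) :
    (insert v u).image r ⊆ F.car v := by
  intro x hx
  obtain ⟨w, hw, rfl⟩ := Finset.mem_image.1 hx
  exact h.car_subset hw ((h.isFlag_insert hv).1 w hw).r_mem

/-- The carriers form a chain and a vertex is determined by its carrier, so a carrier of greatest
size belongs to exactly one vertex. All recursions below split off this top vertex. -/
theorem IsFlag.exists_top {S : Finset α} (h : F.IsFlag S) (hne : S.Nonempty) :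
    ∃ v u, S = insert v u ∧ F.IsVertex v ∧ F.Under v u := by
  obtain ⟨v, hv, hmax⟩ := Finset.exists_max_image S (fun w => (F.car w).card) hne
  have hle : ∀ w ∈ S, F.car w ⊆ F.car v := by
    intro w hw
    rcases h.2 w hw v hv with h1 | h1
    · exact h1
    · rw [Finset.eq_of_subset_of_card_le h1 (hmax w hw)]
  refine ⟨v, S.erase v, (Finset.insert_erase hv).symm, h.1 v hv,
    h.mono (Finset.erase_subset _ _), ?_⟩
  intro w hw
  obtain ⟨hwv, hwS⟩ := Finset.mem_erase.1 hw
  exact ((hle w hwS).ssubset_of_ne fun he => hwv ((h.1 w hwS).eq (h.1 v hv) he))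

variable (F) in
/-- The simplex with image `σ` that has defect zero and largest possible carriers. -/
noncomputable def canon (σ : Finset β) : Finset α :=
  if _h : r (F.vert σ) ∈ σ then insert (F.vert σ) (canon (σ.erase (r (F.vert σ)))) else ∅
termination_by σ.card
decreasing_by exact Finset.card_erase_lt_of_mem _h

theorem canon_empty : F.canon ∅ = ∅ := by
  rw [canon, dif_neg (by simp)]

theorem canon_of_mem {σ : Finset β} (h : σ ∈ K.faces) :
    F.canon σ = insert (F.vert σ) (F.canon (σ.erase (r (F.vert σ)))) := by
  rw [canon, dif_pos (F.mem σ h)]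

theorem face_of_subset {σ τ : Finset β} (h : τ ∈ K.faces) (hσ : σ ⊆ τ) : σ = ∅ ∨ σ ∈ K.faces := by
  rcases σ.eq_empty_or_nonempty with h0 | h0
  · exact Or.inl h0
  · exact Or.inr ((K.isRelLowerSet_faces h).2 hσ h0)

/-- The barycentre of `σ` supplies one vertex `x` of the image. The remaining vertices come from the
face opposite to `x`, whose subfaces are strictly smaller than `σ`, so the result is again a flag.
-/
theorem canon_spec (n : ℕ) : ∀ σ : Finset β, σ.card = n → (σ = ∅ ∨ σ ∈ K.faces) →
    F.IsFlag (F.canon σ) ∧ (∀ w ∈ F.canon σ, F.car w ⊆ σ) ∧ (F.canon σ).image r = σ ∧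
      (F.canon σ).card = σ.card := by
  induction n with
  | zero =>
    intro σ hn _
    rw [Finset.card_eq_zero.1 hn, canon_empty]
    exact ⟨isFlag_empty, by simp, by simp, rfl⟩
  | succ n ih =>
    intro σ hn hσ
    have hσ' : σ ∈ K.faces := hσ.resolve_left (by rintro rfl; simp at hn)
    set x := r (F.vert σ) with hx
    have hxσ : x ∈ σ := F.mem σ hσ'
    obtain ⟨h1, h2, h3, h4⟩ := ih (σ.erase x) (by rw [Finset.card_erase_of_mem hxσ]; omega)
      (face_of_subset hσ' (Finset.erase_subset _ _))
    have hU : F.Under (F.vert σ) (F.canon (σ.erase x)) := ⟨h1, fun w hw => by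
      rw [F.car_vert σ hσ']
      exact Finset.ssubset_of_subset_of_ssubset (h2 w hw) (Finset.erase_ssubset hxσ)⟩
    rw [canon_of_mem hσ']
    refine ⟨hU.isFlag_insert (isVertex_vert hσ'), ?_, ?_, ?_⟩
    · intro w hw
      have := hU.car_subset hw
      rwa [F.car_vert σ hσ'] at this
    · rw [Finset.image_insert, h3, ← hx, Finset.insert_erase hxσ]
    · rw [Finset.card_insert_of_notMem hU.notMem, h4, Finset.card_erase_of_mem hxσ]
      have : 0 < σ.card := Finset.card_pos.2 ⟨x, hxσ⟩
      omega

theorem canon_defect {σ : Finset β} (h : σ = ∅ ∨ σ ∈ K.faces) : defect r (F.canon σ) = 0 := by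
  obtain ⟨-, -, h3, h4⟩ := canon_spec (F := F) _ σ rfl h
  have : ((F.canon σ).image r).card = (F.canon σ).card := by rw [h3, h4]
  exact defect_eq_zero_iff.2 (Finset.card_image_iff.1 this)

theorem canon_under {σ : Finset β} {v : α} (hv : F.IsVertex v) (h : σ ⊂ F.car v) :
    F.Under v (F.canon σ) := by
  obtain ⟨h1, h2, -, -⟩ := canon_spec (F := F) _ σ rfl (face_of_subset hv.1 h.1)
  exact ⟨h1, fun w hw => Finset.ssubset_of_subset_of_ssubset (h2 w hw) h⟩

variable (F) in
/-- The contraction of the fibres, on simplices whose carriers have at most `n` vertices. -/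
noncomputable def contract : ℕ → (Finset α →₀ ℤ) →ₗ[ℤ] (Finset α →₀ ℤ)
  | 0 => 0
  | n + 1 => Finsupp.linearCombination ℤ fun S =>
      if hex : ∃ v ∈ S, ∀ w ∈ S, F.car w ⊆ F.car v then
        -- With `v` the top vertex and `u` the rest, the simplex is here, up to sign, the join of
        -- `v` with `u`. The value is dictated by the homotopy identity: the first summand inverts
        -- the join as in a cone, the second compensates the term with `cone` and `strip` in
        -- `boundary_join`.
        if r hex.choose ∈ (S.erase hex.choose).image r then
          sign r S hex.choose •
            (-(join r hex.choose (contract n (Finsupp.single (S.erase hex.choose) 1))) -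
              cone r hex.choose (contract n (strip r (r hex.choose)
                (contract n (Finsupp.single (S.erase hex.choose) 1)))))
        else
          -- Here the simplex is the cone of `v` over `u`, and coning the contraction of `u` ends at
          -- the cone over the canonical simplex below. That is the canonical simplex when the
          -- carrier of `v` is the whole image; otherwise the subtracted chain connects the two.
          cone r hex.choose (contract n (Finsupp.single (S.erase hex.choose) 1)) -
            if F.car hex.choose = S.image r then 0 else
              augment r (Finsupp.single (S.erase hex.choose) 1) •
                (join r hex.choose (Finsupp.single (F.canon (S.image r)) 1) +
                  cone r hex.choose (contract n (strip r (r hex.choose)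
                    (Finsupp.single (F.canon (S.image r)) 1))))
      else 0

theorem Under.choose_eq {v : α} {u : Finset α} (h : F.Under v u) (hv : F.IsVertex v)
    (hex : ∃ v' ∈ insert v u, ∀ w ∈ insert v u, F.car w ⊆ F.car v') : hex.choose = v := by
  obtain ⟨h1, h2⟩ := hex.choose_spec
  exact ((h.isFlag_insert hv).1 _ h1).eq hv
    ((h.car_subset h1).antisymm (h2 v (Finset.mem_insert_self _ _)))

theorem contract_insert_of_mem (n : ℕ) {v : α} {u : Finset α} (h : F.Under v u)
    (hv : F.IsVertex v) (hx : r v ∈ u.image r) :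
    F.contract (n + 1) (Finsupp.single (insert v u) 1) = sign r (insert v u) v •
      (-(join r v (F.contract n (Finsupp.single u 1))) -
        cone r v (F.contract n (strip r (r v) (F.contract n (Finsupp.single u 1))))) := by
  have hex : ∃ v' ∈ insert v u, ∀ w ∈ insert v u, F.car w ⊆ F.car v' :=
    ⟨v, Finset.mem_insert_self _ _, fun w hw => h.car_subset hw⟩
  rw [contract, Finsupp.linearCombination_single, one_smul, dif_pos hex, h.choose_eq hv hex,
    Finset.erase_insert h.notMem, if_pos hx]

theorem contract_insert_of_notMem (n : ℕ) {v : α} {u : Finset α} (h : F.Under v u)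
    (hv : F.IsVertex v) (hx : r v ∉ u.image r) :
    F.contract (n + 1) (Finsupp.single (insert v u) 1) =
      cone r v (F.contract n (Finsupp.single u 1)) -
        if F.car v = insert (r v) (u.image r) then 0 else
          augment r (Finsupp.single u 1) •
            (join r v (Finsupp.single (F.canon (insert (r v) (u.image r))) 1) +
              cone r v (F.contract n (strip r (r v)
                (Finsupp.single (F.canon (insert (r v) (u.image r))) 1)))) := by
  have hex : ∃ v' ∈ insert v u, ∀ w ∈ insert v u, F.car w ⊆ F.car v' :=
    ⟨v, Finset.mem_insert_self _ _, fun w hw => h.car_subset hw⟩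
  rw [contract, Finsupp.linearCombination_single, one_smul, dif_pos hex, h.choose_eq hv hex,
    Finset.erase_insert h.notMem, if_neg hx, Finset.image_insert]

theorem contract_empty (n : ℕ) : F.contract n (Finsupp.single ∅ 1) = 0 := by
  cases n with
  | zero => rfl
  | succ n => rw [contract, Finsupp.linearCombination_single, dif_neg (by simp), smul_zero]

/-! Chains with prescribed support. -/

theorem map_mem_of_single {P : Finset α → Prop} {M : Type*} [AddCommGroup M]
    {N : Submodule ℤ M} (L : (Finset α →₀ ℤ) →ₗ[ℤ] M)
    (h : ∀ S, P S → L (Finsupp.single S 1) ∈ N) {x : Finset α →₀ ℤ}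
    (hx : x ∈ Finsupp.supported ℤ ℤ {S | P S}) : L x ∈ N := by
  rw [Finsupp.supported_eq_span_single] at hx
  have hle : Submodule.span ℤ ((fun i => Finsupp.single i (1 : ℤ)) '' {S | P S}) ≤ N.comap L := by
    rw [Submodule.span_le]
    rintro _ ⟨S, hS, rfl⟩
    exact h S hS
  exact hle hx

theorem map_eq_of_single {P : Finset α → Prop} {M : Type*} [AddCommGroup M]
    (L L' : (Finset α →₀ ℤ) →ₗ[ℤ] M)
    (h : ∀ S, P S → L (Finsupp.single S 1) = L' (Finsupp.single S 1)) {x : Finset α →₀ ℤ}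
    (hx : x ∈ Finsupp.supported ℤ ℤ {S | P S}) : L x = L' x := by
  have := map_mem_of_single (N := ⊥) (L - L') (fun S hS => by simp [h S hS]) hx
  simpa [sub_eq_zero] using this

theorem single_mem {P : Finset α → Prop} {S : Finset α} (h : P S) :
    Finsupp.single S (1 : ℤ) ∈ Finsupp.supported ℤ ℤ {S | P S} :=
  Finsupp.single_mem_supported ℤ (1 : ℤ) (s := {S | P S}) h

variable (F) in
/-- Chains of simplices over `σ` strictly below the barycentre `v`. -/
noncomputable def openChains (v : α) (σ : Finset β) (m : ℤ) : Submodule ℤ (Finset α →₀ ℤ) :=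
  Finsupp.supported ℤ ℤ {u | F.Under v u ∧ u.image r = σ ∧ u.card = m}

variable (F) in
/-- Chains of simplices over `σ` with carriers in that of `v`. -/
noncomputable def closedChains (v : α) (σ : Finset β) (m : ℤ) : Submodule ℤ (Finset α →₀ ℤ) :=
  Finsupp.supported ℤ ℤ {T | (F.IsFlag T ∧ ∀ w ∈ T, F.car w ⊆ F.car v) ∧ T.image r = σ ∧
    T.card = m}

variable {v : α} {σ : Finset β} {m : ℤ} {x : Finset α →₀ ℤ}

theorem boundary_mem (hx : x ∈ F.openChains v σ m) : boundary r x ∈ F.openChains v σ (m - 1) := by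
  refine map_mem_of_single _ (fun u hu => ?_) hx
  rw [boundary_single]
  refine Submodule.sum_mem _ fun w hw => ?_
  split_ifs with h
  · refine Submodule.smul_mem _ _ (single_mem ⟨⟨hu.1.1.mono (Finset.erase_subset _ _), fun y hy =>
      hu.1.2 y (Finset.mem_of_mem_erase hy)⟩, h.trans hu.2.1, ?_⟩)
    rw [← hu.2.2, Finset.card_erase_of_mem hw, Nat.cast_sub (Finset.card_pos.2 ⟨w, hw⟩)]
    simp
  · exact Submodule.zero_mem _

theorem strip_mem (y : β) (hx : x ∈ F.openChains v σ m) :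
    strip r y x ∈ F.openChains v (σ.erase y) (m - 1) := by
  refine map_mem_of_single _ (fun u hu => ?_) hx
  rw [strip_single]
  refine Submodule.sum_mem _ fun w hw => ?_
  split_ifs with h
  · refine single_mem ⟨⟨hu.1.1.mono (Finset.erase_subset _ _), fun y hy =>
      hu.1.2 y (Finset.mem_of_mem_erase hy)⟩, ?_, ?_⟩
    · rw [← hu.2.1]
      conv_rhs => rw [← Finset.insert_erase hw, Finset.image_insert, h.1, Finset.erase_insert h.2]
    · rw [← hu.2.2, Finset.card_erase_of_mem hw, Nat.cast_sub (Finset.card_pos.2 ⟨w, hw⟩)]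
      simp
  · exact Submodule.zero_mem _

theorem join_mem (hv : F.IsVertex v) (hσ : r v ∈ σ) (hx : x ∈ F.openChains v σ m) :
    join r v x ∈ F.closedChains v σ (m + 1) := by
  refine map_mem_of_single _ (fun u hu => ?_) hx
  rw [join_single]
  split_ifs with h
  · refine Submodule.smul_mem _ _ (single_mem ⟨⟨hu.1.isFlag_insert hv,
      fun w hw => hu.1.car_subset hw⟩, ?_, ?_⟩)
    · rw [Finset.image_insert, hu.2.1, Finset.insert_eq_of_mem hσ]
    · rw [Finset.card_insert_of_notMem hu.1.notMem, ← hu.2.2]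
      simp
  · exact Submodule.zero_mem _

theorem cone_mem (hv : F.IsVertex v) (hx : x ∈ F.openChains v σ m) :
    cone r v x ∈ F.closedChains v (insert (r v) σ) (m + 1) := by
  refine map_mem_of_single _ (fun u hu => ?_) hx
  rw [cone_single]
  split_ifs with h
  · exact Submodule.zero_mem _
  · refine single_mem ⟨⟨hu.1.isFlag_insert hv, fun w hw => hu.1.car_subset hw⟩, ?_, ?_⟩
    · rw [Finset.image_insert, hu.2.1]
    · rw [Finset.card_insert_of_notMem hu.1.notMem, ← hu.2.2]
      simp

/-- The simplices that occur in the contraction of `S`. -/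
def Near (F : FlagData K r) (S T : Finset α) : Prop :=
  (F.IsFlag T ∧ ∀ w ∈ T, ∃ w' ∈ S, F.car w ⊆ F.car w') ∧ T.image r = S.image r ∧
    (T.card : ℤ) = S.card + 1

theorem contract_mem_of (n : ℕ)
    (h : ∀ S, F.IsFlag S →
      F.contract n (Finsupp.single S 1) ∈ Finsupp.supported ℤ ℤ {T | F.Near S T})
    (hx : x ∈ F.openChains v σ m) : F.contract n x ∈ F.openChains v σ (m + 1) := by
  refine map_mem_of_single _ (fun u hu => ?_) hx
  refine Finsupp.supported_mono ?_ (h u hu.1.1)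
  rintro T ⟨⟨h1, h2⟩, h3, h4⟩
  refine ⟨⟨h1, fun w hw => ?_⟩, h3.trans hu.2.1, by rw [h4, hu.2.2]⟩
  obtain ⟨w', hw', hle⟩ := h2 w hw
  exact Finset.ssubset_of_subset_of_ssubset hle (hu.1.2 w' hw')

theorem canon_mem (hv : F.IsVertex v) (h : σ ⊂ F.car v) :
    Finsupp.single (F.canon σ) 1 ∈ F.openChains v σ σ.card := by
  obtain ⟨-, -, h3, h4⟩ := canon_spec (F := F) _ σ rfl (face_of_subset hv.1 h.1)
  exact single_mem ⟨canon_under hv h, h3, by rw [h4]⟩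

/-- The recursion uses only the top vertex `v` and simplices over faces of the carrier of `v`. So
neither images nor bounds on carriers are violated, which makes the contraction usable for both
kinds of labels. -/
theorem contract_near (n : ℕ) : ∀ S, F.IsFlag S →
    F.contract n (Finsupp.single S 1) ∈ Finsupp.supported ℤ ℤ {T | F.Near S T} := by
  induction n with
  | zero => intro S _; exact Submodule.zero_mem _
  | succ n ih =>
    intro S hS
    rcases S.eq_empty_or_nonempty with rfl | hne
    · rw [contract_empty]; exact Submodule.zero_mem _
    obtain ⟨v, u, rfl, hv, hu⟩ := hS.exists_top hne
    have hle : F.closedChains v ((insert v u).image r) ((u.card : ℤ) + 1 + 1) ≤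
        Finsupp.supported ℤ ℤ {T | F.Near (insert v u) T} := by
      apply Finsupp.supported_mono
      rintro T ⟨⟨h1, h2⟩, h3, h4⟩
      refine ⟨⟨h1, fun w hw => ⟨v, Finset.mem_insert_self _ _, h2 w hw⟩⟩, h3, ?_⟩
      rw [h4, Finset.card_insert_of_notMem hu.notMem]
      simp
    apply hle
    have hmem : Finsupp.single u 1 ∈ F.openChains v (u.image r) u.card :=
      single_mem ⟨hu, rfl, rfl⟩
    have hc := contract_mem_of n ih hmem
    by_cases hx : r v ∈ u.image r
    · rw [contract_insert_of_mem n hu hv hx, Finset.image_insert, Finset.insert_eq_of_mem hx]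
      refine Submodule.smul_mem _ _ (Submodule.sub_mem _ (Submodule.neg_mem _
        (join_mem hv hx hc)) ?_)
      have := cone_mem hv (contract_mem_of n ih (strip_mem (r v) hc))
      rwa [Finset.insert_erase hx, sub_add_cancel] at this
    · rw [contract_insert_of_notMem n hu hv hx, Finset.image_insert]
      refine Submodule.sub_mem _ (cone_mem hv hc) ?_
      split_ifs with h
      · exact Submodule.zero_mem _
      rw [augment_single]
      split_ifs with hd
      swap
      · rw [zero_smul]; exact Submodule.zero_mem _
      have hss : insert (r v) (u.image r) ⊂ F.car v := by
        have := hu.image_subset hv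
        rw [Finset.image_insert] at this
        exact this.ssubset_of_ne (Ne.symm h)
      have hcard : ((insert (r v) (u.image r)).card : ℤ) = u.card + 1 := by
        rw [Finset.card_insert_of_notMem hx]
        unfold defect at hd
        push_cast
        omega
      have hcan := canon_mem hv hss
      rw [hcard] at hcan
      refine Submodule.smul_mem _ _ (Submodule.add_mem _
        (join_mem hv (Finset.mem_insert_self _ _) hcan) ?_)
      have := cone_mem hv (contract_mem_of n ih (strip_mem (r v) hcan))
      rwa [Finset.erase_insert hx, add_sub_cancel_right] at this

theorem contract_mem (n : ℕ) (hx : x ∈ F.openChains v σ m) :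
    F.contract n x ∈ F.openChains v σ (m + 1) :=
  contract_mem_of n (contract_near n) hx

/-- The contraction adds a vertex without changing the image, so it only produces simplices of
positive defect. -/
theorem augment_contract (n : ℕ) (hx : x ∈ F.openChains v σ m) :
    augment r (F.contract n x) = 0 := by
  refine map_eq_of_single (augment r ∘ₗ F.contract n) 0 (fun u hu => ?_) hx
  refine map_eq_of_single (augment r) 0 (fun T hT => ?_) (contract_near n u hu.1.1)
  rw [augment_single, if_neg]
  · rfl
  · have h1 := defect_nonneg (r := r) u
    unfold defect at h1 ⊢
    rw [hT.2.1, hT.2.2]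
    omega

theorem contract_join (n : ℕ) (hv : F.IsVertex v) (hσ : r v ∈ σ) (hx : x ∈ F.openChains v σ m) :
    F.contract (n + 1) (join r v x) =
      -(join r v (F.contract n x)) - cone r v (F.contract n (strip r (r v) (F.contract n x))) := by
  refine map_eq_of_single (F.contract (n + 1) ∘ₗ join r v)
    (-(join r v ∘ₗ F.contract n) - cone r v ∘ₗ F.contract n ∘ₗ strip r (r v) ∘ₗ F.contract n)
    (fun u hu => ?_) hx
  have hx : r v ∈ u.image r := hu.2.1 ▸ hσ
  change F.contract (n + 1) (join r v _) = -(join r v (F.contract n _)) - cone r v (F.contract n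
    (strip r (r v) (F.contract n _)))
  rw [join_single, if_pos hx, map_smul, contract_insert_of_mem n hu.1 hv hx, smul_smul, sign_sq,
    one_smul]

theorem contract_cone (n : ℕ) (hv : F.IsVertex v) (hσ : r v ∉ σ) (hx : x ∈ F.openChains v σ m) :
    F.contract (n + 1) (cone r v x) = cone r v (F.contract n x) -
      if F.car v = insert (r v) σ then 0 else
        augment r x • (join r v (Finsupp.single (F.canon (insert (r v) σ)) 1) +
          cone r v (F.contract n (strip r (r v)
            (Finsupp.single (F.canon (insert (r v) σ)) 1)))) := by
  set y := if F.car v = insert (r v) σ then 0 else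
    (join r v (Finsupp.single (F.canon (insert (r v) σ)) 1) +
      cone r v (F.contract n (strip r (r v)
        (Finsupp.single (F.canon (insert (r v) σ)) 1)))) with hy
  have : ∀ z : ℤ, (if F.car v = insert (r v) σ then 0 else
      z • (join r v (Finsupp.single (F.canon (insert (r v) σ)) 1) +
        cone r v (F.contract n (strip r (r v)
          (Finsupp.single (F.canon (insert (r v) σ)) 1))))) = z • y := by
    intro z
    rw [hy, smul_ite, smul_zero]
  rw [this]
  refine map_eq_of_single (F.contract (n + 1) ∘ₗ cone r v)
    (cone r v ∘ₗ F.contract n - (augment r).smulRight y) (fun u hu => ?_) hx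
  have hx : r v ∉ u.image r := hu.2.1 ▸ hσ
  change F.contract (n + 1) (cone r v _) = cone r v (F.contract n _) - augment r _ • y
  rw [cone_single, if_neg hx, contract_insert_of_notMem n hu.1 hv hx, hu.2.1, this]

/-- The contraction does not depend on `n`. -/
theorem contract_stable (n : ℕ) : ∀ S, F.IsFlag S → (∀ w ∈ S, (F.car w).card ≤ n) →
    F.contract (n + 1) (Finsupp.single S 1) = F.contract n (Finsupp.single S 1) := by
  induction n with
  | zero =>
    intro S hS h
    have : S = ∅ := by
      by_contra hne
      obtain ⟨w, hw⟩ := Finset.nonempty_of_ne_empty hne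
      have h1 := (K.isRelLowerSet_faces (hS.1 w hw).1).1
      have h2 := h w hw
      have h3 : 0 < (F.car w).card := Finset.card_pos.2 h1
      omega
    rw [this, contract_empty, contract_empty]
  | succ n ih =>
    intro S hS h
    rcases S.eq_empty_or_nonempty with rfl | hne
    · rw [contract_empty, contract_empty]
    obtain ⟨v, u, rfl, hv, hu⟩ := hS.exists_top hne
    have hcard := h v (Finset.mem_insert_self _ _)
    -- All chains entering the recursion lie strictly below the top vertex, so their carriers are
    -- smaller by at least one and the induction hypothesis covers them.
    have st : ∀ {σ m x}, x ∈ F.openChains v σ m → F.contract (n + 1) x = F.contract n x := by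
      intro σ m x hx
      refine map_eq_of_single _ _ (fun u hu => ih u hu.1.1 fun w hw => ?_) hx
      have := Finset.card_lt_card (hu.1.2 w hw)
      omega
    have hmem : Finsupp.single u 1 ∈ F.openChains v (u.image r) u.card :=
      single_mem ⟨hu, rfl, rfl⟩
    by_cases hx : r v ∈ u.image r
    · rw [contract_insert_of_mem _ hu hv hx, contract_insert_of_mem _ hu hv hx, st hmem,
        st (strip_mem _ (contract_mem n hmem))]
    · rw [contract_insert_of_notMem _ hu hv hx, contract_insert_of_notMem _ hu hv hx, st hmem]
      split_ifs with h
      · rfl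
      have hss : insert (r v) (u.image r) ⊂ F.car v := by
        have := hu.image_subset hv
        rw [Finset.image_insert] at this
        exact this.ssubset_of_ne (Ne.symm h)
      rw [st (strip_mem _ (canon_mem hv hss))]

/-- The contraction is a homotopy from the identity to the projection to `canon σ`. -/
theorem contract_homotopy (n : ℕ) : ∀ S, F.IsFlag S → (∀ w ∈ S, (F.car w).card ≤ n) →
    boundary r (F.contract n (Finsupp.single S 1)) + F.contract n (boundary r (Finsupp.single S 1))
      = Finsupp.single S 1 - augment r (Finsupp.single S 1) •
        Finsupp.single (F.canon (S.image r)) 1 := by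
  have hempty : ∀ n, boundary r (F.contract n (Finsupp.single ∅ 1)) +
      F.contract n (boundary r (Finsupp.single ∅ 1)) =
      Finsupp.single ∅ 1 - augment r (Finsupp.single ∅ 1) •
        Finsupp.single (F.canon ((∅ : Finset α).image r)) 1 := by
    intro n
    rw [contract_empty, boundary_eq_zero (by simp), Finset.image_empty, canon_empty,
      augment_single, if_pos (defect_eq_zero_iff.2 (by simp))]
    simp
  induction n with
  | zero =>
    intro S hS h
    have : S = ∅ := by
      by_contra hne
      obtain ⟨w, hw⟩ := Finset.nonempty_of_ne_empty hne
      have h1 := (K.isRelLowerSet_faces (hS.1 w hw).1).1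
      have h2 := h w hw
      have h3 : 0 < (F.car w).card := Finset.card_pos.2 h1
      omega
    subst this
    exact hempty 0
  | succ n ih =>
    intro S hS h
    rcases S.eq_empty_or_nonempty with rfl | hne
    · exact hempty _
    obtain ⟨v, u, rfl, hv, hu⟩ := hS.exists_top hne
    have hcard := h v (Finset.mem_insert_self _ _)
    have st : ∀ {σ m x}, x ∈ F.openChains v σ m → F.contract (n + 1) x = F.contract n x := by
      intro σ m x hx
      refine map_eq_of_single _ _ (fun u hu => contract_stable n u hu.1.1 fun w hw => ?_) hx
      have := Finset.card_lt_card (hu.1.2 w hw)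
      omega
    -- The induction hypothesis, extended linearly to chains below `v` and solved for the boundary
    -- of the contraction.
    have hh : ∀ {σ m x}, x ∈ F.openChains v σ m → boundary r (F.contract n x) =
        x - augment r x • Finsupp.single (F.canon σ) 1 - F.contract n (boundary r x) := by
      intro σ m x hx
      refine map_eq_of_single (boundary r ∘ₗ F.contract n)
        (LinearMap.id - (augment r).smulRight (Finsupp.single (F.canon σ) 1) -
          F.contract n ∘ₗ boundary r) (fun u hu => ?_) hx
      have := ih u hu.1.1 fun w hw => by
        have := Finset.card_lt_card (hu.1.2 w hw)
        omega
      rw [hu.2.1] at this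
      exact eq_sub_of_add_eq this
    have bj : ∀ {σ m x}, r v ∈ σ → x ∈ F.openChains v σ m → boundary r (join r v x) =
        x - join r v (boundary r x) - cone r v (strip r (r v) x) := by
      intro σ m x hσ hx
      refine map_eq_of_single (boundary r ∘ₗ join r v)
        (LinearMap.id - join r v ∘ₗ boundary r - cone r v ∘ₗ strip r (r v)) (fun u hu => ?_) hx
      exact boundary_join hu.1.notMem (hu.2.1 ▸ hσ)
    have bc : ∀ {σ m x}, r v ∉ σ → x ∈ F.openChains v σ m → boundary r (cone r v x) =
        cone r v (boundary r x) := by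
      intro σ m x hσ hx
      refine map_eq_of_single (boundary r ∘ₗ cone r v) (cone r v ∘ₗ boundary r)
        (fun u hu => ?_) hx
      exact boundary_cone hu.1.notMem (hu.2.1 ▸ hσ)
    have sb : ∀ x, strip r (r v) (boundary r x) = boundary r (strip r (r v) x) := by
      intro x
      exact map_eq_of_single (P := fun _ => True) (strip r (r v) ∘ₗ boundary r)
        (boundary r ∘ₗ strip r (r v)) (fun u _ => strip_boundary _ u) (by simp)
    have ab : ∀ x, augment r (boundary r x) = 0 := by
      intro x
      exact map_eq_of_single (P := fun _ => True) (augment r ∘ₗ boundary r) 0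
        (fun u _ => augment_boundary u) (by simp)
    have as : ∀ {σ m x}, r v ∈ σ → x ∈ F.openChains v σ m →
        augment r (strip r (r v) x) = augment r x := by
      intro σ m x hσ hx
      refine map_eq_of_single (augment r ∘ₗ strip r (r v)) (augment r) (fun u hu => ?_) hx
      exact augment_strip (hu.2.1 ▸ hσ)
    have hmem : Finsupp.single u 1 ∈ F.openChains v (u.image r) u.card :=
      single_mem ⟨hu, rfl, rfl⟩
    have himg := hu.image_subset hv
    rw [Finset.image_insert] at himg ⊢
    -- facts about the canonical simplex, when it lies strictly below `v`
    have hcan : ∀ {σ : Finset β}, r v ∈ σ → σ ⊂ F.car v →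
        boundary r (Finsupp.single (F.canon σ) 1) = 0 ∧
        augment r (Finsupp.single (F.canon σ) 1) = 1 := by
      intro σ _ hss
      have := canon_defect (F := F) (face_of_subset hv.1 hss.1)
      exact ⟨boundary_eq_zero (defect_eq_zero_iff.1 this), by rw [augment_single, if_pos this]⟩
    set z : Finset α →₀ ℤ := Finsupp.single u 1 with hz
    by_cases hx : r v ∈ u.image r
    -- The image of `u` lies in the carrier of the top vertex of `u`, which is strictly below that
    -- of `v`. Hence the canonical simplex over this image is itself below `v`.
    · have hss : u.image r ⊂ F.car v := by
        have hne : u.Nonempty := Finset.image_nonempty.1 ⟨_, hx⟩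
        obtain ⟨v', u', rfl, hv', hu'⟩ := hu.1.exists_top hne
        exact Finset.ssubset_of_subset_of_ssubset (hu'.image_subset hv')
          (hu.2 v' (Finset.mem_insert_self _ _))
      rw [Finset.insert_eq_of_mem hx] at himg ⊢
      have hnd : defect r (insert v u) ≠ 0 := by
        rw [Ne, defect_eq_zero_iff]
        intro hinj
        obtain ⟨y, hy, hyv⟩ := Finset.mem_image.1 hx
        have := hinj (by simp [hy]) (by simp) hyv
        exact hu.notMem (this ▸ hy)
      rw [augment_single (S := insert v u), if_neg hnd, zero_smul, sub_zero]
      have hS : Finsupp.single (insert v u) (1 : ℤ) = sign r (insert v u) v • join r v z := by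
        rw [hz, join_single, if_pos hx, smul_smul, sign_sq, one_smul]
      -- Passing from the simplex to the join removes the sign from the identity.
      suffices key : boundary r (F.contract (n + 1) (join r v z)) +
          F.contract (n + 1) (boundary r (join r v z)) = join r v z by
        rw [hS, map_smul, map_smul, map_smul, map_smul, ← smul_add, key]
      obtain ⟨hc0, hc1⟩ := hcan hx hss
      have m1 := contract_mem n hmem
      have m2 := strip_mem (r v) m1
      have m3 := contract_mem n m2
      have m4 := strip_mem (r v) hmem
      -- After expansion, the canonical terms from the induction hypothesis for `z` cancel those in
      -- the contraction of the cone over the strip of `z`, since stripping preserves the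
      -- augmentation. All terms with the boundary of `z` cancel as well, and the join of `z` is
      -- left.
      rw [contract_join n hv hx hmem, map_sub, map_neg, bj hx m1, bc (by simp) m3,
        bj hx hmem, map_sub, map_sub, st hmem, contract_join n hv hx (boundary_mem hmem),
        contract_cone n hv (by simp) m4, Finset.insert_erase hx, if_neg (Ne.symm hss.ne), as hx hmem,
        hh m2, as hx m1, augment_contract n hmem, zero_smul, sub_zero, ← sb, hh hmem]
      simp only [map_sub, map_smul, smul_add]
      abel
    · have m1 := contract_mem n hmem
      have hS : Finsupp.single (insert v u) (1 : ℤ) = cone r v z := by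
        rw [hz, cone_single, if_neg hx]
      have haug : augment r (cone r v z) = augment r z := augment_cone hu.notMem hx
      rw [hS, contract_cone n hv hx hmem, bc hx hmem, contract_cone n hv hx (boundary_mem hmem),
        haug, ab]
      simp only [zero_smul, ite_self, sub_zero]
      -- If the carrier of `v` is the image, `v` is its barycentre and the canonical simplex is the
      -- cone over the one below.
      by_cases h : F.car v = insert (r v) (u.image r)
      · rw [if_pos h, sub_zero, bc hx m1, hh hmem, ← h, canon_of_mem hv.1, hv.2, h,
          Finset.erase_insert hx, map_sub, map_sub, map_smul,
          cone_single r v (F.canon (u.image r)), if_neg]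
        · abel
        · rwa [(canon_spec (F := F) _ _ rfl (face_of_subset hv.1
            ((Finset.subset_insert _ _).trans himg))).2.2.1]
      -- Let `c` be the canonical simplex over the full image. It lies below `v`, and the boundary
      -- of the correcting chain is `c` minus the cone over the canonical simplex of the image of
      -- `u`: the two cones over the strip of `c` cancel.
      · have hss : insert (r v) (u.image r) ⊂ F.car v := himg.ssubset_of_ne (Ne.symm h)
        have hm := Finset.mem_insert_self (r v) (u.image r)
        obtain ⟨hc0, hc1⟩ := hcan hm hss
        have c1 := canon_mem hv hss
        have c2 := strip_mem (r v) c1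
        have c3 := contract_mem n c2
        rw [if_neg h, map_sub, bc hx m1, map_smul, map_add, bj hm c1, hc0, map_zero, sub_zero,
          bc (by simp) c3, hh c2, as hm c1, hc1, ← sb, hc0, map_zero, map_zero, sub_zero, one_smul,
          Finset.erase_insert hx, hh hmem]
        simp only [map_sub, map_smul, smul_add, smul_sub]
        abel

end

end FlagData

namespace Labelled

variable {A : Type u} [Category.{v} A] [Preadditive A] {I : Type w} [Preorder I]
  {J : Type w} [Preorder J] {s : Variance}

/-- A controlled complex over `J`, labelled by `I`. -/
noncomputable abbrev complex {p : J → I} (hp : Monotone p)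
    (C : ChainComplex (Graded A J (some s)) ℤ) : ChainComplex (Labelled A I s) ℤ :=
  ((ofGraded s p hp).mapHomologicalComplex _).obj C

/-- The identity, as a chain map that changes the labels. -/
noncomputable def relabelMap {p q : J → I} (hp : Monotone p) (hq : Monotone q)
    (h : ∀ S, Variance.allowed (some s) (p S) (q S)) (C : ChainComplex (Graded A J (some s)) ℤ) :
    complex hp C ⟶ complex hq C :=
  (NatTrans.mapHomologicalComplex (relabel hp hq h) _).app C

end Labelled

/-! ### One subdivision step with labels -/

namespace FlagData

open VertexMap

section

open Classical

variable {α β : Type w} {K' : PreAbstractSimplicialComplex α} {K : PreAbstractSimplicialComplex β}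
  {r : α → β} (F : FlagData K r) (hr : IsSimplicial K' K r) (hK' : LocallyFiniteComplex K')

theorem ite_eq_ite {a b : Prop} {_ : Decidable a} {_ : Decidable b} (h : a ↔ b) :
    (if a then (1 : ℤ) else 0) = if b then 1 else 0 := by
  simp only [h]

/-- The simplices of `K'` are the flags. -/
def Describes (K' : PreAbstractSimplicialComplex α) : Prop :=
  ∀ S, S ∈ K'.faces ↔ S.Nonempty ∧ F.IsFlag S

variable {F} (hF : F.Describes K')

theorem support_boundary {S : Finset α} (hS : S ∈ K'.faces) :
    ∀ K ∈ (boundary r (Finsupp.single S 1)).support, K ∈ K'.faces := by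
  have : boundary r (Finsupp.single S 1) ∈ Finsupp.supported ℤ ℤ {K | K ∈ K'.faces} := by
    rw [boundary_single]
    refine Submodule.sum_mem _ fun w hw => ?_
    split_ifs with h
    · refine Submodule.smul_mem _ _ (single_mem ?_)
      refine (K'.isRelLowerSet_faces hS).2 (Finset.erase_subset _ _) ?_
      rw [← Finset.image_nonempty (f := r), h, Finset.image_nonempty]
      exact ⟨w, hw⟩
    · exact Submodule.zero_mem _
  exact fun K hK => this hK

theorem boundary_apply (S T : Finset α) :
    boundary r (Finsupp.single S 1) T = incidence r S T := by
  rw [boundary_single, incidence, Finsupp.finsetSum_apply]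
  refine Finset.sum_congr rfl fun w _ => ?_
  by_cases h : (S.erase w).image r = S.image r
  · rw [if_pos h]
    by_cases hT : T = S.erase w
    · have h2 : T = S.erase w ∧ T.image r = S.image r := ⟨hT, hT ▸ h⟩
      rw [if_pos h2, hT]
      simp [sign]
    · rw [if_neg fun h' : T = S.erase w ∧ _ => hT h'.1]
      simp [Ne.symm hT]
  · rw [if_neg h, if_neg fun h' : T = S.erase w ∧ _ => h (h'.1 ▸ h'.2)]
    rfl

theorem map_apply_eq_finsum (L : (Finset α →₀ ℤ) →ₗ[ℤ] (Finset α →₀ ℤ)) {x : Finset α →₀ ℤ}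
    (hx : ∀ K ∈ x.support, K ∈ K'.faces) (T : Finset α) :
    L x T = ∑ᶠ K : K'.faces, x K.1 * L (Finsupp.single K.1 1) T := by
  have h1 : L x = x.sum fun K a => a • L (Finsupp.single K 1) := by
    conv_lhs => rw [← Finsupp.sum_single x]
    rw [map_finsuppSum]
    refine Finsupp.sum_congr fun K _ => ?_
    rw [← map_smul, Finsupp.smul_single, smul_eq_mul, mul_one]
  rw [h1, Finsupp.sum, Finsupp.finsetSum_apply,
    finsum_eq_sum_of_support_subset (s := x.support.subtype fun K => K ∈ K'.faces)]
  · rw [Finset.sum_subtype_of_mem (fun K => x K * L (Finsupp.single K 1) T) hx]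
    rfl
  · intro K hK
    rw [Finset.mem_coe, Finset.mem_subtype, Finsupp.mem_support_iff]
    exact left_ne_zero_of_mul hK

include hF in
theorem support_contract (n : ℕ) (S : K'.faces) :
    ∀ K ∈ (F.contract n (Finsupp.single S.1 1)).support, K ∈ K'.faces ∧ F.Near S.1 K := by
  intro K hK
  have : F.Near S.1 K := contract_near n S.1 ((hF _).1 S.2).2 hK
  refine ⟨(hF _).2 ⟨?_, this.1.1⟩, this⟩
  rw [← Finset.image_nonempty (f := r), this.2.1, Finset.image_nonempty]
  exact (K'.isRelLowerSet_faces S.2).1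

include hF in
-- This is `contract_homotopy` read as an identity of matrix entries, the form required of a
-- `Contraction`.
theorem contract_eq {n : ℕ} (hn : ∀ σ ∈ K.faces, σ.card ≤ n) (S T : K'.faces) :
    (∑ᶠ L : K'.faces, incidence r S.1 L.1 * F.contract n (Finsupp.single L.1 1) T.1) +
      (∑ᶠ L : K'.faces, F.contract n (Finsupp.single S.1 1) L.1 * incidence r L.1 T.1) =
    (if S = T then 1 else 0) -
      if defect r S.1 = 0 ∧ T.1 = F.canon (S.1.image r) then 1 else 0 := by
  have hS := ((hF _).1 S.2).2
  have h := contract_homotopy n S.1 hS fun w hw => hn _ (hS.1 w hw).1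
  have h' := DFunLike.congr_fun h T.1
  rw [Finsupp.add_apply, map_apply_eq_finsum _ (support_boundary S.2),
    map_apply_eq_finsum (K' := K') (boundary r) (fun K hK => (support_contract hF n S K hK).1),
    add_comm] at h'
  simp only [boundary_apply] at h'
  rw [h', Finsupp.sub_apply, Finsupp.smul_apply, augment_single, Finsupp.single_apply,
    Finsupp.single_apply]
  simp only [Subtype.ext_iff, smul_eq_mul]
  congr 1
  have e : (F.canon (S.1.image r) = T.1) ↔ T.1 = F.canon (S.1.image r) := eq_comm
  by_cases h1 : defect r S.1 = 0 <;> by_cases h2 : T.1 = F.canon (S.1.image r) <;>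
    simp only [h1, h2, e, if_true, if_false, and_true, and_false, mul_one, mul_zero]

/-- The canonical section of the map on simplices. -/
noncomputable def section_ (σ : K.faces) : K'.faces :=
  ⟨F.canon σ.1, (hF _).2 ⟨by
    obtain ⟨-, -, h3, -⟩ := canon_spec (F := F) _ σ.1 rfl (Or.inr σ.2)
    rw [← Finset.image_nonempty (f := r), h3]
    exact (K.isRelLowerSet_faces σ.2).1, (canon_spec _ σ.1 rfl (Or.inr σ.2)).1⟩⟩

theorem onFaces_section (σ : K.faces) : onFaces hr (section_ hF σ) = σ :=
  Subtype.ext (canon_spec (F := F) _ σ.1 rfl (Or.inr σ.2)).2.2.1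

theorem section_eq_iff (S T : K'.faces) :
    T.1 = F.canon (S.1.image r) ↔ T = section_ hF (onFaces hr S) :=
  ⟨fun h => Subtype.ext h, fun h => congrArg Subtype.val h⟩

/-- The smallest simplex that contains a simplex of the subdivision. -/
noncomputable def carrier (S : K'.faces) : K.faces :=
  ⟨S.1.biUnion F.car, by
    obtain ⟨h1, h2⟩ := (hF _).1 S.2
    obtain ⟨v, u, h3, hv, hu⟩ := h2.exists_top h1
    -- The carriers form a chain, so their union is the carrier of the top vertex.
    have : S.1.biUnion F.car = F.car v := by
      apply Finset.Subset.antisymm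
      · exact Finset.biUnion_subset.2 fun w hw => hu.car_subset (h3 ▸ hw)
      · exact Finset.subset_biUnion_of_mem F.car (h3 ▸ Finset.mem_insert_self _ _)
    rw [this]
    exact hv.1⟩

theorem carrier_mono : Monotone (carrier hF) := fun S T (h : S.1 ⊆ T.1) =>
  show S.1.biUnion F.car ⊆ T.1.biUnion F.car from Finset.biUnion_subset_biUnion_of_subset_left _ h

theorem onFaces_mono : Monotone (onFaces hr) := fun S T (h : S.1 ⊆ T.1) =>
  show S.1.image r ⊆ T.1.image r from Finset.image_subset_image h

theorem carrier_le_iff (S : K'.faces) (σ : K.faces) :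
    carrier hF S ≤ σ ↔ ∀ w ∈ S.1, F.car w ⊆ σ.1 := Finset.biUnion_subset

theorem onFaces_le_carrier (S : K'.faces) : onFaces hr S ≤ carrier hF S := by
  intro x hx
  obtain ⟨w, hw, rfl⟩ := Finset.mem_image.1 hx
  exact Finset.mem_biUnion.2 ⟨w, hw, (((hF _).1 S.2).2.1 w hw).r_mem⟩

theorem carrier_section (σ : K.faces) : carrier hF (section_ hF σ) ≤ σ :=
  (carrier_le_iff hF _ _).2 (canon_spec (F := F) _ σ.1 rfl (Or.inr σ.2)).2.1

theorem carrier_le_of_near {S T : K'.faces} (h : F.Near S.1 T.1) :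
    carrier hF T ≤ carrier hF S := by
  rw [carrier_le_iff]
  intro w hw
  obtain ⟨w', hw', hle⟩ := h.1.2 w hw
  exact hle.trans (Finset.subset_biUnion_of_mem F.car hw')

include hF hK' in
-- A vertex of `σ` is the image of a vertex of `S` whose carrier contains it. Local finiteness
-- leaves finitely many such carriers, and finitely many simplices at each of their barycentres.
theorem fibre_finite (hK : LocallyFiniteComplex K) (σ : K.faces) :
    {S : K'.faces | onFaces hr S = σ}.Finite := by
  obtain ⟨x, hx⟩ := (K.isRelLowerSet_faces σ.2).1
  have h1 : (⋃ τ ∈ {τ ∈ K.faces | x ∈ τ}, {S ∈ K'.faces | F.vert τ ∈ S}).Finite :=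
    (hK x).biUnion fun τ _ => hK' _
  refine (h1.preimage (f := Subtype.val) Subtype.val_injective.injOn).subset ?_
  intro S hS
  have : x ∈ S.1.image r := by
    have h2 := congrArg Subtype.val hS
    change S.1.image r = σ.1 at h2
    rwa [h2]
  obtain ⟨w, hw, rfl⟩ := Finset.mem_image.1 this
  have hv := ((hF _).1 S.2).2.1 w hw
  simp only [Set.mem_preimage, Set.mem_iUnion]
  exact ⟨F.car w, ⟨hv.1, hv.r_mem⟩, S.2, by rw [hv.2]; exact hw⟩

/-- Defect zero means that `r` is injective on `S`, so the preimage of `τ` is the only face over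
`τ`. -/
theorem straight_unique (S : K'.faces) (τ : K.faces) (h0 : defect r S.1 = 0)
    (hτ : τ ≤ onFaces hr S) : ∃ L : K'.faces, Straight r S.1 L.1 ∧ onFaces hr L = τ ∧
      ∀ L' : K'.faces, Straight r S.1 L'.1 → onFaces hr L' = τ → L' = L := by
  have hinj := defect_eq_zero_iff.1 h0
  set L : Finset α := S.1.filter fun w => r w ∈ τ.1 with hL
  have himg : L.image r = τ.1 := by
    ext x
    simp only [hL, Finset.mem_image, Finset.mem_filter]
    constructor
    · rintro ⟨w, ⟨-, hw⟩, rfl⟩; exact hw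
    · intro hx
      obtain ⟨w, hw, rfl⟩ := Finset.mem_image.1 (hτ hx)
      exact ⟨w, ⟨hw, hx⟩, rfl⟩
  have hsub : L ⊆ S.1 := Finset.filter_subset _ _
  refine ⟨⟨L, (K'.isRelLowerSet_faces S.2).2 hsub ?_⟩, ⟨hsub, ?_⟩, Subtype.ext himg, ?_⟩
  · rw [← Finset.image_nonempty (f := r), himg]
    exact (K.isRelLowerSet_faces τ.2).1
  · rw [h0, eq_comm, defect_eq_zero_iff]
    exact hinj.mono hsub
  · intro L' hL' he
    have he' : L'.1.image r = τ.1 := congrArg Subtype.val he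
    apply Subtype.ext
    ext w
    simp only [hL, Finset.mem_filter]
    constructor
    · intro hw
      exact ⟨hL'.1 hw, he' ▸ Finset.mem_image_of_mem r hw⟩
    · rintro ⟨hw, hwτ⟩
      rw [← he'] at hwτ
      obtain ⟨y, hy, hyw⟩ := Finset.mem_image.1 hwτ
      rwa [← hinj (hL'.1 hy) hw hyw]

theorem straight_diag {S T : K'.faces} (h : Straight r S.1 T.1)
    (he : onFaces hr S = onFaces hr T) : S = T := by
  have he' : S.1.image r = T.1.image r := congrArg Subtype.val he
  have h2 := h.2
  unfold defect at h2
  rw [he'] at h2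
  exact Subtype.ext (Finset.eq_of_subset_of_card_le h.1 (by omega)).symm

theorem finsum_incidence (S : K'.faces) :
    ∑ᶠ L : K'.faces, incidence r S.1 L.1 * (if defect r L.1 = 0 then 1 else 0) = 0 := by
  -- The augmentation is disguised as an endomorphism of chains concentrated at the empty simplex,
  -- so that the general formula for matrix entries applies.
  set D : (Finset α →₀ ℤ) →ₗ[ℤ] (Finset α →₀ ℤ) := (augment r).smulRight (Finsupp.single ∅ 1)
  have h := map_apply_eq_finsum D (support_boundary (r := r) S.2) ∅
  have e : ∀ x, D x ∅ = augment r x := fun x => by simp [D]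
  simp only [e, augment_boundary, augment_single, boundary_apply] at h
  exact h.symm

/-! The subdivision step. -/

variable {n : ℕ} (hn : ∀ σ ∈ K.faces, σ.card ≤ n)

/-- The contraction of the fibres of the subdivision step, `upper` case. -/
noncomputable def contractionUpper :
    (subdivisionData hr hK' .upper).Contraction
      ((subdivisionData hr hK' .upper).projection (section_ hF)) where
  H S T := F.contract n (Finsupp.single S.1 1) T.1
  mono := onFaces_mono hr
  shift S T h := by
    have := (support_contract hF n S T.1 (Finsupp.mem_support_iff.2 h)).2.2
    change -defect r S.1 = -defect r T.1 + 1
    unfold defect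
    rw [this.1, this.2]
    ring
  fibre S T h := Subtype.ext
    (support_contract hF n S T.1 (Finsupp.mem_support_iff.2 h)).2.2.1.symm
  fin S := ((F.contract n (Finsupp.single S.1 1)).support.finite_toSet.preimage
    (f := Subtype.val) Subtype.val_injective.injOn).subset fun T hT =>
      Finsupp.mem_support_iff.2 hT
  q_refl S := ⟨Finset.Subset.refl _, rfl⟩
  q_diag S T h he := straight_diag hr h he
  eq S T := by
    refine (contract_eq hF hn S T).trans ?_
    refine congrArg₂ _ (ite_eq_ite Iff.rfl) (ite_eq_ite ?_)
    change _ ↔ -defect r S.1 = 0 ∧ T = section_ hF (onFaces hr S)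
    rw [neg_eq_zero, section_eq_iff hr hF]

/-- The contraction of the fibres of the subdivision step, `lower` case. -/
noncomputable def contractionLower (hK : LocallyFiniteComplex K) :
    (subdivisionData hr hK' .lower).Contraction fun S T =>
      (subdivisionData hr hK' .lower).projection (section_ hF) T S where
  H S T := F.contract n (Finsupp.single T.1 1) S.1
  mono := onFaces_mono hr
  shift S T h := by
    have := (support_contract hF n T S.1 (Finsupp.mem_support_iff.2 h)).2.2
    change defect r S.1 = defect r T.1 + 1
    unfold defect
    rw [this.1, this.2]
    ring
  fibre S T h := Subtype.ext
    (support_contract hF n T S.1 (Finsupp.mem_support_iff.2 h)).2.2.1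
  fin S := (fibre_finite hr hK' hF hK (onFaces hr S)).subset fun T hT => Subtype.ext
    (support_contract hF n T S.1 (Finsupp.mem_support_iff.2 hT)).2.2.1.symm
  q_refl S := ⟨Finset.Subset.refl _, rfl⟩
  q_diag S T h he := (straight_diag hr h he.symm).symm
  eq S T := by
    rw [add_comm]
    refine Eq.trans ?_ ((contract_eq hF hn T S).trans ?_)
    · congr 1 <;> exact finsum_congr fun L => mul_comm _ _
    · refine congrArg₂ _ (ite_eq_ite eq_comm) (ite_eq_ite ?_)
      change _ ↔ defect r T.1 = 0 ∧ S = section_ hF (onFaces hr T)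
      rw [section_eq_iff hr hF]

theorem isAugmented : SubdivisionData.IsAugmented (subdivisionData hr hK' .upper) where
  e_zero S := by
    refine Eq.trans (finsum_congr fun L => ?_) (finsum_incidence (r := r) S)
    change incidence r S.1 L.1 * (if -defect r L.1 = 0 then 1 else 0) = _
    simp only [neg_eq_zero]
  q_unique S τ h0 hτ := straight_unique hr S τ (neg_eq_zero.1 h0) hτ

include hF in
theorem isCoaugmented (hK : LocallyFiniteComplex K) :
    SubdivisionData.IsCoaugmented (subdivisionData hr hK' .lower) where
  e_zero T := by
    refine Eq.trans (finsum_congr fun L => mul_comm _ _) (finsum_incidence (r := r) T)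
  q_unique T σ h0 hσ := straight_unique hr T σ h0 hσ
  fin := fibre_finite hr hK' hF hK

/-- Labels of the subdivision that are compatible with given labels. -/
structure Adapted {L : Type w} [Preorder L] (p : K.faces → L) (p' : K'.faces → L) : Prop where
  mono : Monotone p'
  le : ∀ S, p (onFaces hr S) ≤ p' S
  section_le : ∀ σ, p' (section_ hF σ) ≤ p σ
  near : ∀ S T, F.Near S.1 T.1 → p' T ≤ p' S

variable {L : Type w} [Preorder L] {p q : K.faces → L} {p' q' : K'.faces → L}

theorem adapted_onFaces (hp : Monotone p) : Adapted hr hF p fun S => p (onFaces hr S) where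
  mono := hp.comp (onFaces_mono hr)
  le _ := le_rfl
  section_le σ := by rw [onFaces_section]
  near S T h := by rw [show onFaces hr T = onFaces hr S from Subtype.ext h.2.1]

/-- Carriers serve as labels as well as images do, because the canonical section stays within its
simplex and the contraction never enlarges carriers. -/
theorem adapted_carrier (hp : Monotone p) : Adapted hr hF p fun S => p (carrier hF S) where
  mono := hp.comp (carrier_mono hF)
  le S := hp (onFaces_le_carrier hr hF S)
  section_le σ := hp (carrier_section hF σ)
  near _ _ h := hp (carrier_le_of_near hF h)

variable {A : Type u} [Category.{v} A] [Preadditive A] {s : Variance}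

include hn in
/-- Subdivision does not change the labelled complex, up to chain equivalence, naturally in the
labels. -/
theorem isIso_relabel_subdivide (hK : LocallyFiniteComplex K)
    (C : ChainComplex (Graded A K.faces (some s)) ℤ) (hp : Monotone p) (hq : Monotone q)
    (hp' : Adapted hr hF p p') (hq' : Adapted hr hF q q')
    (h : ∀ σ, Variance.allowed (some s) (p σ) (q σ))
    (h' : ∀ S, Variance.allowed (some s) (p' S) (q' S))
    (hiso : IsIso ((HomotopyCategory.quotient _ _).map (Labelled.relabelMap hp hq h C))) :
    IsIso ((HomotopyCategory.quotient _ _).map (Labelled.relabelMap hp'.mono hq'.mono h'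
      ((subdivisionData hr hK' s).subdivide C))) ∧
    Nonempty ((HomotopyCategory.quotient _ _).obj (Labelled.complex hp'.mono
      ((subdivisionData hr hK' s).subdivide C)) ≅
      (HomotopyCategory.quotient _ _).obj (Labelled.complex hp C)) := by
  cases s with
  | upper =>
    have key : ∀ {p : K.faces → L} {p' : K'.faces → L} (hp : Monotone p)
        (hp' : Adapted hr hF p p'), IsIso ((HomotopyCategory.quotient _ _).map
          (SubdivisionData.augmentation C (isAugmented hr hK') hp'.mono hp hp'.le)) := by
      intro p p' hp hp'
      refine SubdivisionData.isIso_augmentation (g := fun σ => σ.1.card) (N := n + 1) C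
        (isAugmented hr hK') (onFaces_section hr hF)
        (fun σ => neg_eq_zero.2 (canon_defect (Or.inr σ.2)))
        (fun S => neg_nonpos.2 (defect_nonneg S.1)) (contractionUpper hr hK' hF hn)
        ⟨hp'.mono, fun S T hST => hp'.near S T
          (support_contract hF n S T.1 (Finsupp.mem_support_iff.2 hST)).2⟩ hp hp'.le
        hp'.section_le ⟨fun σ => Nat.lt_succ_of_le (hn _ σ.2), fun σ τ hστ hne => ?_⟩
      exact Finset.card_lt_card ((show τ.1 ⊆ σ.1 from hστ).ssubset_of_ne fun he =>
        hne (Subtype.ext he.symm))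
    have i1 := key hp hp'
    have i2 := key hq hq'
    -- The augmentation has the same entries for both labellings. So it intertwines the two changes
    -- of labels, and two out of three applies.
    have sq : Labelled.relabelMap hp'.mono hq'.mono h'
        ((subdivisionData hr hK' .upper).subdivide C) ≫
        SubdivisionData.augmentation C (isAugmented hr hK') hq'.mono hq hq'.le =
        SubdivisionData.augmentation C (isAugmented hr hK') hp'.mono hp hp'.le ≫
          Labelled.relabelMap hp hq h C := by
      refine HomologicalComplex.hom_ext _ _ fun m => Labelled.hom_ext fun (S : K'.faces) (σ : K.faces) => ?_
      have e1 := congrArg (fun f => Labelled.Hom.app f S σ) (Category.id_comp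
        ((SubdivisionData.augmentation C (isAugmented hr hK') hp'.mono hp hp'.le).f m))
      have e2 := congrArg (fun f => Labelled.Hom.app f S σ) (Category.comp_id
        ((SubdivisionData.augmentation C (isAugmented hr hK') hp'.mono hp hp'.le).f m))
      exact e1.trans e2.symm
    refine ⟨?_, ⟨asIso ((HomotopyCategory.quotient _ _).map
      (SubdivisionData.augmentation C (isAugmented hr hK') hp'.mono hp hp'.le))⟩⟩
    have e := congrArg (HomotopyCategory.quotient _ _).map sq
    rw [Functor.map_comp, Functor.map_comp] at e
    exact IsIso.of_isIso_fac_right e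
  | lower =>
    have key : ∀ {p : K.faces → L} {p' : K'.faces → L} (hp : Monotone p)
        (hp' : Adapted hr hF p p'), IsIso ((HomotopyCategory.quotient _ _).map
          (SubdivisionData.coaugmentation C (isCoaugmented hr hK' hF hK) hp'.mono hp hp'.le)) := by
      intro p p' hp hp'
      -- Lower control moves to cofaces, so the rank that strictly decreases is `n` minus the number
      -- of vertices.
      refine SubdivisionData.isIso_coaugmentation (g := fun σ => n - σ.1.card) (N := n + 1) C
        (isCoaugmented hr hK' hF hK) (onFaces_section hr hF)
        (fun σ => canon_defect (Or.inr σ.2))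
        (fun S => defect_nonneg S.1) (contractionLower hr hK' hF hn hK)
        ⟨hp'.mono, fun S T hST => hp'.near T S
          (support_contract hF n T S.1 (Finsupp.mem_support_iff.2 hST)).2⟩ hp hp'.le
        hp'.section_le ⟨fun σ => by omega, fun σ τ hστ hne => ?_⟩
      have := Finset.card_lt_card ((show σ.1 ⊆ τ.1 from hστ).ssubset_of_ne fun he =>
        hne (Subtype.ext he))
      have := hn τ.1 τ.2
      omega
    have i1 := key hp hp'
    have i2 := key hq hq'
    have sq : SubdivisionData.coaugmentation C (isCoaugmented hr hK' hF hK) hp'.mono hp hp'.le ≫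
        Labelled.relabelMap hp'.mono hq'.mono h' ((subdivisionData hr hK' .lower).subdivide C) =
        Labelled.relabelMap hp hq h C ≫
        SubdivisionData.coaugmentation C (isCoaugmented hr hK' hF hK) hq'.mono hq hq'.le := by
      refine HomologicalComplex.hom_ext _ _ fun m => Labelled.hom_ext fun (σ : K.faces) (S : K'.faces) => ?_
      have e1 := congrArg (fun f => Labelled.Hom.app f σ S) (Category.id_comp
        ((SubdivisionData.coaugmentation C (isCoaugmented hr hK' hF hK) hp'.mono hp hp'.le).f m))
      have e2 := congrArg (fun f => Labelled.Hom.app f σ S) (Category.comp_id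
        ((SubdivisionData.coaugmentation C (isCoaugmented hr hK' hF hK) hp'.mono hp hp'.le).f m))
      exact e2.trans e1.symm
    refine ⟨?_, ⟨(asIso ((HomotopyCategory.quotient _ _).map (SubdivisionData.coaugmentation C
      (isCoaugmented hr hK' hF hK) hp'.mono hp hp'.le))).symm⟩⟩
    have e := congrArg (HomotopyCategory.quotient _ _).map sq
    rw [Functor.map_comp, Functor.map_comp] at e
    exact IsIso.of_isIso_fac_left e.symm.symm

end

end FlagData

/-! ### Cutting a controlled equivalence down to a set of labels -/

/-- Three labellings of a part `J` of an index set, and a relation which they control near a set of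
labels. -/
structure ControlledCut (s : Variance) {T J L : Type w} [Preorder T] [Preorder J] [Preorder L]
    (e : J ↪o T) (Z : Set L) (p q : J → L) (near : T → T → Prop) : Prop where
  left : ∀ S K, p S ∈ Z → near (e S) K → ∃ S', K = e S' ∧ Variance.allowed (some s) (p S) (q S')
  right : ∀ K S, q S ∈ Z → near K (e S) → ∃ S', K = e S' ∧ Variance.allowed (some s) (p S') (q S)

namespace ControlledCut

variable {s : Variance} {T J L : Type w} [Preorder T] [Preorder J] [Preorder L]
  {e : J ↪o T} {Z : Set L} {p q t : J → L} {near : T → T → Prop}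

theorem trans (h : ControlledCut s e Z p q near) (h' : ControlledCut s e Z q t near)
    (hpq : ∀ S, Variance.allowed (some s) (p S) (q S))
    (hqt : ∀ S, Variance.allowed (some s) (q S) (t S)) : ControlledCut s e Z p t near where
  left S K hS hK := by
    obtain ⟨S', rfl, ha⟩ := h.left S K hS hK
    exact ⟨S', rfl, Variance.allowed_trans ha (hqt S')⟩
  right K S hS hK := by
    obtain ⟨S', rfl, ha⟩ := h'.right K S hS hK
    exact ⟨S', rfl, Variance.allowed_trans (hpq S') ha⟩

end ControlledCut

theorem finsum_comp_injective {α β M : Type*} [AddCommMonoid M] {g : β → α}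
    (hg : Function.Injective g) {f : α → M} (h : ∀ a, f a ≠ 0 → a ∈ Set.range g) :
    ∑ᶠ b, f (g b) = ∑ᶠ a, f a := by
  rw [← finsum_mem_range hg, finsum_mem_def]
  refine finsum_congr fun a => ?_
  by_cases ha : a ∈ Set.range g
  · rw [Set.indicator_of_mem ha]
  · rw [Set.indicator_of_notMem ha]
    by_contra hne
    exact ha (h a (Ne.symm hne))

/-- Two out of six, in the form needed below. -/
theorem isIso_of_ladder {𝒱 : Type*} [Category 𝒱] {X₀ X₁ X₂ Y₀ Y₁ Y₂ : 𝒱} {f₀ : X₀ ⟶ Y₁}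
    {g₁ : Y₁ ⟶ X₂} {g₀ : Y₀ ⟶ X₁} {f₁ : X₁ ⟶ Y₂} {a : X₀ ⟶ X₂} {b : Y₀ ⟶ Y₂} {x : X₀ ⟶ X₁}
    {y : Y₁ ⟶ Y₂} (ha : f₀ ≫ g₁ = a) (hb : g₀ ≫ f₁ = b) (h : f₀ ≫ y = x ≫ f₁)
    [IsIso a] [IsIso b] [IsIso x] [IsIso y] : IsIso f₀ := by
  have h1 : f₀ ≫ g₁ ≫ inv a = 𝟙 _ := by rw [← Category.assoc, ha, IsIso.hom_inv_id]
  have h2 : (y ≫ inv b ≫ g₀ ≫ inv x) ≫ f₀ = 𝟙 _ := by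
    rw [← cancel_mono y]
    simp only [Category.assoc]
    rw [h, IsIso.inv_hom_id_assoc, hb, IsIso.inv_hom_id, Category.comp_id, Category.id_comp]
  -- A right inverse and a left inverse of `f₀` agree.
  have h3 : y ≫ inv b ≫ g₀ ≫ inv x = g₁ ≫ inv a := by
    rw [← Category.comp_id (y ≫ _), ← h1, ← Category.assoc, h2, Category.id_comp]
  exact ⟨g₁ ≫ inv a, h1, h3 ▸ h2⟩

namespace Cut

variable {s : Variance} {T J L : Type w} [Preorder T] [Preorder J] [Preorder L]
  {e : J ↪o T} {Z : Set L} {p q t : J → L} {near : T → T → Prop}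
  {A : Type u} [Category.{v} A] [Preadditive A]

section Entries

variable (s e) {M N P : Graded A T none}

open Classical in
/-- The entries of a matrix that respect the labels. -/
noncomputable def entry (p q : J → L) (φ : M ⟶ N) (S S' : J) : M.obj (e S) ⟶ N.obj (e S') :=
  if Variance.allowed (some s) (p S) (q S') then φ.app (e S) (e S') else 0

variable {s e}

theorem entry_ne_zero {φ : M ⟶ N} {S S' : J} (h : entry s e p q φ S S' ≠ 0) :
    Variance.allowed (some s) (p S) (q S') ∧ φ.app (e S) (e S') ≠ 0 := by
  unfold entry at h
  split_ifs at h with h1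
  · exact ⟨h1, h⟩
  · exact absurd rfl h

theorem entry_eq {φ : M ⟶ N} {S S' : J}
    (h : φ.app (e S) (e S') ≠ 0 → Variance.allowed (some s) (p S) (q S')) :
    entry s e p q φ S S' = φ.app (e S) (e S') := by
  unfold entry
  split_ifs with h1
  · rfl
  · by_contra hne
    exact h1 (h (Ne.symm hne))

theorem entry_finite (φ : M ⟶ N) (S : J) : {S' | entry s e p q φ S S' ≠ 0}.Finite :=
  ((φ.finite (e S)).preimage e.injective.injOn).subset fun _ h => (entry_ne_zero h).2

/-- If each intermediate simplex that contributes lies in the part and has a label between those of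
the ends, convexity puts this label in `Z`. Then truncating the two factors loses no term of the
product. -/
theorem entry_comp (hZ : Z.OrdConnected) (φ : M ⟶ N) (ψ : N ⟶ P) {S S'' : J} (hS : p S ∈ Z)
    (hS'' : t S'' ∈ Z)
    (h : ∀ K, φ.app (e S) K ≠ 0 → ψ.app K (e S'') ≠ 0 → ∃ S', K = e S' ∧
      Variance.allowed (some s) (p S) (q S') ∧ Variance.allowed (some s) (q S') (t S'')) :
    ∑ᶠ S' : {S' // q S' ∈ Z}, entry s e p q φ S S'.1 ≫ entry s e q t ψ S'.1 S'' =
      entry s e p t (φ ≫ ψ) S S'' := by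
  rw [entry_eq (φ := φ ≫ ψ)]
  · rw [Graded.comp_app, ← finsum_comp_injective
      (g := fun S' : {S' // q S' ∈ Z} => e S'.1) (fun a b hab => Subtype.ext (e.injective hab))]
    · refine finsum_congr fun S' => ?_
      by_cases h1 : φ.app (e S) (e S'.1) = 0
      · rw [h1, Limits.zero_comp, entry_eq (φ := φ) (fun h => absurd h1 h), h1, Limits.zero_comp]
      by_cases h2 : ψ.app (e S'.1) (e S'') = 0
      · rw [h2, Limits.comp_zero, entry_eq (φ := ψ) (fun h => absurd h2 h), h2, Limits.comp_zero]
      obtain ⟨S₁, h3, h4, h5⟩ := h _ h1 h2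
      obtain rfl := e.injective h3
      rw [entry_eq fun _ => h4, entry_eq fun _ => h5]
    · intro K hK
      obtain ⟨S', rfl, h1, h2⟩ := h K (fun h => hK (by rw [h, Limits.zero_comp]))
        (fun h => hK (by rw [h, Limits.comp_zero]))
      refine ⟨⟨S', ?_⟩, rfl⟩
      cases s
      · exact hZ.out hS'' hS ⟨h2, h1⟩
      · exact hZ.out hS hS'' ⟨h1, h2⟩
  · intro hne
    obtain ⟨K, hK⟩ := exists_ne_zero_of_finsum hne
    obtain ⟨S', -, h1, h2⟩ := h K (fun h => hK (by rw [h, Limits.zero_comp]))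
      (fun h => hK (by rw [h, Limits.comp_zero]))
    exact Variance.allowed_trans h1 h2

end Entries

section Complexes

variable (e) (he : (Set.range e).OrdConnected) (hZ : Z.OrdConnected)

/-- The part of a controlled complex with labels in `Z`. -/
noncomputable abbrev part {p : J → L} (hp : Monotone p)
    (C : ChainComplex (Graded A T (some s)) ℤ) : ChainComplex (Labelled A L s) ℤ :=
  ((Labelled.restrict s Z hZ).mapHomologicalComplex _).obj
    (Labelled.complex hp (((Graded.restrict e he s).mapHomologicalComplex _).obj C))

variable {e he hZ} {C D E : ChainComplex (Graded A T (some s)) ℤ}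

/-- All entries relate near simplices. -/
def IsNear {M N : Graded A T none} (near : T → T → Prop) (φ : M ⟶ N) : Prop :=
  ∀ σ τ, φ.app σ τ ≠ 0 → near σ τ

theorem d_allowed (hp : Monotone p) {i j : ℤ} {S S' : J}
    (h : ((forgetComplex C).d i j).app (e S) (e S') ≠ 0) :
    Variance.allowed (some s) (p S) (p S') := by
  have h1 : Variance.allowed (some s) (e S) (e S') := (C.d i j).support _ _ h
  have h2 : Variance.allowed (some s) S S' := by
    cases s
    · exact e.le_iff_le.1 h1
    · exact e.le_iff_le.1 h1
  exact Variance.allowed_map hp h2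

theorem part_d (hp : Monotone p) (i j : ℤ) (S S' : {S // p S ∈ Z}) :
    ((part e he hZ hp C).d i j).app S S' =
      entry s e p p ((forgetComplex C).d i j) S.1 S'.1 :=
  (entry_eq (φ := (forgetComplex C).d i j) (d_allowed hp)).symm

/-- Part of a matrix, as a morphism between parts of controlled complexes. -/
noncomputable def hom (hp : Monotone p) (hq : Monotone q) {i j : ℤ}
    (φ : (forgetComplex C).X i ⟶ (forgetComplex D).X j) :
    (part e he hZ hp C).X i ⟶ (part e he hZ hq D).X j where
  app := fun (S : {S : J // p S ∈ Z}) (S' : {S : J // q S ∈ Z}) => entry s e p q φ S.1 S'.1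
  finite := fun (S : {S : J // p S ∈ Z}) =>
    (entry_finite (e := e) (p := p) (q := q) φ S.1).preimage (f := Subtype.val) Subtype.val_injective.injOn
  support := fun (S : {S : J // p S ∈ Z}) (S' : {S : J // q S ∈ Z}) h =>
    (entry_ne_zero (e := e) (p := p) (q := q) (φ := φ) (S := S.1) (S' := S'.1) h).1

theorem comp_hom (hp : Monotone p) (hq : Monotone q) (ht : Monotone t) {i j k : ℤ}
    (φ : (forgetComplex C).X i ⟶ (forgetComplex D).X j)
    (ψ : (forgetComplex D).X j ⟶ (forgetComplex E).X k)
    (h : ∀ S S'' K, p S ∈ Z → t S'' ∈ Z → φ.app (e S) K ≠ 0 → ψ.app K (e S'') ≠ 0 →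
      ∃ S', K = e S' ∧ Variance.allowed (some s) (p S) (q S') ∧
        Variance.allowed (some s) (q S') (t S'')) :
    (hom hp hq φ : (part e he hZ hp C).X i ⟶ (part e he hZ hq D).X j) ≫ hom hq ht ψ =
      hom hp ht (φ ≫ ψ) :=
  Labelled.hom_ext fun (S : {S // p S ∈ Z}) (S'' : {S // t S ∈ Z}) =>
    entry_comp (e := e) (p := p) (q := q) (t := t) hZ φ ψ S.2 S''.2
      fun K => h S.1 S''.1 K S.2 S''.2

theorem part_d_eq (hp : Monotone p) (i j : ℤ) :
    (part e he hZ hp C).d i j = hom hp hp ((forgetComplex C).d i j) :=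
  Labelled.hom_ext fun (S S' : {S : J // p S ∈ Z}) =>
    part_d (e := e) (he := he) (hZ := hZ) hp i j S S'

/-- The differential respects any monotone labels by itself, so only the control at the source of
`φ` matters; `d_comp_hom` uses the control at its target. -/
theorem hom_comp_d (hp : Monotone p) (hq : Monotone q) {i j k : ℤ}
    (φ : (forgetComplex C).X i ⟶ (forgetComplex D).X j) (hφ : IsNear near φ)
    (h : ControlledCut s e Z p q near) :
    (hom hp hq φ : (part e he hZ hp C).X i ⟶ (part e he hZ hq D).X j) ≫
      (part e he hZ hq D).d j k = hom hp hq (φ ≫ (forgetComplex D).d j k) := by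
  rw [part_d_eq]
  refine comp_hom _ _ _ _ _ fun S S'' K hS _ h1 h2 => ?_
  obtain ⟨S', rfl, ha⟩ := h.left S K hS (hφ _ _ h1)
  exact ⟨S', rfl, ha, d_allowed hq h2⟩

theorem d_comp_hom (hp : Monotone p) (hq : Monotone q) {i j k : ℤ}
    (φ : (forgetComplex C).X j ⟶ (forgetComplex D).X k) (hφ : IsNear near φ)
    (h : ControlledCut s e Z p q near) :
    (part e he hZ hp C).d i j ≫
      (hom hp hq φ : (part e he hZ hp C).X j ⟶ (part e he hZ hq D).X k) =
      hom hp hq ((forgetComplex C).d i j ≫ φ) := by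
  rw [part_d_eq]
  refine comp_hom _ _ _ _ _ fun S S'' K _ hS'' h1 h2 => ?_
  obtain ⟨S', rfl, ha⟩ := h.right K S'' hS'' (hφ _ _ h2)
  exact ⟨S', rfl, d_allowed hp h1, ha⟩

theorem hom_add (hp : Monotone p) (hq : Monotone q) {i j : ℤ}
    (φ ψ : (forgetComplex C).X i ⟶ (forgetComplex D).X j) :
    (hom hp hq (φ + ψ) : (part e he hZ hp C).X i ⟶ (part e he hZ hq D).X j) =
      hom hp hq φ + hom hp hq ψ := by
  refine Labelled.hom_ext fun (S : {S // p S ∈ Z}) (S' : {S // q S ∈ Z}) => ?_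
  change entry s e p q (φ + ψ) S.1 S'.1 = entry s e p q φ S.1 S'.1 + entry s e p q ψ S.1 S'.1
  unfold entry
  split_ifs
  · rfl
  · rw [add_zero]

/-- Part of a chain map with controlled entries. -/
noncomputable def map (hp : Monotone p) (hq : Monotone q)
    (f : forgetComplex C ⟶ forgetComplex D) (hf : ∀ n, IsNear near (f.f n))
    (h : ControlledCut s e Z p q near) : part e he hZ hp C ⟶ part e he hZ hq D where
  f n := hom hp hq (f.f n)
  comm' i j _ := by
    rw [hom_comp_d hp hq _ (hf i) h, d_comp_hom hp hq _ (hf j) h, f.comm]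

variable (e he hZ C) in
/-- The identity, as a map between the parts for different labels. -/
noncomputable def change (hp : Monotone p) (hq : Monotone q)
    (hpq : ∀ S, Variance.allowed (some s) (p S) (q S)) :
    part e he hZ hp C ⟶ part e he hZ hq C where
  f n := hom hp hq (𝟙 _)
  comm' i j _ := by
    rw [part_d_eq, part_d_eq, comp_hom, comp_hom, Category.id_comp, Category.comp_id]
    · intro S S'' K _ _ h1 h2
      have : K = e S'' := by
        by_contra hn
        exact h2 (dif_neg hn)
      exact ⟨S'', this, d_allowed hp (this ▸ h1), hpq S''⟩
    · intro S S'' K _ _ h1 h2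
      have : e S = K := by
        by_contra hn
        exact h1 (dif_neg hn)
      exact ⟨S, this.symm, hpq S, d_allowed hq (this.symm ▸ h2)⟩

/-- An intermediate simplex is near both ends. The control of the first map at its source and of the
second at its target places its `q`-label between the outer labels. -/
theorem map_comp_map (hp : Monotone p) (hq : Monotone q) (ht : Monotone t)
    (f : forgetComplex C ⟶ forgetComplex D) (hf : ∀ n, IsNear near (f.f n))
    (g : forgetComplex D ⟶ forgetComplex E) (hg : ∀ n, IsNear near (g.f n))
    (h : ControlledCut s e Z p q near) (h' : ControlledCut s e Z q t near) (n : ℤ) :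
    (map hp hq f hf h ≫ map hq ht g hg h' :
      part e he hZ hp C ⟶ part e he hZ ht E).f n = hom hp ht ((f ≫ g).f n) := by
  rw [HomologicalComplex.comp_f, HomologicalComplex.comp_f]
  refine comp_hom _ _ _ _ _ fun S S'' K hS hS'' h1 h2 => ?_
  obtain ⟨S', rfl, ha⟩ := h.left S K hS (hf n _ _ h1)
  obtain ⟨S₁, h3, ha'⟩ := h'.right _ S'' hS'' (hg n _ _ h2)
  obtain rfl := e.injective h3
  exact ⟨S', rfl, ha, ha'⟩

/-- Both composites are the truncation of `f` from the labels `p` to the labels `t`. -/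
theorem map_comp_change (hp : Monotone p) (hq : Monotone q) (ht : Monotone t)
    (f : forgetComplex C ⟶ forgetComplex D) (hf : ∀ n, IsNear near (f.f n))
    (h : ControlledCut s e Z p q near) (h' : ControlledCut s e Z q t near)
    (hpq : ∀ S, Variance.allowed (some s) (p S) (q S))
    (hqt : ∀ S, Variance.allowed (some s) (q S) (t S)) :
    map hp hq f hf h ≫ change e he hZ D hq ht hqt =
      change e he hZ C hp hq hpq ≫ map hq ht f hf h' := by
  refine HomologicalComplex.hom_ext _ _ fun n => ?_
  refine (comp_hom (E := D) hp hq ht (f.f n) (𝟙 _) ?_).trans (Eq.trans ?_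
    (comp_hom (C := C) (D := C) hp hq ht (𝟙 _) (f.f n) ?_).symm)
  · intro S S'' K hS hS'' h1 h2
    have : K = e S'' := by
      by_contra hn
      exact h2 (dif_neg hn)
    subst this
    obtain ⟨S', h3, ha⟩ := h.left S _ hS (hf n _ _ h1)
    obtain rfl := e.injective h3
    exact ⟨S'', rfl, ha, hqt S''⟩
  · rw [Category.comp_id, Category.id_comp]
  · intro S S'' K hS hS'' h1 h2
    have : e S = K := by
      by_contra hn
      exact h1 (dif_neg hn)
    subst this
    obtain ⟨S', h3, ha⟩ := h'.right _ S'' hS'' (hf n _ _ h2)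
    obtain rfl := e.injective h3
    exact ⟨S, rfl, hpq S, ha⟩

/-- A controlled homotopy to the identity restricts to the parts. -/
noncomputable def homotopy (hp : Monotone p) (hq : Monotone q) (ht : Monotone t)
    (f : forgetComplex C ⟶ forgetComplex D) (hf : ∀ n, IsNear near (f.f n))
    (g : forgetComplex D ⟶ forgetComplex C) (hg : ∀ n, IsNear near (g.f n))
    (η : Homotopy (f ≫ g) (𝟙 _)) (hη : ∀ i j, IsNear near (η.hom i j))
    (h : ControlledCut s e Z p q near) (h' : ControlledCut s e Z q t near)
    (hpq : ∀ S, Variance.allowed (some s) (p S) (q S))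
    (hqt : ∀ S, Variance.allowed (some s) (q S) (t S)) :
    Homotopy (map hp hq f hf h ≫ map hq ht g hg h')
      (change e he hZ C hp ht fun S => Variance.allowed_trans (hpq S) (hqt S)) where
  hom i j := hom hp ht (η.hom i j)
  zero i j hij := by
    rw [η.zero i j hij]
    refine Labelled.hom_ext fun (S : {S // p S ∈ Z}) (S' : {S // t S ∈ Z}) => ?_
    change entry s e p t 0 S.1 S'.1 = 0
    exact ite_self _
  comm n := by
    -- The homotopy passes directly from the first labels to the last, and is controlled because one
    -- of the two comparisons can be followed by a mere change of labels.
    have h2 := h.trans h' hpq hqt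
    have r1 : (ComplexShape.down ℤ).Rel n (n - 1) := by simp
    have r2 : (ComplexShape.down ℤ).Rel (n + 1) n := by simp
    have hc := η.comm n
    rw [dNext_eq _ r1, prevD_eq _ r2] at hc
    rw [map_comp_map, dNext_eq _ r1, prevD_eq _ r2, d_comp_hom hp ht _ (hη _ _) h2,
      hom_comp_d hp ht _ (hη _ _) h2, hc, hom_add, hom_add]
    rfl

/-- The part of a controlled chain equivalence is a chain equivalence, if changing the labels
is. -/
theorem isIso_map (hp : Monotone p) (hq : Monotone q) (ht : Monotone t)
    (f : HomotopyEquiv (forgetComplex C) (forgetComplex D))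
    (hf : ∀ n, IsNear near (f.hom.f n)) (hg : ∀ n, IsNear near (f.inv.f n))
    (h1 : ∀ i j, IsNear near (f.homotopyHomInvId.hom i j))
    (h2 : ∀ i j, IsNear near (f.homotopyInvHomId.hom i j))
    (h : ControlledCut s e Z p q near) (h' : ControlledCut s e Z q t near)
    (hpq : ∀ S, Variance.allowed (some s) (p S) (q S))
    (hqt : ∀ S, Variance.allowed (some s) (q S) (t S))
    (i1 : IsIso ((HomotopyCategory.quotient _ _).map (change e he hZ C hp hq hpq)))
    (i2 : IsIso ((HomotopyCategory.quotient _ _).map (change e he hZ C hp ht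
      fun S => Variance.allowed_trans (hpq S) (hqt S))))
    (i3 : IsIso ((HomotopyCategory.quotient _ _).map (change e he hZ D hp ht
      fun S => Variance.allowed_trans (hpq S) (hqt S))))
    (i4 : IsIso ((HomotopyCategory.quotient _ _).map (change e he hZ D hq ht hqt))) :
    IsIso ((HomotopyCategory.quotient _ _).map
      (map (he := he) (hZ := hZ) hp hq f.hom hf h)) := by
  -- The four maps of the ladder are `f` and its inverse, each cut once from `p` to `q` and once
  -- from `q` to `t`. Their composites are changes of labels up to homotopy.
  have e1 := HomotopyCategory.eq_of_homotopy _ _ (homotopy (he := he) (hZ := hZ) hp hq ht f.hom hf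
    f.inv hg f.homotopyHomInvId h1 h h' hpq hqt)
  have e2 := HomotopyCategory.eq_of_homotopy _ _ (homotopy (he := he) (hZ := hZ) hp hq ht f.inv hg
    f.hom hf f.homotopyInvHomId h2 h h' hpq hqt)
  have e3 := congrArg (HomotopyCategory.quotient _ _).map (map_comp_change (he := he) (hZ := hZ)
    hp hq ht f.hom hf h h' hpq hqt)
  rw [Functor.map_comp] at e1 e2
  rw [Functor.map_comp, Functor.map_comp] at e3
  exact isIso_of_ladder e1 e2 e3

end Complexes

end Cut

/-! ### Transfer of equivalences along functors -/

namespace HomotopyCategory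

variable {𝒱 𝒲 : Type*} [Category 𝒱] [Category 𝒲] [Preadditive 𝒱] [Preadditive 𝒲]
  {C D : ChainComplex 𝒱 ℤ}

theorem isIso_map_functor (F : 𝒱 ⥤ 𝒲) [F.Additive] {f : C ⟶ D}
    (h : IsIso ((quotient _ _).map f)) :
    IsIso ((quotient _ _).map ((F.mapHomologicalComplex _).map f)) := by
  have : IsIso ((F.mapHomotopyCategory (ComplexShape.down ℤ)).map ((quotient _ _).map f)) :=
    inferInstance
  exact this

/-- The image of an isomorphism in the homotopy category. -/
noncomputable def mapIsoFunctor (F : 𝒱 ⥤ 𝒲) [F.Additive]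
    (f : (quotient 𝒱 (ComplexShape.down ℤ)).obj C ≅ (quotient _ _).obj D) :
    (quotient _ (ComplexShape.down ℤ)).obj ((F.mapHomologicalComplex _).obj C) ≅
      (quotient _ _).obj ((F.mapHomologicalComplex _).obj D) :=
  (F.mapHomotopyCategory (ComplexShape.down ℤ)).mapIso f

theorem nonempty_homotopyEquiv_of_fullyFaithful (F : 𝒱 ⥤ 𝒲) [F.Additive] [F.Full] [F.Faithful]
    (h : Nonempty ((quotient _ _).obj ((F.mapHomologicalComplex (ComplexShape.down ℤ)).obj C) ≅
      (quotient _ _).obj ((F.mapHomologicalComplex _).obj D))) :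
    Nonempty (HomotopyEquiv C D) :=
  h.map fun f => homotopyEquivOfIso ((F.mapHomotopyCategory (ComplexShape.down ℤ)).preimageIso f)

/-- Naturality at the equivalence `e`. This carries statements about changes of labels from the
subdivided complex to the translated one. -/
theorem isIso_app_of_homotopyEquiv {F G : 𝒱 ⥤ 𝒲} [F.Additive] [G.Additive] (α : F ⟶ G)
    (e : HomotopyEquiv C D)
    (h : IsIso ((quotient _ _).map ((NatTrans.mapHomologicalComplex α _).app C))) :
    IsIso ((quotient _ _).map ((NatTrans.mapHomologicalComplex α _).app D)) := by
  have e1 := (NatTrans.mapHomologicalComplex α (ComplexShape.down ℤ)).naturality e.hom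
  have e2 := congrArg (quotient _ _).map e1
  rw [Functor.map_comp, Functor.map_comp] at e2
  have i0 : IsIso ((quotient _ _).map e.hom) := (isoOfHomotopyEquiv e).isIso_hom
  have i1 := isIso_map_functor F i0
  have i2 := isIso_map_functor G i0
  have i3 : IsIso ((quotient _ _).map ((F.mapHomologicalComplex _).map e.hom) ≫
      (quotient _ _).map ((NatTrans.mapHomologicalComplex α (ComplexShape.down ℤ)).app D)) := by
    rw [e2]; infer_instance
  exact IsIso.of_isIso_comp_left ((quotient _ _).map ((F.mapHomologicalComplex _).map e.hom)) _

end HomotopyCategory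

namespace Cut

variable {s : Variance} {T J L S : Type w} [Preorder T] [Preorder J] [Preorder L] [Preorder S]
  {A : Type u} [Category.{v} A] [Preadditive A]

/-- Labels given by an order embedding record the order of the indices exactly, so no control is
lost and equivalences of labelled complexes come from controlled ones. -/
theorem ofGraded_full (e : J ↪o L) :
    (Labelled.ofGraded (A := A) s e e.monotone).Full where
  map_surjective {M N} f := ⟨⟨f.app, f.finite, fun S T h => by
    have := f.support S T h
    cases s
    · exact e.le_iff_le.1 this
    · exact e.le_iff_le.1 this⟩, rfl⟩

theorem ofGraded_faithful (p : J → L) (hp : Monotone p) :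
    (Labelled.ofGraded (A := A) s p hp).Faithful where
  map_injective h := Graded.hom_ext fun S T =>
    congrArg (fun f => Labelled.Hom.app f S T) h

theorem restrict_congr {e e' : J ↪o T} (h : ∀ S, e S = e' S) (he : (Set.range e).OrdConnected)
    (he' : (Set.range e').OrdConnected) (C : ChainComplex (Graded A T (some s)) ℤ) :
    ((Graded.restrict e he s).mapHomologicalComplex (ComplexShape.down ℤ)).obj C =
      ((Graded.restrict e' he' s).mapHomologicalComplex _).obj C := by
  obtain rfl : e = e' := by ext S; exact h S
  rfl

theorem ordConnected_range_val {Z : Set L} (hZ : Z.OrdConnected) :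
    (Set.range (OrderEmbedding.subtype (· ∈ Z))).OrdConnected := by
  have : Set.range (OrderEmbedding.subtype (· ∈ Z)) = Z := Subtype.range_val
  rwa [this]

/-- An equivalence between parts of complexes with labels gives an equivalence between
restrictions. -/
theorem nonempty_homotopyEquiv_restrict {e : L ↪o T} {he : (Set.range e).OrdConnected}
    {Z : Set L} {hZ : Z.OrdConnected} {e' : S ↪o T} {he' : (Set.range e').OrdConnected}
    (g : S ≃o Z) (hg : ∀ σ, e (g σ) = e' σ) {C D : ChainComplex (Graded A T (some s)) ℤ}
    (h : Nonempty ((HomotopyCategory.quotient _ _).obj (part e he hZ monotone_id C) ≅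
      (HomotopyCategory.quotient _ _).obj (part e he hZ monotone_id D))) :
    Nonempty (HomotopyEquiv
      (((Graded.restrict e' he' s).mapHomologicalComplex (ComplexShape.down ℤ)).obj C)
      (((Graded.restrict e' he' s).mapHomologicalComplex _).obj D)) := by
  let ι : Z ↪o L := OrderEmbedding.subtype (· ∈ Z)
  have hι : (Set.range ι).OrdConnected := ordConnected_range_val hZ
  let Φ := fun C : ChainComplex (Graded A T (some s)) ℤ =>
    ((Graded.restrict ι hι s).mapHomologicalComplex (ComplexShape.down ℤ)).obj
      (((Graded.restrict e he s).mapHomologicalComplex _).obj C)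
  have full := ofGraded_full (A := A) (s := s) ι
  have faithful := ofGraded_faithful (A := A) (s := s) ι ι.monotone
  obtain ⟨k⟩ : Nonempty (HomotopyEquiv (Φ C) (Φ D)) :=
    HomotopyCategory.nonempty_homotopyEquiv_of_fullyFaithful
      (Labelled.ofGraded (A := A) s ι ι.monotone) h
  have hr : (Set.range (g : S ↪o Z)).OrdConnected := by
    have : Set.range (g : S ↪o Z) = Set.univ := g.surjective.range_eq
    rw [this]
    exact Set.ordConnected_univ
  have hf : ∀ σ, ((g : S ↪o Z).trans (ι.trans e)) σ = e' σ := hg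
  have hr' : (Set.range ((g : S ↪o Z).trans (ι.trans e))).OrdConnected := by
    have : Set.range ((g : S ↪o Z).trans (ι.trans e)) = Set.range e' :=
      congrArg Set.range (funext hf)
    rwa [this]
  rw [← restrict_congr hf hr' he' C, ← restrict_congr hf hr' he' D]
  exact ⟨(Graded.restrict (g : S ↪o Z) hr s).mapHomotopyEquiv k⟩

/-- On a part, the change of labels is the image of the global one under restriction to labels in
`Z`, and additive functors preserve homotopy equivalences. -/
theorem isIso_change {e : J ↪o T} {he : (Set.range e).OrdConnected} {Z : Set L}
    {hZ : Z.OrdConnected} {p q : J → L} (hp : Monotone p) (hq : Monotone q)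
    (hpq : ∀ S, Variance.allowed (some s) (p S) (q S)) {C : ChainComplex (Graded A T (some s)) ℤ}
    (h : IsIso ((HomotopyCategory.quotient _ _).map (Labelled.relabelMap hp hq hpq
      (((Graded.restrict e he s).mapHomologicalComplex _).obj C)))) :
    IsIso ((HomotopyCategory.quotient _ _).map (change e he hZ C hp hq hpq)) := by
  have h1 := HomotopyCategory.isIso_map_functor (Labelled.restrict s Z hZ) h
  have h2 : change e he hZ C hp hq hpq = ((Labelled.restrict s Z hZ).mapHomologicalComplex _).map
      (Labelled.relabelMap hp hq hpq (((Graded.restrict e he s).mapHomologicalComplex _).obj C)) := by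
    refine HomologicalComplex.hom_ext _ _ fun n => ?_
    refine Labelled.hom_ext fun (S : {S : J // p S ∈ Z}) (S' : {S : J // q S ∈ Z}) => ?_
    have e1 : entry s e p q (𝟙 ((forgetComplex C).X n)) S.1 S'.1 =
        Graded.Hom.app (𝟙 ((forgetComplex C).X n)) (e S.1) (e S'.1) := by
      refine entry_eq fun hne => ?_
      have : e S.1 = e S'.1 := by
        by_contra hn
        exact hne (dif_neg hn)
      rw [← e.injective this]
      exact hpq _
    refine e1.trans (Eq.trans (b := Graded.Hom.app (𝟙 ((((Graded.restrict e he s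
      ).mapHomologicalComplex (ComplexShape.down ℤ)).obj C).X n)) S.1 S'.1) ?_ rfl)
    rw [Graded.id_app, Graded.id_app]
    by_cases hS : S.1 = S'.1
    · have h3 : e S.1 = e S'.1 := congrArg e hS
      rw [dif_pos h3, dif_pos hS]
      rfl
    · have h3 : e S.1 ≠ e S'.1 := fun h => hS (e.injective h)
      rw [dif_neg h3, dif_neg hS]
      rfl
  rw [h2]
  exact h1

end Cut

/-! ### Labels on iterated subdivisions -/

namespace Cone

section Tower

variable {V : Type w} [LinearOrder V] {X : PreAbstractSimplicialComplex V} {d : ℕ}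
  {r : ℕ → Pt V → Pt V}

/-- The description of every level as a subdivision of the previous one. -/
structure Tower (X : PreAbstractSimplicialComplex V) (d : ℕ) (r : ℕ → Pt V → Pt V) where
  flag : ∀ k, FlagData (level X d k) (r k)
  describes : ∀ k, (flag k).Describes (level X d (k + 1))
  bound : ℕ
  card_le : ∀ k, ∀ σ ∈ (level X d k).faces, σ.card ≤ bound

variable (hX : LocallyFiniteComplex X) (hr : IsSqueezing X d r) (t : Tower X d r)

/-- A map from the simplices of a level to those of the previous one: the carrier, or the image
under the simplicial approximation. -/
noncomputable def descend (b : Bool) (k : ℕ) (S : (level X d (k + 1)).faces) :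
    (level X d k).faces :=
  if b then FlagData.carrier (t.describes k) S else VertexMap.onFaces (hr.simplicial k) S

/-- Labels of the simplices of a level by simplices of the lowest level. -/
noncomputable def label (b : ℕ → Bool) : ∀ k, (level X d k).faces → (level X d 0).faces
  | 0 => id
  | k + 1 => fun S => label b k (descend hr t (b k) k S)

theorem descend_mono (b : Bool) (k : ℕ) : Monotone (descend hr t b k) := by
  cases b
  · exact FlagData.onFaces_mono (hr.simplicial k)
  · exact FlagData.carrier_mono (t.describes k)

theorem label_mono (b : ℕ → Bool) (k : ℕ) : Monotone (label hr t b k) := by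
  induction k with
  | zero => exact monotone_id
  | succ k ih => exact ih.comp (descend_mono hr t (b k) k)

theorem descend_le {b b' : Bool} (h : b ≤ b') (k : ℕ) (S : (level X d (k + 1)).faces) :
    descend hr t b k S ≤ descend hr t b' k S := by
  cases b <;> cases b'
  · exact le_rfl
  · exact FlagData.onFaces_le_carrier (hr.simplicial k) (t.describes k) S
  · exact absurd h (by decide)
  · exact le_rfl

/-- The image of a simplex under the approximation is a face of its carrier, so every additional use
of carriers enlarges the label. -/
theorem label_le {b b' : ℕ → Bool} (h : ∀ j, b j ≤ b' j) (k : ℕ) (S : (level X d k).faces) :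
    label hr t b k S ≤ label hr t b' k S := by
  induction k with
  | zero => exact le_rfl
  | succ k ih =>
    exact (label_mono hr t b k (descend_le hr t (h k) k S)).trans (ih _)

/-- The condition on words under which the change of labels is allowed. -/
def WordsAllowed (s : Variance) (b b' : ℕ → Bool) : Prop :=
  ∀ j, Variance.allowed (some s) (b j) (b' j)

variable {s : Variance}

theorem label_allowed {b b' : ℕ → Bool} (h : WordsAllowed s b b') (k : ℕ)
    (S : (level X d k).faces) :
    Variance.allowed (some s) (label hr t b k S) (label hr t b' k S) := by
  cases s
  · exact label_le hr t h k S
  · exact label_le hr t h k S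

variable {A : Type u} [Category.{v} A] [Preadditive A]

theorem adapted_descend (b : Bool) (k : ℕ) {L : Type w} [Preorder L]
    {p : (level X d k).faces → L} (hp : Monotone p) :
    FlagData.Adapted (hr.simplicial k) (t.describes k) p fun S => p (descend hr t b k S) := by
  cases b
  · exact FlagData.adapted_onFaces _ _ hp
  · exact FlagData.adapted_carrier _ _ hp

/-- Induction over the subdivision steps. Both statements are carried along together, because the
comparison of labels after a step rests on the comparison before it. -/
theorem subdivided_labels (C : ChainComplex (Graded A (triangulation X d).faces (some s)) ℤ)
    {b b' : ℕ → Bool} (h : WordsAllowed s b b') (k : ℕ) :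
    IsIso ((HomotopyCategory.quotient _ _).map (Labelled.relabelMap (label_mono hr t b k)
      (label_mono hr t b' k) (label_allowed hr t h k) (subdivided hX hr C k))) ∧
    Nonempty ((HomotopyCategory.quotient _ _).obj
      (Labelled.complex (label_mono hr t b k) (subdivided hX hr C k)) ≅
      (HomotopyCategory.quotient _ _).obj (Labelled.complex monotone_id (translated C 0))) := by
  induction k with
  | zero =>
    refine ⟨?_, ⟨Iso.refl _⟩⟩
    have : Labelled.relabelMap (label_mono hr t b 0)
      (label_mono hr t b' 0) (label_allowed hr t h 0) (subdivided hX hr C 0) = 𝟙 _ := rfl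
    rw [this]
    exact (CategoryTheory.Functor.map_id (HomotopyCategory.quotient _ _)
      (Labelled.complex (label_mono hr t b 0) (subdivided hX hr C 0))).symm ▸
      (inferInstance : IsIso (𝟙 _))
  | succ k ih =>
    obtain ⟨i1, ⟨i2⟩⟩ := ih
    obtain ⟨j1, ⟨j2⟩⟩ := FlagData.isIso_relabel_subdivide (hr.simplicial k)
      (locallyFinite_level hX d (k + 1)) (t.describes k) (t.card_le k)
      (locallyFinite_level hX d k) (subdivided hX hr C k) (label_mono hr t b k)
      (label_mono hr t b' k) (adapted_descend hr t (b k) k (label_mono hr t b k))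
      (adapted_descend hr t (b' k) k (label_mono hr t b' k)) (label_allowed hr t h k)
      (label_allowed hr t h (k + 1)) i1
    exact ⟨j1, ⟨j2 ≪≫ i2⟩⟩

/-- Exponential translation equivalence enters here: changes of labels are natural, hence
insensitive to replacing the subdivision by the equivalent translate. -/
theorem translated_labels (C : ChainComplex (Graded A (triangulation X d).faces (some s)) ℤ)
    (hC : ExpTranslationEquivalent hX hr C) {b b' : ℕ → Bool} (h : WordsAllowed s b b') (k : ℕ) :
    IsIso ((HomotopyCategory.quotient _ _).map (Labelled.relabelMap (label_mono hr t b k)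
      (label_mono hr t b' k) (label_allowed hr t h k) (translated C k))) ∧
    Nonempty ((HomotopyCategory.quotient _ _).obj
      (Labelled.complex (label_mono hr t b k) (translated C k)) ≅
      (HomotopyCategory.quotient _ _).obj (Labelled.complex monotone_id (translated C 0))) := by
  obtain ⟨i1, ⟨i2⟩⟩ := subdivided_labels hX hr t C h k
  obtain ⟨e⟩ := hC k
  refine ⟨HomotopyCategory.isIso_app_of_homotopyEquiv _ e i1, ⟨?_ ≪≫ i2⟩⟩
  exact (HomotopyCategory.mapIsoFunctor _ (HomotopyCategory.isoOfHomotopyEquiv e)).symm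

theorem wordsAllowed_refl (b : ℕ → Bool) : WordsAllowed s b b := fun _ =>
  Variance.allowed_refl _ _

/-- A controlled chain equivalence restricts to a part that is controlled by labels. -/
theorem nonempty_homotopyEquiv_slice {i : ℕ} {Z : Set (level X d 0).faces}
    (hZ : Z.OrdConnected) (g : (SdX X i).faces ≃o Z)
    (hg : ∀ σ, levelEmbedding X d 0 (g σ) = sliceEmbedding X d i σ)
    {C D : ChainComplex (Graded A (triangulation X d).faces (some s)) ℤ}
    (hC : ExpTranslationEquivalent hX hr C) (hD : ExpTranslationEquivalent hX hr D)
    (f : HomotopyEquiv (forgetComplex C) (forgetComplex D))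
    {near : (triangulation X d).faces → (triangulation X d).faces → Prop}
    (hf : ∀ n, Cut.IsNear near (f.hom.f n)) (hf' : ∀ n, Cut.IsNear near (f.inv.f n))
    (h1 : ∀ i j, Cut.IsNear near (f.homotopyHomInvId.hom i j))
    (h2 : ∀ i j, Cut.IsNear near (f.homotopyInvHomId.hom i j))
    {k : ℕ} {b₀ b₁ b₂ : ℕ → Bool} (h01 : WordsAllowed s b₀ b₁) (h12 : WordsAllowed s b₁ b₂)
    (c01 : ControlledCut s (levelEmbedding X d k) Z (label hr t b₀ k) (label hr t b₁ k) near)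
    (c12 : ControlledCut s (levelEmbedding X d k) Z (label hr t b₁ k) (label hr t b₂ k) near) :
    Nonempty (HomotopyEquiv (slice C i) (slice D i)) := by
  apply Cut.nonempty_homotopyEquiv_restrict (hZ := hZ) (he := levelEmbedding_convex X d 0) g hg
  have ch : ∀ {C : ChainComplex (Graded A (triangulation X d).faces (some s)) ℤ}
      (_ : ExpTranslationEquivalent hX hr C) {b b' : ℕ → Bool} (h : WordsAllowed s b b'),
      IsIso ((HomotopyCategory.quotient _ _).map (Cut.change (levelEmbedding X d k)
        (levelEmbedding_convex X d k) hZ C (label_mono hr t b k)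
        (label_mono hr t b' k) (label_allowed hr t h k))) := fun {C} hC {b b'} h =>
    Cut.isIso_change _ _ _ (translated_labels hX hr t C hC h k).1
  have h02 : WordsAllowed s b₀ b₂ := fun j => Variance.allowed_trans (h01 j) (h12 j)
  -- The cut of `f` goes from the labels by `b₀` to those by `b₁`; the third word is used only for
  -- the inverse of `f` and the homotopies.
  have key := Cut.isIso_map (he := levelEmbedding_convex X d k) (hZ := hZ)
    (label_mono hr t b₀ k) (label_mono hr t b₁ k) (label_mono hr t b₂ k) f hf hf' h1 h2 c01 c12
    (label_allowed hr t h01 k) (label_allowed hr t h12 k) (ch hC h01) (ch hC h02) (ch hD h02)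
    (ch hD h12)
  -- For any word, the part with labels in `Z` at level `k` is equivalent to the part over `Z` at
  -- level zero, that is, to the slice.
  have idx : ∀ {C : ChainComplex (Graded A (triangulation X d).faces (some s)) ℤ}
      (_ : ExpTranslationEquivalent hX hr C) (b : ℕ → Bool),
      Nonempty ((HomotopyCategory.quotient _ _).obj (Cut.part (levelEmbedding X d k)
        (levelEmbedding_convex X d k) hZ (label_mono hr t b k) C) ≅
        (HomotopyCategory.quotient _ _).obj (Cut.part (levelEmbedding X d 0)
        (levelEmbedding_convex X d 0) hZ monotone_id C)) := fun {C} hC b =>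
    (translated_labels hX hr t C hC (wordsAllowed_refl b) k).2.map fun e =>
      HomotopyCategory.mapIsoFunctor (Labelled.restrict s Z hZ) e
  obtain ⟨eC⟩ := idx hC b₀
  obtain ⟨eD⟩ := idx hD b₁
  exact ⟨eC.symm ≪≫ @asIso _ _ _ _ _ key ≪≫ eD⟩

end Tower

end Cone

/-! ### Barycentric coordinates under subdivision -/

namespace Geometric

section Coord

open Classical

variable {F : Type w}

/-- The sum, over the members `ρ` of `c`, of the weight `A ρ` spread evenly over `ρ`. -/
noncomputable def spread (c : Finset (Finset F)) (A : Finset F → ℝ) (v : F) : ℝ :=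
  ∑ ρ ∈ c, if v ∈ ρ then A ρ / ρ.card else 0

theorem spread_nonneg {c : Finset (Finset F)} {A : Finset F → ℝ} (hA : ∀ ρ, 0 ≤ A ρ) (v : F) :
    0 ≤ spread c A v :=
  Finset.sum_nonneg fun ρ _ => by split_ifs <;> first | exact div_nonneg (hA _) (by positivity) | rfl

theorem spread_eq_zero {c : Finset (Finset F)} {A : Finset F → ℝ} {v : F}
    (h : ∀ ρ ∈ c, v ∉ ρ) : spread c A v = 0 :=
  Finset.sum_eq_zero fun ρ hρ => if_neg (h ρ hρ)

theorem sum_spread_smul {M : Type*} [AddCommGroup M] [Module ℝ M] {c : Finset (Finset F)}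
    {A : Finset F → ℝ} {W : Finset F} (hW : ∀ ρ ∈ c, ρ ⊆ W) (g : F → M) :
    ∑ v ∈ W, spread c A v • g v = ∑ ρ ∈ c, A ρ • ((ρ.card : ℝ)⁻¹ • ∑ v ∈ ρ, g v) := by
  simp only [spread, Finset.sum_smul]
  rw [Finset.sum_comm]
  refine Finset.sum_congr rfl fun ρ hρ => ?_
  simp only [ite_smul, zero_smul]
  rw [Finset.sum_ite_mem, Finset.inter_eq_right.2 (hW ρ hρ), smul_smul, ← div_eq_mul_inv,
    Finset.smul_sum]

theorem sum_spread {c : Finset (Finset F)} {A : Finset F → ℝ} {W : Finset F}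
    (hW : ∀ ρ ∈ c, ρ ⊆ W) (hne : ∀ ρ ∈ c, ρ.Nonempty) :
    ∑ v ∈ W, spread c A v = ∑ ρ ∈ c, A ρ := by
  have := sum_spread_smul (A := A) hW (fun _ => (1 : ℝ))
  simp only [smul_eq_mul, mul_one, Finset.sum_const, nsmul_eq_mul] at this
  rw [this]
  refine Finset.sum_congr rfl fun ρ hρ => ?_
  have : (ρ.card : ℝ) ≠ 0 := by exact_mod_cast (hne ρ hρ).card_pos.ne'
  rw [inv_mul_cancel₀ this, mul_one]

/-- A weight is at most the difference of the spread inside and outside. -/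
theorem weight_le_spread_sub {c : Finset (Finset F)} (hc : IsChain (· ⊆ ·) (c : Set (Finset F)))
    {A : Finset F → ℝ} (hA : ∀ ρ, 0 ≤ A ρ) {ρ : Finset F} (hρ : ρ ∈ c) {v u : F} (hv : v ∈ ρ)
    (hu : u ∉ ρ) : A ρ / ρ.card ≤ spread c A v - spread c A u := by
  rw [spread, spread, ← Finset.sum_sub_distrib]
  have h0 : ∀ κ ∈ c, 0 ≤ (if v ∈ κ then A κ / κ.card else 0) -
      (if u ∈ κ then A κ / κ.card else 0) := by
    intro κ hκ
    have hn : 0 ≤ A κ / (κ.card : ℝ) := div_nonneg (hA _) (by positivity)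
    by_cases h1 : u ∈ κ
    · have : v ∈ κ := by
        rcases hc.total hρ hκ with h | h
        · exact h hv
        · exact absurd (h h1) hu
      simp [h1, this]
    · split_ifs <;> simp [hn]
  refine le_trans (le_of_eq ?_) (Finset.single_le_sum h0 hρ)
  simp [hv, hu]

theorem weight_le_spread {c : Finset (Finset F)} {A : Finset F → ℝ} (hA : ∀ ρ, 0 ≤ A ρ)
    {ρ : Finset F} (hρ : ρ ∈ c) {v : F} (hv : v ∈ ρ) : A ρ / ρ.card ≤ spread c A v := by
  have h0 : ∀ κ ∈ c, 0 ≤ (if v ∈ κ then A κ / (κ.card : ℝ) else 0) := by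
    intro κ _
    have hn : 0 ≤ A κ / (κ.card : ℝ) := div_nonneg (hA _) (by positivity)
    split_ifs <;> simp [hn]
  refine le_trans (le_of_eq ?_) (Finset.single_le_sum h0 hρ)
  simp [hv]

/-- Choose `v` in `ρ` outside the largest member of the chain that does not contain `ρ`, and `u`
outside `ρ` in the smallest member strictly containing `ρ`. Then only `ρ` itself can separate `v`
from `u`. Without a larger member, only `ρ` contributes at `v`. -/
theorem exists_spread_sub_le_weight {c : Finset (Finset F)}
    (hc : IsChain (· ⊆ ·) (c : Set (Finset F))) {A : Finset F → ℝ} (hA : ∀ ρ, 0 ≤ A ρ)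
    {ρ : Finset F} (hρ : ρ.Nonempty) :
    ∃ v ∈ ρ, spread c A v ≤ A ρ / ρ.card ∨ ∃ u ∉ ρ, spread c A v - spread c A u ≤ A ρ / ρ.card := by
  obtain ⟨v, hv, hvc⟩ : ∃ v ∈ ρ, ∀ κ ∈ c, v ∈ κ → ρ ⊆ κ := by
    rcases (c.filter fun κ => ¬ ρ ⊆ κ).eq_empty_or_nonempty with h | h
    · obtain ⟨v, hv⟩ := hρ
      refine ⟨v, hv, fun κ hκ _ => ?_⟩
      by_contra hn
      have : κ ∈ (∅ : Finset (Finset F)) := h ▸ Finset.mem_filter.2 ⟨hκ, hn⟩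
      simp at this
    · obtain ⟨m, hm, hmax⟩ := exists_max_of_chain h (hc.mono (by
        intro κ hκ; exact (Finset.mem_filter.1 (Finset.mem_coe.1 hκ)).1))
      obtain ⟨v, hv, hvm⟩ := Finset.not_subset.1 (Finset.mem_filter.1 hm).2
      refine ⟨v, hv, fun κ hκ hvκ => ?_⟩
      by_contra hn
      exact hvm (hmax κ (Finset.mem_filter.2 ⟨hκ, hn⟩) hvκ)
  have hn : ∀ κ, 0 ≤ A κ / (κ.card : ℝ) := fun κ => div_nonneg (hA _) (by positivity)
  refine ⟨v, hv, ?_⟩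
  rcases (c.filter fun κ => ρ ⊂ κ).eq_empty_or_nonempty with h | h
  · left
    have hle : spread c A v ≤ ∑ κ ∈ c, if κ = ρ then A ρ / ρ.card else 0 := by
      refine Finset.sum_le_sum fun κ hκ => ?_
      by_cases h1 : v ∈ κ
      · by_cases h2 : κ = ρ
        · subst h2; simp [h1]
        · have h3 : κ ∈ c.filter fun κ => ρ ⊂ κ :=
            Finset.mem_filter.2 ⟨hκ, (hvc κ hκ h1).ssubset_of_ne (Ne.symm h2)⟩
          rw [h] at h3
          simp at h3
      · rw [if_neg h1]; split_ifs <;> simp [hn]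
    refine hle.trans ?_
    rw [Finset.sum_ite_eq']
    split_ifs <;> simp [hn]
  · right
    obtain ⟨m, hm, hmin⟩ := (c.filter fun κ => ρ ⊂ κ).exists_min_image Finset.card h
    have hm' := (Finset.mem_filter.1 hm).2
    obtain ⟨u, hum, hu⟩ := Finset.exists_of_ssubset hm'
    have huc : ∀ κ ∈ c, ρ ⊂ κ → u ∈ κ := by
      intro κ hκ hρκ
      rcases hc.total (Finset.mem_filter.1 hm).1 hκ with h1 | h1
      · exact h1 hum
      · exact (Finset.eq_of_subset_of_card_le h1 (hmin κ (Finset.mem_filter.2 ⟨hκ, hρκ⟩))) ▸ hum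
    refine ⟨u, hu, ?_⟩
    rw [spread, spread, ← Finset.sum_sub_distrib]
    have hle : ∑ κ ∈ c, ((if v ∈ κ then A κ / (κ.card : ℝ) else 0) -
        (if u ∈ κ then A κ / (κ.card : ℝ) else 0)) ≤ ∑ κ ∈ c, if κ = ρ then A ρ / ρ.card else 0 := by
      refine Finset.sum_le_sum fun κ hκ => ?_
      by_cases h2 : κ = ρ
      · subst h2; simp [hv, hu]
      · rw [if_neg h2]
        by_cases h1 : v ∈ κ
        · simp [h1, huc κ hκ ((hvc κ hκ h1).ssubset_of_ne (Ne.symm h2))]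
        · rw [if_neg h1]; split_ifs <;> simp [hn]
    refine hle.trans ?_
    rw [Finset.sum_ite_eq']
    split_ifs <;> simp [hn]

/-- A weight divided by the size of its set is a lower bound for the gap between values inside and
outside the set, and for a suitable pair of points it is also an upper bound. Applying the first to
`A` and the second to `A'` costs two errors `ε`. -/
theorem weight_sub_le {c c' : Finset (Finset F)} (hc : IsChain (· ⊆ ·) (c : Set (Finset F)))
    (hc' : IsChain (· ⊆ ·) (c' : Set (Finset F))) {A A' : Finset F → ℝ} (hA : ∀ ρ, 0 ≤ A ρ)
    (hA' : ∀ ρ, 0 ≤ A' ρ) (hA0 : ∀ ρ ∉ c, A ρ = 0) {ε : ℝ}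
    (h : ∀ v, |spread c A v - spread c' A' v| ≤ ε) {ρ : Finset F} (hρ : ρ.Nonempty) :
    A ρ - A' ρ ≤ ρ.card * (2 * ε) := by
  have hcard : (0 : ℝ) < ρ.card := by exact_mod_cast hρ.card_pos
  have hε : 0 ≤ ε := (abs_nonneg _).trans (h hρ.choose)
  by_cases hρc : ρ ∈ c
  swap
  · rw [hA0 ρ hρc]
    have := hA' ρ
    nlinarith
  suffices A ρ / ρ.card - A' ρ / ρ.card ≤ 2 * ε by
    rw [← sub_div, div_le_iff₀ hcard] at this
    linarith
  obtain ⟨v, hv, h1 | ⟨u, hu, h1⟩⟩ := exists_spread_sub_le_weight hc' hA' hρ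
  · have h2 := weight_le_spread hA hρc hv
    have := (abs_le.1 (h v)).2
    linarith
  · have h2 := weight_le_spread_sub hc hA hρc hv hu
    have := (abs_le.1 (h v)).2
    have := (abs_le.1 (h u)).1
    linarith

theorem abs_weight_sub_le {c c' : Finset (Finset F)} (hc : IsChain (· ⊆ ·) (c : Set (Finset F)))
    (hc' : IsChain (· ⊆ ·) (c' : Set (Finset F))) {A A' : Finset F → ℝ} (hA : ∀ ρ, 0 ≤ A ρ)
    (hA' : ∀ ρ, 0 ≤ A' ρ) (hA0 : ∀ ρ ∉ c, A ρ = 0) (hA0' : ∀ ρ ∉ c', A' ρ = 0) {ε : ℝ}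
    (h : ∀ v, |spread c A v - spread c' A' v| ≤ ε) {ρ : Finset F} (hρ : ρ.Nonempty) :
    |A ρ - A' ρ| ≤ ρ.card * (2 * ε) := by
  rw [abs_le]
  have h1 := weight_sub_le hc hc' hA hA' hA0 h hρ
  have h2 := weight_sub_le hc' hc hA' hA hA0' (fun v => by rw [abs_sub_comm]; exact h v) hρ
  constructor <;> linarith

/-- Every function on `σ` is spread from a chain of subsets. -/
theorem exists_spread_eq (σ : Finset F) : ∀ f : F → ℝ, (∀ v, 0 ≤ f v) → (∀ v ∉ σ, f v = 0) →
    ∃ (c : Finset (Finset F)) (A : Finset F → ℝ), IsChain (· ⊆ ·) (c : Set (Finset F)) ∧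
      (∀ ρ ∈ c, ρ.Nonempty ∧ ρ ⊆ σ) ∧ (∀ ρ, 0 ≤ A ρ) ∧ ∀ v, spread c A v = f v := by
  induction σ using Finset.strongInduction with
  | H σ ih =>
    intro f hf h0
    rcases σ.eq_empty_or_nonempty with rfl | hσ
    · exact ⟨∅, 0, by simp, by simp, by simp, fun v => by simp [spread, h0 v]⟩
    -- The minimum of `f` is spread over the whole of `σ`; what remains vanishes at `v₀` and is
    -- treated by induction on the smaller set.
    obtain ⟨v₀, hv₀, hmin⟩ := σ.exists_min_image f hσ
    obtain ⟨c, A, hc, hcσ, hA, hs⟩ := ih (σ.erase v₀) (Finset.erase_ssubset hv₀)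
      (fun v => if v ∈ σ then f v - f v₀ else 0)
      (fun v => by split_ifs with h <;> simp [hmin v, h])
      (fun v hv => by
        by_cases h : v ∈ σ
        · have : v = v₀ := by_contra fun hne => hv (Finset.mem_erase.2 ⟨hne, h⟩)
          simp [this]
        · simp [h])
    have hσc : σ ∉ c := fun h => absurd ((hcσ σ h).2 hv₀) (by simp)
    have hsub : ∀ ρ ∈ c, ρ ⊆ σ := fun ρ hρ => (hcσ ρ hρ).2.trans (Finset.erase_subset _ _)
    -- The weight is the minimum times the number of points, since spreading divides by that number.
    refine ⟨insert σ c, Function.update A σ (σ.card * f v₀), ?_, ?_, ?_, ?_⟩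
    · rw [Finset.coe_insert]
      exact hc.insert fun ρ hρ _ => Or.inr (hsub ρ hρ)
    · intro ρ hρ
      rcases Finset.mem_insert.1 hρ with rfl | hρ
      · exact ⟨hσ, Finset.Subset.refl _⟩
      · exact ⟨(hcσ ρ hρ).1, hsub ρ hρ⟩
    · intro ρ
      by_cases h : ρ = σ
      · subst h; simpa using mul_nonneg (Nat.cast_nonneg _) (hf v₀)
      · simpa [Function.update_of_ne h] using hA ρ
    · intro v
      have h1 : ∑ ρ ∈ c, (if v ∈ ρ then Function.update A σ (σ.card * f v₀) ρ / ρ.card else 0) =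
          spread c A v := by
        refine Finset.sum_congr rfl fun ρ hρ => ?_
        rw [Function.update_of_ne (ne_of_mem_of_not_mem hρ hσc)]
      rw [spread, Finset.sum_insert hσc, h1, hs, Function.update_self]
      have : (σ.card : ℝ) ≠ 0 := by exact_mod_cast hσ.card_pos.ne'
      by_cases h : v ∈ σ
      · simp only [h, if_true]
        field_simp
        ring
      · simp [h, h0 v h]

theorem sum_eq_sum_of_zero {M : Type*} [AddCommMonoid M] {σ τ : Finset F} {g : F → M}
    (hτ : ∀ v ∉ τ, g v = 0) (hσ : ∀ v ∉ σ, g v = 0) : ∑ v ∈ τ, g v = ∑ v ∈ σ, g v :=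
  (Finset.sum_subset (Finset.subset_union_left (s₁ := τ) (s₂ := σ))
    (fun v _ hv => hτ v hv)).trans (Finset.sum_subset
    (Finset.subset_union_right (s₁ := τ) (s₂ := σ)) (fun v _ hv => hσ v hv)).symm

variable [AddCommGroup F] [Module ℝ F]

/-- `α` are the barycentric coordinates of the point `x` of the simplex `σ`, and zero elsewhere. -/
structure IsCoord (σ : Finset F) (x : F) (α : F → ℝ) : Prop where
  nonneg : ∀ v, 0 ≤ α v
  zero : ∀ v ∉ σ, α v = 0
  sum : ∑ v ∈ σ, α v = 1
  point : ∑ v ∈ σ, α v • v = x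

theorem mem_convexHull_iff {σ : Finset F} {x : F} :
    x ∈ convexHull ℝ (σ : Set F) ↔ ∃ α, IsCoord σ x α := by
  rw [Finset.mem_convexHull']
  constructor
  · rintro ⟨f, h0, h1, h2⟩
    refine ⟨fun v => if v ∈ σ then f v else 0, ?_, ?_, ?_, ?_⟩
    · intro v; split_ifs with h <;> simp [h0 v, h]
    · intro v h; simp [h]
    · rw [← h1]; exact Finset.sum_congr rfl fun v h => by simp [h]
    · rw [← h2]; exact Finset.sum_congr rfl fun v h => by simp [h]
  · rintro ⟨α, h⟩
    exact ⟨α, fun v _ => h.nonneg v, h.sum, h.point⟩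

theorem IsCoord.mem {σ : Finset F} {x : F} {α : F → ℝ} (h : IsCoord σ x α) :
    x ∈ convexHull ℝ (σ : Set F) := mem_convexHull_iff.2 ⟨α, h⟩

/-- Barycentric coordinates with respect to a face. -/
theorem IsCoord.of_support {σ τ : Finset F} {x : F} {α : F → ℝ} (h : IsCoord σ x α)
    (hτ : ∀ v ∈ σ, α v ≠ 0 → v ∈ τ) : IsCoord τ x α := by
  have hz : ∀ v ∉ τ, α v = 0 := fun v hv => by
    by_contra hne
    exact hv (hτ v (by_contra fun hσ => hne (h.zero v hσ)) hne)
  refine ⟨h.nonneg, hz, ?_, ?_⟩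
  · rw [← h.sum]
    exact sum_eq_sum_of_zero hz h.zero
  · rw [← h.point]
    exact sum_eq_sum_of_zero (fun v hv => by rw [hz v hv, zero_smul])
      fun v hv => by rw [h.zero v hv, zero_smul]

theorem isCoord_bary {σ : Finset F} (h : σ.Nonempty) :
    IsCoord σ (bary σ) fun v => if v ∈ σ then (σ.card : ℝ)⁻¹ else 0 := by
  have : (σ.card : ℝ) ≠ 0 := by exact_mod_cast h.card_pos.ne'
  refine ⟨fun v => by split_ifs <;> positivity, fun v hv => by simp [hv], ?_, ?_⟩
  · rw [Finset.sum_congr rfl fun v hv => if_pos hv]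
    simp [this]
  · rw [bary, Finset.smul_sum]
    exact Finset.sum_congr rfl fun v hv => by simp [hv]

/-- Barycentric coordinates in `K` are determined by the point, and Lipschitz with respect to `D`
where `P` holds. -/
def Rigid (K : PreAbstractSimplicialComplex F) (D : F → F → ℝ) (P : F → Prop) (L : ℝ) : Prop :=
  ∀ σ ∈ K.faces, ∀ τ ∈ K.faces, ∀ x y α β, P x → P y → IsCoord σ x α → IsCoord τ y β →
    ∀ v, |α v - β v| ≤ L * D x y

/-- Barycentric coordinates in `K` are determined by the point. -/
def Geo (K : PreAbstractSimplicialComplex F) : Prop :=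
  ∀ σ ∈ K.faces, ∀ τ ∈ K.faces, ∀ x α β, IsCoord σ x α → IsCoord τ x β → α = β

theorem Geo.bary_injOn {K : PreAbstractSimplicialComplex F} (hK : Geo K) :
    Set.InjOn bary K.faces := by
  have key : ∀ σ ∈ K.faces, ∀ τ ∈ K.faces, bary σ = bary τ → σ ⊆ τ := by
    intro σ hσ τ hτ h v hv
    have hσ' := (K.isRelLowerSet_faces hσ).1
    have := congrFun (hK σ hσ τ hτ _ _ _ (isCoord_bary hσ')
      (h ▸ isCoord_bary (K.isRelLowerSet_faces hτ).1)) v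
    by_contra hvτ
    simp only [hv, hvτ, if_true, if_false, inv_eq_zero, Nat.cast_eq_zero, Finset.card_eq_zero] at this
    simp [this] at hσ'
  exact fun σ hσ τ hτ h => (key σ hσ τ hτ h).antisymm (key τ hτ σ hσ h.symm)

/-- A closed simplex that contains an inner point of another one contains that one. -/
theorem Geo.subset_of_isCoord {K : PreAbstractSimplicialComplex F} (hK : Geo K) {σ τ : Finset F}
    (hσ : σ ∈ K.faces) (hτ : τ ∈ K.faces) {x : F} {α : F → ℝ} (h : IsCoord σ x α)
    (hx : x ∈ convexHull ℝ (τ : Set F)) : ∀ v ∈ σ, α v ≠ 0 → v ∈ τ := by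
  obtain ⟨β, hβ⟩ := mem_convexHull_iff.1 hx
  rw [hK σ hσ τ hτ x α β h hβ]
  exact fun v _ hv => by_contra fun hn => hv (hβ.zero v hn)

theorem Geo.subset_of_bary {K : PreAbstractSimplicialComplex F} (hK : Geo K) {σ τ : Finset F}
    (hσ : σ ∈ K.faces) (hτ : τ ∈ K.faces) (hx : bary σ ∈ convexHull ℝ (τ : Set F)) : σ ⊆ τ := by
  have hne := (K.isRelLowerSet_faces hσ).1
  intro v hv
  refine hK.subset_of_isCoord hσ hτ (isCoord_bary hne) hx v hv ?_
  have : (σ.card : ℝ) ≠ 0 := by exact_mod_cast hne.card_pos.ne'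
  simp [hv, this]

/-- Coordinates in the barycentric subdivision, as weights on a chain. -/
theorem IsCoord.sd {K : PreAbstractSimplicialComplex F} (hK : Geo K) {c : Finset (Finset F)}
    (hcK : ∀ ρ ∈ c, ρ ∈ K.faces) {x : F} {α : F → ℝ} (h : IsCoord (c.image bary) x α)
    {m : Finset F} (hm : ∀ ρ ∈ c, ρ ⊆ m) :
    IsCoord m x (spread c fun ρ => if ρ ∈ c then α (bary ρ) else 0) := by
  have hinj : Set.InjOn bary (c : Set (Finset F)) := hK.bary_injOn.mono hcK
  refine ⟨spread_nonneg fun ρ => by split_ifs <;> simp [h.nonneg], ?_, ?_, ?_⟩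
  · exact fun v hv => spread_eq_zero fun ρ hρ hvρ => hv (hm ρ hρ hvρ)
  · rw [sum_spread hm fun ρ hρ => (K.isRelLowerSet_faces (hcK ρ hρ)).1, ← h.sum,
      Finset.sum_image hinj]
    exact Finset.sum_congr rfl fun ρ hρ => if_pos hρ
  · rw [sum_spread_smul hm (fun v => v), ← h.point, Finset.sum_image hinj]
    exact Finset.sum_congr rfl fun ρ hρ => by rw [if_pos hρ, bary]

theorem Rigid.geo {K : PreAbstractSimplicialComplex F} {D : F → F → ℝ} {L : ℝ}
    {P : F → Prop} (hD : ∀ x, D x x = 0) (hP : ∀ σ ∈ K.faces, ∀ x ∈ convexHull ℝ (σ : Set F), P x)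
    (h : Rigid K D P L) : Geo K := by
  intro σ hσ τ hτ x α β hα hβ
  funext v
  have := h σ hσ τ hτ x x α β (hP σ hσ x hα.mem) (hP σ hσ x hα.mem) hα hβ v
  rw [hD, mul_zero] at this
  exact sub_eq_zero.1 (abs_eq_zero.1 (le_antisymm this (abs_nonneg _)))

/-- Coordinates in the subdivision are weights on a chain, and coordinates in `K` are their spread.
So `abs_weight_sub_le` recovers the former from the latter with a factor depending only on the
dimension. At points that are not barycentres all coordinates vanish. -/
theorem rigid_sd_aux {K : PreAbstractSimplicialComplex F} (hK : Geo K) {N : ℕ}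
    (hN : ∀ σ ∈ K.faces, σ.card ≤ N) {σ σ' : Finset F} (hσ : σ ∈ (Sd K).faces)
    (hσ' : σ' ∈ (Sd K).faces) {x x' : F} {α α' : F → ℝ} (h : IsCoord σ x α)
    (h' : IsCoord σ' x' α') {ε : ℝ} (hε : ∀ m ∈ K.faces, ∀ m' ∈ K.faces, ∀ β β', IsCoord m x β →
      IsCoord m' x' β' → ∀ v, |β v - β' v| ≤ ε) (v : F) : |α v - α' v| ≤ N * (2 * ε) := by
  obtain ⟨c, hc, hcK, hch, rfl⟩ := hσ
  obtain ⟨c', hc', hcK', hch', rfl⟩ := hσ'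
  obtain ⟨m, hm, hmax⟩ := exists_max_of_chain hc hch
  obtain ⟨m', hm', hmax'⟩ := exists_max_of_chain hc' hch'
  have key := hε m (hcK m hm) m' (hcK' m' hm') _ _ (h.sd hK hcK hmax) (h'.sd hK hcK' hmax')
  have hε0 : 0 ≤ ε := (abs_nonneg _).trans (key v)
  have hval : ∀ {c : Finset (Finset F)} {x : F} {α : F → ℝ} (_ : ∀ ρ ∈ c, ρ ∈ K.faces)
      (_ : IsCoord (c.image bary) x α) {ρ : Finset F} (_ : ρ ∈ K.faces),
      α (bary ρ) = if ρ ∈ c then α (bary ρ) else 0 := by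
    intro c x α hcK h ρ hρ
    split_ifs with hρc
    · rfl
    · refine h.zero _ fun hmem => hρc ?_
      obtain ⟨κ, hκ, he⟩ := Finset.mem_image.1 hmem
      exact hK.bary_injOn (hcK κ hκ) hρ he ▸ hκ
  by_cases hv : ∃ ρ ∈ K.faces, bary ρ = v
  · obtain ⟨ρ, hρ, rfl⟩ := hv
    rw [hval hcK h hρ, hval hcK' h' hρ]
    refine (abs_weight_sub_le hch hch' (fun ρ => ?_) (fun ρ => ?_) (fun ρ hρ => if_neg hρ)
      (fun ρ hρ => if_neg hρ) key (K.isRelLowerSet_faces hρ).1).trans ?_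
    · split_ifs <;> simp [h.nonneg]
    · split_ifs <;> simp [h'.nonneg]
    · have : (ρ.card : ℝ) ≤ N := by exact_mod_cast hN ρ hρ
      exact mul_le_mul_of_nonneg_right this (by linarith)
  · have h0 : ∀ {c : Finset (Finset F)} {x : F} {α : F → ℝ} (_ : ∀ ρ ∈ c, ρ ∈ K.faces)
      (_ : IsCoord (c.image bary) x α), α v = 0 := by
      intro c x α hcK h
      refine h.zero _ fun hmem => hv ?_
      obtain ⟨κ, hκ, he⟩ := Finset.mem_image.1 hmem
      exact ⟨κ, hcK κ hκ, he⟩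
    rw [h0 hcK h, h0 hcK' h', sub_zero, abs_zero]
    positivity

theorem Geo.sd {K : PreAbstractSimplicialComplex F} (hK : Geo K) {N : ℕ}
    (hN : ∀ σ ∈ K.faces, σ.card ≤ N) : Geo (Sd K) := by
  intro σ hσ σ' hσ' x α β hα hβ
  funext v
  have := rigid_sd_aux hK hN hσ hσ' hα hβ (ε := 0) (fun m hm m' hm' β β' h h' v => by
    rw [hK m hm m' hm' x β β' h h', sub_self, abs_zero]) v
  rw [mul_zero, mul_zero] at this
  exact sub_eq_zero.1 (abs_eq_zero.1 (le_antisymm this (abs_nonneg _)))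

theorem Rigid.sd {K : PreAbstractSimplicialComplex F} (hK : Geo K) {N : ℕ}
    (hN : ∀ σ ∈ K.faces, σ.card ≤ N) {D : F → F → ℝ} {P : F → Prop} {L : ℝ}
    (h : Rigid K D P L) : Rigid (Sd K) D P (2 * N * L) := by
  intro σ hσ σ' hσ' x y α β hx hy hα hβ v
  refine (rigid_sd_aux hK hN hσ hσ' hα hβ (fun m hm m' hm' β β' hm2 hm2' v =>
    h m hm m' hm' x y β β' hx hy hm2 hm2' v) v).trans (le_of_eq ?_)
  ring

theorem card_chain_le {G : Type*} {c : Finset (Finset G)} (hc : IsChain (· ⊆ ·) (c : Set (Finset G)))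
    {N : ℕ} (h : ∀ ρ ∈ c, ρ.Nonempty ∧ ρ.card ≤ N) : c.card ≤ N := by
  have hinj : Set.InjOn Finset.card (c : Set (Finset G)) := by
    intro σ hσ τ hτ he
    rcases hc.total hσ hτ with h | h
    · exact Finset.eq_of_subset_of_card_le h he.ge
    · exact (Finset.eq_of_subset_of_card_le h he.le).symm
  rw [← Finset.card_image_of_injOn hinj, ← Nat.card_Icc 1 N |>.trans (Nat.add_sub_cancel N 1)]
  refine Finset.card_le_card fun n hn => ?_
  obtain ⟨ρ, hρ, rfl⟩ := Finset.mem_image.1 hn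
  exact Finset.mem_Icc.2 ⟨(h ρ hρ).1.card_pos, (h ρ hρ).2⟩

theorem card_sd {K : PreAbstractSimplicialComplex F} {N : ℕ} (hN : ∀ σ ∈ K.faces, σ.card ≤ N) :
    ∀ σ ∈ (Sd K).faces, σ.card ≤ N := by
  rintro _ ⟨c, hc, hcK, hch, rfl⟩
  exact Finset.card_image_le.trans (card_chain_le hch fun ρ hρ =>
    ⟨(K.isRelLowerSet_faces (hcK ρ hρ)).1, hN ρ (hcK ρ hρ)⟩)

/-- The barycentric subdivision covers every simplex. -/
theorem exists_mem_sd {K : PreAbstractSimplicialComplex F} {σ : Finset F} (hσ : σ ∈ K.faces) {x : F}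
    (hx : x ∈ convexHull ℝ (σ : Set F)) : ∃ κ ∈ (Sd K).faces, x ∈ convexHull ℝ (κ : Set F) ∧
      ∀ w ∈ κ, ∃ ρ ∈ K.faces, ρ ⊆ σ ∧ w = bary ρ := by
  obtain ⟨α, hα⟩ := mem_convexHull_iff.1 hx
  obtain ⟨c, A, hc, hcσ, hA, hs⟩ := exists_spread_eq σ α hα.nonneg hα.zero
  have hcK : ∀ ρ ∈ c, ρ ∈ K.faces := fun ρ hρ =>
    (K.isRelLowerSet_faces hσ).2 (hcσ ρ hρ).2 (hcσ ρ hρ).1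
  have hsum : ∑ ρ ∈ c, A ρ = 1 := by
    rw [← sum_spread (fun ρ hρ => (hcσ ρ hρ).2) (fun ρ hρ => (hcσ ρ hρ).1), ← hα.sum]
    exact Finset.sum_congr rfl fun v _ => hs v
  have hpt : ∑ ρ ∈ c, A ρ • bary ρ = x := by
    rw [← hα.point]
    simp only [← hs]
    exact (sum_spread_smul (fun ρ hρ => (hcσ ρ hρ).2) fun v => v).symm
  refine ⟨c.image bary, ⟨c, ?_, hcK, hc, rfl⟩, ?_, ?_⟩
  · rw [Finset.nonempty_iff_ne_empty]
    rintro rfl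
    simp at hsum
  · rw [← hpt]
    exact (convex_convexHull ℝ _).sum_mem (fun ρ _ => hA ρ) hsum fun ρ hρ =>
      subset_convexHull ℝ _ (Finset.mem_coe.2 (Finset.mem_image_of_mem _ hρ))
  · intro w hw
    obtain ⟨ρ, hρ, rfl⟩ := Finset.mem_image.1 hw
    exact ⟨ρ, hcK ρ hρ, (hcσ ρ hρ).2, rfl⟩

theorem bary_mem_of_subset {ρ σ : Finset F} (hρ : ρ.Nonempty) (h : ρ ⊆ σ) :
    bary ρ ∈ convexHull ℝ (σ : Set F) :=
  convexHull_mono (Finset.coe_subset.2 h) (bary_mem hρ)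

/-- Every simplex of the subdivision lies in a simplex. -/
theorem exists_carrier_sd {K : PreAbstractSimplicialComplex F} {κ : Finset F}
    (hκ : κ ∈ (Sd K).faces) : ∃ σ ∈ K.faces, ∀ w ∈ κ, w ∈ convexHull ℝ (σ : Set F) := by
  obtain ⟨c, hc, hcK, hch, rfl⟩ := hκ
  obtain ⟨m, hm, hmax⟩ := exists_max_of_chain hc hch
  refine ⟨m, hcK m hm, fun w hw => ?_⟩
  obtain ⟨ρ, hρ, rfl⟩ := Finset.mem_image.1 hw
  exact bary_mem_of_subset (K.isRelLowerSet_faces (hcK ρ hρ)).1 (hmax ρ hρ)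

theorem convexHull_subset_of_forall {κ : Finset F} {Z : Set F} (hZ : Convex ℝ Z)
    (h : ∀ w ∈ κ, w ∈ Z) : convexHull ℝ (κ : Set F) ⊆ Z :=
  convexHull_min (fun w hw => h w hw) hZ

end Coord

end Geometric

/-! ### Lipschitz coordinates on the prism -/

namespace Cone

open Geometric

section Norm

open Classical

variable {V : Type w}

/-- The sum of the absolute values of the coordinates. -/
noncomputable def norm1 (x : V →₀ ℝ) : ℝ := x.sum fun _ a => |a|

theorem norm1_eq {x : V →₀ ℝ} {W : Finset V} (h : x.support ⊆ W) : norm1 x = ∑ v ∈ W, |x v| :=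
  Finsupp.sum_of_support_subset _ h _ (by simp)

theorem norm1_nonneg (x : V →₀ ℝ) : 0 ≤ norm1 x := Finset.sum_nonneg fun _ _ => abs_nonneg _

theorem norm1_zero : norm1 (0 : V →₀ ℝ) = 0 := by simp [norm1]

theorem norm1_add (x y : V →₀ ℝ) : norm1 (x + y) ≤ norm1 x + norm1 y := by
  rw [norm1_eq (W := x.support ∪ y.support) Finsupp.support_add,
    norm1_eq (W := x.support ∪ y.support) Finset.subset_union_left,
    norm1_eq (W := x.support ∪ y.support) Finset.subset_union_right, ← Finset.sum_add_distrib]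
  exact Finset.sum_le_sum fun v _ => abs_add_le _ _

theorem norm1_smul (a : ℝ) (x : V →₀ ℝ) : norm1 (a • x) = |a| * norm1 x := by
  rw [norm1_eq (W := x.support) Finsupp.support_smul, norm1_eq (Finset.Subset.refl _),
    Finset.mul_sum]
  exact Finset.sum_congr rfl fun v _ => by simp [abs_mul]

theorem norm1_neg (x : V →₀ ℝ) : norm1 (-x) = norm1 x := by
  simpa using norm1_smul (-1) x

theorem norm1_sub_comm (x y : V →₀ ℝ) : norm1 (x - y) = norm1 (y - x) := by
  rw [← norm1_neg, neg_sub]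

theorem norm1_sub_le (x y z : V →₀ ℝ) : norm1 (x - z) ≤ norm1 (x - y) + norm1 (y - z) := by
  have := norm1_add (x - y) (y - z)
  rwa [sub_add_sub_cancel] at this

theorem norm1_sum {ι : Type*} (s : Finset ι) (f : ι → V →₀ ℝ) :
    norm1 (∑ i ∈ s, f i) ≤ ∑ i ∈ s, norm1 (f i) := by
  induction s using Finset.induction_on with
  | empty => simp [norm1_zero]
  | insert a s ha ih =>
    rw [Finset.sum_insert ha, Finset.sum_insert ha]
    exact (norm1_add _ _).trans (by linarith)

theorem abs_apply_le_norm1 (x : V →₀ ℝ) (v : V) : |x v| ≤ norm1 x := by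
  rw [norm1_eq (W := insert v x.support) (Finset.subset_insert _ _)]
  exact Finset.single_le_sum (f := fun v => |x v|) (fun _ _ => abs_nonneg _)
    (Finset.mem_insert_self _ _)

/-- A distance of points of `X × ℝ` in terms of coordinates. -/
noncomputable def dist1 (p q : Pt V) : ℝ := norm1 (p.1 - q.1) + |p.2 - q.2|

theorem dist1_self (p : Pt V) : dist1 p p = 0 := by simp [dist1, norm1_zero]

theorem dist1_comm (p q : Pt V) : dist1 p q = dist1 q p := by
  rw [dist1, dist1, norm1_sub_comm, abs_sub_comm]

theorem dist1_nonneg (p q : Pt V) : 0 ≤ dist1 p q := add_nonneg (norm1_nonneg _) (abs_nonneg _)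

end Norm

section Coordinates

open Classical

variable {V : Type w}

theorem vertex_injective : Function.Injective (vertex : V → V →₀ ℝ) := fun _ _ h =>
  Finsupp.single_left_injective one_ne_zero h

theorem centre_eq (ρ : Finset V) : centre ρ = (ρ.card : ℝ)⁻¹ • ∑ v ∈ ρ, vertex v := by
  rw [centre, bary, Finset.card_image_of_injective _ vertex_injective,
    Finset.sum_image vertex_injective.injOn]

theorem sum_vertex_apply (ρ : Finset V) (v : V) :
    (∑ u ∈ ρ, vertex u) v = if v ∈ ρ then 1 else 0 := by
  rw [Finsupp.finsetSum_apply]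
  simp [vertex, Finsupp.single_apply]

theorem centre_apply (ρ : Finset V) (v : V) :
    centre ρ v = if v ∈ ρ then (ρ.card : ℝ)⁻¹ else 0 := by
  rw [centre_eq, Finsupp.smul_apply, sum_vertex_apply]
  split_ifs <;> simp

theorem centre_injOn : Set.InjOn centre {ρ : Finset V | ρ.Nonempty} := by
  have key : ∀ ρ κ : Finset V, ρ.Nonempty → centre ρ = centre κ → ρ ⊆ κ := by
    intro ρ κ hρ h v hv
    have := DFunLike.congr_fun h v
    rw [centre_apply, centre_apply, if_pos hv] at this
    by_contra hn
    simp only [hn, if_false, inv_eq_zero, Nat.cast_eq_zero, Finset.card_eq_zero] at this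
    simp [this] at hρ
  exact fun ρ hρ κ hκ h => (key ρ κ hρ h).antisymm (key κ ρ hκ h.symm)

/-- Coordinates in the prism. -/
theorem sdPrism_coord {τ : Finset V} {c : Finset (Finset V)} (hne : ∀ ρ ∈ c, ρ.Nonempty) {x : Pt V}
    {α : Pt V → ℝ} (h : IsCoord (τ.image (fun v => (vertex v, (0 : ℝ))) ∪
      c.image (fun ρ => (centre ρ, (1 : ℝ)))) x α) :
    (∀ v, x.1 v = α (vertex v, 0) +
      spread c (fun ρ => if ρ ∈ c then α (centre ρ, 1) else 0) v) ∧
    x.2 = ∑ ρ ∈ c, α (centre ρ, 1) := by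
  have hdis : Disjoint (τ.image (fun v => (vertex v, (0 : ℝ))))
      (c.image (fun ρ => (centre ρ, (1 : ℝ)))) := by
    rw [Finset.disjoint_left]
    intro p hp hp'
    obtain ⟨v, -, rfl⟩ := Finset.mem_image.1 hp
    obtain ⟨ρ, -, hρ⟩ := Finset.mem_image.1 hp'
    simp at hρ
  have hp := h.point
  rw [Finset.sum_union hdis, Finset.sum_image fun v _ v' _ hv => vertex_injective
    (congrArg Prod.fst hv), Finset.sum_image fun ρ hρ ρ' hρ' he => centre_injOn (hne ρ hρ)
    (hne ρ' hρ') (congrArg Prod.fst he)] at hp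
  constructor
  · intro v
    rw [← hp]
    simp only [Prod.fst_add, Prod.fst_sum, Prod.smul_fst, Finsupp.add_apply,
      Finsupp.finsetSum_apply, Finsupp.smul_apply, smul_eq_mul]
    congr 1
    · by_cases hv : v ∈ τ
      · rw [Finset.sum_eq_single_of_mem v hv]
        · simp [vertex]
        · intro u _ hu; simp [vertex, hu]
      · rw [Finset.sum_eq_zero, eq_comm]
        · apply h.zero
          simp [vertex_injective.eq_iff, hv]
        · intro u hu
          have : u ≠ v := fun e => hv (e ▸ hu)
          simp [vertex, this]
    · refine Finset.sum_congr rfl fun ρ hρ => ?_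
      rw [centre_apply]
      split_ifs <;> simp [div_eq_mul_inv, hρ]
  · rw [← hp]
    simp [Prod.snd_sum]

/-- Over a vertex of `τ` every member of the chain contributes, which gives the full value of the
sum. Elsewhere the bottom coordinate is zero and the top part accounts for all of `x.1 v`. So the
top part truncates the horizontal coordinates at a common level, and the truncated values add up to
the height of `x`. -/
theorem sdPrism_spread {τ : Finset V} {c : Finset (Finset V)} (hne : ∀ ρ ∈ c, ρ.Nonempty)
    (hτ : ∀ ρ ∈ c, τ ⊆ ρ) {x : Pt V}
    {α : Pt V → ℝ} (h : IsCoord (τ.image (fun v => (vertex v, (0 : ℝ))) ∪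
      c.image (fun ρ => (centre ρ, (1 : ℝ)))) x α) (v : V) :
      spread c (fun ρ => if ρ ∈ c then α (centre ρ, 1) else 0) v =
        min (x.1 v) (∑ ρ ∈ c, α (centre ρ, 1) / ρ.card) := by
  have hx := (sdPrism_coord hne h).1 v
  have hs : spread c (fun ρ => if ρ ∈ c then α (centre ρ, 1) else 0) v =
      ∑ ρ ∈ c, if v ∈ ρ then α (centre ρ, 1) / ρ.card else 0 :=
    Finset.sum_congr rfl fun ρ hρ => by simp [hρ]
  have h0 := h.nonneg (vertex v, 0)
  by_cases hv : v ∈ τ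
  · have : spread c (fun ρ => if ρ ∈ c then α (centre ρ, 1) else 0) v =
        ∑ ρ ∈ c, α (centre ρ, 1) / ρ.card := by
      rw [hs]
      exact Finset.sum_congr rfl fun ρ hρ => if_pos (hτ ρ hρ hv)
    rw [hx, this, min_eq_right]
    linarith
  · have : α (vertex v, 0) = 0 := by
      apply h.zero
      simp [vertex_injective.eq_iff, hv]
    rw [hx, this, zero_add, eq_comm, min_eq_left]
    rw [hs]
    refine Finset.sum_le_sum fun ρ _ => ?_
    have := div_nonneg (h.nonneg (centre ρ, 1)) (Nat.cast_nonneg (α := ℝ) ρ.card)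
    split_ifs <;> simp [this]

/-- As `s ≤ t`, raising the truncation level of `y` from `s` to `t` increases every summand. One
increase is at most their sum, which is controlled by the two truncated sums and the distance of `x`
and `y`; no estimate of `t - s` is needed. -/
theorem abs_min_sub_min_le {x y : V → ℝ} {s t : ℝ} {W : Finset V} (hst : s ≤ t) {v : V}
    (hv : v ∈ W) : |min (x v) s - min (y v) t| ≤
      |∑ u ∈ W, min (x u) s - ∑ u ∈ W, min (y u) t| + 2 * ∑ u ∈ W, |x u - y u| := by
  have h1 : ∀ u, |min (x u) s - min (y u) s| ≤ |x u - y u| := fun u =>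
    (abs_min_sub_min_le_max _ _ _ _).trans (by simp)
  have h2 : ∀ u ∈ W, 0 ≤ min (y u) t - min (y u) s := fun u _ =>
    sub_nonneg.2 (min_le_min_left _ hst)
  have h3 := Finset.single_le_sum h2 hv
  have h4 : |x v - y v| ≤ ∑ u ∈ W, |x u - y u| :=
    Finset.single_le_sum (f := fun u => |x u - y u|) (fun _ _ => abs_nonneg _) hv
  have h5 : ∑ u ∈ W, (min (y u) t - min (y u) s) =
      -(∑ u ∈ W, min (x u) s - ∑ u ∈ W, min (y u) t) +
        ∑ u ∈ W, (min (x u) s - min (y u) s) := by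
    simp only [Finset.sum_sub_distrib]
    ring
  have h6 : ∑ u ∈ W, (min (x u) s - min (y u) s) ≤ ∑ u ∈ W, |x u - y u| :=
    Finset.sum_le_sum fun u _ => (le_abs_self _).trans (h1 u)
  have h7 := neg_abs_le (∑ u ∈ W, min (x u) s - ∑ u ∈ W, min (y u) t)
  have h8 := abs_le.1 (h1 v)
  have h9 := h2 v hv
  rw [abs_le]
  constructor <;> linarith

theorem abs_min_sub_min_le' {x y : V → ℝ} {s t : ℝ} {W : Finset V} {v : V}
    (hv : v ∈ W) : |min (x v) s - min (y v) t| ≤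
      |∑ u ∈ W, min (x u) s - ∑ u ∈ W, min (y u) t| + 2 * ∑ u ∈ W, |x u - y u| := by
  rcases le_total s t with h | h
  · exact abs_min_sub_min_le h hv
  · rw [abs_sub_comm, abs_sub_comm (∑ u ∈ W, min (x u) s)]
    simp only [abs_sub_comm (x _)]
    exact abs_min_sub_min_le h hv

/-- Top coordinates are the weights of a truncation of the horizontal coordinates whose total is the
height, and bottom coordinates are what the truncation cuts off. Both depend on the point in a
Lipschitz way. -/
theorem rigid_sdPrism {X : PreAbstractSimplicialComplex V} {N : ℕ}
    (hN : ∀ σ ∈ X.faces, σ.card ≤ N) : Rigid (sdPrism X) dist1 (fun _ => True) (4 * N + 3) := by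
  rintro _ ⟨τ, c, hτ, hc, hch, -, rfl⟩ _ ⟨τ', c', hτ', hc', hch', -, rfl⟩ x y α β - - hα hβ p
  have hne : ∀ ρ ∈ c, ρ.Nonempty := fun ρ hρ => (X.isRelLowerSet_faces (hc ρ hρ).1).1
  have hne' : ∀ ρ ∈ c', ρ.Nonempty := fun ρ hρ => (X.isRelLowerSet_faces (hc' ρ hρ).1).1
  have hcx := sdPrism_coord hne hα
  have hcy := sdPrism_coord hne' hβ
  have hsx := sdPrism_spread hne (fun ρ hρ => (hc ρ hρ).2) hα
  have hsy := sdPrism_spread hne' (fun ρ hρ => (hc' ρ hρ).2) hβ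
  set A : Finset V → ℝ := fun ρ => if ρ ∈ c then α (centre ρ, 1) else 0 with hA
  set A' : Finset V → ℝ := fun ρ => if ρ ∈ c' then β (centre ρ, 1) else 0 with hA'
  -- `W` is a finite set that contains everything occurring in either point, so the truncated sums
  -- over it are the two heights.
  have key : ∀ v, |spread c A v - spread c' A' v| ≤ 2 * dist1 x y := by
    intro v
    set W := insert v (c.biUnion id ∪ c'.biUnion id ∪ (x.1 - y.1).support)
    have hW : ∀ ρ ∈ c, ρ ⊆ W := fun ρ hρ u hu => Finset.mem_insert_of_mem
      (Finset.mem_union_left _ (Finset.mem_union_left _ (Finset.mem_biUnion.2 ⟨ρ, hρ, hu⟩)))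
    have hW' : ∀ ρ ∈ c', ρ ⊆ W := fun ρ hρ u hu => Finset.mem_insert_of_mem
      (Finset.mem_union_left _ (Finset.mem_union_right _ (Finset.mem_biUnion.2 ⟨ρ, hρ, hu⟩)))
    have hx2 : ∑ u ∈ W, min (x.1 u) (∑ ρ ∈ c, α (centre ρ, 1) / ρ.card) = x.2 := by
      simp only [← hsx]
      rw [sum_spread hW hne, hcx.2]
      exact Finset.sum_congr rfl fun ρ hρ => if_pos hρ
    have hy2 : ∑ u ∈ W, min (y.1 u) (∑ ρ ∈ c', β (centre ρ, 1) / ρ.card) = y.2 := by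
      simp only [← hsy]
      rw [sum_spread hW' hne', hcy.2]
      exact Finset.sum_congr rfl fun ρ hρ => if_pos hρ
    have hn : norm1 (x.1 - y.1) = ∑ u ∈ W, |x.1 u - y.1 u| :=
      norm1_eq fun u hu => Finset.mem_insert_of_mem (Finset.mem_union_right _ hu)
    have := abs_min_sub_min_le' (x := x.1) (y := y.1) (s := ∑ ρ ∈ c, α (centre ρ, 1) / ρ.card)
      (t := ∑ ρ ∈ c', β (centre ρ, 1) / ρ.card) (Finset.mem_insert_self v _ : v ∈ W)
    rw [hx2, hy2, ← hn] at this
    rw [hsx, hsy, dist1]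
    refine this.trans ?_
    have := abs_nonneg (x.2 - y.2)
    linarith
  have hd := dist1_nonneg x y
  -- A bottom coordinate is a horizontal coordinate minus a spread, whence 1 + 2. A top coordinate
  -- is a weight, whence at most `N * (2 * 2)`. The constant is the sum of both.
  have hle1 : 3 * dist1 x y ≤ (4 * N + 3) * dist1 x y := by
    have : 0 ≤ (4 * N : ℝ) * dist1 x y := by positivity
    linarith
  by_cases hp : ∃ v, (vertex v, (0 : ℝ)) = p
  · obtain ⟨v, rfl⟩ := hp
    refine le_trans ?_ hle1
    have h1 := hcx.1 v
    have h2 := hcy.1 v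
    have h3 := abs_le.1 (key v)
    have h4 := abs_le.1 (abs_apply_le_norm1 (x.1 - y.1) v)
    have h5 : norm1 (x.1 - y.1) ≤ dist1 x y := by
      rw [dist1]; linarith [abs_nonneg (x.2 - y.2)]
    rw [Finsupp.sub_apply] at h4
    rw [abs_le]
    constructor <;> linarith [h3.1, h3.2, h4.1, h4.2]
  have hα0 : ∀ p : Pt V, (¬ ∃ v, (vertex v, (0 : ℝ)) = p) → (∀ ρ ∈ c, (centre ρ, (1 : ℝ)) ≠ p) →
      α p = 0 := by
    intro p hp hρ
    apply hα.zero
    simp only [Finset.mem_union, Finset.mem_image, not_or]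
    exact ⟨fun ⟨v, _, hv⟩ => hp ⟨v, hv⟩, fun ⟨ρ, h, he⟩ => hρ ρ h he⟩
  have hβ0 : ∀ p : Pt V, (¬ ∃ v, (vertex v, (0 : ℝ)) = p) → (∀ ρ ∈ c', (centre ρ, (1 : ℝ)) ≠ p) →
      β p = 0 := by
    intro p hp hρ
    apply hβ.zero
    simp only [Finset.mem_union, Finset.mem_image, not_or]
    exact ⟨fun ⟨v, _, hv⟩ => hp ⟨v, hv⟩, fun ⟨ρ, h, he⟩ => hρ ρ h he⟩
  by_cases hp' : ∃ ρ ∈ X.faces, (centre ρ, (1 : ℝ)) = p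
  · obtain ⟨ρ, hρ, rfl⟩ := hp'
    have hρne := (X.isRelLowerSet_faces hρ).1
    have e1 : α (centre ρ, 1) = A ρ := by
      simp only [hA]
      split_ifs with h
      · rfl
      · exact hα0 _ hp fun κ hκ he =>
          h (centre_injOn (hne κ hκ) hρne (congrArg Prod.fst he) ▸ hκ)
    have e2 : β (centre ρ, 1) = A' ρ := by
      simp only [hA']
      split_ifs with h
      · rfl
      · exact hβ0 _ hp fun κ hκ he =>
          h (centre_injOn (hne' κ hκ) hρne (congrArg Prod.fst he) ▸ hκ)
    rw [e1, e2]
    refine (abs_weight_sub_le hch hch' (fun ρ => ?_) (fun ρ => ?_) (fun ρ hρ => if_neg hρ)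
      (fun ρ hρ => if_neg hρ) key hρne).trans ?_
    · split_ifs <;> simp [hα.nonneg]
    · split_ifs <;> simp [hβ.nonneg]
    · have : (ρ.card : ℝ) ≤ N := by exact_mod_cast hN ρ hρ
      have := mul_le_mul_of_nonneg_right this hd
      linarith
  · rw [hα0 p hp fun ρ hρ he => hp' ⟨ρ, (hc ρ hρ).1, he⟩,
      hβ0 p hp fun ρ hρ he => hp' ⟨ρ, (hc' ρ hρ).1, he⟩, sub_zero, abs_zero]
    positivity

theorem card_sdPrism {X : PreAbstractSimplicialComplex V} {N : ℕ}
    (hN : ∀ σ ∈ X.faces, σ.card ≤ N) : ∀ σ ∈ (sdPrism X).faces, σ.card ≤ 2 * N := by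
  rintro _ ⟨τ, c, hτ, hc, hch, -, rfl⟩
  have h1 : τ.card ≤ N := by
    rcases hτ with rfl | h
    · simp
    · exact hN τ h
  have h2 : c.card ≤ N := card_chain_le hch fun ρ hρ =>
    ⟨(X.isRelLowerSet_faces (hc ρ hρ).1).1, hN ρ (hc ρ hρ).1⟩
  have h3 := Finset.card_union_le (τ.image (fun v => (vertex v, (0 : ℝ))))
    (c.image (fun ρ => (centre ρ, (1 : ℝ))))
  have h4 : (τ.image (fun v => (vertex v, (0 : ℝ)))).card ≤ τ.card := Finset.card_image_le
  have h5 : (c.image (fun ρ => (centre ρ, (1 : ℝ)))).card ≤ c.card := Finset.card_image_le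
  omega

/-- The block `Sd^n` of the prism has Lipschitz coordinates. -/
theorem rigid_iterate {X : PreAbstractSimplicialComplex V} {N : ℕ}
    (hN : ∀ σ ∈ X.faces, σ.card ≤ N) (n : ℕ) : (∃ L, 0 ≤ L ∧
      Rigid (Sd^[n] (sdPrism X)) dist1 (fun _ => True) L) ∧
      ∀ σ ∈ (Sd^[n] (sdPrism X)).faces, σ.card ≤ 2 * N := by
  induction n with
  | zero => exact ⟨⟨_, by positivity, rigid_sdPrism hN⟩, card_sdPrism hN⟩
  | succ n ih =>
    obtain ⟨⟨L, hL0, hL⟩, hcard⟩ := ih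
    rw [Function.iterate_succ_apply']
    exact ⟨⟨_, by positivity, hL.sd (hL.geo dist1_self fun _ _ _ _ => trivial) hcard⟩,
      card_sd hcard⟩

end Coordinates

end Cone

/-! ### Images of finite sets under injective and affine maps -/

namespace Geometric

section Push

open Classical

/-- The image of a finite set. -/
noncomputable def push {α β : Type*} (f : α → β) (σ : Finset α) : Finset β := σ.image f

variable {α β γ : Type*} {f : α → β} {σ τ : Finset α}

theorem image_eq_push [DecidableEq β] (f : α → β) (σ : Finset α) : σ.image f = push f σ := by
  rw [push]
  congr!

theorem mem_push {y : β} : y ∈ push f σ ↔ ∃ x ∈ σ, f x = y := Finset.mem_image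

theorem mem_push_of_mem {x : α} (h : x ∈ σ) : f x ∈ push f σ := mem_push.2 ⟨x, h, rfl⟩

theorem forall_mem_push {P : β → Prop} : (∀ y ∈ push f σ, P y) ↔ ∀ x ∈ σ, P (f x) := by
  simp [mem_push]

theorem push_nonempty : (push f σ).Nonempty ↔ σ.Nonempty := Finset.image_nonempty

theorem push_mono (h : σ ⊆ τ) : push f σ ⊆ push f τ := Finset.image_subset_image h

theorem push_subset_push (hf : Function.Injective f) : push f σ ⊆ push f τ ↔ σ ⊆ τ :=
  Finset.image_subset_image_iff hf

theorem push_injective (hf : Function.Injective f) : Function.Injective (push f) :=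
  Finset.image_injective hf

theorem subset_push_iff {κ : Finset β} : κ ⊆ push f σ ↔ ∃ ρ ⊆ σ, push f ρ = κ :=
  Finset.subset_image_iff

theorem push_push (g : β → γ) (f : α → β) (σ : Finset α) :
    push g (push f σ) = push (fun x => g (f x)) σ := by
  ext; simp [mem_push]

theorem push_congr {g : α → β} (h : ∀ x ∈ σ, f x = g x) : push f σ = push g σ :=
  Finset.image_congr h

theorem push_eq_self {g : α → α} (h : ∀ x ∈ σ, g x = x) : push g σ = σ := by
  ext x
  rw [mem_push]
  exact ⟨fun ⟨y, hy, e⟩ => by rw [← e, h y hy]; exact hy, fun hx => ⟨x, hx, h x hx⟩⟩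

theorem push_empty (f : α → β) : push f ∅ = ∅ := by ext; simp [mem_push]

theorem exists_push_eq {c : Finset β} {P : α → Prop} (h : ∀ y ∈ c, ∃ x, P x ∧ f x = y) :
    ∃ c' : Finset α, push f c' = c ∧ ∀ x ∈ c', P x := by
  rcases c.eq_empty_or_nonempty with rfl | ⟨y, hy⟩
  · exact ⟨∅, push_empty f, by simp⟩
  have : Nonempty α := ⟨(h y hy).choose⟩
  choose! g hg hg' using h
  refine ⟨push g c, ?_, ?_⟩
  · rw [push_push]
    exact push_eq_self hg'
  · rw [forall_mem_push]
    exact hg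

theorem isChain_push {f : Finset α → Finset β} (hf : ∀ σ τ, σ ⊆ τ → f σ ⊆ f τ)
    {c : Finset (Finset α)} (hc : IsChain (· ⊆ ·) (c : Set (Finset α))) :
    IsChain (· ⊆ ·) (push f c : Set (Finset β)) := by
  intro σ hσ τ hτ _
  obtain ⟨ρ, hρ, rfl⟩ := mem_push.1 (Finset.mem_coe.1 hσ)
  obtain ⟨κ, hκ, rfl⟩ := mem_push.1 (Finset.mem_coe.1 hτ)
  exact (hc.total hρ hκ).imp (hf _ _) (hf _ _)

theorem isChain_of_push {f : Finset α → Finset β} (hf : ∀ σ τ, f σ ⊆ f τ → σ ⊆ τ)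
    {c : Finset (Finset α)} (hc : IsChain (· ⊆ ·) (push f c : Set (Finset β))) :
    IsChain (· ⊆ ·) (c : Set (Finset α)) := fun _ hσ _ hτ _ =>
  (hc.total (Finset.mem_coe.2 (mem_push_of_mem hσ)) (Finset.mem_coe.2 (mem_push_of_mem hτ))).imp
    (hf _ _) (hf _ _)

theorem coe_push : (push f σ : Set β) = f '' (σ : Set α) := Finset.coe_image

theorem mem_map_iff [DecidableEq β] {K : PreAbstractSimplicialComplex α} {κ : Finset β} :
    κ ∈ (K.map f).faces ↔ ∃ σ ∈ K.faces, push f σ = κ := by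
  simp only [← image_eq_push]
  exact Iff.rfl

end Push

variable {F G : Type*} [AddCommGroup F] [Module ℝ F] [AddCommGroup G] [Module ℝ G]

open Classical in
theorem mem_sd_iff {F : Type w} [AddCommGroup F] [Module ℝ F] {K : PreAbstractSimplicialComplex F}
    {κ : Finset F} : κ ∈ (Sd K).faces ↔ ∃ c : Finset (Finset F), c.Nonempty ∧
      (∀ ρ ∈ c, ρ ∈ K.faces) ∧ IsChain (· ⊆ ·) (c : Set (Finset F)) ∧ κ = push bary c := by
  simp only [← image_eq_push]
  exact Iff.rfl

theorem exists_affine_eq (f : F →ᵃ[ℝ] G) : ∃ (L : F →ₗ[ℝ] G) (b : G), ∀ x, f x = L x + b :=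
  ⟨f.linear, f 0, fun x => by
    have := f.linearMap_vsub x 0
    simp only [vsub_eq_sub, sub_zero] at this
    rw [this, sub_add_cancel]⟩

theorem bary_push {f : F →ᵃ[ℝ] G} (hf : Function.Injective f) {σ : Finset F} (hσ : σ.Nonempty) :
    bary (push f σ) = f (bary σ) := by
  classical
  have hc : (σ.card : ℝ) ≠ 0 := by exact_mod_cast hσ.card_pos.ne'
  obtain ⟨L, b, hd⟩ := exists_affine_eq f
  rw [← image_eq_push, bary, bary, Finset.card_image_of_injective _ hf,
    Finset.sum_image hf.injOn]
  simp only [hd, Finset.sum_add_distrib, map_smul, map_sum, smul_add, Finset.sum_const]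
  rw [← Nat.cast_smul_eq_nsmul ℝ, smul_smul, inv_mul_cancel₀ hc, one_smul]

theorem convexHull_push (f : F →ᵃ[ℝ] G) (σ : Finset F) :
    convexHull ℝ (push f σ : Set G) = f '' convexHull ℝ (σ : Set F) := by
  rw [coe_push, AffineMap.image_convexHull]

theorem IsCoord.of_push {F G : Type w} [AddCommGroup F] [Module ℝ F] [AddCommGroup G]
    [Module ℝ G] {f : F →ᵃ[ℝ] G} (hf : Function.Injective f) {σ : Finset F} {y : G} {α : G → ℝ}
    (h : IsCoord (push f σ) y α) : ∃ x, f x = y ∧ IsCoord σ x fun v => α (f v) := by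
  classical
  obtain ⟨L, b, hd⟩ := exists_affine_eq f
  have h1 := h.sum
  have h2 := h.point
  rw [← image_eq_push, Finset.sum_image hf.injOn] at h1 h2
  refine ⟨_, ?_, fun v => h.nonneg _, fun v hv => h.zero _ fun hm => ?_, h1, rfl⟩
  · rw [hd, map_sum, ← h2]
    simp only [hd] at h1
    simp only [hd, smul_add, Finset.sum_add_distrib, map_smul]
    rw [← Finset.sum_smul, h1, one_smul]
  · obtain ⟨u, hu, he⟩ := mem_push.1 hm
    exact hv (hf he ▸ hu)

end Geometric

/-! ### Ends of the blocks, and levels as iterated subdivisions -/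

namespace Cone

open Geometric

section Boundary

open Classical

variable {V : Type w}

/-- The point of `X × ℝ` with given height. -/
noncomputable def atHeight (V : Type w) (e : ℝ) : (V →₀ ℝ) →ᵃ[ℝ] Pt V :=
  (AffineMap.id ℝ _).prod (AffineMap.const ℝ _ e)

theorem atHeight_apply (e : ℝ) (x : V →₀ ℝ) : atHeight V e x = (x, e) := rfl

theorem atHeight_injective (e : ℝ) : Function.Injective (atHeight V e) := fun _ _ h =>
  congrArg Prod.fst h

/-- `J` is the part of `K` at height `e`. -/
def IsPart (K : PreAbstractSimplicialComplex (Pt V)) (J : PreAbstractSimplicialComplex (V →₀ ℝ))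
    (e : ℝ) : Prop :=
  ∀ κ, (κ ∈ K.faces ∧ ∀ p ∈ κ, p.2 = e) ↔ ∃ σ ∈ J.faces, push (atHeight V e) σ = κ

theorem height_bary (σ : Finset (Pt V)) : (bary σ).2 = (σ.card : ℝ)⁻¹ * ∑ p ∈ σ, p.2 := by
  rw [bary, Prod.smul_snd, Prod.snd_sum, smul_eq_mul]

/-- An average of numbers on one side of `e` equals `e` only if all of them do. The sign of `ε`
selects the side, so that the bottom and the top of a block are treated at once. -/
theorem eq_of_height_bary {σ : Finset (Pt V)} (hσ : σ.Nonempty) {e ε : ℝ} (hε : ε ≠ 0)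
    (h : ∀ p ∈ σ, 0 ≤ ε * (p.2 - e)) (hb : (bary σ).2 = e) : ∀ p ∈ σ, p.2 = e := by
  have hc : (σ.card : ℝ) ≠ 0 := by exact_mod_cast hσ.card_pos.ne'
  have h0 : ∑ p ∈ σ, ε * (p.2 - e) = 0 := by
    rw [← Finset.mul_sum, Finset.sum_sub_distrib, Finset.sum_const, nsmul_eq_mul, ← hb, height_bary,
      mul_inv_cancel_left₀ hc, sub_self, mul_zero]
  intro p hp
  have := (Finset.sum_eq_zero_iff_of_nonneg h).1 h0 p hp
  exact sub_eq_zero.1 ((mul_eq_zero.1 this).resolve_left hε)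

/-- When the complex lies on one side of height `e`, a flag whose barycentres have that height
consists of simplices at that height. So subdivision commutes with passing to an end. -/
theorem IsPart.sd {K : PreAbstractSimplicialComplex (Pt V)}
    {J : PreAbstractSimplicialComplex (V →₀ ℝ)} {e ε : ℝ} (hε : ε ≠ 0)
    (hK : ∀ σ ∈ K.faces, ∀ p ∈ σ, 0 ≤ ε * (p.2 - e)) (h : IsPart K J e) :
    IsPart (Sd K) (Sd J) e := by
  have himg : ∀ c : Finset (Finset (V →₀ ℝ)), (∀ σ ∈ c, σ ∈ J.faces) →
      push (atHeight V e) (push bary c) = push bary (push (push (atHeight V e)) c) := by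
    intro c hc
    rw [push_push, push_push]
    exact push_congr fun σ hσ =>
      (bary_push (atHeight_injective e) (J.isRelLowerSet_faces (hc σ hσ)).1).symm
  intro κ
  simp only [mem_sd_iff]
  constructor
  · rintro ⟨⟨c, hc, hcK, hch, rfl⟩, he⟩
    obtain ⟨c', rfl, hcJ⟩ := exists_push_eq (f := push (atHeight V e)) (P := (· ∈ J.faces))
      fun ρ (hρ : ρ ∈ c) => (h ρ).1 ⟨hcK ρ hρ, eq_of_height_bary
        (K.isRelLowerSet_faces (hcK ρ hρ)).1 hε (hK ρ (hcK ρ hρ)) (he _ (mem_push_of_mem hρ))⟩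
    exact ⟨push bary c', ⟨c', push_nonempty.1 hc, hcJ,
      isChain_of_push (fun _ _ => (push_subset_push (atHeight_injective e)).1) hch, rfl⟩,
      himg c' hcJ⟩
  · rintro ⟨_, ⟨c, hc, hcJ, hch, rfl⟩, rfl⟩
    refine ⟨⟨push (push (atHeight V e)) c, push_nonempty.2 hc, ?_,
      isChain_push (fun _ _ => push_mono) hch, himg c hcJ⟩, ?_⟩
    · rw [forall_mem_push]
      exact fun σ hσ => ((h _).2 ⟨σ, hcJ σ hσ, rfl⟩).1
    · rw [forall_mem_push]
      exact fun _ _ => rfl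

variable {X : PreAbstractSimplicialComplex V}

theorem mem_realize {σ : Finset (V →₀ ℝ)} :
    σ ∈ (realize X).faces ↔ ∃ τ ∈ X.faces, push vertex τ = σ := mem_map_iff

theorem mem_sdPrism {σ : Finset (Pt V)} : σ ∈ (sdPrism X).faces ↔
    ∃ (τ : Finset V) (c : Finset (Finset V)), (τ = ∅ ∨ τ ∈ X.faces) ∧
    (∀ ρ ∈ c, ρ ∈ X.faces ∧ τ ⊆ ρ) ∧ IsChain (· ⊆ ·) (c : Set (Finset V)) ∧
    (τ.Nonempty ∨ c.Nonempty) ∧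
    ∀ p, p ∈ σ ↔ (∃ x ∈ τ, (vertex x, (0 : ℝ)) = p) ∨ ∃ ρ ∈ c, (centre ρ, (1 : ℝ)) = p := by
  constructor
  · rintro ⟨τ, c, h1, h2, h3, h4, rfl⟩
    exact ⟨τ, c, h1, h2, h3, h4, fun p => by simp⟩
  · rintro ⟨τ, c, h1, h2, h3, h4, h5⟩
    exact ⟨τ, c, h1, h2, h3, h4, by ext1 p; rw [h5 p]; simp⟩

theorem centre_eq_bary (ρ : Finset V) : centre ρ = bary (push vertex ρ) := by
  rw [centre, image_eq_push]

theorem isPart_sdPrism_bottom : IsPart (sdPrism X) (realize X) 0 := by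
  intro κ
  rw [mem_sdPrism]
  constructor
  · rintro ⟨⟨τ, c, hτ, hc, hch, hne, hκ⟩, he⟩
    have : c = ∅ := by
      rw [Finset.eq_empty_iff_forall_notMem]
      intro ρ hρ
      have := he (centre ρ, 1) ((hκ _).2 (Or.inr ⟨ρ, hρ, rfl⟩))
      simp at this
    subst this
    refine ⟨push vertex τ, mem_realize.2 ⟨τ, ?_, rfl⟩, ?_⟩
    · rcases hτ with rfl | h
      · simp at hne
      · exact h
    · ext p
      rw [push_push, mem_push, hκ]
      simp [atHeight_apply]
  · rintro ⟨_, hσ, rfl⟩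
    obtain ⟨τ, hτ, rfl⟩ := mem_realize.1 hσ
    refine ⟨⟨τ, ∅, Or.inr hτ, by simp, by simp, Or.inl (X.isRelLowerSet_faces hτ).1, ?_⟩, ?_⟩
    · intro p
      rw [push_push, mem_push]
      simp [atHeight_apply]
    · rw [forall_mem_push]
      exact fun _ _ => rfl

theorem isPart_sdPrism_top : IsPart (sdPrism X) (Sd (realize X)) 1 := by
  intro κ
  rw [mem_sdPrism]
  have himg : ∀ (c : Finset (Finset V)) p,
      p ∈ push (atHeight V 1) (push bary (push (push vertex) c)) ↔
      (∃ x ∈ (∅ : Finset V), (vertex x, (0 : ℝ)) = p) ∨ ∃ ρ ∈ c, (centre ρ, (1 : ℝ)) = p := by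
    intro c p
    rw [push_push, push_push, mem_push]
    simp [atHeight_apply, centre_eq_bary]
  constructor
  · rintro ⟨⟨τ, c, hτ, hc, hch, hne, hκ⟩, he⟩
    have : τ = ∅ := by
      rw [Finset.eq_empty_iff_forall_notMem]
      intro x hx
      have := he (vertex x, 0) ((hκ _).2 (Or.inl ⟨x, hx, rfl⟩))
      simp at this
    subst this
    refine ⟨push bary (push (push vertex) c), mem_sd_iff.2 ⟨push (push vertex) c, ?_, ?_,
      isChain_push (fun _ _ => push_mono) hch, rfl⟩, ?_⟩
    · rw [push_nonempty]
      simpa using hne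
    · rw [forall_mem_push]
      exact fun σ hσ => mem_realize.2 ⟨σ, (hc σ hσ).1, rfl⟩
    · ext p
      rw [himg, hκ]
  · rintro ⟨_, hσ, rfl⟩
    obtain ⟨c, hc, hcJ, hch, rfl⟩ := mem_sd_iff.1 hσ
    obtain ⟨c', rfl, hcX⟩ := exists_push_eq (f := push vertex) (P := (· ∈ X.faces))
      fun ρ (hρ : ρ ∈ c) => mem_realize.1 (hcJ ρ hρ)
    refine ⟨⟨∅, c', Or.inl rfl, fun ρ hρ => ⟨hcX ρ hρ, by simp⟩,
      isChain_of_push (fun _ _ => (push_subset_push vertex_injective).1) hch,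
      Or.inr (push_nonempty.1 hc), himg c'⟩, ?_⟩
    rw [forall_mem_push]
    exact fun _ _ => rfl

theorem prism_top [LinearOrder V] {κ : Finset (Pt V)} (h : κ ∈ (prism X).faces)
    (he : ∀ p ∈ κ, p.2 = 1) : ∃ σ ∈ (realize X).faces, push (atHeight V 1) σ = κ := by
  obtain ⟨a, b, hab, -, rfl⟩ := h
  have : a = ∅ := by
    rw [Finset.eq_empty_iff_forall_notMem]
    intro x hx
    have := he (vertex x, 0) (Finset.mem_union_left _ (Finset.mem_image_of_mem _ hx))
    simp at this
  subst this
  refine ⟨push vertex b, mem_realize.2 ⟨b, by convert hab; simp, rfl⟩, ?_⟩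
  ext p
  rw [push_push, mem_push]
  simp [atHeight_apply]

theorem sdPrism_slab (n : ℕ) : ∀ σ ∈ (Sd^[n] (sdPrism X)).faces,
    (σ : Set (Pt V)) ⊆ {p : Pt V | p.2 ∈ Set.Icc (0 : ℝ) 1} := by
  induction n with
  | zero =>
    rintro _ ⟨τ, c, -, -, -, -, rfl⟩ p hp
    simp only [Finset.mem_coe, Finset.mem_union, Finset.mem_image] at hp
    rcases hp with ⟨x, -, rfl⟩ | ⟨x, -, rfl⟩ <;> simp
  | succ n ih => rw [Function.iterate_succ_apply']; exact Sd_subset convex_slab ih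

theorem isPart_bottom (n : ℕ) : IsPart (Sd^[n] (sdPrism X)) (SdX X n) 0 := by
  induction n with
  | zero => exact isPart_sdPrism_bottom
  | succ n ih =>
    rw [SdX, Function.iterate_succ_apply', Function.iterate_succ_apply']
    refine IsPart.sd (ε := 1) one_ne_zero (fun σ hσ p hp => ?_) ih
    have := (sdPrism_slab n σ hσ hp).1
    simpa using this

theorem isPart_top (n : ℕ) : IsPart (Sd^[n] (sdPrism X)) (SdX X (n + 1)) 1 := by
  induction n with
  | zero => exact isPart_sdPrism_top
  | succ n ih =>
    rw [SdX, Function.iterate_succ_apply', Function.iterate_succ_apply']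
    refine IsPart.sd (ε := -1) (by norm_num) (fun σ hσ p hp => ?_) ih
    have := (sdPrism_slab n σ hσ hp).2
    linarith

end Boundary

section Heights

variable {V : Type w} (d : ℕ)

/-- The ratio of the exponential translation. -/
noncomputable def ratio : ℝ := ((d : ℝ) + 2) / (d + 1)

theorem one_lt_ratio : 1 < ratio d := by
  rw [ratio, lt_div_iff₀ (by positivity)]; linarith

theorem height_natCast_succ (n : ℕ) : height d ((n + 1 : ℕ) : ℤ) = ratio d * height d n + 1 := by
  rw [height_nat, height_nat, geom_sum_succ]
  rfl

theorem height_natCast_succ' (n : ℕ) :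
    height d ((n + 1 : ℕ) : ℤ) = height d n + ratio d ^ n := by
  rw [height_nat, height_nat, Finset.sum_range_succ]
  rfl

theorem height_zero : height d 0 = 0 := by simp [height]

theorem height_strictMono : StrictMono (height d) := strictMono_int_of_lt_succ (height_lt d)

theorem shift_iterate (k : ℕ) {t : ℝ} (ht : 0 ≤ t) :
    (shift d)^[k] t = ratio d ^ k * t + height d k := by
  have h1 : ∀ t, 0 ≤ t → shift d t = ratio d * t + 1 := by
    intro t ht
    rw [shift]
    split_ifs with h
    · rw [le_antisymm h ht]; simp
    · rfl
  have h0 : 0 < ratio d := by linarith [one_lt_ratio d]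
  induction k with
  | zero => simp [height_zero]
  | succ k ih =>
    rw [Function.iterate_succ_apply', ih, h1, height_natCast_succ, pow_succ]
    · ring
    · have : (0 : ℝ) ≤ height d k := by
        have := le_height d k
        push_cast at this
        linarith [Nat.cast_nonneg (α := ℝ) k]
      positivity

theorem height_nonneg (k : ℕ) : 0 ≤ height d k := by
  have := le_height d k
  push_cast at this
  linarith [Nat.cast_nonneg (α := ℝ) k]

theorem height_add (j k : ℕ) : height d ((j + k : ℕ) : ℤ) = ratio d ^ k * height d j + height d k := by
  induction k with
  | zero => simp [height_zero]
  | succ k ih => rw [← add_assoc, height_natCast_succ, ih, height_natCast_succ, pow_succ]; ring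

theorem blockMap_nat (j : ℕ) (p : Pt V) :
    blockMap d j p = (p.1, height d j + ratio d ^ j * p.2) := by
  rw [blockMap_apply, AffineMap.lineMap_apply]
  have := height_natCast_succ' d j
  push_cast at this
  rw [this]
  simp only [vsub_eq_sub, smul_eq_mul, vadd_eq_add, add_sub_cancel_left]
  ext1
  · rfl
  · show p.2 * _ + _ = _ + _ * p.2
    ring

theorem translate_eq (k : ℕ) {p : Pt V} (h : 0 ≤ p.2) :
    translate d k p = (p.1, ratio d ^ k * p.2 + height d k) := by
  rw [translate, shift_iterate d k h]

theorem translate_blockMap (j k : ℕ) {p : Pt V} (h : 0 ≤ p.2) :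
    translate d k (blockMap d j p) = blockMap d ((j + k : ℕ) : ℤ) p := by
  have h0 : 0 < ratio d := by linarith [one_lt_ratio d]
  have := height_nonneg d j
  rw [blockMap_nat, blockMap_nat, translate_eq, height_add, pow_add]
  · ext1
    · rfl
    · show _ * (_ + _) + _ = _ * _ + _ + _ * _
      ring
  · show 0 ≤ height d j + ratio d ^ j * p.2
    positivity

end Heights

section Levels

variable {V : Type w} {X : PreAbstractSimplicialComplex V} {d : ℕ}

theorem translate_push_blockMap (j k : ℕ) {κ : Finset (Pt V)} (h : ∀ p ∈ κ, 0 ≤ p.2) :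
    push (translate d k) (push (blockMap d j) κ) = push (blockMap d ((j + k : ℕ) : ℤ)) κ := by
  rw [push_push]
  exact push_congr fun p hp => translate_blockMap d j k (h p hp)

theorem blockMap_height_nonneg (j : ℕ) {p : Pt V} (h : 0 ≤ p.2) : 0 ≤ (blockMap d j p).2 := by
  have h0 : 0 < ratio d := by linarith [one_lt_ratio d]
  have := height_nonneg d j
  rw [blockMap_nat]
  show 0 ≤ height d j + ratio d ^ j * p.2
  positivity

theorem blockMap_height_mem (i : ℤ) {p : Pt V} (h : p.2 ∈ Set.Icc (0 : ℝ) 1) :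
    (blockMap d i p).2 ∈ Set.Icc (height d i) (height d (i + 1)) := by
  have hlt := height_lt d i
  rw [blockMap_apply, AffineMap.lineMap_apply]
  simp only [vsub_eq_sub, smul_eq_mul, vadd_eq_add, Set.mem_Icc] at h ⊢
  constructor <;> nlinarith

theorem blockMap_push_top (i : ℤ) (σ : Finset (V →₀ ℝ)) :
    push (blockMap d i) (push (atHeight V 1) σ) =
      push (blockMap d (i + 1)) (push (atHeight V 0) σ) := by
  rw [push_push, push_push]
  refine push_congr fun x _ => ?_
  simp [blockMap_apply, atHeight_apply]

theorem blockMap_height_eq {i : ℤ} {p : Pt V} (h : p.2 ∈ Set.Icc (0 : ℝ) 1)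
    (ht : height d (i + 1) ≤ (blockMap d i p).2) : p.2 = 1 := by
  have hlt := height_lt d i
  rw [blockMap_apply, AffineMap.lineMap_apply] at ht
  simp only [vsub_eq_sub, smul_eq_mul, vadd_eq_add, Set.mem_Icc] at h ht
  nlinarith [h.1, h.2]

theorem push_blockMap_bary {K : PreAbstractSimplicialComplex (Pt V)} (j : ℕ)
    {c : Finset (Finset (Pt V))} (hc : ∀ σ ∈ c, σ ∈ K.faces) :
    push (blockMap d j) (push bary c) = push bary (push (push (blockMap d j)) c) := by
  rw [push_push, push_push]
  exact push_congr fun σ hσ =>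
    (bary_push (blockMap_injective d j) (K.isRelLowerSet_faces (hc σ hσ)).1).symm

variable [LinearOrder V]

theorem mem_triangulation {σ : Finset (Pt V)} : σ ∈ (triangulation X d).faces ↔
    ∃ i : ℤ, ∃ κ ∈ (block X i).faces, push (blockMap d i) κ = σ := by
  simp only [← image_eq_push]
  exact Iff.rfl

theorem mem_level_iff {k : ℕ} {σ : Finset (Pt V)} : σ ∈ (level X d k).faces ↔
    push (translate d k) σ ∈ (triangulation X d).faces ∧ ∀ p ∈ σ, 0 ≤ p.2 := by
  rw [← image_eq_push]
  exact Iff.rfl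

theorem block_nat (j : ℕ) : block X j = Sd^[j] (sdPrism X) := by
  rw [block, if_pos (by omega)]
  rfl

/-- A simplex of the triangulation over large heights lies in a block of large index. -/
theorem exists_block {k : ℕ} {i : ℤ} {κ : Finset (Pt V)} (hκ : κ ∈ (block X i).faces)
    (hge : ∀ p ∈ κ, height d k ≤ (blockMap d i p).2) :
    ∃ j : ℕ, ∃ κ' ∈ (Sd^[j + k] (sdPrism X)).faces,
      push (blockMap d ((j + k : ℕ) : ℤ)) κ' = push (blockMap d i) κ := by
  have hslab := block_slab X i κ hκ
  rcases lt_or_ge i k with hlt | hle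
  · have hne := ((block X i).isRelLowerSet_faces hκ).1
    -- A block of smaller index reaches height `v_k` only if it is the one just below, and then only
    -- in its top, which is also the bottom of the next block.
    have hik : i = k - 1 := by
      obtain ⟨p, hp⟩ := hne
      have h1 := (hge p hp).trans (blockMap_height_mem i (hslab hp)).2
      have := (height_strictMono d).le_iff_le.1 h1
      omega
    have htop : ∀ p ∈ κ, p.2 = 1 := fun p hp =>
      blockMap_height_eq (i := i) (hslab hp) (by
        rw [show i + 1 = k by omega]
        exact hge p hp)
    have : ∃ σ ∈ (SdX X k).faces, push (atHeight V 1) σ = κ := by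
      -- For `k = 0` the block below is the product prism, with top `X`; otherwise it is a
      -- subdivided prism with top `Sd^k X`.
      rcases k with _ | k
      · have : i = -1 := by simpa using hik
        subst this
        exact prism_top (by simpa [block] using hκ) htop
      · have : i = (k : ℤ) := by rw [hik]; push_cast; ring
        subst this
        rw [block_nat] at hκ
        exact (isPart_top k κ).1 ⟨hκ, htop⟩
    obtain ⟨σ', hσ', rfl⟩ := this
    refine ⟨0, push (atHeight V 0) σ', ?_, ?_⟩
    · rw [zero_add]
      exact ((isPart_bottom k _).2 ⟨σ', hσ', rfl⟩).1
    · rw [blockMap_push_top, zero_add, hik, sub_add_cancel]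
  · obtain ⟨j, rfl⟩ : ∃ j : ℕ, i = ((j + k : ℕ) : ℤ) := ⟨(i - k).toNat, by omega⟩
    rw [block_nat] at hκ
    exact ⟨j, κ, hκ, rfl⟩

/-- The simplices of the levels. -/
theorem mem_level {k : ℕ} {σ : Finset (Pt V)} : σ ∈ (level X d k).faces ↔
    ∃ j : ℕ, ∃ κ ∈ (Sd^[j + k] (sdPrism X)).faces, push (blockMap d j) κ = σ := by
  rw [mem_level_iff, mem_triangulation]
  constructor
  · rintro ⟨⟨i, κ, hκ, he⟩, h0⟩
    -- The translation takes heights at least zero to heights at least `v_k`.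
    have hge : ∀ p ∈ κ, height d k ≤ (blockMap d i p).2 := by
      intro p hp
      obtain ⟨q, hq, hqp⟩ := mem_push.1 (he ▸ mem_push_of_mem (f := blockMap d i) hp)
      rw [← hqp, translate_eq d k (h0 q hq)]
      have := h0 q hq
      have h0 : 0 < ratio d := by linarith [one_lt_ratio d]
      show height d k ≤ ratio d ^ k * q.2 + height d k
      have : 0 ≤ ratio d ^ k * q.2 := by positivity
      linarith
    obtain ⟨j, κ', hκ', hj⟩ := exists_block hκ hge
    refine ⟨j, κ', hκ', push_injective (translate_injective d k) ?_⟩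
    rw [translate_push_blockMap j k fun p hp => (sdPrism_slab _ κ' hκ' hp).1, hj, he]
  · rintro ⟨j, κ, hκ, rfl⟩
    refine ⟨⟨((j + k : ℕ) : ℤ), κ, by rw [block_nat]; exact hκ, ?_⟩, ?_⟩
    · exact (translate_push_blockMap j k fun p hp => (sdPrism_slab _ κ hκ hp).1).symm
    · rw [forall_mem_push]
      exact fun q hq => blockMap_height_nonneg j (sdPrism_slab _ κ hκ hq).1

/-- A flag lies in the block of its largest member, and within a block the subdivision commutes with
the injective affine parametrization. -/
theorem sd_level (k : ℕ) : Sd (level X d k) = level X d (k + 1) := by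
  apply PreAbstractSimplicialComplex.ext
  ext κ
  rw [mem_level, mem_sd_iff]
  constructor
  · rintro ⟨c, hc, hcK, hch, rfl⟩
    obtain ⟨m, hm, hmax⟩ := exists_max_of_chain hc hch
    obtain ⟨j, μ, hμ, rfl⟩ := mem_level.1 (hcK m hm)
    obtain ⟨c', rfl, hc'⟩ := exists_push_eq (f := push (blockMap d j)) (P := (· ⊆ μ))
      fun ρ (hρ : ρ ∈ c) => subset_push_iff.1 (hmax ρ hρ)
    have hface : ∀ σ ∈ c', σ ∈ (Sd^[j + k] (sdPrism X)).faces := fun σ hσ =>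
      (PreAbstractSimplicialComplex.isRelLowerSet_faces _ hμ).2 (hc' σ hσ)
        (push_nonempty.1 ((level X d k).isRelLowerSet_faces (hcK _ (mem_push_of_mem hσ))).1)
    refine ⟨j, push bary c', ?_, push_blockMap_bary j hface⟩
    rw [← add_assoc, Function.iterate_succ_apply', mem_sd_iff]
    exact ⟨c', push_nonempty.1 hc, hface, isChain_of_push
      (fun _ _ => (push_subset_push (blockMap_injective d j)).1) hch, rfl⟩
  · rintro ⟨j, κ, hκ, rfl⟩
    rw [← add_assoc, Function.iterate_succ_apply', mem_sd_iff] at hκ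
    obtain ⟨c, hc, hcK, hch, rfl⟩ := hκ
    refine ⟨push (push (blockMap d j)) c, push_nonempty.2 hc, ?_,
      isChain_push (fun _ _ => push_mono) hch, push_blockMap_bary j hcK⟩
    rw [forall_mem_push]
    exact fun σ hσ => mem_level.2 ⟨j, σ, hcK σ hσ, rfl⟩

end Levels

end Cone

/-! ### Lipschitz coordinates on the levels -/

namespace Cone

open Geometric

section Covering

variable {V : Type w} {X : PreAbstractSimplicialComplex V}

theorem over_of_mem {κ : Finset (Pt V)} {ρ : Finset (V →₀ ℝ)}
    (h : ∀ p ∈ κ, p.1 ∈ convexHull ℝ (ρ : Set (V →₀ ℝ))) {q : Pt V}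
    (hq : q ∈ convexHull ℝ (κ : Set (Pt V))) : q.1 ∈ convexHull ℝ (ρ : Set (V →₀ ℝ)) := by
  have h1 := Set.mem_image_of_mem (LinearMap.fst ℝ (V →₀ ℝ) ℝ) hq
  rw [LinearMap.image_convexHull] at h1
  refine convexHull_min ?_ (convex_convexHull ℝ _) h1
  rintro _ ⟨p, hp, rfl⟩
  exact h p hp

theorem height_of_mem {κ : Finset (Pt V)} {a b : ℝ} (h : ∀ p ∈ κ, p.2 ∈ Set.Icc a b) {q : Pt V}
    (hq : q ∈ convexHull ℝ (κ : Set (Pt V))) : q.2 ∈ Set.Icc a b := by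
  have h1 := Set.mem_image_of_mem (LinearMap.snd ℝ (V →₀ ℝ) ℝ) hq
  rw [LinearMap.image_convexHull] at h1
  refine convexHull_min ?_ (convex_Icc a b) h1
  rintro _ ⟨p, hp, rfl⟩
  exact h p hp

/-- Blocks lie over `X`. -/
theorem exists_realize_carrier (n : ℕ) : ∀ κ ∈ (Sd^[n] (sdPrism X)).faces,
    ∃ ρ ∈ (realize X).faces, ∀ p ∈ κ, p.1 ∈ convexHull ℝ (ρ : Set (V →₀ ℝ)) := by
  induction n with
  | zero =>
    intro κ hκ
    obtain ⟨τ, c, hτ, hc, hch, hne, h⟩ := mem_sdPrism.1 hκ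
    obtain ⟨ρ, hρ, h1, h2⟩ : ∃ ρ ∈ X.faces, τ ⊆ ρ ∧ ∀ κ ∈ c, κ ⊆ ρ := by
      rcases c.eq_empty_or_nonempty with rfl | hcne
      · refine ⟨τ, ?_, Finset.Subset.refl _, by simp⟩
        rcases hτ with rfl | hτ
        · simp at hne
        · exact hτ
      · obtain ⟨m, hm, hmax⟩ := exists_max_of_chain hcne hch
        exact ⟨m, (hc m hm).1, (hc m hm).2, hmax⟩
    refine ⟨push vertex ρ, mem_realize.2 ⟨ρ, hρ, rfl⟩, fun p hp => ?_⟩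
    rcases (h p).1 hp with ⟨x, hx, rfl⟩ | ⟨κ, hκ, rfl⟩
    · exact subset_convexHull ℝ _ (Finset.mem_coe.2 (mem_push_of_mem (h1 hx)))
    · rw [centre_eq_bary]
      exact bary_mem_of_subset (push_nonempty.2 (X.isRelLowerSet_faces (hc κ hκ).1).1)
        (push_mono (h2 κ hκ))
  | succ n ih =>
    intro κ hκ
    rw [Function.iterate_succ_apply'] at hκ
    obtain ⟨σ, hσ, h1⟩ := exists_carrier_sd hκ
    obtain ⟨ρ, hρ, h2⟩ := ih σ hσ
    refine ⟨ρ, hρ, fun p hp => ?_⟩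
    exact over_of_mem h2 (h1 p hp)

theorem exists_mem_iterate_sd {F : Type w} [AddCommGroup F] [Module ℝ F]
    {K : PreAbstractSimplicialComplex F} (n : ℕ) {σ : Finset F} (hσ : σ ∈ K.faces) {x : F}
    (hx : x ∈ convexHull ℝ (σ : Set F)) : ∃ κ ∈ (Sd^[n] K).faces, x ∈ convexHull ℝ (κ : Set F) ∧
      ∀ w ∈ κ, w ∈ convexHull ℝ (σ : Set F) := by
  induction n with
  | zero => exact ⟨σ, hσ, hx, fun w hw => subset_convexHull ℝ _ hw⟩
  | succ n ih =>
    obtain ⟨κ, hκ, hxκ, h⟩ := ih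
    obtain ⟨κ', hκ', hx', h'⟩ := exists_mem_sd hκ hxκ
    rw [Function.iterate_succ_apply']
    refine ⟨κ', hκ', hx', fun w hw => ?_⟩
    obtain ⟨ρ, hρ, hsub, rfl⟩ := h' w hw
    exact convexHull_subset_of_forall (convex_convexHull ℝ _) (fun u hu => h u (hsub hu))
      (bary_mem (PreAbstractSimplicialComplex.isRelLowerSet_faces _ hρ).1)

end Covering

section LevelCoordinates

variable {V : Type w} {X : PreAbstractSimplicialComplex V} {d : ℕ}

theorem IsCoord.le_one {F : Type w} [AddCommGroup F] [Module ℝ F] {σ : Finset F} {x : F}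
    {α : F → ℝ} (h : IsCoord σ x α) (v : F) : α v ≤ 1 := by
  by_cases hv : v ∈ σ
  · rw [← h.sum]
    exact Finset.single_le_sum (fun u _ => h.nonneg u) hv
  · rw [h.zero v hv]
    exact zero_le_one

/-- Block `j` is stretched vertically by the `j`-th power of the ratio, which is at least one. So
Lipschitz constants of the unit prism remain valid. -/
theorem dist1_le_dist1_blockMap (j : ℕ) (p q : Pt V) :
    dist1 p q ≤ dist1 (blockMap d j p) (blockMap d j q) := by
  have h1 : 1 ≤ ratio d ^ j := one_le_pow₀ (one_lt_ratio d).le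
  rw [blockMap_nat, blockMap_nat, dist1, dist1]
  show _ ≤ norm1 (p.1 - q.1) + |height d j + ratio d ^ j * p.2 - (height d j + ratio d ^ j * q.2)|
  rw [add_sub_add_left_eq_sub, ← mul_sub, abs_mul, abs_of_nonneg (zero_le_one.trans h1)]
  nlinarith [abs_nonneg (p.2 - q.2)]

theorem rigid_block {j : ℕ} {L : ℝ} (hL0 : 0 ≤ L)
    (hL : Rigid (Sd^[j] (sdPrism X)) dist1 (fun _ => True) L) {κ κ' : Finset (Pt V)}
    (hκ : κ ∈ (Sd^[j] (sdPrism X)).faces) (hκ' : κ' ∈ (Sd^[j] (sdPrism X)).faces) {x y : Pt V}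
    {α β : Pt V → ℝ} (hα : IsCoord (push (blockMap d j) κ) x α)
    (hβ : IsCoord (push (blockMap d j) κ') y β) (v : Pt V) : |α v - β v| ≤ L * dist1 x y := by
  have hinj := blockMap_injective (V := V) d j
  obtain ⟨x', rfl, hα'⟩ := hα.of_push hinj
  obtain ⟨y', rfl, hβ'⟩ := hβ.of_push hinj
  by_cases hv : ∃ u, blockMap d j u = v
  · obtain ⟨u, rfl⟩ := hv
    exact (hL κ hκ κ' hκ' x' y' _ _ trivial trivial hα' hβ' u).trans
      (mul_le_mul_of_nonneg_left (dist1_le_dist1_blockMap j x' y') hL0)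
  · rw [hα.zero v fun h => hv ?_, hβ.zero v fun h => hv ?_, sub_zero, abs_zero]
    · exact mul_nonneg hL0 (dist1_nonneg _ _)
    · obtain ⟨u, -, hu⟩ := mem_push.1 h; exact ⟨u, hu⟩
    · obtain ⟨u, -, hu⟩ := mem_push.1 h; exact ⟨u, hu⟩

theorem exists_of_mem_block {j : ℕ} {κ : Finset (Pt V)} (hκ : κ ∈ (Sd^[j] (sdPrism X)).faces)
    {x : Pt V} (hx : x ∈ convexHull ℝ (push (blockMap d j) κ : Set (Pt V))) :
    x.2 ∈ Set.Icc (height d j) (height d ((j + 1 : ℕ) : ℤ)) ∧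
    ∃ ρ ∈ (realize X).faces, x.1 ∈ convexHull ℝ (ρ : Set (V →₀ ℝ)) := by
  rw [convexHull_push] at hx
  obtain ⟨p, hp, rfl⟩ := hx
  refine ⟨?_, ?_⟩
  · have := blockMap_height_mem (d := d) j (height_of_mem
      (fun q hq => sdPrism_slab j κ hκ hq) hp)
    push_cast
    exact this
  · obtain ⟨ρ, hρ, h⟩ := exists_realize_carrier j κ hκ
    exact ⟨ρ, hρ, over_of_mem (q := p) h hp⟩

/-- Both points are compared with the point `z` over `x` on the common end of the blocks. Its height
lies between those of `x` and `y`, so neither comparison exceeds the distance of `x` and `y`, and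
its coordinates may be read in either block. -/
theorem rigid_adjacent {j : ℕ} {L L' : ℝ} (hL0 : 0 ≤ L) (hL0' : 0 ≤ L')
    (hL : Rigid (Sd^[j] (sdPrism X)) dist1 (fun _ => True) L)
    (hL' : Rigid (Sd^[j + 1] (sdPrism X)) dist1 (fun _ => True) L') {κ κ' : Finset (Pt V)}
    (hκ : κ ∈ (Sd^[j] (sdPrism X)).faces) (hκ' : κ' ∈ (Sd^[j + 1] (sdPrism X)).faces) {x y : Pt V}
    {α β : Pt V → ℝ} (hα : IsCoord (push (blockMap d j) κ) x α)
    (hβ : IsCoord (push (blockMap d ((j + 1 : ℕ) : ℤ)) κ') y β) (v : Pt V) :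
    |α v - β v| ≤ (L + L') * dist1 x y := by
  obtain ⟨hx2, ρ, hρ, hx1⟩ := exists_of_mem_block hκ hα.mem
  obtain ⟨hy2, -⟩ := exists_of_mem_block hκ' hβ.mem
  obtain ⟨μ, hμ, hxμ, -⟩ := exists_mem_iterate_sd (j + 1) hρ hx1
  set z : Pt V := (x.1, height d ((j + 1 : ℕ) : ℤ)) with hz
  have hzμ : z ∈ convexHull ℝ (push (blockMap d j) (push (atHeight V 1) μ) : Set (Pt V)) := by
    rw [convexHull_push, convexHull_push]
    refine ⟨_, ⟨_, hxμ, rfl⟩, ?_⟩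
    rw [atHeight_apply, blockMap_apply]
    simp [hz]
  obtain ⟨γ, hγ⟩ := Geometric.mem_convexHull_iff.1 hzμ
  have hγ' := hγ
  rw [blockMap_push_top] at hγ'
  have h1 := rigid_block hL0 hL hκ ((isPart_top j _).2 ⟨μ, hμ, rfl⟩).1 hα hγ v
  have h2 := rigid_block hL0' hL' ((isPart_bottom (j + 1) _).2 ⟨μ, hμ, rfl⟩).1 hκ'
    (by simpa using hγ') hβ v
  have hn := norm1_nonneg (x.1 - y.1)
  have hle : |x.2 - y.2| = y.2 - x.2 := by
    rw [abs_sub_comm, abs_of_nonneg]; linarith [hx2.2, hy2.1]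
  have d1 : dist1 x z ≤ dist1 x y := by
    rw [dist1, dist1, hz]
    simp only [sub_self, norm1_zero, zero_add]
    rw [hle, abs_sub_comm, abs_of_nonneg (by linarith [hx2.2])]
    linarith [hy2.1]
  have d2 : dist1 z y ≤ dist1 x y := by
    rw [dist1, dist1, hz]
    simp only
    rw [hle, abs_sub_comm, abs_of_nonneg (by linarith [hy2.1])]
    linarith [hx2.2]
  calc |α v - β v| ≤ |α v - γ v| + |γ v - β v| := abs_sub_le _ _ _
    _ ≤ L * dist1 x y + L' * dist1 x y := add_le_add
        (h1.trans (mul_le_mul_of_nonneg_left d1 hL0)) (h2.trans (mul_le_mul_of_nonneg_left d2 hL0'))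
    _ = _ := by ring

/-- A block of height at least one separates the points, and coordinates differ by at most one. -/
theorem rigid_distant {j j' : ℕ} (hj : j + 2 ≤ j') {κ κ' : Finset (Pt V)}
    (hκ : κ ∈ (Sd^[j] (sdPrism X)).faces) (hκ' : κ' ∈ (Sd^[j'] (sdPrism X)).faces) {x y : Pt V}
    {α β : Pt V → ℝ} (hα : IsCoord (push (blockMap d j) κ) x α)
    (hβ : IsCoord (push (blockMap d j') κ') y β) (v : Pt V) :
    |α v - β v| ≤ dist1 x y := by
  obtain ⟨hx2, -⟩ := exists_of_mem_block hκ hα.mem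
  obtain ⟨hy2, -⟩ := exists_of_mem_block hκ' hβ.mem
  have h1 : height d ((j + 2 : ℕ) : ℤ) ≤ height d j' :=
    (height_strictMono d).monotone (by exact_mod_cast hj)
  have h2 := height_natCast_succ' d (j + 1)
  have h3 : 1 ≤ ratio d ^ (j + 1) := one_le_pow₀ (one_lt_ratio d).le
  have h4 : 1 ≤ dist1 x y := by
    rw [dist1]
    have := norm1_nonneg (x.1 - y.1)
    have := neg_abs_le (x.2 - y.2)
    linarith [hx2.2, hy2.1]
  refine le_trans ?_ h4
  rw [abs_le]
  constructor <;> linarith [IsCoord.le_one hα v, IsCoord.le_one hβ v, hα.nonneg v, hβ.nonneg v]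

variable [LinearOrder V]

theorem rigid_level_zero (hd : ∀ σ ∈ X.faces, σ.card ≤ d + 1) (H : ℝ) : ∃ L, 0 ≤ L ∧
    Rigid (level X d 0) dist1 (fun p => p.2 ≤ H) L := by
  choose L hL0 hL using fun n => (rigid_iterate hd n).1
  -- Since `v_j` is at least `j`, every block that reaches below `H` is counted here, so `S`
  -- dominates each relevant constant. The final `2 * S + 1` covers equal, adjacent and distant
  -- blocks.
  set S := ∑ j ∈ Finset.range (⌈H⌉₊ + 1), L j with hS
  have hS0 : 0 ≤ S := Finset.sum_nonneg fun j _ => hL0 j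
  have hle : ∀ j : ℕ, height d j ≤ H → L j ≤ S := by
    intro j hj
    refine Finset.single_le_sum (fun j _ => hL0 j) (Finset.mem_range.2 ?_)
    have h1 : (j : ℝ) ≤ H := by
      have := le_height d j
      push_cast at this
      linarith
    have h2 : (j : ℝ) ≤ ⌈H⌉₊ := h1.trans (Nat.le_ceil H)
    have : j ≤ ⌈H⌉₊ := by exact_mod_cast h2
    omega
  have key : ∀ {j j' : ℕ} (_ : j ≤ j') {κ κ' : Finset (Pt V)}
    (_ : κ ∈ (Sd^[j] (sdPrism X)).faces) (_ : κ' ∈ (Sd^[j'] (sdPrism X)).faces) {x y : Pt V}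
    (_ : x.2 ≤ H) (_ : y.2 ≤ H)
    {α β : Pt V → ℝ} (_ : IsCoord (push (blockMap d j) κ) x α)
    (_ : IsCoord (push (blockMap d j') κ') y β) (v : Pt V),
    |α v - β v| ≤ (2 * S + 1) * dist1 x y := by
    intro j j' hjj κ κ' hκ hκ' x y hx hy α β hα hβ v
    have hxj := hle j ((exists_of_mem_block hκ hα.mem).1.1.trans hx)
    have hyj := hle j' ((exists_of_mem_block hκ' hβ.mem).1.1.trans hy)
    have hd0 := dist1_nonneg x y
    rcases hjj.eq_or_lt with rfl | hlt
    · exact (rigid_block (hL0 j) (hL j) hκ hκ' hα hβ v).trans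
        (mul_le_mul_of_nonneg_right (by linarith) hd0)
    · rcases (Nat.succ_le_of_lt hlt).eq_or_lt with rfl | hlt
      · exact (rigid_adjacent (hL0 _) (hL0 _) (hL _) (hL _) hκ hκ' hα hβ v).trans
          (mul_le_mul_of_nonneg_right (by linarith) hd0)
      · refine (rigid_distant (Nat.succ_le_of_lt hlt) hκ hκ' hα hβ v).trans ?_
        have := mul_le_mul_of_nonneg_right (show (1 : ℝ) ≤ 2 * S + 1 by linarith) hd0
        linarith
  refine ⟨2 * S + 1, by positivity, ?_⟩
  intro σ hσ τ hτ x y α β hx hy hα hβ v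
  obtain ⟨j, κ, hκ, rfl⟩ := mem_level.1 hσ
  obtain ⟨j', κ', hκ', rfl⟩ := mem_level.1 hτ
  rw [add_zero] at hκ hκ'
  rcases le_total j j' with h | h
  · exact key h hκ hκ' hx hy hα hβ v
  · rw [abs_sub_comm, dist1_comm]
    exact key h hκ' hκ hy hx hβ hα v

theorem card_level (hd : ∀ σ ∈ X.faces, σ.card ≤ d + 1) (k : ℕ) :
    ∀ σ ∈ (level X d k).faces, σ.card ≤ 2 * (d + 1) := by
  classical
  intro σ hσ
  obtain ⟨j, κ, hκ, rfl⟩ := mem_level.1 hσ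
  rw [← image_eq_push]
  exact Finset.card_image_le.trans ((rigid_iterate hd (j + k)).2 κ hκ)

theorem geo_level (hd : ∀ σ ∈ X.faces, σ.card ≤ d + 1) (k : ℕ) : Geo (level X d k) := by
  induction k with
  | zero =>
    intro σ hσ τ hτ x α β hα hβ
    -- Uniqueness concerns one point at a time, so its own height serves as the bound.
    obtain ⟨L, -, hL⟩ := rigid_level_zero hd x.2
    funext v
    have := hL σ hσ τ hτ x x α β le_rfl le_rfl hα hβ v
    rw [dist1_self, mul_zero] at this
    exact sub_eq_zero.1 (abs_eq_zero.1 (le_antisymm this (abs_nonneg _)))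
  | succ k ih =>
    rw [← sd_level]
    exact ih.sd (card_level hd k)

/-- Barycentric coordinates of levels are Lipschitz at bounded height. -/
theorem rigid_level (hd : ∀ σ ∈ X.faces, σ.card ≤ d + 1) (H : ℝ) (k : ℕ) : ∃ L, 0 ≤ L ∧
    Rigid (level X d k) dist1 (fun p => p.2 ≤ H) L := by
  induction k with
  | zero => exact rigid_level_zero hd H
  | succ k ih =>
    obtain ⟨L, hL0, hL⟩ := ih
    rw [← sd_level]
    exact ⟨_, by positivity, hL.sd (geo_level hd k) (card_level hd k)⟩

end LevelCoordinates

end Cone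

open Classical in
theorem VertexMap.mem_onFaces {α β : Type w} {K' : PreAbstractSimplicialComplex α}
    {K : PreAbstractSimplicialComplex β} {r : α → β} (hr : VertexMap.IsSimplicial K' K r)
    {S : K'.faces} {u : β} : u ∈ (VertexMap.onFaces hr S).1 ↔ ∃ w ∈ S.1, r w = u :=
  Finset.mem_image

open Classical in
theorem FlagData.mem_carrier {α β : Type w} {K' : PreAbstractSimplicialComplex α}
    {K : PreAbstractSimplicialComplex β} {r : α → β} {F : FlagData K r} (hF : F.Describes K')
    {S : K'.faces} {u : β} : u ∈ (FlagData.carrier hF S).1 ↔ ∃ w ∈ S.1, u ∈ F.car w :=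
  Finset.mem_biUnion

/-! ### Squeezing of fine simplices, and what the labels mean -/

namespace Cone

open Geometric

theorem composite_add {V : Type w} (r : ℕ → Pt V → Pt V) (m i j : ℕ) (w : Pt V) :
    composite r m (i + j) w = composite r m i (composite r (m + i) j w) := by
  induction j generalizing w with
  | zero => rfl
  | succ j ih =>
    show composite r m (i + j) (r (m + (i + j)) w) = _
    rw [ih, ← add_assoc]
    rfl

section LevelGeometry

variable {V : Type w} [LinearOrder V] {X : PreAbstractSimplicialComplex V} {d : ℕ}

theorem convexHull_subset_convexHull {F : Type w} [AddCommGroup F] [Module ℝ F] {κ σ : Finset F}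
    (h : ∀ w ∈ κ, w ∈ convexHull ℝ (σ : Set F)) {x : F} (hx : x ∈ convexHull ℝ (κ : Set F)) :
    x ∈ convexHull ℝ (σ : Set F) :=
  convexHull_subset_of_forall (convex_convexHull ℝ _) h hx

theorem mem_level_succ {k : ℕ} {κ : Finset (Pt V)} : κ ∈ (level X d (k + 1)).faces ↔
    ∃ c : Finset (Finset (Pt V)), c.Nonempty ∧ (∀ ρ ∈ c, ρ ∈ (level X d k).faces) ∧
      IsChain (· ⊆ ·) (c : Set (Finset (Pt V))) ∧ κ = push bary c := by
  rw [← sd_level, mem_sd_iff]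

theorem exists_vertex {k : ℕ} {κ : Finset (Pt V)} (hκ : κ ∈ (level X d (k + 1)).faces) {w : Pt V}
    (hw : w ∈ κ) : ∃ ρ ∈ (level X d k).faces, w = bary ρ := by
  obtain ⟨c, -, hcK, -, rfl⟩ := mem_level_succ.1 hκ
  obtain ⟨ρ, hρ, rfl⟩ := mem_push.1 hw
  exact ⟨ρ, hcK ρ hρ, rfl⟩

theorem level_nonempty {k : ℕ} {σ : Finset (Pt V)} (hσ : σ ∈ (level X d k).faces) : σ.Nonempty :=
  ((level X d k).isRelLowerSet_faces hσ).1

/-- A closed simplex is covered by the simplices of finer levels inside it. -/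
theorem exists_mem_level_add {m : ℕ} (j : ℕ) {σ : Finset (Pt V)} (hσ : σ ∈ (level X d m).faces)
    {x : Pt V} (hx : x ∈ convexHull ℝ (σ : Set (Pt V))) : ∃ κ ∈ (level X d (m + j)).faces,
      x ∈ convexHull ℝ (κ : Set (Pt V)) ∧ ∀ w ∈ κ, w ∈ convexHull ℝ (σ : Set (Pt V)) := by
  have key : Sd^[j] (level X d m) = level X d (m + j) := by
    induction j with
    | zero => rfl
    | succ j ih => rw [Function.iterate_succ_apply', ih, sd_level, add_assoc]
  obtain ⟨κ, hκ, h⟩ := exists_mem_iterate_sd j hσ hx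
  exact ⟨κ, key ▸ hκ, h⟩

theorem exists_carrier_level_add {m : ℕ} (j : ℕ) {κ : Finset (Pt V)}
    (hκ : κ ∈ (level X d (m + j)).faces) : ∃ σ ∈ (level X d m).faces,
      ∀ w ∈ κ, w ∈ convexHull ℝ (σ : Set (Pt V)) := by
  induction j generalizing κ with
  | zero => exact ⟨κ, hκ, fun w hw => subset_convexHull ℝ _ hw⟩
  | succ j ih =>
    rw [← add_assoc, ← sd_level] at hκ
    obtain ⟨ρ, hρ, h⟩ := exists_carrier_sd hκ
    obtain ⟨σ, hσ, h'⟩ := ih hρ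
    exact ⟨σ, hσ, fun w hw => convexHull_subset_convexHull h' (h w hw)⟩

variable (hd : ∀ σ ∈ X.faces, σ.card ≤ d + 1)
include hd

theorem vertex_mem_of_mem_convexHull {k : ℕ} {σ κ : Finset (Pt V)} (hσ : σ ∈ (level X d k).faces)
    (hκ : κ ∈ (level X d k).faces) {w : Pt V} (hw : w ∈ κ)
    (h : w ∈ convexHull ℝ (σ : Set (Pt V))) : w ∈ σ := by
  have h1 : ({w} : Finset (Pt V)) ∈ (level X d k).faces :=
    ((level X d k).isRelLowerSet_faces hκ).2 (Finset.singleton_subset_iff.2 hw) ⟨w, by simp⟩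
  have h2 : bary ({w} : Finset (Pt V)) = w := by simp [bary]
  exact (geo_level hd k).subset_of_bary h1 hσ (by rw [h2]; exact h) (by simp)

/-- If a closed simplex of a coarser level contains a point, it contains its carrier. -/
theorem mem_convexHull_of_isCoord {m j : ℕ} {σ κ : Finset (Pt V)} (hσ : σ ∈ (level X d m).faces)
    (hκ : κ ∈ (level X d (m + j)).faces) {x : Pt V} {α : Pt V → ℝ} (h : IsCoord κ x α)
    (hx : x ∈ convexHull ℝ (σ : Set (Pt V))) {v : Pt V} (hv : v ∈ κ) (hα : α v ≠ 0) :
    v ∈ convexHull ℝ (σ : Set (Pt V)) := by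
  obtain ⟨κ', hκ', hx', h'⟩ := exists_mem_level_add j hσ hx
  exact h' v ((geo_level hd (m + j)).subset_of_isCoord hκ hκ' h hx' v hv hα)

theorem mem_convexHull_of_bary {m j : ℕ} {σ κ : Finset (Pt V)} (hσ : σ ∈ (level X d m).faces)
    (hκ : κ ∈ (level X d (m + j)).faces) (hx : bary κ ∈ convexHull ℝ (σ : Set (Pt V))) :
    ∀ v ∈ κ, v ∈ convexHull ℝ (σ : Set (Pt V)) := by
  classical
  intro v hv
  have hne := level_nonempty hκ
  refine mem_convexHull_of_isCoord hd hσ hκ (isCoord_bary hne) hx hv ?_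
  have : (κ.card : ℝ) ≠ 0 := by exact_mod_cast hne.card_pos.ne'
  simp [hv, this]

/-- The smallest simplex of a coarser level that contains a simplex. -/
theorem exists_inner_carrier {m j : ℕ} {T : Finset (Pt V)} (hT : T ∈ (level X d (m + j)).faces) :
    ∃ κ ∈ (level X d m).faces, (∀ w ∈ T, w ∈ convexHull ℝ (κ : Set (Pt V))) ∧
      ∃ α, IsCoord κ (bary T) α ∧ ∀ v ∈ κ, α v ≠ 0 := by
  classical
  have hne := level_nonempty hT
  obtain ⟨μ, hμ, hTμ⟩ := exists_carrier_level_add j hT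
  obtain ⟨β, hβ⟩ := Geometric.mem_convexHull_iff.1
    (convexHull_subset_convexHull hTμ (bary_mem hne))
  -- Dropping the vertices with zero coordinate leaves the face that has the barycentre of `T` as an
  -- inner point.
  have hs : IsCoord (μ.filter fun v => β v ≠ 0) (bary T) β :=
    hβ.of_support fun v hv h => Finset.mem_filter.2 ⟨hv, h⟩
  have hface : (μ.filter fun v => β v ≠ 0) ∈ (level X d m).faces := by
    refine ((level X d m).isRelLowerSet_faces hμ).2 (Finset.filter_subset _ μ) ?_
    rw [Finset.nonempty_iff_ne_empty]
    intro h
    have := hs.sum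
    rw [h] at this
    simp at this
  exact ⟨_, hface, mem_convexHull_of_bary (m := m) hd hface hT hs.mem, β, hs,
    fun v hv => (Finset.mem_filter.1 hv).2⟩

variable {r : ℕ → Pt V → Pt V} (hr : IsSqueezing X d r)
include hr

/-- The approximations preserve all closed simplices. -/
theorem composite_mem {n j : ℕ} {κ T : Finset (Pt V)} (hκ : κ ∈ (level X d n).faces)
    (hT : T ∈ (level X d (n + j)).faces) {w : Pt V} (hw : w ∈ T)
    (h : w ∈ convexHull ℝ (κ : Set (Pt V))) : composite r n j w ∈ κ := by
  induction j generalizing T w with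
  | zero => exact vertex_mem_of_mem_convexHull hd hκ hT hw h
  | succ j ih =>
    obtain ⟨ρ, hρ, rfl⟩ := exists_vertex hT hw
    have h1 := hr.approximation (n + j) T hT _ hw ρ hρ (bary_mem (level_nonempty hρ))
    -- A closed simplex that contains the barycentre of `ρ` contains all vertices of `ρ`, in
    -- particular the one chosen by the approximation.
    exact ih hρ h1 (mem_convexHull_of_bary hd hκ hρ h _ h1)

/-- Sufficiently fine simplices near a point of a closed simplex are squeezed into it. -/
theorem exists_squeeze (m : ℕ) (H : ℝ) : ∃ (k : ℕ) (δ : ℝ), 0 < δ ∧ δ ≤ 1 ∧ ∀ j, k ≤ j →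
    ∀ σ ∈ (level X d m).faces, ∀ z ∈ convexHull ℝ (σ : Set (Pt V)), z.2 ≤ H →
    ∀ T ∈ (level X d (m + j)).faces, dist1 (bary T) z ≤ δ → ∀ w ∈ T, composite r m j w ∈ σ := by
  obtain ⟨k, hk⟩ := hr.retraction m
  obtain ⟨L, hL0, hL⟩ := rigid_level hd (H + 1) (m + k)
  set N : ℝ := 2 * (d + 1) with hN
  have hN0 : 0 < N := by positivity
  -- Within this distance a coordinate changes by at most `1 / (2 * N)`, half of the coordinate
  -- found below; the bound 1 keeps `T` below height `H + 1`, where `L` is valid.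
  refine ⟨k, min 1 (1 / (2 * N * (L + 1))), by positivity, min_le_left _ _, ?_⟩
  intro j hj σ hσ z hz hzH T hT hTz w hw
  obtain ⟨i, rfl⟩ := Nat.exists_eq_add_of_le hj
  rw [← add_assoc] at hT
  rw [composite_add]
  have hTne := level_nonempty hT
  obtain ⟨κ, hκ, hzκ, hκσ⟩ := exists_mem_level_add k hσ hz
  obtain ⟨α, hα⟩ := Geometric.mem_convexHull_iff.1 hzκ
  obtain ⟨μ, hμ, hTμ⟩ := exists_carrier_level_add i hT
  obtain ⟨β, hβ⟩ := Geometric.mem_convexHull_iff.1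
    (convexHull_subset_convexHull hTμ (bary_mem hTne))
  -- At most `N` coordinates add up to one.
  obtain ⟨v, hv, hvα⟩ : ∃ v ∈ κ, 1 / N ≤ α v := by
    by_contra hn
    push Not at hn
    have h1 : ∑ v ∈ κ, α v < ∑ v ∈ κ, 1 / N := Finset.sum_lt_sum_of_nonempty
      (level_nonempty hκ) hn
    rw [hα.sum, Finset.sum_const, nsmul_eq_mul, mul_one_div, lt_div_iff₀ hN0, one_mul] at h1
    have h2 : (κ.card : ℝ) ≤ N := by
      rw [hN]; exact_mod_cast card_level hd (m + k) κ hκ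
    linarith
  have hheight : (bary T).2 ≤ H + 1 := by
    have h1 := hTz.trans (min_le_left _ _)
    rw [dist1] at h1
    have := norm1_nonneg ((bary T).1 - z.1)
    have := le_abs_self ((bary T).2 - z.2)
    linarith
  -- The coordinate at `v` survives the passage from `z` to the barycentre of `T`, so `v` is a
  -- vertex of the simplex `μ` that carries `T`.
  have hβv : β v ≠ 0 := by
    intro h0
    have h1 := hL κ hκ μ hμ z (bary T) α β (by linarith) hheight hα hβ v
    rw [h0, sub_zero, dist1_comm] at h1
    have h2 := (le_abs_self _).trans h1
    have h3 : L * dist1 (bary T) z ≤ (L + 1) * (1 / (2 * N * (L + 1))) :=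
      mul_le_mul (by linarith) (hTz.trans (min_le_right _ _)) (dist1_nonneg _ _) (by linarith)
    have h4 : (L + 1) * (1 / (2 * N * (L + 1))) = 1 / N / 2 := by
      have : L + 1 ≠ 0 := by positivity
      field_simp
    have : 0 < 1 / N := by positivity
    linarith
  -- The upper steps send `T` into `μ`. Since `μ` has the vertex `v` in `σ`, the retraction property
  -- sends it into `σ` in `k` more steps.
  exact hk σ hσ μ hμ ⟨v, by_contra fun h => hβv (hβ.zero v h), hκσ v hv⟩ _
    (composite_mem hd hr hμ hT hw (hTμ w hw))

end LevelGeometry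

section Labels

open Classical

variable {V : Type w} [LinearOrder V] {X : PreAbstractSimplicialComplex V} {d : ℕ}
  {r : ℕ → Pt V → Pt V} (hr : IsSqueezing X d r) (hd : ∀ σ ∈ X.faces, σ.card ≤ d + 1)

/-- The simplex of a level with given barycentre. -/
noncomputable def ofBary (X : PreAbstractSimplicialComplex V) (d k : ℕ) (w : Pt V) :
    Finset (Pt V) :=
  if h : ∃ τ ∈ (level X d k).faces, bary τ = w then h.choose else ∅

include hd in
theorem ofBary_bary {k : ℕ} {τ : Finset (Pt V)} (hτ : τ ∈ (level X d k).faces) :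
    ofBary X d k (bary τ) = τ := by
  have h : ∃ τ' ∈ (level X d k).faces, bary τ' = bary τ := ⟨τ, hτ, rfl⟩
  rw [ofBary, dif_pos h]
  exact (geo_level hd k).bary_injOn h.choose_spec.1 hτ h.choose_spec.2

theorem bary_ofBary {k : ℕ} {w : Pt V} (h : ofBary X d k w ∈ (level X d k).faces) :
    bary (ofBary X d k w) = w := by
  unfold ofBary at h ⊢
  split_ifs at h ⊢ with h1
  · exact h1.choose_spec.2
  · simpa using level_nonempty h

/-- Every level is the barycentric subdivision of the previous one. -/
noncomputable def tower : Tower X d r where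
  flag k :=
    { car := ofBary X d k
      vert := bary
      car_vert := fun τ hτ => ofBary_bary hd hτ
      mem := fun τ hτ => hr.approximation k {bary τ}
        (mem_level_succ.2 ⟨{τ}, by simp, by simpa using hτ, by simp, by ext; simp [mem_push, eq_comm]⟩)
        _ (by simp) τ hτ (bary_mem (level_nonempty hτ)) }
  describes k S := by
    rw [mem_level_succ]
    constructor
    · rintro ⟨c, hc, hcK, hch, rfl⟩
      refine ⟨push_nonempty.2 hc, ?_, ?_⟩
      · rw [forall_mem_push]
        intro τ hτ
        show ofBary X d k (bary τ) ∈ _ ∧ bary (ofBary X d k (bary τ)) = _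
        rw [ofBary_bary hd (hcK τ hτ)]
        exact ⟨hcK τ hτ, rfl⟩
      · simp only [forall_mem_push]
        intro τ hτ τ' hτ'
        show ofBary X d k (bary τ) ⊆ ofBary X d k (bary τ') ∨ _ ⊆ ofBary X d k (bary τ)
        rw [ofBary_bary hd (hcK τ hτ), ofBary_bary hd (hcK τ' hτ')]
        exact hch.total hτ hτ'
    · rintro ⟨hne, h1, h2⟩
      refine ⟨push (ofBary X d k) S, push_nonempty.2 hne, ?_, ?_, ?_⟩
      · rw [forall_mem_push]
        exact fun w hw => (h1 w hw).1
      · intro σ hσ τ hτ _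
        obtain ⟨w, hw, rfl⟩ := mem_push.1 (Finset.mem_coe.1 hσ)
        obtain ⟨w', hw', rfl⟩ := mem_push.1 (Finset.mem_coe.1 hτ)
        exact h2 w hw w' hw'
      · rw [push_push]
        exact (push_eq_self fun w hw => bary_ofBary (h1 w hw).1).symm
  bound := 2 * (d + 1)
  card_le k := card_level hd k

/-- Every vertex of `S` is the barycentre of its own carrier, and a closed simplex of a coarser
level contains such a barycentre exactly when it contains the carrier. -/
theorem carrier_tower_le_iff {k : ℕ} (S : (level X d (k + 1)).faces) {m j : ℕ} (hk : k = m + j)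
    {σ : Finset (Pt V)} (hσ : σ ∈ (level X d m).faces) :
    (∀ u ∈ (FlagData.carrier ((tower hr hd).describes k) S).1,
      u ∈ convexHull ℝ (σ : Set (Pt V))) ↔ ∀ w ∈ S.1, w ∈ convexHull ℝ (σ : Set (Pt V)) := by
  subst hk
  have hmem : ∀ u, u ∈ (FlagData.carrier ((tower hr hd).describes (m + j)) S).1 ↔
      ∃ w ∈ S.1, u ∈ ofBary X d (m + j) w := fun u => FlagData.mem_carrier _
  constructor
  · intro h w hw
    obtain ⟨ρ, hρ, rfl⟩ := exists_vertex S.2 hw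
    refine convexHull_subset_convexHull (fun u hu => h u ((hmem u).2 ⟨_, hw, ?_⟩))
      (bary_mem (level_nonempty hρ))
    rw [ofBary_bary hd hρ]
    exact hu
  · intro h u hu
    obtain ⟨w, hw, huw⟩ := (hmem u).1 hu
    obtain ⟨ρ, hρ, rfl⟩ := exists_vertex S.2 hw
    rw [ofBary_bary hd hρ] at huw
    exact mem_convexHull_of_bary hd hσ hρ (h _ hw) u huw

/-- The word that takes carriers in all but the first `m` steps from the top. -/
def word (m : ℕ) (j : ℕ) : Bool := decide (j < m)

theorem word_le {m n : ℕ} (h : m ≤ n) (j : ℕ) : word m j ≤ word n j := by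
  by_cases h1 : j < m
  · simp [word, h1, h1.trans_le h]
  · simp [word, h1]

/-- Iterated carriers give the smallest simplex of the lowest level that contains `S` geometrically.
-/
theorem label_word_self_le_iff {m k : ℕ} (hk : k ≤ m) (S : (level X d k).faces)
    (σ : (level X d 0).faces) : label hr (tower hr hd) (word m) k S ≤ σ ↔
      ∀ w ∈ S.1, w ∈ convexHull ℝ (σ.1 : Set (Pt V)) := by
  induction k with
  | zero => exact ⟨fun h w hw => subset_convexHull ℝ _ (h hw),
      fun h w hw => vertex_mem_of_mem_convexHull hd σ.2 S.2 hw (h w hw)⟩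
  | succ k ih =>
    have h1 : descend hr (tower hr hd) (word m k) k S =
        FlagData.carrier ((tower hr hd).describes k) S := by
      rw [word, decide_eq_true (show k < m by omega)]
      rfl
    show label hr (tower hr hd) (word m) k (descend hr (tower hr hd) (word m k) k S) ≤ σ ↔ _
    rw [h1, ih (by omega)]
    exact carrier_tower_le_iff hr hd S (zero_add k).symm σ.2

/-- The `j` upper steps apply the approximations and the `m` lower ones take carriers. So the label
is the smallest simplex of the lowest level that contains the image of `S` at level `m`. -/
theorem label_word_le_iff (m j : ℕ) (S : (level X d (m + j)).faces) (σ : (level X d 0).faces) :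
    label hr (tower hr hd) (word m) (m + j) S ≤ σ ↔
      ∀ w ∈ S.1, composite r m j w ∈ convexHull ℝ (σ.1 : Set (Pt V)) := by
  induction j with
  | zero => exact label_word_self_le_iff hr hd le_rfl S σ
  | succ j ih =>
    have h1 : descend hr (tower hr hd) (word m (m + j)) (m + j) S =
        VertexMap.onFaces (hr.simplicial (m + j)) S := by
      rw [word, decide_eq_false (by omega)]
      rfl
    show label hr (tower hr hd) (word m) (m + j) (descend hr (tower hr hd) (word m (m + j)) (m + j) S)
      ≤ σ ↔ _
    rw [h1, ih]
    constructor
    · intro h w hw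
      exact h _ ((VertexMap.mem_onFaces _).2 ⟨w, hw, rfl⟩)
    · intro h u hu
      obtain ⟨w, hw, rfl⟩ := (VertexMap.mem_onFaces _).1 hu
      exact h w hw

end Labels

end Cone

/-! ### From cone bounds to control by labels -/

namespace Cone

open Geometric

section Distance

variable {V : Type w} {X : PreAbstractSimplicialComplex V} {d : ℕ}

theorem abs_apply_le_euclid (x y : V →₀ ℝ) (v : V) : |x v - y v| ≤ euclid x y := by
  classical
  rw [euclid]
  refine Real.abs_le_sqrt ?_
  rw [Finsupp.sum_of_support_subset (s := insert v (x - y).support) _ (Finset.subset_insert _ _) _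
    (by simp)]
  exact Finset.single_le_sum (f := fun u => (x - y) u ^ 2) (fun _ _ => sq_nonneg _)
    (Finset.mem_insert_self v _)

theorem euclid_le_norm1 (x y : V →₀ ℝ) : euclid x y ≤ norm1 (x - y) := by
  rw [euclid]
  refine Real.sqrt_le_iff.2 ⟨norm1_nonneg _, ?_⟩
  have h : ∀ v ∈ (x - y).support, (x - y) v ^ 2 ≤ |(x - y) v| * norm1 (x - y) := fun v _ => by
    rw [← sq_abs, sq]
    exact mul_le_mul_of_nonneg_left (abs_apply_le_norm1 _ v) (abs_nonneg _)
  refine (Finset.sum_le_sum h).trans ?_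
  rw [← Finset.sum_mul, sq]
  exact le_rfl

theorem apply_eq_zero_of_mem {τ : Finset V} {x : V →₀ ℝ}
    (hx : x ∈ convexHull ℝ (push vertex τ : Set (V →₀ ℝ))) {v : V} (hv : v ∉ τ) : x v = 0 := by
  have h1 := Set.mem_image_of_mem (Finsupp.lapply (R := ℝ) v) hx
  rw [LinearMap.image_convexHull] at h1
  refine convexHull_min (t := {(0 : ℝ)}) ?_ (convex_singleton _) h1
  rintro _ ⟨p, hp, rfl⟩
  obtain ⟨u, hu, rfl⟩ := mem_push.1 (Finset.mem_coe.1 hp)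
  have : u ≠ v := fun h => hv (h ▸ hu)
  simp [vertex, this]

/-- Inside a simplex of `X` at most `d + 1` coordinates can differ. -/
theorem norm1_le_euclid (hd : ∀ σ ∈ X.faces, σ.card ≤ d + 1) {σ : Finset (V →₀ ℝ)}
    (hσ : σ ∈ (realize X).faces) {x y : V →₀ ℝ} (hx : x ∈ convexHull ℝ (σ : Set (V →₀ ℝ)))
    (hy : y ∈ convexHull ℝ (σ : Set (V →₀ ℝ))) : norm1 (x - y) ≤ (d + 1) * euclid x y := by
  obtain ⟨τ, hτ, rfl⟩ := mem_realize.1 hσ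
  rw [norm1_eq (W := τ)]
  · refine (Finset.sum_le_sum fun v _ => abs_apply_le_euclid x y v).trans ?_
    rw [Finset.sum_const, nsmul_eq_mul]
    have : (τ.card : ℝ) ≤ d + 1 := by exact_mod_cast hd τ hτ
    exact mul_le_mul_of_nonneg_right this (Real.sqrt_nonneg _)
  · intro v hv
    by_contra hn
    rw [Finsupp.mem_support_iff] at hv
    exact hv (by rw [Finsupp.sub_apply, apply_eq_zero_of_mem hx hn, apply_eq_zero_of_mem hy hn,
      sub_zero])

theorem norm1_le_path (hd : ∀ σ ∈ X.faces, σ.card ≤ d + 1) {m : ℕ} {p : ℕ → V →₀ ℝ}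
    (h : ∀ j < m, ∃ σ ∈ (realize X).faces,
      p j ∈ convexHull ℝ (σ : Set (V →₀ ℝ)) ∧ p (j + 1) ∈ convexHull ℝ (σ : Set (V →₀ ℝ))) :
    norm1 (p 0 - p m) ≤ (d + 1) * ∑ j ∈ Finset.range m, euclid (p j) (p (j + 1)) := by
  induction m with
  | zero => simp [norm1_zero]
  | succ m ih =>
    obtain ⟨σ, hσ, h1, h2⟩ := h m (Nat.lt_succ_self m)
    have h3 := ih fun j hj => h j (hj.trans (Nat.lt_succ_self m))
    have h4 := norm1_le_euclid hd hσ h1 h2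
    have h5 := norm1_sub_le (p 0) (p m) (p (m + 1))
    rw [Finset.sum_range_succ, mul_add]
    linarith

theorem norm1_le_of_pathDist_lt (hd : ∀ σ ∈ X.faces, σ.card ≤ d + 1) {x y : V →₀ ℝ} {c : ℝ}
    (h : pathDist X x y < ENNReal.ofReal c) : norm1 (x - y) ≤ (d + 1) * c := by
  rw [pathDist] at h
  simp only [iInf_lt_iff] at h
  obtain ⟨m, p, ⟨rfl, rfl, hp⟩, hlt⟩ := h
  refine (norm1_le_path hd hp).trans (mul_le_mul_of_nonneg_left ?_ (by positivity))
  rw [← ENNReal.ofReal_sum_of_nonneg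
    (f := fun j => euclid (p j) (p (j + 1))) fun _ _ => Real.sqrt_nonneg _] at hlt
  exact (ENNReal.ofReal_lt_ofReal_iff'.1 hlt).1.le

/-- What a bound of the distance in the open cone means for coordinates. -/
def Close (d : ℕ) (B : ℝ) (p q : Pt V) : Prop :=
  ∃ u, u ≤ p.2 ∧ u ≤ q.2 ∧ p.2 - u ≤ B + 1 ∧ q.2 - u ≤ B + 1 ∧
    (0 < u → u * norm1 (p.1 - q.1) ≤ (d + 1) * (B + 2))

theorem Close.symm {B : ℝ} {p q : Pt V} (h : Close d B p q) : Close d B q p := by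
  obtain ⟨u, h1, h2, h3, h4, h5⟩ := h
  exact ⟨u, h2, h1, h4, h3, by rw [norm1_sub_comm]; exact h5⟩

/-- The infima in the distances need not be attained. Enlarging `B` to `B + 1` yields a height `u`,
and enlarging once more to `B + 2` yields a broken line. -/
theorem close_of_coneDist_le (hd : ∀ σ ∈ X.faces, σ.card ≤ d + 1) {B : ℝ} (hB : 0 ≤ B) {p q : Pt V}
    (h : coneDist X p q ≤ ENNReal.ofReal B) : Close d B p q := by
  have hlt := h.trans_lt ((ENNReal.ofReal_lt_ofReal_iff (by linarith)).2 (lt_add_one B))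
  rw [coneDist] at hlt
  simp only [iInf_lt_iff] at hlt
  obtain ⟨u, h1, h2, hlt⟩ := hlt
  have hB1 : 0 ≤ B + 1 := by linarith
  refine ⟨u, h1, h2, ?_, ?_, fun hu => ?_⟩
  · exact (ENNReal.ofReal_le_ofReal_iff hB1).1
      ((le_add_right (le_add_right le_rfl)).trans hlt.le)
  · exact (ENNReal.ofReal_le_ofReal_iff hB1).1
      ((le_add_right (le_add_left le_rfl)).trans hlt.le)
  · have h3 : ENNReal.ofReal u * pathDist X p.1 q.1 ≤ ENNReal.ofReal (B + 1) :=
      (le_add_left le_rfl).trans hlt.le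
    have hu0 : ENNReal.ofReal u ≠ 0 := by simpa using hu
    have h4 : pathDist X p.1 q.1 ≤ ENNReal.ofReal ((B + 1) / u) := by
      rw [ENNReal.ofReal_div_of_pos hu, ENNReal.le_div_iff_mul_le (Or.inl hu0)
        (Or.inl ENNReal.ofReal_ne_top), mul_comm]
      exact h3
    -- The strict inequality gives an actual path of length less than `(B + 2) / u`.
    have h5 : (B + 1) / u < (B + 2) / u := div_lt_div_of_pos_right (by linarith) hu
    have h6 := norm1_le_of_pathDist_lt hd (h4.trans_lt ((ENNReal.ofReal_lt_ofReal_iff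
      (by positivity)).2 h5))
    calc u * norm1 (p.1 - q.1) ≤ u * ((d + 1) * ((B + 2) / u)) := mul_le_mul_of_nonneg_left h6 hu.le
      _ = _ := by field_simp

end Distance

section Translate

variable {V : Type w} {X : PreAbstractSimplicialComplex V} {d : ℕ}

/-- The translation is only piecewise affine, but over nonnegative heights it agrees with the affine
map `A`, which preserves barycentres. -/
theorem bary_translate {k : ℕ} {S : Finset (Pt V)} (hS : S.Nonempty) (h : ∀ p ∈ S, 0 ≤ p.2) :
    bary (push (translate d k) S) = ((bary S).1, ratio d ^ k * (bary S).2 + height d k) := by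
  have h0 : 0 < ratio d ^ k := pow_pos (zero_lt_one.trans (one_lt_ratio d)) k
  let A : Pt V →ᵃ[ℝ] Pt V := (AffineMap.id ℝ (V →₀ ℝ)).prodMap
    (AffineMap.lineMap (height d k) (height d k + ratio d ^ k))
  have hA : ∀ p : Pt V, A p = (p.1, ratio d ^ k * p.2 + height d k) := by
    intro p
    show (p.1, AffineMap.lineMap (height d k) (height d k + ratio d ^ k) p.2) = _
    rw [AffineMap.lineMap_apply]
    simp [mul_comm]
  have hinj : Function.Injective A := by
    intro p q hpq
    rw [hA, hA, Prod.mk.injEq] at hpq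
    exact Prod.ext hpq.1 (mul_left_cancel₀ h0.ne' (add_right_cancel hpq.2))
  rw [← hA, ← bary_push hinj hS]
  congr 1
  exact push_congr fun p hp => by rw [hA, translate_eq d k (h p hp)]

variable [LinearOrder V]

theorem height_bary_nonneg {k : ℕ} {S : Finset (Pt V)} (hS : S ∈ (level X d k).faces) :
    0 ≤ (bary S).2 := by
  rw [height_bary]
  exact mul_nonneg (by positivity) (Finset.sum_nonneg (mem_level_iff.1 hS).2)

/-- A simplex that is close to a translated simplex of positive height is itself translated, and
close before the translation. -/
theorem exists_translate_of_close {k : ℕ} {B δ : ℝ} (h1 : B + 2 ≤ ratio d ^ k * δ)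
    (h2 : (d + 1) * (B + 2) ≤ k * δ) (hk : 0 < k) {S K : Finset (Pt V)}
    (hS : S ∈ (level X d k).faces) (hSδ : δ ≤ (bary S).2) (hK : K ∈ (triangulation X d).faces)
    (hc : Close d B (bary (push (translate d k) S)) (bary K)) :
    ∃ T ∈ (level X d k).faces, push (translate d k) T = K ∧ dist1 (bary S) (bary T) ≤ 2 * δ := by
  have hr0 : 0 < ratio d ^ k := pow_pos (zero_lt_one.trans (one_lt_ratio d)) k
  obtain ⟨u, hu1, hu2, hu3, hu4, hu5⟩ := hc
  rw [bary_translate (level_nonempty hS) (mem_level_iff.1 hS).2] at hu1 hu3 hu5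
  simp only at hu1 hu3 hu5
  have hkh : (k : ℝ) ≤ height d k := by simpa using le_height d k
  -- The translate of `S` lies at least `B + 2` above `v_k`, and the connecting path descends by at
  -- most `B + 1`.
  have hku : height d k < u := by
    have := mul_le_mul_of_nonneg_left hSδ hr0.le
    linarith
  have hk0 : (0 : ℝ) < k := by exact_mod_cast hk
  obtain ⟨i, κ, hκ, rfl⟩ := mem_triangulation.1 hK
  have hslab := block_slab X i κ hκ
  have hne := ((block X i).isRelLowerSet_faces hκ).1
  -- The barycentre of the neighbour lies above `v_k`. So its block has index at least `k` and is a
  -- translate of a block over nonnegative heights.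
  have hi : (k : ℤ) ≤ i := by
    have h3 := height_of_mem (a := height d i) (b := height d (i + 1))
      (forall_mem_push.2 fun p hp => blockMap_height_mem i (hslab hp))
      (bary_mem (push_nonempty.2 hne))
    have := (height_strictMono d).lt_iff_lt.1 ((hku.trans_le hu2).trans_le h3.2)
    omega
  obtain ⟨j, κ', hκ', hj⟩ := exists_block hκ fun p hp =>
    ((height_strictMono d).monotone hi).trans (blockMap_height_mem i (hslab hp)).1
  have hT : push (blockMap d j) κ' ∈ (level X d k).faces := mem_level.2 ⟨j, κ', hκ', rfl⟩
  have hTK : push (translate d k) (push (blockMap d j) κ') = push (blockMap d i) κ := by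
    rw [translate_push_blockMap j k fun p hp => (sdPrism_slab _ κ' hκ' hp).1, hj]
  refine ⟨_, hT, hTK, ?_⟩
  rw [← hTK, bary_translate (level_nonempty hT) (mem_level_iff.1 hT).2] at hu2 hu4 hu5
  simp only at hu2 hu4 hu5
  set T := push (blockMap d j) κ'
  -- Horizontal distances in the cone are multiplied by `u`, and `u` exceeds `v_k`, which is at
  -- least `k`.
  have h3 : norm1 ((bary S).1 - (bary T).1) ≤ δ := by
    have h4 := hu5 (by linarith)
    have h5 := mul_le_mul_of_nonneg_right (show (k : ℝ) ≤ u by linarith)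
      (norm1_nonneg ((bary S).1 - (bary T).1))
    exact le_of_mul_le_mul_left (h5.trans (h4.trans h2)) hk0
  have h4 : |(bary S).2 - (bary T).2| ≤ δ := by
    refine le_of_mul_le_mul_left ?_ hr0
    rw [← abs_of_pos hr0, ← abs_mul, abs_of_pos hr0]
    refine le_trans ?_ h1
    rw [abs_le, mul_sub]
    constructor <;> linarith
  rw [dist1]
  linarith

end Translate

section Control

variable {V : Type w} [LinearOrder V] {X : PreAbstractSimplicialComplex V} {d : ℕ}
  {r : ℕ → Pt V → Pt V} (hr : IsSqueezing X d r) (hd : ∀ σ ∈ X.faces, σ.card ≤ d + 1)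

theorem label_word_le_iff' {m j k : ℕ} (hk : m + j = k) (S : (level X d k).faces)
    (σ : (level X d 0).faces) : label hr (tower hr hd) (word m) k S ≤ σ ↔
      ∀ w ∈ S.1, composite r m j w ∈ convexHull ℝ (σ.1 : Set (Pt V)) := by
  subst hk
  exact label_word_le_iff hr hd m j S σ

/-- The squeezing of one of two close simplices into labels of the other one. -/
theorem label_le_label_of_close {m j k : ℕ} (hk : m + j = k) {δ : ℝ}
    (hm : ∀ σ ∈ (level X d 0).faces, ∀ κ ∈ (level X d m).faces,
      (∃ w ∈ κ, w ∈ convexHull ℝ (σ : Set (Pt V))) → ∀ w ∈ κ, composite r 0 m w ∈ σ)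
    {S T : (level X d k).faces}
    (hj : ∀ σ ∈ (level X d m).faces, bary S.1 ∈ convexHull ℝ (σ : Set (Pt V)) →
      dist1 (bary T.1) (bary S.1) ≤ δ → ∀ w ∈ T.1, composite r m j w ∈ σ)
    (h : dist1 (bary T.1) (bary S.1) ≤ δ) :
    label hr (tower hr hd) (word m) k T ≤ label hr (tower hr hd) (word k) k S ∧
    label hr (tower hr hd) (word 0) k T ≤ label hr (tower hr hd) (word m) k S := by
  subst hk
  -- `κ` is the smallest simplex of level `m` that contains `S`. Being close to `S`, the simplex `T`
  -- is squeezed into it by the upper steps.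
  obtain ⟨κ, hκ, hSκ, α, hα, hα0⟩ := exists_inner_carrier hd S.2
  have hTκ := hj κ hκ hα.mem h
  have hne := level_nonempty S.2
  constructor
  -- The all-carrier label of `S` contains the barycentre of `S`, an inner point of `κ`, and
  -- therefore all of `κ`.
  · rw [label_word_le_iff]
    intro w hw
    have hS : bary S.1 ∈ convexHull ℝ
        ((label hr (tower hr hd) (word (m + j)) (m + j) S).1 : Set (Pt V)) :=
      convexHull_subset_convexHull ((label_word_self_le_iff hr hd le_rfl S _).1 le_rfl) (bary_mem hne)
    have hκ' : κ ∈ (level X d (0 + m)).faces := by rwa [zero_add]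
    exact mem_convexHull_of_isCoord hd (label hr (tower hr hd) (word (m + j)) (m + j) S).2 hκ' hα hS
      (hTκ w hw) (hα0 _ (hTκ w hw))
  -- The upper steps send a vertex of `S` to a vertex of `κ` that lies in the middle label of `S`.
  -- By the choice of `m`, the remaining steps retract all of `κ` into that label.
  · rw [label_word_le_iff' hr hd (zero_add (m + j))]
    intro w hw
    obtain ⟨w₀, hw₀⟩ := hne
    have h1 := (label_word_le_iff hr hd m j S _).1 le_rfl w₀ hw₀
    have h2 := composite_mem hd hr hκ S.2 hw₀ (hSκ w₀ hw₀)
    rw [composite_add, zero_add]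
    exact subset_convexHull ℝ _ (hm _ (label hr (tower hr hd) (word m) (m + j) S).2 κ hκ
      ⟨_, h2, h1⟩ _ (hTκ w hw))

/-- The simplices of the lowest level at height `e`. -/
def sliceSet (X : PreAbstractSimplicialComplex V) (d : ℕ) (e : ℝ) : Set (level X d 0).faces :=
  {σ | ∀ p ∈ σ.1, p.2 = e}

theorem sliceSet_mono {e : ℝ} {σ τ : (level X d 0).faces} (h : τ ≤ σ) (hσ : σ ∈ sliceSet X d e) :
    τ ∈ sliceSet X d e := fun p hp => hσ p (h hp)

theorem sliceSet_ordConnected (e : ℝ) : (sliceSet X d e).OrdConnected :=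
  ⟨fun _ _ _ hτ _ h => sliceSet_mono h.2 hτ⟩

/-- The foot point of `S` at height zero lies in a simplex of the bottom. It is used to show that
simplices near the bottom receive approximation labels in the bottom. -/
theorem exists_bottom {k : ℕ} {S : Finset (Pt V)} (hS : S ∈ (level X d k).faces) :
    ∃ σ ∈ (level X d 0).faces, (∀ p ∈ σ, p.2 = 0) ∧
      ((bary S).1, (0 : ℝ)) ∈ convexHull ℝ (σ : Set (Pt V)) := by
  obtain ⟨j, κ, hκ, rfl⟩ := mem_level.1 hS
  obtain ⟨ρ, hρ, h⟩ := exists_realize_carrier _ κ hκ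
  have hne := (PreAbstractSimplicialComplex.isRelLowerSet_faces _ hκ).1
  have hb : ∀ x, blockMap d (0 : ℕ) (atHeight V 0 x) = (x, 0) := fun x => by
    rw [blockMap_nat, atHeight_apply]
    simp [height_zero]
  refine ⟨push (blockMap d (0 : ℕ)) (push (atHeight V 0) ρ), mem_level.2 ⟨0, _,
    ((isPart_bottom 0 _).2 ⟨ρ, hρ, rfl⟩).1, rfl⟩, ?_, ?_⟩
  · rw [forall_mem_push, forall_mem_push]
    intro x _
    rw [hb]
  · rw [convexHull_push, convexHull_push]
    refine ⟨_, ⟨(bary (push (blockMap d j) κ)).1, ?_, rfl⟩, hb _⟩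
    rw [bary_push (blockMap_injective d j) hne]
    exact over_of_mem (q := bary κ) h (bary_mem hne)

/-- The approximation label is a face of the all-carrier label, which contains `S` and lies in a
single block. As this block reaches height `v_i`, its index is at most `i`, hence the bound
`v_{i+1}`. -/
theorem height_le_of_label {k i : ℕ} (S : (level X d k).faces)
    (hS : label hr (tower hr hd) (word 0) k S ∈ sliceSet X d (height d i)) :
    (bary S.1).2 ≤ height d (i + 1) := by
  set c := label hr (tower hr hd) (word k) k S with hc
  have hle : label hr (tower hr hd) (word 0) k S ≤ c :=
    label_le hr (tower hr hd) (word_le (Nat.zero_le k)) k S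
  obtain ⟨p, hp⟩ := level_nonempty (label hr (tower hr hd) (word 0) k S).2
  have hpi := hS p hp
  have hSc : bary S.1 ∈ convexHull ℝ (c.1 : Set (Pt V)) :=
    convexHull_subset_convexHull ((label_word_self_le_iff hr hd le_rfl S _).1 hc.ge)
      (bary_mem (level_nonempty S.2))
  obtain ⟨j, κ, hκ, he⟩ := mem_level.1 c.2
  have hj : ∀ q ∈ c.1, q.2 ∈ Set.Icc (height d j) (height d (j + 1)) := by
    rw [← he, forall_mem_push]
    exact fun q hq => blockMap_height_mem j (sdPrism_slab _ κ hκ hq)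
  have h1 := (hj p (hle hp)).1
  rw [hpi, (height_strictMono d).le_iff_le] at h1
  exact (height_of_mem hj hSc).2.trans ((height_strictMono d).monotone (by omega))

/-- On a sufficiently high level, simplices close to the given slice are controlled by labels. -/
theorem exists_control {i : ℕ} (hi : 0 < i) {B : ℝ} (hB : 0 ≤ B) : ∃ m k : ℕ, m ≤ k ∧
    ∀ (S : (level X d k).faces) (K : (triangulation X d).faces),
      label hr (tower hr hd) (word 0) k S ∈ sliceSet X d (height d i) →
      Close d B (bary (levelEmbedding X d k S).1) (bary K.1) →
      ∃ T, K = levelEmbedding X d k T ∧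
        label hr (tower hr hd) (word m) k T ≤ label hr (tower hr hd) (word k) k S ∧
        label hr (tower hr hd) (word 0) k T ≤ label hr (tower hr hd) (word m) k S ∧
        label hr (tower hr hd) (word m) k S ≤ label hr (tower hr hd) (word k) k T ∧
        label hr (tower hr hd) (word 0) k S ≤ label hr (tower hr hd) (word m) k T := by
  obtain ⟨m, hm⟩ := hr.retraction 0
  simp only [zero_add] at hm
  -- One more than the height of `S`, so that the neighbours of `S` are also covered by the
  -- squeezing estimates.
  set H := height d (i + 1) + 1 with hH
  obtain ⟨k₁, δ₁, hδ₁, hδ₁', h₁⟩ := exists_squeeze hd hr m H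
  obtain ⟨k₀, δ₀, hδ₀, hδ₀', h₀⟩ := exists_squeeze hd hr 0 H
  -- The first bound keeps `S` off the bottom; the half in the second absorbs the factor 2 with
  -- which translated neighbours are found.
  set δ := min δ₀ (δ₁ / 2) with hδ
  have hδ0 : 0 < δ := lt_min hδ₀ (half_pos hδ₁)
  set M := (d + 1) * (B + 2) with hM
  have hMB : B + 2 ≤ M := by rw [hM]; nlinarith [Nat.cast_nonneg (α := ℝ) d]
  -- Both the vertical factor, a power of the ratio, and the horizontal factor, the number of
  -- translations, eventually exceed `M / δ`.
  obtain ⟨k₂, hk₂⟩ := Filter.eventually_atTop.1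
    (((tendsto_pow_atTop_atTop_of_one_lt (one_lt_ratio d)).eventually_ge_atTop (M / δ)).and
      ((tendsto_natCast_atTop_atTop (R := ℝ)).eventually_ge_atTop (M / δ)))
  obtain ⟨j, hj₁, hj₀, hj₂⟩ : ∃ j, k₁ ≤ j ∧ k₀ ≤ m + j ∧ k₂ ≤ m + j :=
    ⟨k₁ + k₀ + k₂, by omega, by omega, by omega⟩
  obtain ⟨hr₁, hr₂⟩ := hk₂ (m + j) hj₂
  rw [div_le_iff₀ hδ0] at hr₁ hr₂
  have hkpos : 0 < m + j := by
    by_contra hn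
    rw [Nat.eq_zero_of_not_pos hn] at hr₂
    simp only [Nat.cast_zero, zero_mul] at hr₂
    linarith
  refine ⟨m, m + j, Nat.le_add_right _ _, fun S K hS hK => ?_⟩
  -- Lower down, `S` would be squeezed into a simplex at height zero. So would its approximation
  -- label, which however has height `v_i > 0`.
  have hlow : δ ≤ (bary S.1).2 := by
    by_contra hn
    obtain ⟨σ, hσ, hσ0, hz⟩ := exists_bottom S.2
    have hnn := height_bary_nonneg S.2
    have hSσ := h₀ (m + j) hj₀ σ hσ _ hz (by
      rw [hH]
      have := height_nonneg d (i + 1)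
      push_cast at this
      show (0 : ℝ) ≤ _
      linarith) S.1 (by rw [zero_add]; exact S.2) (by
      rw [dist1]
      simp only [sub_self, norm1_zero, zero_add, sub_zero]
      rw [abs_of_nonneg hnn]
      exact (not_le.1 hn).le.trans (min_le_left _ _))
    have hle : label hr (tower hr hd) (word 0) (m + j) S ≤ ⟨σ, hσ⟩ := by
      rw [label_word_le_iff' hr hd (zero_add (m + j))]
      exact fun w hw => subset_convexHull ℝ _ (hSσ w hw)
    obtain ⟨p, hp⟩ := level_nonempty (label hr (tower hr hd) (word 0) (m + j) S).2
    have h1 := hS p hp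
    rw [hσ0 p (hle hp)] at h1
    have h2 := height_strictMono d (show (0 : ℤ) < i by exact_mod_cast hi)
    rw [height_zero] at h2
    linarith
  have hheight := height_le_of_label hr hd S hS
  have hK' : Close d B (bary (push (translate d (m + j)) S.1)) (bary K.1) := by
    rw [← image_eq_push]
    exact hK
  obtain ⟨T, hT, hTK, hST⟩ := exists_translate_of_close (hMB.trans hr₁) hr₂ hkpos S.2 hlow
    K.2 hK'
  have hST1 : dist1 (bary S.1) (bary T) ≤ δ₁ := by
    have := min_le_right δ₀ (δ₁ / 2)
    linarith
  have hTheight : (bary T).2 ≤ H := by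
    have h1 := hST1
    rw [dist1] at h1
    have := norm1_nonneg ((bary S.1).1 - (bary T).1)
    have := neg_abs_le ((bary S.1).2 - (bary T).2)
    linarith
  obtain ⟨a1, a2⟩ := label_le_label_of_close hr hd rfl hm (S := S) (T := ⟨T, hT⟩)
    (fun σ hσ hb hdist => h₁ j hj₁ σ hσ _ hb (by linarith) T hT hdist)
    (by rw [dist1_comm]; exact hST1)
  obtain ⟨b1, b2⟩ := label_le_label_of_close hr hd rfl hm (S := ⟨T, hT⟩) (T := S)
    (fun σ hσ hb hdist => h₁ j hj₁ σ hσ _ hb hTheight S.1 S.2 hdist) hST1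
  refine ⟨⟨T, hT⟩, Subtype.ext ?_, a1, a2, b1, b2⟩
  rw [← hTK, ← image_eq_push]
  rfl

end Control

end Cone

open Classical in
theorem VertexMap.isSimplicial_iff {α β : Type w} {K' : PreAbstractSimplicialComplex α}
    {K : PreAbstractSimplicialComplex β} {r : α → β} : VertexMap.IsSimplicial K' K r ↔
      ∀ S ∈ K'.faces, Geometric.push r S ∈ K.faces := by
  simp only [← Geometric.image_eq_push]
  exact Iff.rfl

/-! ### Slices of the triangulation, and their mesh -/

namespace Cone

open Geometric

section Slice

variable {V : Type w} {X : PreAbstractSimplicialComplex V} {d : ℕ}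

theorem blockMap_atHeight_zero (i : ℕ) (x : V →₀ ℝ) :
    blockMap d i (atHeight V 0 x) = (x, height d i) := by
  rw [blockMap_nat, atHeight_apply]
  simp

theorem pair_injective (e : ℝ) : Function.Injective fun x : V →₀ ℝ => (x, e) := fun _ _ h =>
  congrArg Prod.fst h

variable [LinearOrder V]

theorem push_height_mem {i : ℕ} {σ : Finset (V →₀ ℝ)} (hσ : σ ∈ (SdX X i).faces) :
    push (fun x => (x, height d i)) σ ∈ (level X d 0).faces := by
  refine mem_level.2 ⟨i, push (atHeight V 0) σ, ((isPart_bottom i _).2 ⟨σ, hσ, rfl⟩).1, ?_⟩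
  rw [push_push]
  exact push_congr fun x _ => blockMap_atHeight_zero i x

/-- Only the blocks `i` and `i - 1` meet height `v_i`, the one in its bottom and the other in its
top, and both ends are `Sd^i X`. -/
theorem exists_of_mem_slice {i : ℕ} {S : Finset (Pt V)} (hS : S ∈ (level X d 0).faces)
    (h : ∀ p ∈ S, p.2 = height d i) :
    ∃ σ ∈ (SdX X i).faces, push (fun x => (x, height d i)) σ = S := by
  obtain ⟨j, κ, hκ, rfl⟩ := mem_level.1 hS
  rw [add_zero] at hκ
  rw [forall_mem_push] at h
  have hslab := sdPrism_slab j κ hκ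
  obtain ⟨p, hp⟩ := (PreAbstractSimplicialComplex.isRelLowerSet_faces _ hκ).1
  have hpj := blockMap_height_mem (d := d) j (hslab hp)
  rw [h p hp, Set.mem_Icc, (height_strictMono d).le_iff_le, (height_strictMono d).le_iff_le] at hpj
  rcases (show j = i ∨ i = j + 1 by omega) with rfl | rfl
  · have h0 : ∀ p ∈ κ, p.2 = 0 := by
      intro p hp
      have h1 := h p hp
      rw [blockMap_nat] at h1
      have h2 := pow_pos (zero_lt_one.trans (one_lt_ratio d)) j
      simpa [h2.ne'] using h1
    obtain ⟨σ, hσ, rfl⟩ := (isPart_bottom j κ).1 ⟨hκ, h0⟩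
    refine ⟨σ, hσ, ?_⟩
    rw [push_push]
    exact push_congr fun x _ => (blockMap_atHeight_zero j x).symm
  · have h1 : ∀ p ∈ κ, p.2 = 1 := fun p hp =>
      blockMap_height_eq (d := d) (i := j) (hslab hp) (by rw [h p hp]; push_cast; exact le_rfl)
    obtain ⟨σ, hσ, rfl⟩ := (isPart_top j κ).1 ⟨hκ, h1⟩
    refine ⟨σ, hσ, ?_⟩
    rw [blockMap_push_top, push_push]
    exact push_congr fun x _ => by
      have := blockMap_atHeight_zero (d := d) (j + 1) x
      push_cast at this ⊢
      exact this.symm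

/-- The simplices of `Sd^i X` are those of the lowest level at height `v_i`. -/
noncomputable def sliceIso (X : PreAbstractSimplicialComplex V) (d i : ℕ) :
    (SdX X i).faces ≃o sliceSet X d (height d i) :=
  RelIso.ofSurjective
    { toFun := fun σ => ⟨⟨push (fun x => (x, height d i)) σ.1, push_height_mem σ.2⟩,
        forall_mem_push.2 fun _ _ => rfl⟩
      inj' := fun σ τ h => Subtype.ext (push_injective (pair_injective _)
        (congrArg (fun S => S.1.1) h))
      map_rel_iff' := push_subset_push (pair_injective _) }
    fun S => by
      obtain ⟨σ, hσ, h⟩ := exists_of_mem_slice S.1.2 S.2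
      exact ⟨⟨σ, hσ⟩, Subtype.ext (Subtype.ext h)⟩

theorem levelEmbedding_sliceIso (i : ℕ) (σ : (SdX X i).faces) :
    levelEmbedding X d 0 (sliceIso X d i σ).1 = sliceEmbedding X d i σ := by
  apply Subtype.ext
  show (push (fun x => (x, height d i)) σ.1).image (translate d 0) = σ.1.image _
  rw [image_eq_push, image_eq_push]
  exact push_eq_self fun _ _ => rfl

end Slice

section Mesh

variable {V : Type w} {X : PreAbstractSimplicialComplex V} {d : ℕ}

theorem convex_norm1_le (z : V →₀ ℝ) (R : ℝ) : Convex ℝ {x : V →₀ ℝ | norm1 (x - z) ≤ R} := by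
  intro x hx y hy a b ha hb hab
  have h : a • x + b • y - z = a • (x - z) + b • (y - z) := by
    have : z = a • z + b • z := by rw [← add_smul, hab, one_smul]
    rw [smul_sub, smul_sub]
    nth_rewrite 1 [this]
    abel
  show norm1 (a • x + b • y - z) ≤ R
  rw [h]
  refine (norm1_add _ _).trans ?_
  rw [norm1_smul, norm1_smul, abs_of_nonneg ha, abs_of_nonneg hb]
  have h1 := mul_le_mul_of_nonneg_left (show norm1 (x - z) ≤ R from hx) ha
  have h2 := mul_le_mul_of_nonneg_left (show norm1 (y - z) ≤ R from hy) hb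
  have h3 : a * R + b * R = R := by rw [← add_mul, hab, one_mul]
  linarith

/-- The difference is the average of the differences from all vertices of `κ`. One of them is zero,
which gains the factor `1 - 1 / κ.card`. -/
theorem norm1_sub_bary_le {κ : Finset (V →₀ ℝ)} {R : ℝ} (hR : 0 ≤ R)
    (h : ∀ x ∈ κ, ∀ y ∈ κ, norm1 (x - y) ≤ R) (hκ : κ.card ≤ d + 1) {x : V →₀ ℝ} (hx : x ∈ κ) :
    norm1 (x - bary κ) ≤ d / (d + 1) * R := by
  classical
  have hc : (0 : ℝ) < κ.card := by exact_mod_cast Finset.card_pos.2 ⟨x, hx⟩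
  have h1 : x - bary κ = (κ.card : ℝ)⁻¹ • ∑ y ∈ κ, (x - y) := by
    rw [Finset.sum_sub_distrib, Finset.sum_const, smul_sub, ← Nat.cast_smul_eq_nsmul ℝ, smul_smul,
      inv_mul_cancel₀ hc.ne', one_smul, bary]
  have h2 : norm1 (∑ y ∈ κ, (x - y)) ≤ (κ.card - 1) * R := by
    rw [← Finset.sum_erase κ (sub_self x)]
    refine (norm1_sum _ _).trans ((Finset.sum_le_sum fun y hy =>
      h x hx y (Finset.mem_of_mem_erase hy)).trans ?_)
    rw [Finset.sum_const, Finset.card_erase_of_mem hx, nsmul_eq_mul,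
      Nat.cast_sub (Finset.card_pos.2 ⟨x, hx⟩), Nat.cast_one]
  rw [h1, norm1_smul, abs_of_pos (inv_pos.2 hc)]
  have hκ' : (κ.card : ℝ) ≤ d + 1 := by exact_mod_cast hκ
  calc (κ.card : ℝ)⁻¹ * norm1 (∑ y ∈ κ, (x - y)) ≤ (κ.card : ℝ)⁻¹ * ((κ.card - 1) * R) :=
        mul_le_mul_of_nonneg_left h2 (inv_pos.2 hc).le
    _ = (1 - (κ.card : ℝ)⁻¹) * R := by field_simp
    _ ≤ d / (d + 1) * R := by
        refine mul_le_mul_of_nonneg_right ?_ hR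
        have h3 : (d : ℝ) / (d + 1) = 1 - ((d : ℝ) + 1)⁻¹ := by field_simp; ring
        have h4 : ((d : ℝ) + 1)⁻¹ ≤ (κ.card : ℝ)⁻¹ := inv_anti₀ hc hκ'
        linarith

theorem norm1_bary_sub_bary_le {ρ κ : Finset (V →₀ ℝ)} {R : ℝ} (hR : 0 ≤ R)
    (h : ∀ x ∈ κ, ∀ y ∈ κ, norm1 (x - y) ≤ R) (hκ : κ.card ≤ d + 1) (hρ : ρ.Nonempty) (hρκ : ρ ⊆ κ) :
    norm1 (bary ρ - bary κ) ≤ d / (d + 1) * R :=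
  convexHull_subset_of_forall (convex_norm1_le (bary κ) _)
    (fun _ hx => norm1_sub_bary_le hR h hκ (hρκ hx)) (bary_mem hρ)

/-- Vertices of a simplex of the subdivision are barycentres of nested simplices, so each step
contracts diameters by `d / (d + 1)`. The initial 2 is the distance of two vertices in the sum norm.
-/
theorem mesh_SdX (hd : ∀ σ ∈ X.faces, σ.card ≤ d + 1) (n : ℕ) : ∀ σ ∈ (SdX X n).faces,
    σ.card ≤ d + 1 ∧ ∀ x ∈ σ, ∀ y ∈ σ, norm1 (x - y) ≤ 2 * ((d : ℝ) / (d + 1)) ^ n := by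
  classical
  induction n with
  | zero =>
    intro σ hσ
    obtain ⟨τ, hτ, rfl⟩ := mem_realize.1 hσ
    refine ⟨?_, ?_⟩
    · rw [← image_eq_push]
      exact Finset.card_image_le.trans (hd τ hτ)
    · simp only [forall_mem_push]
      intro u _ v _
      have h1 : ∀ u : V, norm1 (vertex u) = 1 := fun u => by
        rw [norm1, vertex, Finsupp.sum_single_index] <;> simp
      have := norm1_add (vertex u) (-vertex v)
      rw [norm1_neg, h1, h1, ← sub_eq_add_neg] at this
      simpa [one_add_one_eq_two] using this
  | succ n ih =>
    intro σ hσ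
    rw [SdX, Function.iterate_succ_apply'] at hσ
    refine ⟨card_sd (fun σ hσ => (ih σ hσ).1) σ hσ, ?_⟩
    obtain ⟨c, hc, hcK, hch, rfl⟩ := mem_sd_iff.1 hσ
    have key : ∀ ρ ∈ c, ∀ κ ∈ c, ρ ⊆ κ →
        norm1 (bary ρ - bary κ) ≤ 2 * ((d : ℝ) / (d + 1)) ^ (n + 1) := by
      intro ρ hρ κ hκ hsub
      refine (norm1_bary_sub_bary_le (by positivity) (ih κ (hcK κ hκ)).2 (ih κ (hcK κ hκ)).1
        ((SdX X n).isRelLowerSet_faces (hcK ρ hρ)).1 hsub).trans (le_of_eq ?_)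
      rw [pow_succ]
      ring
    simp only [forall_mem_push]
    intro ρ hρ κ hκ
    rcases hch.total hρ hκ with h | h
    · exact key ρ hρ κ hκ h
    · rw [norm1_sub_comm]
      exact key κ hκ ρ hρ h

theorem exists_carrier_SdX (n : ℕ) : ∀ σ ∈ (SdX X n).faces, ∃ ρ ∈ (realize X).faces,
    ∀ x ∈ σ, x ∈ convexHull ℝ (ρ : Set (V →₀ ℝ)) := by
  induction n with
  | zero => exact fun σ hσ => ⟨σ, hσ, fun x hx => subset_convexHull ℝ _ hx⟩
  | succ n ih =>
    intro σ hσ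
    rw [SdX, Function.iterate_succ_apply'] at hσ
    obtain ⟨κ, hκ, h⟩ := exists_carrier_sd hσ
    obtain ⟨ρ, hρ, h'⟩ := ih κ hκ
    exact ⟨ρ, hρ, fun x hx => convexHull_subset_convexHull h' (h x hx)⟩

theorem pathDist_le_norm1 {ρ : Finset (V →₀ ℝ)} (hρ : ρ ∈ (realize X).faces) {x y : V →₀ ℝ}
    (hx : x ∈ convexHull ℝ (ρ : Set (V →₀ ℝ))) (hy : y ∈ convexHull ℝ (ρ : Set (V →₀ ℝ))) :
    pathDist X x y ≤ ENNReal.ofReal (norm1 (x - y)) := by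
  rw [pathDist]
  refine iInf_le_of_le 1 (iInf_le_of_le (fun j => if j = 0 then x else y) (iInf_le_of_le ?_ ?_))
  · refine ⟨by simp, by simp, fun j hj => ⟨ρ, hρ, ?_⟩⟩
    have : j = 0 := by omega
    subst this
    simpa using ⟨hx, hy⟩
  · simpa using ENNReal.ofReal_le_ofReal (euclid_le_norm1 x y)

/-- Distances of barycentres of nested simplices of `Sd^n X`. -/
theorem pathDist_bary_le (hd : ∀ σ ∈ X.faces, σ.card ≤ d + 1) {n : ℕ} {σ τ : Finset (V →₀ ℝ)}
    (hσ : σ ∈ (SdX X n).faces) (hτ : τ ∈ (SdX X n).faces) (h : σ ⊆ τ) :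
    pathDist X (bary σ) (bary τ) ≤ ENNReal.ofReal (2 * ((d : ℝ) / (d + 1)) ^ n) ∧
    pathDist X (bary τ) (bary σ) ≤ ENNReal.ofReal (2 * ((d : ℝ) / (d + 1)) ^ n) := by
  obtain ⟨ρ, hρ, hτρ⟩ := exists_carrier_SdX n τ hτ
  have hσn := ((SdX X n).isRelLowerSet_faces hσ).1
  have hτn := ((SdX X n).isRelLowerSet_faces hτ).1
  have h1 := convexHull_subset_convexHull (fun x hx => hτρ x (h hx)) (bary_mem hσn)
  have h2 := convexHull_subset_convexHull hτρ (bary_mem hτn)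
  have h3 : norm1 (bary σ - bary τ) ≤ 2 * ((d : ℝ) / (d + 1)) ^ n := by
    refine (norm1_bary_sub_bary_le (by positivity) (mesh_SdX hd n τ hτ).2 (mesh_SdX hd n τ hτ).1
      hσn h).trans ?_
    have h4 : (d : ℝ) / (d + 1) ≤ 1 := by rw [div_le_one (by positivity)]; linarith
    exact mul_le_of_le_one_left (by positivity) h4
  refine ⟨(pathDist_le_norm1 hρ h1 h2).trans (ENNReal.ofReal_le_ofReal h3),
    (pathDist_le_norm1 hρ h2 h1).trans (ENNReal.ofReal_le_ofReal ?_)⟩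
  rwa [norm1_sub_comm]

theorem exists_mesh_le (d : ℕ) {ε : ℝ} (hε : 0 < ε) :
    ∃ N : ℕ, ∀ n, N ≤ n → 2 * ((d : ℝ) / (d + 1)) ^ n ≤ ε := by
  have h1 : (d : ℝ) / (d + 1) < 1 := by rw [div_lt_one (by positivity)]; linarith
  obtain ⟨N, hN⟩ := exists_pow_lt_of_lt_one (half_pos hε) h1
  refine ⟨N, fun n hn => ?_⟩
  have := pow_le_pow_of_le_one (by positivity) h1.le hn
  linarith

end Mesh

/-! ### Existence of squeezing choices -/

section Existence

variable {V : Type w} [LinearOrder V] {X : PreAbstractSimplicialComplex V} {d : ℕ}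

/-- Every simplex has a vertex that is the barycentre of a smallest simplex, if the level is a
subdivision. -/
theorem exists_least_vertex (hd : ∀ σ ∈ X.faces, σ.card ≤ d + 1) (k : ℕ) (κ : Finset (Pt V)) :
    ∃ v, κ ∈ (level X d k).faces → v ∈ κ ∧ ∀ k', k = k' + 1 → ∀ u ∈ κ,
      ofBary X d k' v ⊆ ofBary X d k' u := by
  by_cases hκ : κ ∈ (level X d k).faces
  swap
  · exact ⟨0, fun h => absurd h hκ⟩
  rcases k with _ | k
  · obtain ⟨v, hv⟩ := level_nonempty hκ
    exact ⟨v, fun _ => ⟨hv, fun k' h => absurd h (by omega)⟩⟩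
  · obtain ⟨c, hc, hcK, hch, rfl⟩ := mem_level_succ.1 hκ
    obtain ⟨μ, hμ, hmin⟩ := c.exists_min_image Finset.card hc
    refine ⟨bary μ, fun _ => ⟨mem_push_of_mem hμ, ?_⟩⟩
    rintro k' hk
    obtain rfl : k = k' := by omega
    rw [forall_mem_push]
    intro ρ hρ
    rw [ofBary_bary hd (hcK μ hμ), ofBary_bary hd (hcK ρ hρ)]
    rcases hch.total hμ hρ with h | h
    · exact h
    · exact (Finset.eq_of_subset_of_card_le h (hmin ρ hρ)).ge

/-- Squeezing choices exist. -/
theorem exists_isSqueezing (hd : ∀ σ ∈ X.faces, σ.card ≤ d + 1) :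
    ∃ r, IsSqueezing X d r := by
  choose g hg using exists_least_vertex (X := X) hd
  have hval : ∀ k, ∀ ρ ∈ (level X d k).faces, g k (ofBary X d k (bary ρ)) ∈ ρ := fun k ρ hρ => by
    rw [ofBary_bary hd hρ]
    exact (hg k ρ hρ).1
  -- The barycentre of a simplex goes to the vertex of that simplex which is the barycentre of a
  -- smallest simplex of the level before.
  refine ⟨fun k w => g k (ofBary X d k w), fun k => ?_, ?_, ?_⟩
  · rw [VertexMap.isSimplicial_iff]
    intro S hS
    obtain ⟨c, hc, hcK, hch, rfl⟩ := mem_level_succ.1 hS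
    obtain ⟨m, hm, hmax⟩ := exists_max_of_chain hc hch
    refine ((level X d k).isRelLowerSet_faces (hcK m hm)).2 ?_
      (push_nonempty.2 (push_nonempty.2 hc))
    intro v hv
    obtain ⟨w, hw, rfl⟩ := mem_push.1 hv
    obtain ⟨ρ, hρ, rfl⟩ := mem_push.1 hw
    exact hmax ρ hρ (hval k ρ (hcK ρ hρ))
  · intro k κ hκ w hw σ hσ hwσ
    obtain ⟨ρ, hρ, rfl⟩ := exists_vertex hκ hw
    exact (geo_level hd k).subset_of_bary hρ hσ hwσ (hval k ρ hρ)
  · intro m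
    -- Two steps suffice: the first chooses a vertex that is a barycentre of a smallest simplex, the
    -- second a vertex of that simplex.
    refine ⟨2, fun σ hσ κ hκ hex w' hw' => ?_⟩
    obtain ⟨w, hw, hwσ⟩ := hex
    obtain ⟨c, hc, hcK, hch, rfl⟩ := mem_level_succ.1 hκ
    obtain ⟨μ, hμ, rfl⟩ := mem_push.1 hw
    obtain ⟨μ', hμ', rfl⟩ := mem_push.1 hw'
    show g m (ofBary X d m (g (m + 1) (ofBary X d (m + 1) (bary μ')))) ∈ σ
    have hμL := hcK μ hμ
    have hμL' := hcK μ' hμ'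
    -- Any two vertices of `κ` are barycentres of nested simplices, which share a vertex. It lies in
    -- `σ`, because `σ` contains the barycentre of `μ`.
    obtain ⟨u, hu, hu'⟩ : ∃ u ∈ μ, u ∈ μ' := by
      rcases hch.total hμ hμ' with h | h
      · obtain ⟨u, hu⟩ := level_nonempty hμL
        exact ⟨u, hu, h hu⟩
      · obtain ⟨u, hu⟩ := level_nonempty hμL'
        exact ⟨u, h hu, hu⟩
    have huσ := mem_convexHull_of_bary (m := m) (j := 1) hd hσ hμL hwσ u hu
    obtain ⟨τ, hτ, rfl⟩ := exists_vertex hμL hu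
    have hτσ := (geo_level hd m).subset_of_bary hτ hσ huσ
    rw [ofBary_bary hd hμL']
    obtain ⟨h1, h2⟩ := hg (m + 1) μ' hμL'
    -- The chosen vertex of `μ'` is the barycentre of a face of `τ`, hence of a face of `σ`.
    have h3 := h2 m rfl _ hu'
    obtain ⟨ρ, hρ, he⟩ := exists_vertex hμL' h1
    rw [he] at h3 ⊢
    rw [ofBary_bary hd hρ, ofBary_bary hd hτ] at h3
    exact hτσ (h3 (hval m ρ hρ))

end Existence

/-! ### The equivalence over a slice -/

section Splitting

variable {V : Type w} [LinearOrder V] {X : PreAbstractSimplicialComplex V} {d : ℕ}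
  {r : ℕ → Pt V → Pt V} {A : Type u} [Category.{v} A] [Preadditive A] {s : Variance}

/-- `exists_control` provides one fine level on which all constituents of `f` compare consecutive
labels of the three words, which is what the cutting argument requires. -/
theorem nonempty_homotopyEquiv_slice_of_hasBound (hX : LocallyFiniteComplex X)
    (hd : ∀ σ ∈ X.faces, σ.card ≤ d + 1) (hr : IsSqueezing X d r)
    {C D : ChainComplex (Graded A (triangulation X d).faces (some s)) ℤ}
    (hC : ExpTranslationEquivalent hX hr C) (hD : ExpTranslationEquivalent hX hr D)
    {B : ℝ} (hB : 0 ≤ B) (f : HomotopyEquiv (forgetComplex C) (forgetComplex D))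
    (hf : HasBound (fun σ τ => coneDist X (bary σ.1) (bary τ.1)) (ENNReal.ofReal B) f) {i : ℕ}
    (hi : 0 < i) : Nonempty (HomotopyEquiv (slice C i) (slice D i)) := by
  obtain ⟨m, k, hmk, hctl⟩ := exists_control hr hd hi hB
  -- The slice is closed under faces and words with fewer carriers give smaller labels. So the
  -- weakest condition, on the approximation label, follows from each of the others.
  have hZ : ∀ {n n' : ℕ} (_ : n ≤ n') {S : (level X d k).faces},
      label hr (tower hr hd) (word n') k S ∈ sliceSet X d (height d i) →
      label hr (tower hr hd) (word n) k S ∈ sliceSet X d (height d i) := fun {n n'} h {S} hS =>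
    sliceSet_mono (label_le hr (tower hr hd) (word_le h) k S) hS
  have hnear : ∀ {p q : Pt V}, coneDist X p q ≤ ENNReal.ofReal B → Close d B p q :=
    close_of_coneDist_le hd hB
  have main := fun {b₀ b₁ b₂ : ℕ → Bool} => nonempty_homotopyEquiv_slice hX hr (tower hr hd)
    (sliceSet_ordConnected (height d i)) (sliceIso X d i) (levelEmbedding_sliceIso i) hC hD f
    (near := fun σ τ => Close d B (bary σ.1) (bary τ.1))
    (fun n σ τ h => hnear (hf.hom n σ τ h)) (fun n σ τ h => hnear (hf.inv n σ τ h))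
    (fun n n' σ τ h => hnear (hf.homHomInv n n' σ τ h))
    (fun n n' σ τ h => hnear (hf.homInvHom n n' σ τ h)) (k := k) (b₀ := b₀) (b₁ := b₁) (b₂ := b₂)
  cases s
  -- Upper control decreases labels, so the words run from all carriers to none.
  · refine main (b₀ := word k) (b₁ := word m) (b₂ := word 0) (word_le hmk) (word_le (Nat.zero_le m))
      ⟨fun S K hS hK => ?_, fun K S hS hK => ?_⟩ ⟨fun S K hS hK => ?_, fun K S hS hK => ?_⟩
    · obtain ⟨T, hT, h1, h2, h3, h4⟩ := hctl S K (hZ (Nat.zero_le k) hS) hK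
      exact ⟨T, hT, h1⟩
    · obtain ⟨T, hT, h1, h2, h3, h4⟩ := hctl S K (hZ (Nat.zero_le m) hS) hK.symm
      exact ⟨T, hT, h3⟩
    · obtain ⟨T, hT, h1, h2, h3, h4⟩ := hctl S K (hZ (Nat.zero_le m) hS) hK
      exact ⟨T, hT, h2⟩
    · obtain ⟨T, hT, h1, h2, h3, h4⟩ := hctl S K hS hK.symm
      exact ⟨T, hT, h4⟩
  -- Lower control increases labels, so the words run the other way and the same four comparisons
  -- are used in the opposite sense.
  · refine main (b₀ := word 0) (b₁ := word m) (b₂ := word k) (word_le (Nat.zero_le m)) (word_le hmk)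
      ⟨fun S K hS hK => ?_, fun K S hS hK => ?_⟩ ⟨fun S K hS hK => ?_, fun K S hS hK => ?_⟩
    · obtain ⟨T, hT, h1, h2, h3, h4⟩ := hctl S K hS hK
      exact ⟨T, hT, h4⟩
    · obtain ⟨T, hT, h1, h2, h3, h4⟩ := hctl S K (hZ (Nat.zero_le m) hS) hK.symm
      exact ⟨T, hT, h2⟩
    · obtain ⟨T, hT, h1, h2, h3, h4⟩ := hctl S K (hZ (Nat.zero_le m) hS) hK
      exact ⟨T, hT, h3⟩
    · obtain ⟨T, hT, h1, h2, h3, h4⟩ := hctl S K (hZ (Nat.zero_le k) hS) hK.symm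
      exact ⟨T, hT, h1⟩

end Splitting

/-- Controlled morphisms over fine subdivisions have small bounds. -/
theorem pathDist_le_of_allowed {V : Type w} {X : PreAbstractSimplicialComplex V} {d : ℕ}
    {s : Variance} (hd : ∀ σ ∈ X.faces, σ.card ≤ d + 1) {n : ℕ}
    {σ τ : (SdX X n).faces} (h : Variance.allowed (some s) σ τ) :
    pathDist X (bary σ.1) (bary τ.1) ≤ ENNReal.ofReal (2 * ((d : ℝ) / (d + 1)) ^ n) := by
  cases s
  · exact (pathDist_bary_le hd τ.2 σ.2 h).2
  · exact (pathDist_bary_le hd σ.2 τ.2 h).1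

end Cone

theorem theorem10p3 {V : Type w} [LinearOrder V] (X : PreAbstractSimplicialComplex V)
    (hX : LocallyFiniteComplex X) (d : ℕ) (hd : ∀ σ ∈ X.faces, σ.card ≤ d + 1)
    (hd' : ∃ σ ∈ X.faces, σ.card = d + 1) :
    (∃ r, Cone.IsSqueezing X d r) ∧
    ∀ (r : ℕ → Cone.Pt V → Cone.Pt V) (hr : Cone.IsSqueezing X d r)
      (A : Type u) [Category.{v} A] [Preadditive A] [Limits.HasFiniteBiproducts A] (s : Variance)
      (C D : ChainComplex (Graded A (Cone.triangulation X d).faces (some s)) ℤ),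
      IsFiniteComplex C → IsFiniteComplex D →
      Cone.ExpTranslationEquivalent hX hr C → Cone.ExpTranslationEquivalent hX hr D →
      ∀ (B : ℝ) (_ : 0 ≤ B) (f : HomotopyEquiv (forgetComplex C) (forgetComplex D)),
        HasBound (fun σ τ => Cone.coneDist X (Geometric.bary σ.1) (Geometric.bary τ.1))
          (ENNReal.ofReal B) f →
        ∃ g : ∀ i : ℕ, B < i → HomotopyEquiv (Cone.slice C i) (Cone.slice D i),
          ∀ ε : ℝ, 0 < ε → ∃ N : ℕ, ∀ (i : ℕ) (hi : B < i), N ≤ i →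
            HasBound (fun σ τ => Cone.pathDist X (Geometric.bary σ.1) (Geometric.bary τ.1))
              (ENNReal.ofReal ε) (g i hi) := by
  refine ⟨Cone.exists_isSqueezing hd, ?_⟩
  intro r hr A _ _ _ s C D _ _ hC hD B hB f hf
  -- Positivity of `i` puts the slice at positive height, as needed for translation to shrink
  -- distances near it.
  have hpos : ∀ i : ℕ, B < i → 0 < i := fun i hi => by exact_mod_cast hB.trans_lt hi
  refine ⟨fun i hi => (Cone.nonempty_homotopyEquiv_slice_of_hasBound hX hd hr hC hD hB f hf
    (hpos i hi)).some, fun ε hε => ?_⟩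
  obtain ⟨N, hN⟩ := Cone.exists_mesh_le d hε
  refine ⟨N, fun i hi hNi => ?_⟩
  -- Every constituent of a chain equivalence over the slice joins nested simplices only, so the
  -- mesh bounds it whichever equivalence has been chosen.
  have key : ∀ {σ τ : (Cone.SdX X i).faces}, Variance.allowed (some s) σ τ →
      Cone.pathDist X (Geometric.bary σ.1) (Geometric.bary τ.1) ≤ ENNReal.ofReal ε := fun h =>
    (Cone.pathDist_le_of_allowed hd h).trans (ENNReal.ofReal_le_ofReal (hN i hNi))
  exact ⟨fun n σ τ h => key (Graded.Hom.support _ σ τ h),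
    fun n σ τ h => key (Graded.Hom.support _ σ τ h),
    fun m n σ τ h => key (Graded.Hom.support _ σ τ h),
    fun m n σ τ h => key (Graded.Hom.support _ σ τ h)⟩
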